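/- Let $m,n\ge 1$ and let $A=(a_{ij}),B=(b_{ij})$ be $m\times n$ matrices with entries in $\mathbb{Z}\cup\{-\infty\}$, whose finite entries have absolute value at most $M\in\mathbb{N}$. Assume that neither $A$ nor $B$ has a row identically $-\infty$, and that no column is identically $-\infty$ in both $A$ and $B$. For $x\in(\mathbb{R}\cup\{-\infty\})^n$ put $(Ax)_i=\max_j(a_{ij}+x_j)$, and for $y\in(\mathbb{R}\cup\{-\infty\})^m$ put $(A^\sharp y)_j=\min_i(-a_{ij}+y_i)$, where terms with $a_{ij}=-\infty$ count as $+\infty$. For a self-map $f$ of $(\mathbb{R}\cup\{-\infty\})^n$ let $r(f)$ be the largest $\mu\in\mathbb{R}\cup\{-\infty\}$ such that $f(x)=\mu+x$ for some $x\not\equiv-\infty$. For $\lambda\in\mathbb{R}$ let $$h_\lambda(x)=(\lambda+A^\sharp Bx)\wedge(-\lambda+B^\sharp Ax),\qquad s(\lambda)=r(h_\lambda),$$ and let $\operatorname{spec}(A,B)=\{\lambda\in\mathbb{R}: Ax=\lambda+Bx\text{ for some }x\not\equiv-\infty\}$. Put $\kappa=\min(2m,n)$, $$\overline C=\max\{a_{ij}-b_{ik}: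 a_{ij},b_{ik}\ne-\infty\},\quad \underline C=\min\{a_{ij}-b_{ik}: a_{ij},b_{ik}\ne-\infty\},$$ $$\Delta=\max\bigl(\overline C,\ \max\{b_{ij}-a_{ik}: b_{ij},a_{ik}\ne-\infty\}\bigr).$$ Algorithms are programs of a random access machine over the integers with logarithmic cost. A mean-payoff oracle receives $P,Q\in(\mathbb{Z}\cup\{-\infty\})^{p\times n}$, where $P$ has no column and $Q$ no row identically $-\infty$, and returns the rational number $r(P^\sharp Q)$, the greatest value of the associated mean-payoff game. For any program that implements such an oracle, $\operatorname{MPG}(p,n,W)$ denotes its worst-case execution time on pairs $P,Q$ of format $p\times n$ whose finite entries have absolute value at most $W$. To *reconstruct* $s$ is to output the finitely many breakpoints of the piecewise affine function $s$ in increasing order and the slope and offset of each of its maximal affine pieces on $\mathbb{R}$, together with $\operatorname{spec}(A,B)$ as a finite ordered list of disjoint closed (possibly unbounded or one-point) intervals, all finite data being rational numbers. There is an algorithm with access to a mean-payoff oracle that, given any such $m,n,A,B$, reconstructs $s$ and $\operatorname{spec}(A,B)$, spends outside the oracle a time polynomial in $m$, $n$ and the bit length of $M$ per call (more precisely, at most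 (number of calls $+\,1$) times such a polynomial), and satisfies the following, with absolute constants in the $O(\cdot)$. 1. It makes at most $\Delta\cdot O(\kappa^6)$ oracle calls, each on a pair of $2m\times n$ matrices with finite entries of absolute value at most $\kappa^2(M+4M\kappa^2)$, so that each call takes time at most $\operatorname{MPG}(2m,n,\kappa^2(M+4M\kappa^2))$, whatever the implementation of the oracle. 2. If neither $A$ nor $B$ has a column identically $-\infty$, it makes at most $\Delta\cdot O(\kappa^5)$ calls, each of complexity at most $\operatorname{MPG}(2m,n,\kappa^2(M+4M\kappa))$ in the same sense. If all entries of $A$ and $B$ are finite, it makes at most $(\overline C-\underline C)\cdot O(\kappa^4)$ calls, each of complexity at most $\operatorname{MPG}(2m,n,3M\kappa^2)$ in the same sense. In particular the reconstruction can be done in pseudo-polynomial time: there is an algorithm without oracle that performs it in time polynomial in $m$, $n$ and $M$. -/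

import Mathlib

namespace TwoSided

noncomputable section

/-! ### Max-plus matrices, residuation, spectral radius -/

/-- The max-plus product `A x`: `(A x) i = max_j (a i j + x j)` over `ℝ ∪ {-∞}`. -/
def mulVec {m n : ℕ} (A : Matrix (Fin m) (Fin n) (WithBot ℝ)) (x : Fin n → WithBot ℝ) :
    Fin m → WithBot ℝ :=
  fun i => Finset.univ.sup fun j => A i j + x j

/-- The residuated operator `(A♯ y) j = min_i (-a i j + y i)`, where by convention a term with
`a i j = -∞` equals `+∞`. It takes values in `ℝ ∪ {-∞, +∞}`. -/
def resid {m n : ℕ} (A : Matrix (Fin m) (Fin n) (WithBot ℝ)) (y : Fin m → WithBot ℝ) :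
    Fin n → WithTop (WithBot ℝ) :=
  fun j => Finset.univ.inf fun i =>
    match A i j with
    | ⊥ => (⊤ : WithTop (WithBot ℝ))
    | (a : ℝ) => ((((-a : ℝ) : WithBot ℝ) + y i : WithBot ℝ) : WithTop (WithBot ℝ))

/-- The eigenvalues in `ℝ ∪ {-∞}` of a self-map of `(ℝ ∪ {-∞})ⁿ`: those `l` such that
`f x = l + x` for some vector `x` that is not identically `-∞`. -/
def eigenvalues {n : ℕ} (f : (Fin n → WithBot ℝ) → (Fin n → WithTop (WithBot ℝ))) :
    Set (WithBot ℝ) :=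
  {l | ∃ x : Fin n → WithBot ℝ, (∃ j, x j ≠ ⊥) ∧
    ∀ j, f x j = ((l + x j : WithBot ℝ) : WithTop (WithBot ℝ))}

/-- The spectral radius `r(f)`, the largest eigenvalue. -/
def specRadius {n : ℕ} (f : (Fin n → WithBot ℝ) → (Fin n → WithTop (WithBot ℝ))) : WithBot ℝ :=
  sSup (eigenvalues f)

/-- An integer matrix with `-∞` entries, viewed as a real one. -/
def toReal {m n : ℕ} (A : Matrix (Fin m) (Fin n) (WithBot ℤ)) :
    Matrix (Fin m) (Fin n) (WithBot ℝ) :=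
  A.map (WithBot.map fun z : ℤ => (z : ℝ))

/-- The parametric min-max function `h_l(x) = (l + A♯ B x) ∧ (-l + B♯ A x)`. -/
def minMax {m n : ℕ} (A B : Matrix (Fin m) (Fin n) (WithBot ℝ)) (l : ℝ)
    (x : Fin n → WithBot ℝ) : Fin n → WithTop (WithBot ℝ) :=
  fun j =>
    ((((l : ℝ) : WithBot ℝ) : WithTop (WithBot ℝ)) + resid A (mulVec B x) j) ⊓
    ((((-l : ℝ) : WithBot ℝ) : WithTop (WithBot ℝ)) + resid B (mulVec A x) j)

/-- The spectral function `s(l) = r(h_l)`. -/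
def specFun {m n : ℕ} (A B : Matrix (Fin m) (Fin n) (WithBot ℝ)) (l : ℝ) : WithBot ℝ :=
  specRadius (minMax A B l)

/-- The (finite) spectrum of the two-sided eigenproblem `A x = l + B x`. -/
def spec {m n : ℕ} (A B : Matrix (Fin m) (Fin n) (WithBot ℝ)) : Set ℝ :=
  {l | ∃ x : Fin n → WithBot ℝ, (∃ j, x j ≠ ⊥) ∧
    ∀ i, mulVec A x i = (l : WithBot ℝ) + mulVec B x i}

/-- All differences `a i j - b i k` of finite entries in a common row. -/
def diffs {m n : ℕ} (A B : Matrix (Fin m) (Fin n) (WithBot ℤ)) : Set ℤ :=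
  {d | ∃ (i : Fin m) (j k : Fin n) (a b : ℤ), A i j = a ∧ B i k = b ∧ d = a - b}

/-- The largest difference `a i j - b i k` of finite entries. -/
def upperC {m n : ℕ} (A B : Matrix (Fin m) (Fin n) (WithBot ℤ)) : ℤ := sSup (diffs A B)

/-- The smallest difference `a i k - b i j` of finite entries. -/
def lowerC {m n : ℕ} (A B : Matrix (Fin m) (Fin n) (WithBot ℤ)) : ℤ := sInf (diffs A B)

/-- `Δ(A,B)`, the largest of the differences `a i j - b i k` and `b i j - a i k`. -/
def Delta {m n : ℕ} (A B : Matrix (Fin m) (Fin n) (WithBot ℤ)) : ℤ :=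
  max (upperC A B) (upperC B A)

/-- `κ = min(2m, n)`. -/
def kappa (m n : ℕ) : ℕ := min (2 * m) n

/-! ### Mean-payoff games -/

/-- A mean-payoff game with integer payments: `cols` nodes of Min, `rows` nodes of Max. Moving from
node `j` of Min to node `i` of Max costs Min `-P i j`; moving from node `i` of Max to node `k` of
Min yields `Q i k` to Max; the entry `-∞` means that there is no such move. -/
structure Game where
  rows : ℕ
  cols : ℕ
  P : Matrix (Fin rows) (Fin cols) (WithBot ℤ)
  Q : Matrix (Fin rows) (Fin cols) (WithBot ℤ)

/-- There is at least one node, and every node of either player has a move. -/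
def Game.Valid (G : Game) : Prop :=
  0 < G.cols ∧ (∀ j, ∃ i, G.P i j ≠ ⊥) ∧ (∀ i, ∃ j, G.Q i j ≠ ⊥)

/-- The greatest value of the game over all initial nodes, `r(P♯ Q)`. -/
def Game.value (G : Game) : WithBot ℝ :=
  specRadius fun x => resid (toReal G.P) (mulVec (toReal G.Q) x)

/-- All finite entries have absolute value at most `W`. -/
def EntriesLE {m n : ℕ} (A : Matrix (Fin m) (Fin n) (WithBot ℤ)) (W : ℕ) : Prop :=
  ∀ i j (a : ℤ), A i j = a → |a| ≤ W

/-- The game has `p` nodes of Max, `n` nodes of Min and payments of absolute value at most `W`. -/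
def Game.HasSize (G : Game) (p n W : ℕ) : Prop :=
  G.rows = p ∧ G.cols = n ∧ EntriesLE G.P W ∧ EntriesLE G.Q W

/-! ### Programs: an integer random access machine with logarithmic costs and oracle calls -/

/-- Binary operations of the machine. The two tests return `1` for true and `0` for false. -/
inductive Op
  | add | sub | mul | div | lt | eq

/-- The result of an operation (`div` rounds down for a positive divisor). -/
def Op.eval : Op → ℤ → ℤ → ℤ
  | .add, a, b => a + b
  | .sub, a, b => a - b
  | .mul, a, b => a * b
  | .div, a, b => a / b
  | .lt, a, b => if a < b then 1 else 0
  | .eq, a, b => if a = b then 1 else 0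

/-- Integer expressions: constants, registers, cells of two-dimensional arrays, operations. -/
inductive Expr
  | const (c : ℤ)
  | reg (x : ℕ)
  | cell (a : ℕ) (i j : Expr)
  | op (o : Op) (e₁ e₂ : Expr)

/-- A memory state: integer registers, and arrays of integers indexed by pairs of integers. -/
structure State where
  reg : ℕ → ℤ
  mem : ℕ → ℤ → ℤ → ℤ

/-- The value of an expression. -/
def Expr.eval (σ : State) : Expr → ℤ
  | .const c => c
  | .reg x => σ.reg x
  | .cell a i j => σ.mem a (i.eval σ) (j.eval σ)
  | .op o e₁ e₂ => o.eval (e₁.eval σ) (e₂.eval σ)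

/-- The number of binary digits of an integer. -/
def bits (z : ℤ) : ℕ := Nat.size z.natAbs

/-- Logarithmic cost of evaluating an expression: every node of the expression costs one more than
the length of the integer it evaluates to. -/
def Expr.cost (σ : State) : Expr → ℕ
  | .const c => bits c + 1
  | .reg x => bits (σ.reg x) + 1
  | .cell a i j => i.cost σ + j.cost σ + bits (σ.mem a (i.eval σ) (j.eval σ)) + 1
  | .op o e₁ e₂ => e₁.cost σ + e₂.cost σ + bits (o.eval (e₁.eval σ) (e₂.eval σ)) + 1

/-- Programs. Conditions hold when the expression evaluates to a nonzero number; `call` consults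
the mean-payoff oracle. -/
inductive Com
  | skip
  | assign (x : ℕ) (e : Expr)
  | store (a : ℕ) (i j e : Expr)
  | seq (c₁ c₂ : Com)
  | ite (e : Expr) (c₁ c₂ : Com)
  | loop (e : Expr) (c : Com)
  | call

/-- The program makes no oracle calls. -/
def Com.CallFree : Com → Prop
  | .skip => True
  | .assign _ _ => True
  | .store _ _ _ _ => True
  | .seq c₁ c₂ => c₁.CallFree ∧ c₂.CallFree
  | .ite _ c₁ c₂ => c₁.CallFree ∧ c₂.CallFree
  | .loop _ c => c.CallFree
  | .call => False

/-- Change of one register. -/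
def State.setReg (σ : State) (x : ℕ) (v : ℤ) : State :=
  { σ with reg := Function.update σ.reg x v }

/-- Change of one array cell. -/
def State.setCell (σ : State) (a : ℕ) (i j v : ℤ) : State :=
  { σ with mem := fun a' i' j' => if a' = a ∧ i' = i ∧ j' = j then v else σ.mem a' i' j' }

/-- A finite entry is represented by the flag `1` and its value, `-∞` by the flag `0` and `0`. -/
def flag : WithBot ℤ → ℤ
  | ⊥ => 0
  | (_ : ℤ) => 1

/-- See `flag`. -/
def val : WithBot ℤ → ℤ
  | ⊥ => 0
  | (a : ℤ) => a

/-- The state holds the pair of matrices `P, Q` of `G`: dimensions in registers 0 and 1, flags and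
values of `P` in arrays 0 and 1, flags and values of `Q` in arrays 2 and 3. -/
def Loaded (σ : State) (G : Game) : Prop :=
  σ.reg 0 = G.rows ∧ σ.reg 1 = G.cols ∧ ∀ (i : Fin G.rows) (j : Fin G.cols),
    σ.mem 0 (i : ℕ) (j : ℕ) = flag (G.P i j) ∧ σ.mem 1 (i : ℕ) (j : ℕ) = val (G.P i j) ∧
    σ.mem 2 (i : ℕ) (j : ℕ) = flag (G.Q i j) ∧ σ.mem 3 (i : ℕ) (j : ℕ) = val (G.Q i j)

/-- The array holding `f` of the entries of a matrix, and zeros elsewhere. -/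
def table {m n : ℕ} (f : WithBot ℤ → ℤ) (A : Matrix (Fin m) (Fin n) (WithBot ℤ)) (i j : ℤ) : ℤ :=
  if h : (0 ≤ i ∧ i < m) ∧ (0 ≤ j ∧ j < n) then
    f (A ⟨i.toNat, by omega⟩ ⟨j.toNat, by omega⟩)
  else 0

/-- The initial state for the input consisting of two matrices `P, Q` of the same format: it holds
this pair of matrices and zeros everywhere else. -/
def load (G : Game) : State where
  reg x := match x with
    | 0 => G.rows
    | 1 => G.cols
    | _ => 0
  mem a := match a with
    | 0 => table flag G.P
    | 1 => table val G.P
    | 2 => table flag G.Q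
    | 3 => table val G.Q
    | _ => fun _ _ => 0

/-- `Exec c σ σ' t gs`: started in the state `σ`, the program `c` stops in the state `σ'` after
time `t`, not counting the time spent by the oracle (issuing a call costs one unit), and the games
submitted to the oracle are, in this order, those of the list `gs`. An oracle call submits the game
held by the current state; its value is returned as a reduced fraction in registers 2 and 3. -/
inductive Exec : Com → State → State → ℕ → List Game → Prop
  | skip (σ : State) : Exec .skip σ σ 1 []
  | assign (σ : State) (x : ℕ) (e : Expr) :
      Exec (.assign x e) σ (σ.setReg x (e.eval σ)) (e.cost σ + 1) []
  | store (σ : State) (a : ℕ) (i j e : Expr) :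
      Exec (.store a i j e) σ (σ.setCell a (i.eval σ) (j.eval σ) (e.eval σ))
        (i.cost σ + j.cost σ + e.cost σ + 1) []
  | seq {c₁ c₂ : Com} {σ₁ σ₂ σ₃ : State} {t₁ t₂ : ℕ} {gs₁ gs₂ : List Game} :
      Exec c₁ σ₁ σ₂ t₁ gs₁ → Exec c₂ σ₂ σ₃ t₂ gs₂ →
      Exec (.seq c₁ c₂) σ₁ σ₃ (t₁ + t₂) (gs₁ ++ gs₂)
  | ite_true {e : Expr} {c₁ c₂ : Com} {σ σ' : State} {t : ℕ} {gs : List Game} :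
      e.eval σ ≠ 0 → Exec c₁ σ σ' t gs → Exec (.ite e c₁ c₂) σ σ' (e.cost σ + 1 + t) gs
  | ite_false {e : Expr} {c₁ c₂ : Com} {σ σ' : State} {t : ℕ} {gs : List Game} :
      e.eval σ = 0 → Exec c₂ σ σ' t gs → Exec (.ite e c₁ c₂) σ σ' (e.cost σ + 1 + t) gs
  | loop_true {e : Expr} {c : Com} {σ₁ σ₂ σ₃ : State} {t₁ t₂ : ℕ} {gs₁ gs₂ : List Game} :
      e.eval σ₁ ≠ 0 → Exec c σ₁ σ₂ t₁ gs₁ → Exec (.loop e c) σ₂ σ₃ t₂ gs₂ →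
      Exec (.loop e c) σ₁ σ₃ (e.cost σ₁ + 1 + t₁ + t₂) (gs₁ ++ gs₂)
  | loop_false {e : Expr} {c : Com} {σ : State} :
      e.eval σ = 0 → Exec (.loop e c) σ σ (e.cost σ + 1) []
  | call {σ : State} {G : Game} {q : ℚ} :
      G.Valid → Loaded σ G → G.value = ((q : ℝ) : WithBot ℝ) →
      Exec .call σ ((σ.setReg 2 q.num).setReg 3 q.den) 1 [G]

/-- `O` is a mean-payoff oracle: a program without oracle calls that, for every mean-payoff game,
stops with the value of the game, as a reduced fraction, in registers 2 and 3. -/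
def IsOracle (O : Com) : Prop :=
  O.CallFree ∧ ∀ G : Game, G.Valid → ∃ (σ : State) (t : ℕ) (q : ℚ),
    Exec O (load G) σ t [] ∧ G.value = ((q : ℝ) : WithBot ℝ) ∧ σ.reg 2 = q.num ∧ σ.reg 3 = q.den

/-- The execution time of `O` on the game `G`. -/
def runTime (O : Com) (G : Game) : ℕ∞ :=
  ⨆ (t : ℕ) (_ : ∃ σ : State, Exec O (load G) σ t []), (t : ℕ∞)

/-- `MPG(p, n, W)`: the worst-case execution time of `O` on games with `p` nodes of Max, `n` nodes
of Min and integer payments of absolute value at most `W`. -/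
def MPG (O : Com) (p n W : ℕ) : ℕ∞ :=
  ⨆ (G : Game) (_ : G.Valid ∧ G.HasSize p n W), runTime O G

/-- There are at most `N` oracle calls; all of them submit games with `p` nodes of Max, `n` nodes of
Min and payments of absolute value at most `W`, and so, whatever the oracle, each of them takes it
at most the time `MPG(p, n, W)`. -/
def CallsWithin (gs : List Game) (N : ℤ) (p n W : ℕ) : Prop :=
  (gs.length : ℤ) ≤ N ∧ ∀ G ∈ gs, (G.Valid ∧ G.HasSize p n W) ∧
    ∀ O : Com, IsOracle O → runTime O G ≤ MPG O p n W

/-! ### The reconstruction problem -/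

/-- The function `s` has exactly `K + 1` affine pieces: its successive breakpoints are
`brk 0 < ⋯ < brk (K-1)`, and the pieces are `x ↦ slope i * x + off i` for `i = 0, …, K`. -/
def IsAffineDecomposition (s : ℝ → WithBot ℝ) (K : ℕ) (brk slope off : ℕ → ℚ) : Prop :=
  (∀ i, i + 1 < K → brk i < brk (i + 1)) ∧
  (∀ i, i < K → slope i ≠ slope (i + 1)) ∧
  ∀ i, i ≤ K → ∀ x : ℝ, (0 < i → (brk (i - 1) : ℝ) ≤ x) → (i < K → x ≤ (brk i : ℝ)) →
    s x = (((slope i : ℝ) * x + (off i : ℝ) : ℝ) : WithBot ℝ)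

/-- `S` is the union of the `J` successive disjoint nonempty closed intervals `[lo j, hi j] ∩ ℝ`. -/
def IsIntervalDecomposition (S : Set ℝ) (J : ℕ) (lo hi : ℕ → EReal) : Prop :=
  (∀ j, j < J → lo j ≤ hi j) ∧
  (∀ j, j + 1 < J → hi j < lo (j + 1)) ∧
  S = {x : ℝ | ∃ j, j < J ∧ lo j ≤ (x : EReal) ∧ (x : EReal) ≤ hi j}

/-- The fraction whose numerator and denominator are in cell `(i, 0)` of arrays `a` and `a + 1`. -/
def frac (σ : State) (a i : ℕ) : ℚ := (σ.mem a i 0 : ℚ) / (σ.mem (a + 1) i 0 : ℚ)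

/-- The same as an interval end, where the denominator `0` stands for the infinite end `e`. -/
def extFrac (σ : State) (e : EReal) (a i : ℕ) : EReal :=
  if σ.mem (a + 1) i 0 = 0 then e else ((frac σ a i : ℝ) : EReal)

/-- The state holds, as its output, all the affine pieces of the spectral function of `(A, B)`
(number of breakpoints in register 4; breakpoints, slopes and offsets as fractions in arrays 4-5,
6-7 and 8-9) and the spectrum of `(A, B)` (number of intervals in register 5; lower and upper ends
in arrays 10-11 and 12-13). -/
def IsReconstruction {m n : ℕ} (A B : Matrix (Fin m) (Fin n) (WithBot ℤ)) (σ : State) : Prop :=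
  (∃ K : ℕ, σ.reg 4 = K ∧
    (∀ i : ℕ, i < K → 0 < σ.mem 5 i 0) ∧
    (∀ i : ℕ, i ≤ K → 0 < σ.mem 7 i 0 ∧ 0 < σ.mem 9 i 0) ∧
    IsAffineDecomposition (specFun (toReal A) (toReal B)) K (frac σ 4) (frac σ 6) (frac σ 8)) ∧
  (∃ J : ℕ, σ.reg 5 = J ∧
    (∀ j : ℕ, j < J → 0 ≤ σ.mem 11 j 0 ∧ 0 ≤ σ.mem 13 j 0) ∧
    IsIntervalDecomposition (spec (toReal A) (toReal B)) J (extFrac σ ⊥ 10) (extFrac σ ⊤ 12))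

/-- The standing assumptions: the matrices are nonempty, neither of them has a row of `-∞`, they
have no common column of `-∞`, and their finite entries have absolute value at most `M`. -/
structure Admissible {m n : ℕ} (A B : Matrix (Fin m) (Fin n) (WithBot ℤ)) (M : ℕ) : Prop where
  rows_pos : 0 < m
  cols_pos : 0 < n
  row_left : ∀ i, ∃ j, A i j ≠ ⊥
  row_right : ∀ i, ∃ j, B i j ≠ ⊥
  column : ∀ j, ∃ i, A i j ≠ ⊥ ∨ B i j ≠ ⊥
  bound_left : EntriesLE A M
  bound_right : EntriesLE B M

end

end TwoSided

/-! The map `h_λ` is the Shapley operator of a deterministic mean-payoff game (`pgame`) with `2m`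
nodes of Max and `n` nodes of Min. Such a game has a value `v`, certified from above by a finite
potential (`Up`) and from below by an eigenvector over `ℝ ∪ {-∞}` (`Eig`). The two kinds of
certificates never cross (`Sub.le_of_up`) and both exist (`exists_eig`), so `r(h_λ) = v`
(`Represents.specRadius_eq`).

Optimal moves along the eigenvector close a cycle of length at most `κ` (`Eig.exists_cycle`). With
`p` turns through `A♯ B` and `q` turns through `B♯ A`, its mean payment is `(a + (p - q) λ) / (p +
q)`. Hence the continuous function `s` selects among finitely many lines (`exists_line`). Two of
these lines can cross only at a fraction `N / (2 D)` with `D ≤ κ²` (`lines_crossing`), so `s` is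
affine between consecutive fractions of this kind. It is also affine on two explicit rays
(`affine_hiEnd`, `affine_loEnd`); the length of the interval left between them produces the three
different call bounds. Sampling `s` at the `O(κ⁴ · length)` grid points of that interval
(`card_gridFrom_le`) determines all affine pieces. Since `s ≤ 0` and the spectrum is the zero set of
`s` (`mem_spec_iff`), the same samples determine the spectrum: a zero inside an affine piece makes
the whole piece vanish.

One sample is one game with integer payments, obtained by multiplying with `D` and adding a constant
(`sampleGame_isVal`). If all differences of entries coincide, then `C̄ - C̲ = 0`, and in the finite
case no call is allowed; the entries are then scaled to `0`, and the game is solved by value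
iteration, whose horizon depends on `m` and `n` only (`evalSpec_call`). Value iteration followed by
rounding to a fraction with denominator at most `n` (`run_viProg`) also replaces the oracle in the
pseudo-polynomial algorithm.

The algorithms are actual programs, verified by static means. Every register and every array has a
fixed exponent, and its contents stay below that power of a base `b` (`Ty`); so all numbers have
length `O(Z)`, where `Z` bounds the length of `b`. The time of each block is at most `kc * Z ^ kc`,
where `kc` is read off the program text (`Run`), and the places that a block may change are read off
in the same way (`Fr`). The main loop keeps the output correct up to the current sample point
(`LoopInv`) and ends because fewer and fewer grid points remain (`exec_main`). -/

namespace TwoSided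

/-! ### Deterministic two-player games with real payments -/

/-- A game in which Min moves from a node `j` to a node `i` of Max for the payment `p j i`, and Max
moves from `i` to a node `k` of Min for the payment `q i k`, along the edges `e` and `f`. -/
structure RG (I J : Type*) where
  e : J → I → Prop
  f : I → J → Prop
  p : J → I → ℝ
  q : I → J → ℝ

namespace RG

variable {I J : Type*} (g : RG I J)

/-- The payment received by Max in one turn. -/
def w (j : J) (i : I) (k : J) : ℝ := g.p j i + g.q i k

/-- Both players have a move from every node. -/
structure Valid : Prop where
  e_total : ∀ j, ∃ i, g.e j i
  f_total : ∀ i, ∃ k, g.f i k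

/-- `T y ≤ μ + y` for the Shapley operator `T` of the game. -/
def Up (μ : ℝ) (y : J → ℝ) : Prop :=
  ∀ j, ∃ i, g.e j i ∧ ∀ k, g.f i k → g.w j i k + y k ≤ μ + y j

/-- `z = T y` for the Shapley operator `T` of the game. -/
structure IsStep (y z : J → ℝ) : Prop where
  le : ∀ j, ∃ i, g.e j i ∧ ∀ k, g.f i k → g.w j i k + y k ≤ z j
  ge : ∀ j i, g.e j i → ∃ k, g.f i k ∧ z j ≤ g.w j i k + y k

/-- `T x ≥ μ + x` for a vector `x` over `ℝ ∪ {-∞}` that is not identically `-∞`. -/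
structure Sub (μ : ℝ) (x : J → WithBot ℝ) : Prop where
  ne_bot : ∃ j, x j ≠ ⊥
  ge : ∀ j i, g.e j i → ∃ k, g.f i k ∧ (μ : WithBot ℝ) + x j ≤ (g.w j i k : WithBot ℝ) + x k

/-- `T x = μ + x` for a vector `x` over `ℝ ∪ {-∞}` that is not identically `-∞`. -/
structure Eig (μ : ℝ) (x : J → WithBot ℝ) : Prop extends g.Sub μ x where
  le : ∀ j, ∃ i, g.e j i ∧
    ∀ k, g.f i k → (g.w j i k : WithBot ℝ) + x k ≤ (μ : WithBot ℝ) + x j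

/-- All payments per turn differ from `μ` by at most `W`. -/
def PayLE (μ W : ℝ) : Prop := ∀ j i k, g.e j i → g.f i k → |g.w j i k - μ| ≤ W

variable {g}

theorem exists_step [Finite I] [Finite J] (hg : g.Valid) (y : J → ℝ) : ∃ z, g.IsStep y z := by
  have h1 : ∀ i, ∃ k, g.f i k ∧ ∀ k', g.f i k' → g.q i k' + y k' ≤ g.q i k + y k := by
    intro i
    obtain ⟨k, hk, h⟩ := Set.exists_max_image {k | g.f i k} (fun k => g.q i k + y k)
      (Set.toFinite _) (hg.f_total i)
    exact ⟨k, hk, h⟩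
  choose τ hτ hτm using h1
  have h2 : ∀ j, ∃ i, g.e j i ∧ ∀ i', g.e j i' →
      g.p j i + (g.q i (τ i) + y (τ i)) ≤ g.p j i' + (g.q i' (τ i') + y (τ i')) := by
    intro j
    obtain ⟨k, hk, h⟩ := Set.exists_min_image {i | g.e j i}
      (fun i => g.p j i + (g.q i (τ i) + y (τ i))) (Set.toFinite _) (hg.e_total j)
    exact ⟨k, hk, h⟩
  choose σ hσ hσm using h2
  refine ⟨fun j => g.p j (σ j) + (g.q (σ j) (τ (σ j)) + y (τ (σ j))), ⟨fun j => ?_, fun j i hi => ?_⟩⟩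
  · refine ⟨σ j, hσ j, fun k hk => ?_⟩
    have := hτm (σ j) k hk
    simp only [w]
    linarith
  · refine ⟨τ i, hτ i, ?_⟩
    have := hσm j i hi
    simp only [w]
    linarith

/-- The Shapley operator is monotone and commutes with the addition of constants; the constant `c`
combines both facts. -/
theorem IsStep.mono {y y' z z' : J → ℝ} (h : g.IsStep y z) (h' : g.IsStep y' z') {c : ℝ}
    (hy : ∀ j, y j ≤ y' j + c) (j : J) : z j ≤ z' j + c := by
  obtain ⟨i, hi, hk⟩ := h'.le j
  obtain ⟨k, hf, hz⟩ := h.ge j i hi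
  linarith [hk k hf, hy k]

theorem IsStep.le_of_up {y y' z : J → ℝ} {μ c : ℝ} (h : g.IsStep y z) (h' : g.Up μ y')
    (hy : ∀ j, y j ≤ y' j + c) (j : J) : z j ≤ μ + y' j + c := by
  obtain ⟨i, hi, hk⟩ := h' j
  obtain ⟨k, hf, hz⟩ := h.ge j i hi
  linarith [hk k hf, hy k]

theorem IsStep.up {y z : J → ℝ} {μ : ℝ} (h : g.IsStep y z) (hz : ∀ j, z j ≤ μ + y j) :
    g.Up μ y := fun j => by
  obtain ⟨i, hi, hk⟩ := h.le j
  exact ⟨i, hi, fun k hf => (hk k hf).trans (hz j)⟩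

theorem Up.shift {μ c : ℝ} {y : J → ℝ} (h : g.Up μ y) : g.Up μ (fun j => y j + c) := fun j => by
  obtain ⟨i, hi, hk⟩ := h j
  exact ⟨i, hi, fun k hf => by linarith [hk k hf]⟩

/-- Of all potentials, the least nonnegative one has no large gaps between its values. -/
theorem Up.exists_bounded [Finite I] [Fintype J] (hg : g.Valid) {μ W : ℝ} (hW : g.PayLE μ W)
    (hW0 : 0 ≤ W) {y : J → ℝ} (hy : g.Up μ y) :
    ∃ y', g.Up μ y' ∧ ∀ j, 0 ≤ y' j ∧ y' j ≤ Fintype.card J * W := by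
  classical
  let Y : Set (J → ℝ) := {y | g.Up μ y ∧ ∀ j, 0 ≤ y j}
  have hne : Nonempty Y := by
    obtain ⟨c, hc⟩ := (Set.finite_range y).bddBelow
    refine ⟨⟨fun j => y j + (-c), hy.shift, fun j => ?_⟩⟩
    have := hc (Set.mem_range_self j)
    linarith
  let u : J → ℝ := fun j => ⨅ y : Y, (y : J → ℝ) j
  have hbdd : ∀ j, BddBelow (Set.range fun y : Y => (y : J → ℝ) j) := fun j =>
    ⟨0, by rintro _ ⟨y, rfl⟩; exact y.2.2 j⟩
  have hu : ∀ y ∈ Y, ∀ j, u j ≤ y j := fun y hy j => ciInf_le (hbdd j) ⟨y, hy⟩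
  have hu0 : ∀ j, 0 ≤ u j := fun j => le_ciInf fun y => y.2.2 j
  obtain ⟨z, hz⟩ := exists_step hg u
  -- By monotonicity `T u ≤ T y ≤ μ + y` for every `y` in `Y`, and the infimum over `y` gives `T u ≤
  -- μ + u`.
  have huUp : g.Up μ u := hz.up fun j => by
    have : z j - μ ≤ u j := le_ciInf fun y => by
      have := hz.le_of_up (c := 0) y.2.1 (fun j => by simpa using hu y y.2 j) j
      linarith
    linarith
  refine ⟨u, huUp, fun j => ⟨hu0 j, ?_⟩⟩
  by_contra! hj
  -- One of the bands `(m W, (m + 1) W]` with `m < |J|` contains no value of `u`: otherwise choosing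
  -- a node in each band exhausts all nodes, including `j`, which lies above all bands.
  obtain ⟨m, hm⟩ : ∃ m : Fin (Fintype.card J), ∀ k, ¬ (m * W < u k ∧ u k ≤ (m + 1) * W) := by
    by_contra! H
    choose k hk1 hk2 using H
    have hinj : Function.Injective k := by
      intro a b hab
      by_contra hne
      rcases lt_or_gt_of_ne hne with h | h
      · have h1 : (a : ℝ) + 1 ≤ b := by exact_mod_cast h
        have h2 := hk2 a
        have h3 := hk1 b
        rw [← hab] at h3
        nlinarith
      · have h1 : (b : ℝ) + 1 ≤ a := by exact_mod_cast h
        have h2 := hk2 b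
        have h3 := hk1 a
        rw [hab] at h3
        nlinarith
    have hsurj := ((Fintype.bijective_iff_injective_and_card k).2 ⟨hinj, by simp⟩).2
    obtain ⟨a, ha⟩ := hsurj j
    have h1 : (a : ℝ) + 1 ≤ Fintype.card J := by exact_mod_cast a.2
    have := hk2 a
    rw [ha] at this
    nlinarith
  set θ : ℝ := m * W with hθ
  have hθ0 : 0 ≤ θ := by positivity
  have hm' : ∀ k, u k ≤ θ + W → u k ≤ θ := fun k hk => by
    by_contra! h
    exact hm k ⟨h, by linarith⟩
  have hjS : θ + W < u j := by
    have h1 : (m : ℝ) + 1 ≤ Fintype.card J := by exact_mod_cast m.2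
    nlinarith
  obtain ⟨j1, hj1, hmin⟩ := Set.exists_min_image {j | θ + W < u j} u (Set.toFinite _) ⟨j, hjS⟩
  simp only [Set.mem_ofPred_eq] at hj1 hmin
  set ε := u j1 - θ - W with hε
  have hε0 : 0 < ε := by linarith
  -- Lowering everything above the gap by `ε` leaves a potential: a turn from above the gap to below
  -- it still descends by at least `W`, which pays for any payment. This contradicts the minimality
  -- of `u`.
  have hY : (fun j => if θ + W < u j then u j - ε else u j) ∈ Y := by
    refine ⟨fun j => ?_, fun j => ?_⟩
    · obtain ⟨i, hi, hk⟩ := huUp j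
      refine ⟨i, hi, fun k hf => ?_⟩
      have h1 := hk k hf
      have h2 := abs_le.1 (hW j i k hi hf)
      by_cases hjS : θ + W < u j
      · have h3 := hmin j hjS
        by_cases hkS : θ + W < u k
        · simp only [hjS, hkS, if_true]; linarith
        · have := hm' k (not_lt.1 hkS)
          simp only [hjS, hkS, if_true, if_false]; linarith
      · by_cases hkS : θ + W < u k <;> simp only [hjS, hkS, if_true, if_false] <;> linarith
    · by_cases hjS : θ + W < u j
      · have h3 := hmin j hjS
        simp only [hjS, if_true]; linarith
      · simpa only [hjS, if_false] using hu0 j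
  have := hu _ hY j1
  simp only [hj1, if_true] at this
  linarith

/-- Start at a node that maximises `x - y` on the support of `x`. Let Min move according to `y` and
Max reply according to `x`; adding the two inequalities leaves `μ ≤ ν`. -/
theorem Sub.le_of_up [Finite J] {μ ν : ℝ} {x : J → WithBot ℝ} {y : J → ℝ}
    (hx : g.Sub μ x) (hy : g.Up ν y) : μ ≤ ν := by
  obtain ⟨j, hj, hmax⟩ := Set.exists_max_image {j | x j ≠ ⊥} (fun j => (x j).unbotD 0 - y j)
    (Set.toFinite _) hx.ne_bot
  obtain ⟨i, hi, hk⟩ := hy j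
  obtain ⟨k, hf, hle⟩ := hx.ge j i hi
  obtain ⟨a, ha⟩ := WithBot.ne_bot_iff_exists.1 hj
  have hkb : x k ≠ ⊥ := by
    intro h
    rw [h, ← ha, WithBot.add_bot, le_bot_iff] at hle
    exact WithBot.coe_ne_bot hle
  have hm := hmax k hkb
  obtain ⟨b, hb⟩ := WithBot.ne_bot_iff_exists.1 hkb
  rw [← ha, ← hb] at hle hm
  norm_cast at hle
  simp only [WithBot.unbotD_coe] at hm
  linarith [hk k hf]

/-- Infinite pigeonhole principle. It extracts a single move from moves that are good at each finite
time. -/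
theorem exists_frequently {α : Type*} [Finite α] {P : ℕ → α → Prop} (h : ∀ N, ∃ a, P N a) :
    ∃ a, ∀ M, ∃ N ≥ M, P N a := by
  classical
  cases nonempty_fintype α
  by_contra! H
  choose M hM using H
  obtain ⟨a, ha⟩ := h (Finset.univ.sup M)
  exact hM a _ (Finset.le_sup (Finset.mem_univ a)) ha

theorem isClosed_up [Finite I] [Finite J] : IsClosed {p : ℝ × (J → ℝ) | g.Up p.1 p.2} := by
  have : {p : ℝ × (J → ℝ) | g.Up p.1 p.2} = ⋂ j, ⋃ i, {p | g.e j i ∧ ∀ k, g.f i k →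
      g.w j i k + p.2 k ≤ p.1 + p.2 j} := by
    ext p; simp [Up]
  rw [this]
  refine isClosed_iInter fun j => isClosed_iUnion_of_finite fun i => ?_
  by_cases h : g.e j i
  · simp only [h, true_and, Set.ofPred_forall]
    refine isClosed_iInter fun k => isClosed_iInter fun _ => ?_
    exact isClosed_le (by fun_prop) (by fun_prop)
  · simp [h]

theorem exists_payLE [Finite I] [Finite J] (g : RG I J) : ∃ W, 0 ≤ W ∧ g.PayLE 0 W := by
  obtain ⟨c, hc⟩ := (Set.finite_range fun a : J × I × J => |g.w a.1 a.2.1 a.2.2|).bddAbove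
  refine ⟨max c 0, le_max_right _ _, fun j i k _ _ => ?_⟩
  rw [sub_zero]
  exact (hc ⟨(j, i, k), rfl⟩).trans (le_max_left _ _)

theorem Up.neg_le [Finite J] [Nonempty J] (hg : g.Valid) {μ W : ℝ} (hW : g.PayLE 0 W) {y : J → ℝ}
    (hy : g.Up μ y) : -W ≤ μ := by
  obtain ⟨j, hj⟩ := Finite.exists_min y
  obtain ⟨i, hi, hk⟩ := hy j
  obtain ⟨k, hf⟩ := hg.f_total i
  have h1 := abs_le.1 (hW j i k hi hf)
  linarith [hk k hf, hj k]

theorem up_zero (hg : g.Valid) {W : ℝ} (hW : g.PayLE 0 W) : g.Up W 0 := fun j => by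
  obtain ⟨i, hi⟩ := hg.e_total j
  refine ⟨i, hi, fun k hf => ?_⟩
  have h1 := abs_le.1 (hW j i k hi hf)
  simp; linarith

/-- Potentials can be taken from a fixed box by `Up.exists_bounded`, and relevant `μ` lie in `[-W,
W]`; so the closed set of pairs `(μ, y)` may be cut down to a compact one, on which `μ` attains its
minimum. -/
theorem exists_min_up [Finite I] [Fintype J] [Nonempty J] (hg : g.Valid) :
    ∃ v y, g.Up v y ∧ ∀ μ y', g.Up μ y' → v ≤ μ := by
  obtain ⟨W, hW0, hW⟩ := g.exists_payLE
  let K : Set (ℝ × (J → ℝ)) := (Set.Icc (-W) W ×ˢ Set.univ.pi fun _ =>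
    Set.Icc 0 (Fintype.card J * (2 * W))) ∩ {p | g.Up p.1 p.2}
  have hb : ∀ μ ∈ Set.Icc (-W) W, ∀ y, g.Up μ y → ∃ y', (μ, y') ∈ K := by
    intro μ hμ y hy
    obtain ⟨y', h1, h2⟩ := hy.exists_bounded hg (W := 2 * W) (fun j i k hi hf => by
      have := abs_le.1 (hW j i k hi hf)
      rw [abs_le]
      constructor <;> linarith [hμ.1, hμ.2]) (by linarith)
    exact ⟨y', ⟨hμ, fun j _ => h2 j⟩, h1⟩
  have hK : IsCompact K := (isCompact_Icc.prod (isCompact_univ_pi fun _ => isCompact_Icc)).inter_right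
    isClosed_up
  obtain ⟨y0, hy0⟩ := hb W ⟨by linarith, le_rfl⟩ 0 (up_zero hg hW)
  obtain ⟨⟨v, y⟩, hvy, hmin⟩ := hK.exists_isMinOn ⟨_, hy0⟩ continuous_fst.continuousOn
  refine ⟨v, y, hvy.2, fun μ y' hy' => ?_⟩
  by_cases h : μ ≤ W
  · obtain ⟨y'', hy''⟩ := hb μ ⟨hy'.neg_le hg hW, h⟩ y' hy'
    exact hmin hy''
  · exact hvy.1.1.2.trans (not_le.1 h).le

/-- Every game has a value. -/
theorem exists_eig [Finite I] [Fintype J] [Nonempty J] (hg : g.Valid) :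
    ∃ v y x, g.Up v y ∧ g.Eig v x := by
  classical
  obtain ⟨v, y, hy, hmin⟩ := exists_min_up hg
  choose T hT using exists_step hg
  -- The orbit of the potential under `T - v`. It decreases, and its limit, with `-∞` at the nodes
  -- where it is unbounded, will be the eigenvector.
  let z : ℕ → J → ℝ := fun N => Nat.rec y (fun _ u j => T u j - v) N
  have z0 : z 0 = y := rfl
  have zs : ∀ N j, z (N + 1) j = T (z N) j - v := fun N j => rfl
  have hanti1 : ∀ N j, z (N + 1) j ≤ z N j := by
    intro N
    induction N with
    | zero =>
      intro j
      have := (hT y).le_of_up hy (c := 0) (by simp) j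
      rw [zs, z0]
      linarith
    | succ N ih =>
      intro j
      have := (hT (z (N + 1))).mono (hT (z N)) (c := 0) (by simpa using ih) j
      linarith [zs (N + 1) j, zs N j]
  have hanti : ∀ j, Antitone fun N => z N j := fun j => antitone_nat_of_succ_le fun N => hanti1 N j
  -- If every coordinate had dropped by time `N`, the orbit could be tilted into a potential for a
  -- number smaller than `v`. This ensures that the limit is not identically `-∞`.
  have hstay : ∀ N, ∃ j, z N j = y j := by
    intro N
    refine Classical.byContradiction fun H => ?_
    push Not at H
    have hlt : ∀ j, z N j < y j := fun j => lt_of_le_of_ne (hanti j (Nat.zero_le N)) (H j)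
    have hN : 0 < N := Nat.pos_of_ne_zero fun h => by
      obtain ⟨j⟩ := ‹Nonempty J›
      exact absurd (hlt j) (by simp [h, z0])
    obtain ⟨j0, hj0⟩ := Finite.exists_min fun j => y j - z N j
    set ε := y j0 - z N j0 with hε
    have hε0 : 0 < ε := by have := hlt j0; linarith
    have hNr : (0 : ℝ) < N := by exact_mod_cast hN
    set δ := ε / N with hδ
    have hδ0 : 0 < δ := by positivity
    have hNδ : N * δ = ε := by rw [hδ]; field_simp
    have hrange : (Finset.range N).Nonempty := ⟨0, by simpa using hN⟩
    -- The tilted orbit. A step leads from the term of index `k` to the next one and saves `δ`; the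
    -- last step returns to the term of index `0`, because `z N ≤ y - N δ`. Hence `T u ≤ v - δ + u`.
    let u : J → ℝ := fun j => (Finset.range N).inf' hrange fun k => z k j + k * δ
    have hu : ∀ j k, k < N → u j ≤ z k j + k * δ := fun j k hk =>
      Finset.inf'_le _ (Finset.mem_range.2 hk)
    have : g.Up (v - δ) u := by
      intro j
      obtain ⟨k, hk, hkeq⟩ := Finset.exists_mem_eq_inf' hrange fun k => z k j + k * δ
      rw [Finset.mem_range] at hk
      have hkeq : u j = z k j + k * δ := hkeq
      rcases k with _ | k
      · obtain ⟨N, rfl⟩ : ∃ N', N = N' + 1 := ⟨N - 1, by omega⟩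
        obtain ⟨i, hi, hle⟩ := (hT (z N)).le j
        refine ⟨i, hi, fun k' hf => ?_⟩
        have h1 := hle k' hf
        have h2 := hu k' N (by omega)
        have h3 := zs N j
        have h4 := hj0 j
        push_cast at hNδ hkeq
        simp only [z0] at hkeq
        have h5 : ((N : ℝ) + 1) * δ = N * δ + δ := by ring
        linarith
      · obtain ⟨i, hi, hle⟩ := (hT (z k)).le j
        refine ⟨i, hi, fun k' hf => ?_⟩
        have h1 := hle k' hf
        have h2 := hu k' k (by omega)
        have h3 := zs k j
        push_cast at hkeq
        linarith
    linarith [hmin _ _ this]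
  obtain ⟨j0, hj0⟩ := exists_frequently hstay
  have hj0' : ∀ N, y j0 ≤ z N j0 := fun N => by
    obtain ⟨M, hM, h⟩ := hj0 N
    rw [← h]
    exact hanti j0 hM
  let x : J → WithBot ℝ := fun j =>
    if BddBelow (Set.range fun N => z N j) then ((⨅ N, z N j : ℝ) : WithBot ℝ) else ⊥
  have hx : ∀ j (c : ℝ), (c : WithBot ℝ) ≤ x j ↔ ∀ N, c ≤ z N j := by
    intro j c
    by_cases h : BddBelow (Set.range fun N => z N j)
    · simp only [x, h, if_true, WithBot.coe_le_coe]
      exact le_ciInf_iff h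
    · simp only [x, h, if_false, le_bot_iff, WithBot.coe_ne_bot, false_iff]
      exact fun h' => h ⟨c, by rintro _ ⟨N, rfl⟩; exact h' N⟩
  refine ⟨v, y, x, hy, ⟨⟨⟨j0, ?_⟩, fun j i hi => ?_⟩, fun j => ?_⟩⟩
  · intro h
    have := (hx j0 (y j0)).2 hj0'
    rw [h, le_bot_iff] at this
    exact WithBot.coe_ne_bot this
  · rcases h : x j with _ | a
    · obtain ⟨k, hf⟩ := hg.f_total i
      exact ⟨k, hf, by erw [WithBot.add_bot]; exact bot_le⟩
    · have ha : ∀ N, a ≤ z N j := (hx j a).1 h.ge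
      -- The best reply may depend on `N`; one that recurs for arbitrarily large `N` remains good in
      -- the limit, since the orbit decreases.
      obtain ⟨k, hk⟩ := exists_frequently fun N => (hT (z N)).ge j i hi
      obtain ⟨N0, _, hf, _⟩ := hk 0
      refine ⟨k, hf, ?_⟩
      have : ((v + a - g.w j i k : ℝ) : WithBot ℝ) ≤ x k := (hx k _).2 fun M => by
        obtain ⟨N, hN, _, h2⟩ := hk M
        have h3 := zs N j
        have h4 := ha (N + 1)
        have h5 : z N k ≤ z M k := hanti k hN
        linarith
      calc (v : WithBot ℝ) + (a : ℝ) = (g.w j i k : WithBot ℝ) + ((v + a - g.w j i k : ℝ) : WithBot ℝ) := by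
            norm_cast; ring
        _ ≤ _ := by gcongr
  · obtain ⟨i, hi⟩ := exists_frequently fun N => (hT (z N)).le j
    obtain ⟨N0, _, he, _⟩ := hi 0
    refine ⟨i, he, fun k hf => ?_⟩
    rcases h : x k with _ | b
    · erw [WithBot.add_bot]; exact bot_le
    · have hb : ∀ N, b ≤ z N k := (hx k b).1 h.ge
      have : ((g.w j i k + b - v : ℝ) : WithBot ℝ) ≤ x j := (hx j _).2 fun M => by
        obtain ⟨N, hN, _, h2⟩ := hi M
        have h3 := zs N j
        have h4 := h2 k hf
        have h5 : z (N + 1) j ≤ z M j := (hanti1 N j).trans (hanti j hN)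
        linarith [hb N]
      calc (g.w j i k : WithBot ℝ) + (b : ℝ) = (v : WithBot ℝ) + ((g.w j i k + b - v : ℝ) : WithBot ℝ) := by
            norm_cast; ring
        _ ≤ _ := by gcongr

end RG
-- Optimal cycles, and the value of a game
namespace RG

variable {I J : Type*} {g : RG I J}

/-- Along an eigenvector, optimal moves lead to a cycle whose mean payment is the eigenvalue. -/
theorem Eig.exists_cycle [Finite I] [Finite J] (hg : g.Valid) {v : ℝ} {x : J → WithBot ℝ}
    (hx : g.Eig v x) : ∃ (k : ℕ) (c : ℕ → J) (d : ℕ → I), 0 < k ∧ k ≤ Nat.card J ∧ k ≤ Nat.card I ∧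
      (∀ t, g.e (c t) (d t) ∧ g.f (d t) (c (t + 1))) ∧
      ∑ t ∈ Finset.range k, g.w (c t) (d t) (c (t + 1)) = k * v := by
  choose σ hσ hσle using hx.le
  have h1 : ∀ i, ∃ k, g.f i k ∧ ∀ k', g.f i k' →
      (g.q i k' : WithBot ℝ) + x k' ≤ (g.q i k : WithBot ℝ) + x k := by
    intro i
    obtain ⟨k, hk, h⟩ := Set.exists_max_image {k | g.f i k}
      (fun k => (g.q i k : WithBot ℝ) + x k) (Set.toFinite _) (hg.f_total i)
    exact ⟨k, hk, h⟩
  choose τ hτ hτm using h1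
  -- Both players move by fixed optimal choices, so the play is the orbit of a map, and `v + x`
  -- loses exactly the payment at each turn.
  set F : J → J := fun j => τ (σ j) with hF
  have hstep : ∀ j, (v : WithBot ℝ) + x j = (g.w j (σ j) (F j) : WithBot ℝ) + x (F j) := by
    intro j
    refine le_antisymm ?_ (hσle j _ (hτ _))
    obtain ⟨k, hf, hk⟩ := hx.ge j (σ j) (hσ j)
    refine hk.trans ?_
    have := hτm (σ j) k hf
    calc (g.w j (σ j) k : WithBot ℝ) + x k
        = (g.p j (σ j) : WithBot ℝ) + ((g.q (σ j) k : WithBot ℝ) + x k) := by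
          rw [← add_assoc, ← WithBot.coe_add]; rfl
      _ ≤ (g.p j (σ j) : WithBot ℝ) + ((g.q (σ j) (F j) : WithBot ℝ) + x (F j)) := by gcongr
      _ = _ := by rw [← add_assoc, ← WithBot.coe_add]; rfl
  have hsupp : ∀ j, x j ≠ ⊥ → x (F j) ≠ ⊥ := by
    intro j hj h
    have := hstep j
    rw [h, WithBot.add_bot, WithBot.add_eq_bot] at this
    rcases this with h | h
    · exact WithBot.coe_ne_bot h
    · exact hj h
  obtain ⟨j0, hj0⟩ := hx.ne_bot
  have hiter : ∀ t, x (F^[t] j0) ≠ ⊥ := by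
    intro t
    induction t with
    | zero => exact hj0
    | succ t ih => rw [Function.iterate_succ_apply']; exact hsupp _ ih
  obtain ⟨a, b, hab, heq⟩ := Finite.exists_ne_map_eq_of_infinite fun t : ℕ => F^[t] j0
  wlog hlt : a < b generalizing a b
  · exact this b a hab.symm heq.symm (by omega)
  have heq : F^[a] j0 = F^[b] j0 := heq
  obtain ⟨c0, hc0⟩ : ∃ c0, c0 = F^[a] j0 := ⟨_, rfl⟩
  have hper : c0 ∈ Function.periodicPts F := by
    refine ⟨b - a, by omega, ?_⟩
    show F^[b - a] c0 = c0
    rw [hc0, ← Function.iterate_add_apply, show b - a + a = b by omega, heq]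
  have hsc : ∀ t, x (F^[t] c0) ≠ ⊥ := fun t => by
    rw [hc0, ← Function.iterate_add_apply]
    exact hiter _
  set k := Function.minimalPeriod F c0 with hk
  have hkpos : 0 < k := Function.minimalPeriod_pos_of_mem_periodicPts hper
  have hkper : F^[k] c0 = c0 := Function.iterate_minimalPeriod
  have hinj := Function.iterate_injOn_Iio_minimalPeriod (f := F) (x := c0)
  have hinjc : Function.Injective fun t : Fin k => F^[t] c0 := fun s t h =>
    Fin.ext (hinj s.2 t.2 h)
  -- Equal nodes of Max have equal successors under `τ`, so the minimal cycle repeats no node of Max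
  -- either. This is where the number `2m` enters `κ`.
  have hinjd : Function.Injective fun t : Fin k => σ (F^[t] c0) := by
    intro s t h
    have h' : F^[s + 1] c0 = F^[t + 1] c0 := by
      rw [Function.iterate_succ_apply', Function.iterate_succ_apply']
      exact congrArg τ h
    have key : ∀ s t : Fin k, F^[(s : ℕ) + 1] c0 = F^[(t : ℕ) + 1] c0 → (s : ℕ) + 1 = k →
        (t : ℕ) + 1 = k := by
      intro s t h' hs
      by_contra hne
      rw [hs, hkper] at h'
      have := hinj (show 0 ∈ Set.Iio k from hkpos)
        (show (t : ℕ) + 1 ∈ Set.Iio k from by have := t.2; simp only [Set.mem_Iio]; omega) h'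
      omega
    apply Fin.ext
    by_cases hs : (s : ℕ) + 1 = k
    · have := key s t h' hs
      omega
    · by_cases ht : (t : ℕ) + 1 = k
      · have := key t s h'.symm ht
        omega
      · have := hinj (show (s : ℕ) + 1 ∈ Set.Iio k from by
          have := s.2; simp only [Set.mem_Iio]; omega) (show (t : ℕ) + 1 ∈ Set.Iio k from by
          have := t.2; simp only [Set.mem_Iio]; omega) h'
        omega
  refine ⟨k, fun t => F^[t] c0, fun t => σ (F^[t] c0), hkpos, ?_, ?_, fun t => ⟨hσ _, ?_⟩, ?_⟩
  · simpa using Nat.card_le_card_of_injective _ hinjc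
  · simpa using Nat.card_le_card_of_injective _ hinjd
  · show g.f _ (F^[t + 1] c0)
    rw [Function.iterate_succ_apply']
    exact hτ _
  · have hreal : ∀ t, g.w (F^[t] c0) (σ (F^[t] c0)) (F^[t + 1] c0) =
        v + (x (F^[t] c0)).unbotD 0 - (x (F^[t + 1] c0)).unbotD 0 := by
      intro t
      have h := hstep (F^[t] c0)
      rw [← Function.iterate_succ_apply' F] at h
      obtain ⟨p, hp⟩ := WithBot.ne_bot_iff_exists.1 (hsc t)
      obtain ⟨q, hq⟩ := WithBot.ne_bot_iff_exists.1 (hsc (t + 1))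
      rw [← hp, ← hq] at h ⊢
      norm_cast at h
      simp only [WithBot.unbotD_coe]
      linarith
    have : ∀ N, ∑ t ∈ Finset.range N, g.w (F^[t] c0) (σ (F^[t] c0)) (F^[t + 1] c0) =
        N * v + (x c0).unbotD 0 - (x (F^[N] c0)).unbotD 0 := by
      intro N
      induction N with
      | zero => simp
      | succ N ih => rw [Finset.sum_range_succ, ih, hreal]; push_cast; ring
    rw [this, hkper]
    ring

/-- `v` is the greatest value of the game. -/
structure IsVal (g : RG I J) (v : ℝ) : Prop where
  up : ∃ y, g.Up v y
  eig : ∃ x, g.Eig v x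

theorem exists_isVal [Finite I] [Finite J] [Nonempty J] (hg : g.Valid) : ∃ v, g.IsVal v := by
  cases nonempty_fintype J
  obtain ⟨v, y, x, hy, hx⟩ := exists_eig hg
  exact ⟨v, ⟨y, hy⟩, ⟨x, hx⟩⟩

theorem IsVal.le [Finite J] {v μ : ℝ} {y : J → ℝ} (h : g.IsVal v) (hy : g.Up μ y) : v ≤ μ := by
  obtain ⟨x, hx⟩ := h.eig
  exact hx.toSub.le_of_up hy

theorem IsVal.ge [Finite J] {v μ : ℝ} {x : J → WithBot ℝ} (h : g.IsVal v) (hx : g.Sub μ x) :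
    μ ≤ v := by
  obtain ⟨y, hy⟩ := h.up
  exact hx.le_of_up hy

theorem IsVal.unique [Finite J] {v v' : ℝ} (h : g.IsVal v) (h' : g.IsVal v') : v = v' := by
  obtain ⟨y, hy⟩ := h.up
  obtain ⟨y', hy'⟩ := h'.up
  exact le_antisymm (h.le hy') (h'.le hy)

/-- Renaming the nodes of Max and scaling and shifting the payments. -/
theorem IsVal.map {I' : Type*} [Finite I'] [Finite J] [Nonempty J] {g' : RG I' J}
    (hg' : g'.Valid) (φ : I ≃ I') (he : ∀ j i, g'.e j (φ i) ↔ g.e j i)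
    (hf : ∀ i k, g'.f (φ i) k ↔ g.f i k) {D c : ℝ} (hD : 0 < D)
    (hw : ∀ j i k, g.e j i → g.f i k → g'.w j (φ i) k = D * g.w j i k + c) {v : ℝ}
    (h : g.IsVal v) : g'.IsVal (D * v + c) := by
  obtain ⟨v', hv'⟩ := exists_isVal hg'
  obtain ⟨y, hy⟩ := h.up
  obtain ⟨y', hy'⟩ := hv'.up
  have h1 : v' ≤ D * v + c := hv'.le (y := fun j => D * y j) fun j => by
    obtain ⟨i, hi, hk⟩ := hy j
    refine ⟨φ i, (he j i).2 hi, fun k hfk => ?_⟩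
    rw [hf] at hfk
    rw [hw j i k hi hfk]
    nlinarith [hk k hfk]
  have h2 : v ≤ (v' - c) / D := h.le (y := fun j => y' j / D) fun j => by
    obtain ⟨i, hi, hk⟩ := hy' j
    obtain ⟨i, rfl⟩ := φ.surjective i
    rw [he] at hi
    refine ⟨i, hi, fun k hfk => ?_⟩
    have h3 := hk k ((hf i k).2 hfk)
    rw [hw j i k hi hfk] at h3
    have : g.w j i k = (D * g.w j i k + c - c) / D := by field_simp; ring
    rw [this, ← add_div, ← add_div]
    exact div_le_div_of_nonneg_right (by linarith) hD.le
  rw [le_div_iff₀ hD] at h2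
  rwa [le_antisymm h1 (by linarith)] at hv'

/-- The values of the finite-horizon games, divided by the horizon, approach the value. -/
theorem IsVal.iterate [Finite J] {v C : ℝ} (h : g.IsVal v) {y : J → ℝ} (hy : g.Up v y)
    (hyC : ∀ j, 0 ≤ y j ∧ y j ≤ C) {z : ℕ → J → ℝ} (hz0 : z 0 = 0)
    (hz : ∀ N, g.IsStep (z N) (z (N + 1))) (N : ℕ) :
    (∀ j, z N j ≤ N * v + C) ∧ ∃ j, N * v ≤ z N j := by
  constructor
  · have : ∀ N j, z N j ≤ y j + N * v := by
      intro N
      induction N with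
      | zero => intro j; simp [hz0, (hyC j).1]
      | succ N ih =>
        intro j
        have := (hz N).le_of_up hy ih j
        push_cast
        linarith
    intro j
    linarith [this N j, (hyC j).2]
  · obtain ⟨x, hx⟩ := h.eig
    -- Induction gives `z N j ≥ N v + x j - max x`. At a maximiser of `x` the correction disappears,
    -- so the lower bound loses no constant.
    obtain ⟨j0, hj0, hmax⟩ := Set.exists_max_image {j | x j ≠ ⊥} x (Set.toFinite _) hx.ne_bot
    obtain ⟨a, ha⟩ := WithBot.ne_bot_iff_exists.1 hj0
    have hmax' : ∀ j (b : ℝ), x j = b → b ≤ a := fun j b hb => by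
      have := hmax j (by simp [hb])
      rw [hb, ← ha] at this
      exact_mod_cast this
    have : ∀ N j (b : ℝ), x j = b → N * v + b ≤ z N j + a := by
      intro N
      induction N with
      | zero => intro j b hb; simpa [hz0] using hmax' j b hb
      | succ N ih =>
        intro j b hb
        obtain ⟨i, hi, hk⟩ := (hz N).le j
        obtain ⟨k, hf, hle⟩ := hx.ge j i hi
        rw [hb] at hle
        rcases hxk : x k with _ | b'
        · rw [hxk] at hle
          erw [WithBot.add_bot, le_bot_iff] at hle
          exact absurd hle WithBot.coe_ne_bot
        · have h1 := ih k b' hxk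
          have h2 : v + b ≤ g.w j i k + b' := by
            rw [hxk] at hle
            exact WithBot.coe_le_coe.1 hle
          have h3 := hk k hf
          push_cast
          linarith
    exact ⟨j0, by linarith [this N j0 a ha.symm]⟩

/-- The game describes the min-max function `F`. -/
structure Represents (g : RG I J) (F : (J → WithBot ℝ) → J → WithTop (WithBot ℝ)) : Prop where
  le_iff : ∀ x j (c : WithBot ℝ), F x j ≤ (c : WithTop (WithBot ℝ)) ↔
    ∃ i, g.e j i ∧ ∀ k, g.f i k → (g.w j i k : WithBot ℝ) + x k ≤ c
  ge_iff : ∀ x j (c : WithBot ℝ), (c : WithTop (WithBot ℝ)) ≤ F x j ↔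
    ∀ i, g.e j i → ∃ k, g.f i k ∧ c ≤ (g.w j i k : WithBot ℝ) + x k

/-- The value is an eigenvalue, and every real eigenvalue comes with a sub-eigenvector, which the
potential of the value bounds by `v`. -/
theorem Represents.specRadius_eq {n : ℕ} {g : RG I (Fin n)}
    {F : (Fin n → WithBot ℝ) → Fin n → WithTop (WithBot ℝ)} (h : g.Represents F) {v : ℝ}
    (hv : g.IsVal v) : specRadius F = v := by
  refine IsGreatest.csSup_eq ⟨?_, ?_⟩
  · obtain ⟨x, hx⟩ := hv.eig
    exact ⟨x, hx.ne_bot, fun j =>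
      le_antisymm ((h.le_iff x j _).2 (hx.le j)) ((h.ge_iff x j _).2 (hx.ge j))⟩
  · rintro l ⟨x, hx, hl⟩
    rcases l with _ | l
    · exact bot_le
    · refine WithBot.coe_le_coe.2 (hv.ge (x := x) ⟨hx, fun j i hi => ?_⟩)
      exact (h.ge_iff x j _).1 (hl j).ge i hi

end RG

theorem coe_val {a : WithBot ℤ} (h : a ≠ ⊥) : (val a : WithBot ℤ) = a := by
  cases a with
  | bot => exact absurd rfl h
  | coe a => rfl

theorem map_coe_val {a : WithBot ℤ} (h : a ≠ ⊥) :
    WithBot.map (fun z : ℤ => (z : ℝ)) a = (((val a : ℤ) : ℝ) : WithBot ℝ) := by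
  conv_lhs => rw [← coe_val h]
  rfl

/-! ### Residuated max-plus operators as moves in a game -/

section Resid

variable {m n : ℕ}

/-- The condition on the row serves the case `c = ⊥`, in which the inequality itself provides no
index. -/
theorem le_mulVec_iff {B : Matrix (Fin m) (Fin n) (WithBot ℤ)} {i : Fin m}
    (hB : ∃ k, B i k ≠ ⊥) (x : Fin n → WithBot ℝ) (c : WithBot ℝ) :
    c ≤ mulVec (toReal B) x i ↔ ∃ k, B i k ≠ ⊥ ∧ c ≤ (((val (B i k) : ℤ) : ℝ) : WithBot ℝ) + x k := by
  rcases eq_or_ne c ⊥ with rfl | hc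
  · simpa using hB
  · rw [mulVec, Finset.le_sup_iff (bot_lt_iff_ne_bot.2 hc)]
    simp only [Finset.mem_univ, true_and]
    refine exists_congr fun k => ?_
    by_cases h : B i k = ⊥
    · simp [toReal, h, hc]
    · simp only [toReal, Matrix.map_apply, map_coe_val h, ne_eq, h, not_false_eq_true, true_and]

theorem mulVec_le_iff {B : Matrix (Fin m) (Fin n) (WithBot ℤ)} {i : Fin m}
    (x : Fin n → WithBot ℝ) (c : WithBot ℝ) :
    mulVec (toReal B) x i ≤ c ↔ ∀ k, B i k ≠ ⊥ → (((val (B i k) : ℤ) : ℝ) : WithBot ℝ) + x k ≤ c := by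
  rw [mulVec, Finset.sup_le_iff]
  simp only [Finset.mem_univ, true_imp_iff]
  refine forall_congr' fun k => ?_
  by_cases h : B i k = ⊥
  · simp [toReal, h]
  · simp only [toReal, Matrix.map_apply, map_coe_val h, ne_eq, h, not_false_eq_true, true_imp_iff]

theorem resid_le_iff {A : Matrix (Fin m) (Fin n) (WithBot ℤ)} (y : Fin m → WithBot ℝ) (j : Fin n)
    (c : WithBot ℝ) : resid (toReal A) y j ≤ (c : WithTop (WithBot ℝ)) ↔
      ∃ i, A i j ≠ ⊥ ∧ ((-((val (A i j) : ℤ) : ℝ) : ℝ) : WithBot ℝ) + y i ≤ c := by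
  rw [resid, Finset.inf_le_iff (WithTop.coe_lt_top c)]
  simp only [Finset.mem_univ, true_and]
  refine exists_congr fun i => ?_
  by_cases h : A i j = ⊥
  · simp [toReal, h]
  · simp only [toReal, Matrix.map_apply, map_coe_val h, ne_eq, h, not_false_eq_true, true_and]
    exact WithTop.coe_le_coe

theorem le_resid_iff {A : Matrix (Fin m) (Fin n) (WithBot ℤ)} (y : Fin m → WithBot ℝ) (j : Fin n)
    (c : WithBot ℝ) : (c : WithTop (WithBot ℝ)) ≤ resid (toReal A) y j ↔
      ∀ i, A i j ≠ ⊥ → c ≤ ((-((val (A i j) : ℤ) : ℝ) : ℝ) : WithBot ℝ) + y i := by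
  rw [resid, Finset.le_inf_iff]
  simp only [Finset.mem_univ, true_imp_iff]
  refine forall_congr' fun i => ?_
  by_cases h : A i j = ⊥
  · simp [toReal, h]
  · simp only [toReal, Matrix.map_apply, map_coe_val h, ne_eq, h, not_false_eq_true, true_imp_iff]
    exact WithTop.coe_le_coe

theorem coe_add_le_iff (l : ℝ) (a c : WithBot ℝ) :
    (l : WithBot ℝ) + a ≤ c ↔ a ≤ ((-l : ℝ) : WithBot ℝ) + c := by
  cases a with
  | bot => simp
  | coe a =>
    cases c with
    | bot => simp [← WithBot.coe_add]
    | coe c => norm_cast; constructor <;> intro h <;> linarith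

theorem le_coe_add_iff (l : ℝ) (a c : WithBot ℝ) :
    c ≤ (l : WithBot ℝ) + a ↔ ((-l : ℝ) : WithBot ℝ) + c ≤ a := by
  rw [coe_add_le_iff, neg_neg]

theorem top_coe_add_le_iff (l : ℝ) (a : WithTop (WithBot ℝ)) (c : WithBot ℝ) :
    ((l : WithBot ℝ) : WithTop (WithBot ℝ)) + a ≤ c ↔
      a ≤ ((((-l : ℝ) : WithBot ℝ) + c : WithBot ℝ) : WithTop (WithBot ℝ)) := by
  cases a with
  | top => simp
  | coe a => rw [← WithTop.coe_add, WithTop.coe_le_coe, WithTop.coe_le_coe, coe_add_le_iff]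

theorem le_top_coe_add_iff (l : ℝ) (a : WithTop (WithBot ℝ)) (c : WithBot ℝ) :
    (c : WithTop (WithBot ℝ)) ≤ ((l : WithBot ℝ) : WithTop (WithBot ℝ)) + a ↔
      ((((-l : ℝ) : WithBot ℝ) + c : WithBot ℝ) : WithTop (WithBot ℝ)) ≤ a := by
  cases a with
  | top => simp
  | coe a => rw [← WithTop.coe_add, WithTop.coe_le_coe, WithTop.coe_le_coe, le_coe_add_iff]

theorem resid_mulVec_le_iff {A B : Matrix (Fin m) (Fin n) (WithBot ℤ)} (x : Fin n → WithBot ℝ)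
    (j : Fin n) (c : WithBot ℝ) :
    resid (toReal A) (mulVec (toReal B) x) j ≤ (c : WithTop (WithBot ℝ)) ↔
      ∃ i, A i j ≠ ⊥ ∧ ∀ k, B i k ≠ ⊥ →
        ((-(val (A i j) : ℝ) + (val (B i k) : ℝ) : ℝ) : WithBot ℝ) + x k ≤ c := by
  rw [resid_le_iff]
  refine exists_congr fun i => and_congr_right fun _ => ?_
  rw [coe_add_le_iff, mulVec_le_iff]
  refine forall_congr' fun k => imp_congr_right fun _ => ?_
  rw [← coe_add_le_iff, ← add_assoc, ← WithBot.coe_add]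

theorem le_resid_mulVec_iff {A B : Matrix (Fin m) (Fin n) (WithBot ℤ)}
    (hB : ∀ i, ∃ k, B i k ≠ ⊥) (x : Fin n → WithBot ℝ) (j : Fin n) (c : WithBot ℝ) :
    (c : WithTop (WithBot ℝ)) ≤ resid (toReal A) (mulVec (toReal B) x) j ↔
      ∀ i, A i j ≠ ⊥ → ∃ k, B i k ≠ ⊥ ∧
        c ≤ ((-(val (A i j) : ℝ) + (val (B i k) : ℝ) : ℝ) : WithBot ℝ) + x k := by
  rw [le_resid_iff]
  refine forall_congr' fun i => imp_congr_right fun _ => ?_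
  rw [le_coe_add_iff, le_mulVec_iff (hB i)]
  refine exists_congr fun k => and_congr_right fun _ => ?_
  rw [← le_coe_add_iff, ← add_assoc, ← WithBot.coe_add]

end Resid

/-! ### Integer games, and the parametric game of the two matrices -/

/-- The real game described by an integer game. -/
def Game.rg (G : Game) : RG (Fin G.rows) (Fin G.cols) where
  e j i := G.P i j ≠ ⊥
  f i k := G.Q i k ≠ ⊥
  p j i := -(val (G.P i j) : ℝ)
  q i k := (val (G.Q i k) : ℝ)

theorem Game.Valid.rg {G : Game} (h : G.Valid) : G.rg.Valid := ⟨h.2.1, h.2.2⟩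

theorem Game.value_eq {G : Game} (h : G.Valid) {v : ℝ} (hv : G.rg.IsVal v) :
    G.value = (v : WithBot ℝ) :=
  RG.Represents.specRadius_eq (g := G.rg)
    ⟨fun x j c => resid_mulVec_le_iff x j c, fun x j c => le_resid_mulVec_iff h.2.2 x j c⟩ hv

/-- The game of the parametric min-max function; the left nodes of Max come from `A♯ B`, the right
ones from `B♯ A`. -/
def pgame {m n : ℕ} (A B : Matrix (Fin m) (Fin n) (WithBot ℤ)) (l : ℝ) :
    RG (Fin m ⊕ Fin m) (Fin n) where
  e j i := i.elim (fun i => A i j ≠ ⊥) (fun i => B i j ≠ ⊥)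
  f i k := i.elim (fun i => B i k ≠ ⊥) (fun i => A i k ≠ ⊥)
  p j i := i.elim (fun i => l - val (A i j)) (fun i => -l - val (B i j))
  q i k := i.elim (fun i => (val (B i k) : ℝ)) (fun i => (val (A i k) : ℝ))

section Pgame

variable {m n M : ℕ} {A B : Matrix (Fin m) (Fin n) (WithBot ℤ)}

theorem Admissible.valid (h : Admissible A B M) (l : ℝ) : (pgame A B l).Valid where
  e_total j := by
    obtain ⟨i, hi | hi⟩ := h.column j
    · exact ⟨Sum.inl i, hi⟩
    · exact ⟨Sum.inr i, hi⟩
  f_total i := by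
    rcases i with i | i
    · exact h.row_right i
    · exact h.row_left i

theorem minMax_represents (h : Admissible A B M) (l : ℝ) :
    (pgame A B l).Represents (minMax (toReal A) (toReal B) l) where
  le_iff x j c := by
    rw [minMax, inf_le_iff, top_coe_add_le_iff, top_coe_add_le_iff, resid_mulVec_le_iff,
      resid_mulVec_le_iff, Sum.exists]
    refine or_congr ?_ ?_ <;> refine exists_congr fun i => and_congr_right fun _ => ?_ <;>
      refine forall_congr' fun k => imp_congr_right fun _ => ?_ <;>
      rw [← coe_add_le_iff, ← add_assoc, ← WithBot.coe_add] <;>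
      simp only [RG.w, pgame, Sum.elim_inl, Sum.elim_inr] <;> ring_nf
  ge_iff x j c := by
    rw [minMax, le_inf_iff, le_top_coe_add_iff, le_top_coe_add_iff,
      le_resid_mulVec_iff h.row_right, le_resid_mulVec_iff h.row_left, Sum.forall]
    refine and_congr ?_ ?_ <;> refine forall_congr' fun i => imp_congr_right fun _ => ?_ <;>
      refine exists_congr fun k => and_congr_right fun _ => ?_ <;>
      rw [← le_coe_add_iff, ← add_assoc, ← WithBot.coe_add] <;>
      simp only [RG.w, pgame, Sum.elim_inl, Sum.elim_inr] <;> ring_nf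

theorem Admissible.nonempty (h : Admissible A B M) : Nonempty (Fin n) := ⟨⟨0, h.cols_pos⟩⟩

theorem Admissible.exists_val (h : Admissible A B M) (l : ℝ) : ∃ v, (pgame A B l).IsVal v :=
  haveI := h.nonempty
  RG.exists_isVal (h.valid l)

/-- The spectral function as a real function. -/
noncomputable def sval (A B : Matrix (Fin m) (Fin n) (WithBot ℤ)) (l : ℝ) : ℝ :=
  (specFun (toReal A) (toReal B) l).unbotD 0

theorem Admissible.specFun_eq (h : Admissible A B M) (l : ℝ) :
    specFun (toReal A) (toReal B) l = (sval A B l : WithBot ℝ) := by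
  obtain ⟨v, hv⟩ := h.exists_val l
  rw [sval, specFun, (minMax_represents h l).specRadius_eq hv]
  rfl

theorem Admissible.isVal (h : Admissible A B M) (l : ℝ) : (pgame A B l).IsVal (sval A B l) := by
  obtain ⟨v, hv⟩ := h.exists_val l
  rw [sval, specFun, (minMax_represents h l).specRadius_eq hv]
  exact hv

end Pgame

variable {m n M : ℕ} {A B : Matrix (Fin m) (Fin n) (WithBot ℤ)}

/-! ### Differences of entries; lines and zeros of the spectral function -/

theorem val_mem_diffs {i : Fin m} {j k : Fin n} (ha : A i j ≠ ⊥) (hb : B i k ≠ ⊥) :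
    val (A i j) - val (B i k) ∈ diffs A B :=
  ⟨i, j, k, val (A i j), val (B i k), (coe_val ha).symm, (coe_val hb).symm, rfl⟩

theorem mem_diffs_iff {d : ℤ} : d ∈ diffs A B ↔
    ∃ i j k, A i j ≠ ⊥ ∧ B i k ≠ ⊥ ∧ d = val (A i j) - val (B i k) := by
  constructor
  · rintro ⟨i, j, k, a, b, ha, hb, rfl⟩
    exact ⟨i, j, k, by simp [ha], by simp [hb], by simp [ha, hb, val]⟩
  · rintro ⟨i, j, k, ha, hb, rfl⟩
    exact val_mem_diffs ha hb

theorem neg_mem_diffs_swap {d : ℤ} : -d ∈ diffs B A ↔ d ∈ diffs A B := by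
  simp only [mem_diffs_iff]
  constructor
  · rintro ⟨i, j, k, h1, h2, h⟩
    exact ⟨i, k, j, h2, h1, by omega⟩
  · rintro ⟨i, j, k, h1, h2, h⟩
    exact ⟨i, k, j, h2, h1, by omega⟩

theorem EntriesLE.abs_val_le {W : ℕ} (h : EntriesLE A W) (i : Fin m) (j : Fin n) :
    |val (A i j)| ≤ W := by
  rcases hA : A i j with _ | a
  · show |(0 : ℤ)| ≤ W
    simp
  · exact h i j a hA

namespace Admissible

theorem swap (h : Admissible A B M) : Admissible B A M :=
  ⟨h.rows_pos, h.cols_pos, h.row_right, h.row_left,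
    fun j => (h.column j).imp fun _ => Or.symm, h.bound_right, h.bound_left⟩

theorem abs_diff_le (h : Admissible A B M) {d : ℤ} (hd : d ∈ diffs A B) : |d| ≤ 2 * M := by
  obtain ⟨i, j, k, _, _, rfl⟩ := mem_diffs_iff.1 hd
  have h1 := abs_le.1 (h.bound_left.abs_val_le i j)
  have h2 := abs_le.1 (h.bound_right.abs_val_le i k)
  rw [abs_le]
  constructor <;> linarith

theorem diffs_nonempty (h : Admissible A B M) : (diffs A B).Nonempty := by
  obtain ⟨j, hj⟩ := h.row_left ⟨0, h.rows_pos⟩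
  obtain ⟨k, hk⟩ := h.row_right ⟨0, h.rows_pos⟩
  exact ⟨_, val_mem_diffs hj hk⟩

theorem isGreatest_upperC (h : Admissible A B M) : IsGreatest (diffs A B) (upperC A B) := by
  have hb : BddAbove (diffs A B) := ⟨2 * M, fun d hd => (abs_le.1 (h.abs_diff_le hd)).2⟩
  exact ⟨Int.csSup_mem h.diffs_nonempty hb, fun d hd => le_csSup hb hd⟩

theorem isLeast_lowerC (h : Admissible A B M) : IsLeast (diffs A B) (lowerC A B) := by
  have hb : BddBelow (diffs A B) := ⟨-(2 * M), fun d hd => by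
    have := (abs_le.1 (h.abs_diff_le hd)).1; linarith⟩
  exact ⟨Int.csInf_mem h.diffs_nonempty hb, fun d hd => csInf_le hb hd⟩

theorem upperC_swap (h : Admissible A B M) : upperC B A = -lowerC A B := by
  refine h.swap.isGreatest_upperC.unique ⟨?_, fun d hd => ?_⟩
  · exact neg_mem_diffs_swap.2 h.isLeast_lowerC.1
  · have := h.isLeast_lowerC.2 (neg_mem_diffs_swap.2 hd)
    linarith

theorem delta_eq (h : Admissible A B M) : Delta A B = max (upperC A B) (-lowerC A B) := by
  rw [Delta, h.upperC_swap]

theorem lowerC_le (h : Admissible A B M) : lowerC A B ≤ upperC A B :=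
  h.isLeast_lowerC.2 h.isGreatest_upperC.1

theorem delta_swap (A B : Matrix (Fin m) (Fin n) (WithBot ℤ)) : Delta B A = Delta A B :=
  max_comm _ _

theorem abs_le_delta (h : Admissible A B M) {d : ℤ} (hd : d ∈ diffs A B) : |d| ≤ Delta A B := by
  rw [h.delta_eq, abs_le]
  have h1 := h.isGreatest_upperC.2 hd
  have h2 := h.isLeast_lowerC.2 hd
  have h3 := le_max_left (upperC A B) (-lowerC A B)
  have h4 := le_max_right (upperC A B) (-lowerC A B)
  constructor <;> linarith

theorem delta_nonneg (h : Admissible A B M) : 0 ≤ Delta A B :=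
  (abs_nonneg _).trans (h.abs_le_delta h.isGreatest_upperC.1)

theorem delta_le (h : Admissible A B M) : Delta A B ≤ 2 * M := by
  rw [h.delta_eq]
  exact max_le (abs_le.1 (h.abs_diff_le h.isGreatest_upperC.1)).2
    (by have := (abs_le.1 (h.abs_diff_le h.isLeast_lowerC.1)).1; linarith)

/-- Along a cycle with `p` moves through `A♯ B` and `q` moves through `B♯ A`, the mean payment is
an affine function of the parameter. -/
theorem exists_line (h : Admissible A B M) (l : ℝ) : ∃ (p q : ℕ) (a : ℤ), 0 < p + q ∧
    p + q ≤ kappa m n ∧ |a| ≤ ((p + q : ℕ) : ℤ) * Delta A B ∧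
    (∀ c, (∀ d ∈ diffs A B, d = c) → a = -c * ((p : ℤ) - q)) ∧
    sval A B l * (p + q) = a + (p - q) * l := by
  obtain ⟨x, hx⟩ := (h.isVal l).eig
  obtain ⟨k, c, d, hk, hkn, hkm, hedge, hsum⟩ := hx.exists_cycle (h.valid l)
  -- The payment of each turn is a difference of entries up to sign, plus or minus the parameter.
  -- The second property, for the case that all differences equal `c0`, makes every line pass
  -- through the point `(c0, 0)`.
  have step : ∀ t, ∃ ω : ℤ, |ω| ≤ Delta A B ∧
      (∀ c0, (∀ d ∈ diffs A B, d = c0) → ω = if (d t).isLeft then -c0 else c0) ∧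
      (pgame A B l).w (c t) (d t) (c (t + 1)) = ω + if (d t).isLeft then l else -l := by
    intro t
    obtain ⟨he, hf⟩ := hedge t
    rcases hd : d t with i | i
    · rw [hd] at he hf
      have hm := val_mem_diffs (A := A) (B := B) (i := i) (j := c t) (k := c (t + 1)) he hf
      refine ⟨-(val (A i (c t)) - val (B i (c (t + 1)))), ?_, ?_, ?_⟩
      · rw [abs_neg]; exact h.abs_le_delta hm
      · intro c0 hc; simp [hc _ hm]
      · simp [RG.w, pgame]; ring
    · rw [hd] at he hf
      have hm := val_mem_diffs (A := A) (B := B) (i := i) (j := c (t + 1)) (k := c t) hf he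
      refine ⟨val (A i (c (t + 1))) - val (B i (c t)), ?_, ?_, ?_⟩
      · exact h.abs_le_delta hm
      · intro c0 hc; simp [hc _ hm]
      · simp [RG.w, pgame]; ring
  choose ω hω1 hω2 hω3 using step
  have hpq : ∑ t ∈ Finset.range k, (if (d t).isLeft then 1 else 0) +
      ∑ t ∈ Finset.range k, (if (d t).isLeft then 0 else 1) = k := by
    rw [← Finset.sum_add_distrib]
    conv_rhs => rw [← Finset.card_range k, Finset.card_eq_sum_ones]
    exact Finset.sum_congr rfl fun t _ => by split_ifs <;> rfl
  refine ⟨∑ t ∈ Finset.range k, (if (d t).isLeft then 1 else 0),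
    ∑ t ∈ Finset.range k, (if (d t).isLeft then 0 else 1), ∑ t ∈ Finset.range k, ω t,
    by omega, ?_, ?_, ?_, ?_⟩
  · rw [hpq, kappa]
    simp only [Nat.card_eq_fintype_card, Fintype.card_fin, Fintype.card_sum] at hkn hkm
    omega
  · rw [hpq]
    refine (Finset.abs_sum_le_sum_abs _ _).trans ((Finset.sum_le_sum fun t _ => hω1 t).trans ?_)
    simp
  · intro c0 hc
    rw [Finset.sum_congr rfl fun t _ => hω2 t c0 hc]
    push_cast
    rw [← Finset.sum_sub_distrib, Finset.mul_sum]
    exact Finset.sum_congr rfl fun t _ => by split_ifs <;> simp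
  · have h1 : ((∑ t ∈ Finset.range k, (if (d t).isLeft then 1 else 0) : ℕ) : ℝ) +
        ((∑ t ∈ Finset.range k, (if (d t).isLeft then 0 else 1) : ℕ) : ℝ) = k := by
      exact_mod_cast hpq
    rw [h1, mul_comm, ← hsum, Finset.sum_congr rfl fun t _ => hω3 t, Finset.sum_add_distrib]
    push_cast
    rw [← Finset.sum_sub_distrib, Finset.sum_mul]
    congr 1
    exact Finset.sum_congr rfl fun t _ => by split_ifs <;> simp

/-- The parameter changes each payment by at most `|l - l'|`, so a potential for one parameter
serves for the other with the value raised by that amount. -/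
theorem sval_le_add (h : Admissible A B M) (l l' : ℝ) : sval A B l ≤ sval A B l' + |l - l'| := by
  obtain ⟨y, hy⟩ := (h.isVal l').up
  refine (h.isVal l).le (y := y) fun j => ?_
  obtain ⟨i, hi, hk⟩ := hy j
  refine ⟨i, hi, fun k hf => ?_⟩
  have h1 := hk k hf
  have h2 := le_abs_self (l - l')
  have h3 := neg_abs_le (l - l')
  rcases i with i | i <;> simp only [RG.w, pgame, Sum.elim_inl, Sum.elim_inr] at h1 ⊢ <;> linarith

theorem continuous_sval (h : Admissible A B M) : Continuous (sval A B) :=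
  (LipschitzWith.of_le_add fun l l' => by
    simpa [Real.dist_eq] using h.sval_le_add l l').continuous

/-- Exchanging the matrices reflects the parameter; so every statement about the right end yields
one about the left end. -/
theorem sval_swap (A B : Matrix (Fin m) (Fin n) (WithBot ℤ)) (l : ℝ) : sval B A l = sval A B (-l) := by
  have : minMax (toReal B) (toReal A) l = minMax (toReal A) (toReal B) (-l) := by
    funext x j
    rw [minMax, minMax, inf_comm, neg_neg]
  rw [sval, sval, specFun, specFun, this]

/-- Two turns through the same row `i`, first by `A♯ B` and then by `B♯ A`, cancel the parameter.
From a column that maximises `a i j + x j`, they lead to a column where this sum has grown by twice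
the value; so the value is not positive. -/
theorem sval_nonpos (h : Admissible A B M) (l : ℝ) : sval A B l ≤ 0 := by
  obtain ⟨x, hx⟩ := (h.isVal l).eig
  obtain ⟨j0, hj0⟩ := hx.ne_bot
  by_contra! hpos
  have hA : ∀ i j a, A i j ≠ ⊥ → x j = (a : ℝ) → ∃ k b, B i k ≠ ⊥ ∧ x k = (b : ℝ) ∧
      sval A B l + a + val (A i j) - l ≤ val (B i k) + b := by
    intro i j a hi ha
    obtain ⟨k, hf, hle⟩ := hx.ge j (Sum.inl i) hi
    rcases hxk : x k with _ | b
    · rw [hxk, ha] at hle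
      erw [WithBot.add_bot, le_bot_iff] at hle
      exact absurd hle WithBot.coe_ne_bot
    · refine ⟨k, b, hf, hxk, ?_⟩
      rw [hxk, ha] at hle
      have hle := WithBot.coe_le_coe.1 hle
      simp only [RG.w, pgame, Sum.elim_inl] at hle
      linarith
  have hB : ∀ i j a, B i j ≠ ⊥ → x j = (a : ℝ) → ∃ k b, A i k ≠ ⊥ ∧ x k = (b : ℝ) ∧
      sval A B l + a + val (B i j) + l ≤ val (A i k) + b := by
    intro i j a hi ha
    obtain ⟨k, hf, hle⟩ := hx.ge j (Sum.inr i) hi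
    rcases hxk : x k with _ | b
    · rw [hxk, ha] at hle
      erw [WithBot.add_bot, le_bot_iff] at hle
      exact absurd hle WithBot.coe_ne_bot
    · refine ⟨k, b, hf, hxk, ?_⟩
      rw [hxk, ha] at hle
      have hle := WithBot.coe_le_coe.1 hle
      simp only [RG.w, pgame, Sum.elim_inr] at hle
      linarith
  obtain ⟨a0, ha0⟩ := WithBot.ne_bot_iff_exists.1 hj0
  obtain ⟨i, j1, hAi, hx1⟩ : ∃ i j, A i j ≠ ⊥ ∧ x j ≠ ⊥ := by
    obtain ⟨i, hi | hi⟩ := h.column j0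
    · exact ⟨i, j0, hi, hj0⟩
    · obtain ⟨k, b, h1, h2, _⟩ := hB i j0 a0 hi ha0.symm
      exact ⟨i, k, h1, by simp [h2]⟩
  obtain ⟨j, ⟨hj, hxj⟩, hmax⟩ := Set.exists_max_image {j | A i j ≠ ⊥ ∧ x j ≠ ⊥}
    (fun j => val (A i j) + (x j).unbotD 0) (Set.toFinite _) ⟨j1, hAi, hx1⟩
  obtain ⟨a, ha⟩ := WithBot.ne_bot_iff_exists.1 hxj
  obtain ⟨k, b, h1, h2, h3⟩ := hA i j a hj ha.symm
  obtain ⟨k', b', h1', h2', h3'⟩ := hB i k b h1 h2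
  have := hmax k' ⟨h1', by simp [h2']⟩
  simp only [h2', ← ha, WithBot.unbotD_coe] at this
  linarith

/-- The two-sided spectrum is the zero set of the spectral function. -/
theorem mem_spec_iff (h : Admissible A B M) (l : ℝ) :
    l ∈ spec (toReal A) (toReal B) ↔ sval A B l = 0 := by
  have hrep := minMax_represents h l
  -- By residuation, `A x ≤ l + B x` is what the left nodes of Max say and the reverse inequality is
  -- what the right ones say. So the solutions are the vectors with `x ≤ h_l x`, the
  -- sub-eigenvectors for `0`.
  have key : ∀ x : Fin n → WithBot ℝ,
      (∀ i, mulVec (toReal A) x i = (l : WithBot ℝ) + mulVec (toReal B) x i) ↔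
        ∀ j i, (pgame A B l).e j i → ∃ k, (pgame A B l).f i k ∧
          x j ≤ ((pgame A B l).w j i k : WithBot ℝ) + x k := by
    intro x
    have h1 : (∀ i, mulVec (toReal A) x i ≤ (l : WithBot ℝ) + mulVec (toReal B) x i) ↔
        ∀ j i, A i j ≠ ⊥ → ∃ k, B i k ≠ ⊥ ∧
          x j ≤ ((pgame A B l).w j (Sum.inl i) k : WithBot ℝ) + x k := by
      rw [forall_comm]
      refine forall_congr' fun i => ?_
      rw [mulVec_le_iff]
      refine forall_congr' fun j => imp_congr_right fun _ => ?_
      rw [coe_add_le_iff, ← add_assoc, ← WithBot.coe_add, le_coe_add_iff,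
        le_mulVec_iff (h.row_right i)]
      refine exists_congr fun k => and_congr_right fun _ => ?_
      rw [← le_coe_add_iff, ← add_assoc, ← WithBot.coe_add]
      simp only [RG.w, pgame, Sum.elim_inl]
      ring_nf
    have h2 : (∀ i, (l : WithBot ℝ) + mulVec (toReal B) x i ≤ mulVec (toReal A) x i) ↔
        ∀ j i, B i j ≠ ⊥ → ∃ k, A i k ≠ ⊥ ∧
          x j ≤ ((pgame A B l).w j (Sum.inr i) k : WithBot ℝ) + x k := by
      rw [forall_comm]
      refine forall_congr' fun i => ?_
      rw [coe_add_le_iff, mulVec_le_iff]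
      refine forall_congr' fun j => imp_congr_right fun _ => ?_
      rw [coe_add_le_iff, ← add_assoc, ← WithBot.coe_add, le_coe_add_iff,
        le_mulVec_iff (h.row_left i)]
      refine exists_congr fun k => and_congr_right fun _ => ?_
      rw [← le_coe_add_iff, ← add_assoc, ← WithBot.coe_add]
      simp only [RG.w, pgame, Sum.elim_inr]
      ring_nf
    simp only [le_antisymm_iff, forall_and, h1, h2]
    constructor
    · rintro ⟨h1, h2⟩ j (i | i) hi
      · exact h1 j i hi
      · exact h2 j i hi
    · intro H
      exact ⟨fun j i hi => H j (Sum.inl i) hi, fun j i hi => H j (Sum.inr i) hi⟩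
  constructor
  · rintro ⟨x, hx, heq⟩
    refine le_antisymm (h.sval_nonpos l) ((h.isVal l).ge (x := x) ⟨hx, fun j i hi => ?_⟩)
    obtain ⟨k, hf, hk⟩ := (key x).1 heq j i hi
    exact ⟨k, hf, by simpa using hk⟩
  · intro h0
    obtain ⟨x, hx⟩ := (h.isVal l).eig
    refine ⟨x, hx.ne_bot, (key x).2 fun j i hi => ?_⟩
    obtain ⟨k, hf, hk⟩ := hx.ge j i hi
    exact ⟨k, hf, by simpa [h0] using hk⟩

end Admissible

/-! ### Continuous selections of finitely many affine functions -/

/-- The set where `s` follows one line and the set where it follows another one are closed, cover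
`E`, and do not meet where no lines cross; connectedness leaves one of them. Continuity extends this
to the closure. -/
theorem exists_affine_of_preconnected {s : ℝ → ℝ} (hs : Continuous s) {E : Set ℝ}
    (hE : IsPreconnected E) (hne : E.Nonempty) {P : Set (ℝ × ℝ)} (hP : P.Finite)
    (hsel : ∀ x ∈ E, ∃ f ∈ P, s x = f.1 * x + f.2)
    (hcross : ∀ x ∈ E, ∀ f ∈ P, ∀ f' ∈ P, f.1 * x + f.2 = f'.1 * x + f'.2 → f = f') :
    ∃ f ∈ P, ∀ x ∈ closure E, s x = f.1 * x + f.2 := by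
  obtain ⟨x0, hx0⟩ := hne
  obtain ⟨f, hf, hf0⟩ := hsel x0 hx0
  have hcl : ∀ f : ℝ × ℝ, IsClosed {x | s x = f.1 * x + f.2} := fun f =>
    isClosed_eq hs (by fun_prop)
  refine ⟨f, hf, ?_⟩
  refine closure_minimal (fun x hx => ?_) (hcl f)
  by_contra hne
  have hC := (hP.subset (Set.sdiff_subset (s := P) (t := {f}))).isClosed_biUnion
    fun f' _ => hcl f'
  obtain ⟨g, hg, hgx⟩ := hsel x hx
  obtain ⟨y, hy, hy1, hy2⟩ := isPreconnected_closed_iff.1 hE _ _ (hcl f) hC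
    (fun y hy => by
      obtain ⟨g, hg, hgy⟩ := hsel y hy
      by_cases hgf : g = f
      · exact Or.inl (by rw [← hgf]; exact hgy)
      · exact Or.inr (Set.mem_biUnion ⟨hg, hgf⟩ hgy))
    ⟨x0, hx0, hf0⟩
    ⟨x, hx, Set.mem_biUnion (⟨hg, fun h => hne (by rw [← Set.mem_singleton_iff.1 h]; exact hgx)⟩ :
      g ∈ P \ {f}) hgx⟩
  obtain ⟨g', ⟨hg', hg'f⟩, hg'y⟩ := Set.mem_iUnion₂.1 hy2
  exact hg'f (hcross y hy g' hg' f hf (hg'y.symm.trans hy1))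

/-- The lines along which the spectral function can run. -/
def lines (A B : Matrix (Fin m) (Fin n) (WithBot ℤ)) : Set (ℝ × ℝ) :=
  {f | ∃ (p q : ℕ) (a : ℤ), 0 < p + q ∧ p + q ≤ kappa m n ∧ |a| ≤ ((p + q : ℕ) : ℤ) * Delta A B ∧
    (∀ c, (∀ d ∈ diffs A B, d = c) → a = -c * ((p : ℤ) - q)) ∧
    f = (((p : ℝ) - q) / (p + q), (a : ℝ) / (p + q))}

theorem finite_lines (A B : Matrix (Fin m) (Fin n) (WithBot ℤ)) : (lines A B).Finite := by
  let X : ℤ := kappa m n * |Delta A B|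
  refine (((Set.finite_Iic (kappa m n)).prod ((Set.finite_Iic (kappa m n)).prod
    (Set.finite_Icc (-X) X))).image fun t : ℕ × ℕ × ℤ =>
      (((t.1 : ℝ) - t.2.1) / (t.1 + t.2.1), (t.2.2 : ℝ) / (t.1 + t.2.1))).subset ?_
  rintro f ⟨p, q, a, h1, h2, h3, -, rfl⟩
  refine ⟨(p, q, a), ⟨?_, ?_, ?_⟩, rfl⟩
  · simp; omega
  · simp; omega
  · have : |a| ≤ X := h3.trans (mul_le_mul (by exact_mod_cast h2) (le_abs_self _)
      (by
        by_contra! hneg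
        have hpos : (0 : ℤ) < ((p + q : ℕ) : ℤ) := by exact_mod_cast h1
        have := (abs_nonneg a).trans h3
        nlinarith) (by positivity))
    exact abs_le.1 this

theorem Admissible.exists_mem_lines (h : Admissible A B M) (l : ℝ) :
    ∃ f ∈ lines A B, sval A B l = f.1 * l + f.2 := by
  obtain ⟨p, q, a, h1, h2, h3, h4, h5⟩ := h.exists_line l
  refine ⟨_, ⟨p, q, a, h1, h2, h3, h4, rfl⟩, ?_⟩
  have : (0 : ℝ) < p + q := by exact_mod_cast h1
  field_simp
  linarith

/-- The fractions with denominators `2 D`, `1 ≤ D ≤ κ²`. -/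
def IsGrid (κ : ℕ) (x : ℝ) : Prop := ∃ (N : ℤ) (D : ℕ), 1 ≤ D ∧ D ≤ κ ^ 2 ∧ x = N / (2 * D)

/-- For slopes `(p - q) / (p + q)` and `(p' - q') / (p' + q')`, the coefficient of `x` after
clearing denominators is `2 E` with `E = p q' - p' q`; hence the factor `2` in the grid and the
bound `|E| ≤ κ²`. If `E = 0` the lines are parallel, so they meet only if they coincide. The
constant term is at most `2 κ² Δ`, which bounds `|x|`. -/
theorem lines_crossing {f f' : ℝ × ℝ} (hf : f ∈ lines A B)
    (hf' : f' ∈ lines A B) {x : ℝ} (hx : f.1 * x + f.2 = f'.1 * x + f'.2) (hne : f ≠ f') :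
    IsGrid (kappa m n) x ∧ |x| ≤ (kappa m n : ℝ) ^ 2 * Delta A B ∧
      ∀ c : ℤ, (∀ d ∈ diffs A B, d = c) → x = c := by
  obtain ⟨p, q, a, h1, h2, h3, h4, rfl⟩ := hf
  obtain ⟨p', q', a', h1', h2', h3', h4', rfl⟩ := hf'
  have hk : (0 : ℝ) < p + q := by exact_mod_cast h1
  have hk' : (0 : ℝ) < p' + q' := by exact_mod_cast h1'
  have h0 : (0 : ℤ) < p + q := by exact_mod_cast h1
  have h0' : (0 : ℤ) < p' + q' := by exact_mod_cast h1'
  set E : ℤ := p * q' - p' * q with hE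
  have hcr : 2 * (E : ℝ) * x = a' * (p + q) - a * (p' + q') := by
    rw [hE]
    push_cast
    simp only at hx
    field_simp at hx
    linarith
  have hE0 : E ≠ 0 := by
    intro h0
    apply hne
    have hER : (p : ℝ) * q' - p' * q = 0 := by
      have : ((E : ℤ) : ℝ) = 0 := by rw [h0]; simp
      rw [hE] at this
      push_cast at this
      exact this
    rw [h0] at hcr
    refine Prod.ext ?_ ?_
    · simp only
      rw [div_eq_div_iff hk.ne' hk'.ne']
      linarith
    · simp only
      rw [div_eq_div_iff hk.ne' hk'.ne']
      simp at hcr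
      linarith
  have hEle : E.natAbs ≤ kappa m n ^ 2 := by
    have e1 : (p : ℤ) * q' ≤ kappa m n * kappa m n := by
      exact_mod_cast Nat.mul_le_mul (show p ≤ kappa m n by omega) (show q' ≤ kappa m n by omega)
    have e2 : (p' : ℤ) * q ≤ kappa m n * kappa m n := by
      exact_mod_cast Nat.mul_le_mul (show p' ≤ kappa m n by omega) (show q ≤ kappa m n by omega)
    have e3 : (0 : ℤ) ≤ p * q' := by positivity
    have e4 : (0 : ℤ) ≤ p' * q := by positivity
    zify
    rw [hE, abs_le]
    constructor <;> nlinarith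
  have hE1 : 1 ≤ E.natAbs := Int.natAbs_pos.2 hE0
  refine ⟨⟨E.sign * (a' * (p + q) - a * (p' + q')), E.natAbs, hE1, hEle, ?_⟩, ?_, ?_⟩
  · have h2 : ((E.natAbs : ℕ) : ℝ) = (E.sign : ℝ) * E := by
      rw [Nat.cast_natAbs]
      exact_mod_cast (Int.sign_mul_self_eq_abs E).symm
    have h3 : (E.natAbs : ℝ) ≠ 0 := by exact_mod_cast (show E.natAbs ≠ 0 by omega)
    rw [eq_div_iff (by positivity), h2]
    push_cast
    rw [← hcr]
    ring
  · have hE1' : (1 : ℝ) ≤ |(E : ℝ)| := by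
      have : (1 : ℤ) ≤ |E| := Int.one_le_abs hE0
      exact_mod_cast this
    have h5 : |(a' : ℝ) * (p + q) - a * (p' + q')| ≤ 2 * ((kappa m n : ℝ) ^ 2 * Delta A B) := by
      have hΔ : 0 ≤ Delta A B := by
        by_contra! hneg
        have := (abs_nonneg a).trans h3
        push_cast at this
        nlinarith
      have g1 : |a' * (p + q)| ≤ (kappa m n : ℤ) ^ 2 * Delta A B := by
        rw [abs_mul, abs_of_pos h0, sq]
        calc |a'| * ((p : ℤ) + q) ≤ ((kappa m n : ℤ) * Delta A B) * kappa m n := by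
              refine mul_le_mul (h3'.trans ?_) (by exact_mod_cast h2) h0.le (by positivity)
              exact mul_le_mul_of_nonneg_right (by exact_mod_cast h2') hΔ
          _ = _ := by ring
      have g2 : |a * (p' + q')| ≤ (kappa m n : ℤ) ^ 2 * Delta A B := by
        rw [abs_mul, abs_of_pos h0', sq]
        calc |a| * ((p' : ℤ) + q') ≤ ((kappa m n : ℤ) * Delta A B) * kappa m n := by
              refine mul_le_mul (h3.trans ?_) (by exact_mod_cast h2') h0'.le (by positivity)
              exact mul_le_mul_of_nonneg_right (by exact_mod_cast h2) hΔ
          _ = _ := by ring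
      have g3 := (abs_sub (a' * ((p : ℤ) + q)) (a * (p' + q'))).trans (add_le_add g1 g2)
      have : |a' * ((p : ℤ) + q) - a * (p' + q')| ≤ 2 * ((kappa m n : ℤ) ^ 2 * Delta A B) := by
        linarith
      exact_mod_cast this
    rw [← hcr, abs_mul, abs_mul] at h5
    simp only [Nat.abs_ofNat] at h5
    nlinarith [abs_nonneg x]
  · intro c hc
    have e1 := h4 c hc
    have e2 := h4' c hc
    have h2 : (E : ℝ) ≠ 0 := by exact_mod_cast hE0
    have : 2 * (E : ℝ) * x = 2 * (E : ℝ) * c := by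
      rw [hcr, e1, e2, hE]
      push_cast
      ring
    exact mul_left_cancel₀ (by simpa using h2) this


/-- Both matrices are real. -/
def AllFin (A B : Matrix (Fin m) (Fin n) (WithBot ℤ)) : Prop :=
  (∀ i j, A i j ≠ ⊥) ∧ ∀ i j, B i j ≠ ⊥

/-- Neither matrix has a column of `-∞`. -/
def ColsFin (A B : Matrix (Fin m) (Fin n) (WithBot ℤ)) : Prop :=
  (∀ j, ∃ i, A i j ≠ ⊥) ∧ ∀ j, ∃ i, B i j ≠ ⊥

/-! ### Affine behaviour between grid points and on the two outer rays -/

namespace Admissible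

theorem kappa_pos (h : Admissible A B M) : 0 < kappa m n := by
  have h1 := h.rows_pos
  have h2 := h.cols_pos
  simp only [kappa]
  omega

theorem delta_pos (h : Admissible A B M) (hlt : lowerC A B < upperC A B) : 1 ≤ Delta A B := by
  rw [h.delta_eq]
  by_contra! h'
  have h1 := le_max_left (upperC A B) (-lowerC A B)
  have h2 := le_max_right (upperC A B) (-lowerC A B)
  omega

theorem exists_affine_gap (h : Admissible A B M) {u v : ℝ} (huv : u < v)
    (hgap : ∀ x, u < x → x < v → ¬ IsGrid (kappa m n) x) :
    ∃ f : ℝ × ℝ, ∀ x, u ≤ x → x ≤ v → sval A B x = f.1 * x + f.2 := by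
  obtain ⟨f, -, hf⟩ := exists_affine_of_preconnected h.continuous_sval (isPreconnected_Ioo (a := u)
    (b := v)) (Set.nonempty_Ioo.2 huv) (finite_lines A B) (fun x _ => h.exists_mem_lines x)
    (fun x hx f hf f' hf' heq => by
      by_contra hne
      exact hgap x hx.1 hx.2 (lines_crossing hf hf' heq hne).1)
  rw [closure_Ioo huv.ne] at hf
  exact ⟨f, fun x h1 h2 => hf x ⟨h1, h2⟩⟩

theorem exists_affine_right (h : Admissible A B M) :
    ∃ f : ℝ × ℝ, ∀ x, (kappa m n : ℝ) ^ 2 * Delta A B ≤ x → sval A B x = f.1 * x + f.2 := by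
  obtain ⟨f, -, hf⟩ := exists_affine_of_preconnected h.continuous_sval
    (isPreconnected_Ioi (a := (kappa m n : ℝ) ^ 2 * Delta A B)) Set.nonempty_Ioi
    (finite_lines A B) (fun x _ => h.exists_mem_lines x)
    (fun x hx f hf f' hf' heq => by
      by_contra hne
      have := (lines_crossing hf hf' heq hne).2.1
      exact absurd ((le_abs_self x).trans this) (not_le.2 hx))
  rw [closure_Ioi] at hf
  exact ⟨f, fun x h1 => hf x h1⟩

/-- If all differences equal `c`, distinct lines can cross at `c` only. -/
theorem exists_affine_right_of_const (h : Admissible A B M) {c : ℤ}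
    (hc : ∀ d ∈ diffs A B, d = c) :
    ∃ f : ℝ × ℝ, ∀ x, (c : ℝ) ≤ x → sval A B x = f.1 * x + f.2 := by
  obtain ⟨f, -, hf⟩ := exists_affine_of_preconnected h.continuous_sval
    (isPreconnected_Ioi (a := (c : ℝ))) Set.nonempty_Ioi
    (finite_lines A B) (fun x _ => h.exists_mem_lines x)
    (fun x hx f hf f' hf' heq => by
      by_contra hne
      exact hx.ne' ((lines_crossing hf hf' heq hne).2.2 c hc))
  rw [closure_Ioi] at hf
  exact ⟨f, fun x h1 => hf x h1⟩

/-- If `B` has no column of `-∞`, Min can always move through `B♯ A`, so `s(x) ≤ Δ - x`. A line with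
`p ≥ 1` obeys this bound only up to `κ Δ`, so beyond that point all selected lines have slope `-1`,
and parallel lines do not cross. -/
theorem exists_affine_right_of_cols (h : Admissible A B M) (hB : ∀ j, ∃ i, B i j ≠ ⊥) :
    ∃ f : ℝ × ℝ, ∀ x, (kappa m n : ℝ) * Delta A B ≤ x → sval A B x = f.1 * x + f.2 := by
  have hΔ : (0 : ℝ) ≤ Delta A B := by exact_mod_cast h.delta_nonneg
  have hup : ∀ x, sval A B x ≤ Delta A B - x := by
    intro x
    refine (h.isVal x).le (y := 0) fun j => ?_
    obtain ⟨i, hi⟩ := hB j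
    refine ⟨Sum.inr i, hi, fun k hf => ?_⟩
    have h1 := h.abs_le_delta (val_mem_diffs (A := A) (B := B) (i := i) (j := k) (k := j) hf hi)
    have h2 : (val (A i k) : ℝ) - val (B i j) ≤ Delta A B := by
      exact_mod_cast (abs_le.1 h1).2
    simp only [RG.w, pgame, Sum.elim_inr, Pi.zero_apply]
    linarith
  have hsel : ∀ x ∈ Set.Ioi ((kappa m n : ℝ) * Delta A B), ∃ f ∈ lines A B ∩ {f | f.1 = -1},
      sval A B x = f.1 * x + f.2 := by
    intro x hx
    obtain ⟨p, q, a, h1, h2, h3, h4, h5⟩ := h.exists_line x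
    have hk : (0 : ℝ) < p + q := by exact_mod_cast h1
    have hkκ : (p : ℝ) + q ≤ kappa m n := by exact_mod_cast h2
    have hx0 : 0 < x := lt_of_le_of_lt (by positivity) hx
    have hx1 : (kappa m n : ℝ) * Delta A B < x := hx
    have hp : p = 0 := by
      by_contra hp
      have hp1 : (1 : ℝ) ≤ p := by exact_mod_cast Nat.one_le_iff_ne_zero.2 hp
      have ha : -(((p : ℝ) + q) * Delta A B) ≤ a := by
        have := (abs_le.1 h3).1
        exact_mod_cast this
      have h6 := mul_le_mul_of_nonneg_right (hup x) hk.le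
      rw [h5] at h6
      have h7 : ((p : ℝ) + q) * Delta A B ≤ kappa m n * Delta A B :=
        mul_le_mul_of_nonneg_right hkκ hΔ
      nlinarith
    refine ⟨_, ⟨⟨p, q, a, h1, h2, h3, h4, rfl⟩, ?_⟩, ?_⟩
    · subst hp
      have : (q : ℝ) ≠ 0 := by simpa using hk.ne'
      simp only [Set.mem_ofPred_eq]
      simp
      field_simp
    · field_simp
      linarith
  obtain ⟨f, -, hf⟩ := exists_affine_of_preconnected h.continuous_sval
    isPreconnected_Ioi Set.nonempty_Ioi ((finite_lines A B).inter_of_left _) hsel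
    (fun x hx f hf f' hf' heq => by
      have h1 : f.1 = -1 := hf.2
      have h2 : f'.1 = -1 := hf'.2
      refine Prod.ext (h1.trans h2.symm) ?_
      rw [h1, h2] at heq
      linarith)
  rw [closure_Ioi] at hf
  exact ⟨f, fun x h1 => hf x h1⟩

/-- To the right of `C̄`, a move of Min to the left copy of row `i` can be replaced by one to its
right copy without loss, since two differences of entries sum to at most `2 C̄ ≤ 2 x`. So `s(x) + x`
is constant there. -/
theorem exists_affine_right_of_allFin (h : Admissible A B M) (hfin : AllFin A B) :
    ∃ f : ℝ × ℝ, ∀ x, (upperC A B : ℝ) ≤ x → sval A B x = f.1 * x + f.2 := by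
  have key : ∀ x x', (upperC A B : ℝ) ≤ x → (upperC A B : ℝ) ≤ x' →
      sval A B x' ≤ sval A B x + (x - x') := by
    intro x x' hx hx'
    obtain ⟨y, hy⟩ := (h.isVal x).up
    refine (h.isVal x').le (y := y) fun j => ?_
    obtain ⟨i, hi, hk⟩ := hy j
    have hd : ∀ i j k, (val (A i j) : ℝ) - val (B i k) ≤ upperC A B := fun i j k => by
      exact_mod_cast h.isGreatest_upperC.2 (val_mem_diffs (hfin.1 i j) (hfin.2 i k))
    rcases i with i | i
    · refine ⟨Sum.inr i, hfin.2 i j, fun k hf => ?_⟩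
      have h1 := hk k (hfin.2 i k)
      have h2 := hd i j k
      have h3 := hd i k j
      simp only [RG.w, pgame, Sum.elim_inl, Sum.elim_inr] at h1 ⊢
      linarith
    · refine ⟨Sum.inr i, hi, fun k hf => ?_⟩
      have h1 := hk k hf
      simp only [RG.w, pgame, Sum.elim_inr] at h1 ⊢
      linarith
  refine ⟨(-1, sval A B (upperC A B) + upperC A B), fun x hx => ?_⟩
  have h1 := key x _ hx le_rfl
  have h2 := key _ x le_rfl hx
  simp only
  linarith

end Admissible

open Classical in
/-- The right end of the interval on which the spectral function has to be sampled. -/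
noncomputable def hiEnd (A B : Matrix (Fin m) (Fin n) (WithBot ℤ)) : ℤ :=
  -- The summand `1`, like the factor `2` in the other cases, puts a unit interval of the affine ray
  -- inside the sampled range.
  if upperC A B ≤ lowerC A B ∨ AllFin A B then upperC A B + 1
  else if ColsFin A B then 2 * (Delta A B * kappa m n) else 2 * (Delta A B * kappa m n ^ 2)

open Classical in
/-- The left end of the interval on which the spectral function has to be sampled. -/
noncomputable def loEnd (A B : Matrix (Fin m) (Fin n) (WithBot ℤ)) : ℤ :=
  if upperC A B ≤ lowerC A B ∨ AllFin A B then lowerC A B - 1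
  else if ColsFin A B then -(2 * (Delta A B * kappa m n)) else -(2 * (Delta A B * kappa m n ^ 2))

namespace Admissible

theorem eq_of_le (h : Admissible A B M) (hle : upperC A B ≤ lowerC A B) :
    ∀ d ∈ diffs A B, d = upperC A B := fun _ hd =>
  le_antisymm (h.isGreatest_upperC.2 hd) (hle.trans (h.isLeast_lowerC.2 hd))

theorem hiEnd_swap (h : Admissible A B M) : hiEnd B A = -loEnd A B := by
  have h1 := h.upperC_swap
  have h2 := h.swap.upperC_swap
  have h3 : upperC B A ≤ lowerC B A ↔ upperC A B ≤ lowerC A B := by constructor <;> intro _ <;> linarith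
  have h4 : AllFin B A ↔ AllFin A B := and_comm
  have h5 : ColsFin B A ↔ ColsFin A B := and_comm
  have h6 : (upperC B A ≤ lowerC B A ∨ AllFin B A) ↔ (upperC A B ≤ lowerC A B ∨ AllFin A B) :=
    or_congr h3 h4
  simp only [hiEnd, loEnd, delta_swap A B]
  by_cases g1 : upperC A B ≤ lowerC A B ∨ AllFin A B
  · rw [if_pos g1, if_pos (h6.2 g1)]
    linarith
  · rw [if_neg g1, if_neg (mt h6.1 g1)]
    by_cases g2 : ColsFin A B
    · rw [if_pos g2, if_pos (h5.2 g2), neg_neg]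
    · rw [if_neg g2, if_neg (mt h5.1 g2), neg_neg]

/-- The ray starts one unit before the end of the sampled interval; this overlap carries the last
piece and the last zero test over to all larger parameters. -/
theorem affine_hiEnd (h : Admissible A B M) :
    ∃ f : ℝ × ℝ, ∀ x, (hiEnd A B : ℝ) - 1 ≤ x → sval A B x = f.1 * x + f.2 := by
  by_cases h1 : upperC A B ≤ lowerC A B
  · simpa [hiEnd, h1] using h.exists_affine_right_of_const (h.eq_of_le h1)
  by_cases h2 : AllFin A B
  · simpa [hiEnd, h2] using h.exists_affine_right_of_allFin h2
  have hΔ := h.delta_pos (not_le.1 h1)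
  have hκ := h.kappa_pos
  by_cases h3 : ColsFin A B
  · obtain ⟨f, hf⟩ := h.exists_affine_right_of_cols h3.2
    refine ⟨f, fun x hx => hf x ?_⟩
    simp only [hiEnd, h1, h2, h3, or_self, if_false, if_true] at hx
    have : 1 ≤ Delta A B * kappa m n := by nlinarith
    have : (1 : ℝ) ≤ Delta A B * kappa m n := by exact_mod_cast this
    push_cast at hx
    linarith
  · obtain ⟨f, hf⟩ := h.exists_affine_right
    refine ⟨f, fun x hx => hf x ?_⟩
    simp only [hiEnd, h1, h2, h3, or_self, if_false] at hx
    have : 1 ≤ Delta A B * (kappa m n : ℤ) ^ 2 := by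
      have : (0 : ℤ) < (kappa m n : ℤ) ^ 2 := by positivity
      nlinarith
    have : (1 : ℝ) ≤ Delta A B * (kappa m n : ℝ) ^ 2 := by exact_mod_cast this
    push_cast at hx
    linarith

theorem affine_loEnd (h : Admissible A B M) :
    ∃ f : ℝ × ℝ, ∀ x, x ≤ (loEnd A B : ℝ) + 1 → sval A B x = f.1 * x + f.2 := by
  obtain ⟨f, hf⟩ := h.swap.affine_hiEnd
  refine ⟨(-f.1, f.2), fun x hx => ?_⟩
  have := hf (-x) (by rw [h.hiEnd_swap]; push_cast; linarith)
  rw [sval_swap A B, neg_neg] at this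
  rw [this]
  ring

theorem lo_lt_hi (h : Admissible A B M) : loEnd A B < hiEnd A B := by
  have h0 := h.lowerC_le
  have hκ := h.kappa_pos
  by_cases h1 : upperC A B ≤ lowerC A B
  · simp only [hiEnd, loEnd, h1, true_or, if_true]
    linarith
  have hΔ := h.delta_pos (not_le.1 h1)
  have h2 : 0 < Delta A B * kappa m n := by positivity
  have h3 : 0 < Delta A B * kappa m n ^ 2 := by positivity
  simp only [hiEnd, loEnd]
  split_ifs <;> linarith

/-- Bounds for the interval of sampling. -/
theorem hiEnd_sub_loEnd_le (h : Admissible A B M) (hlt : lowerC A B < upperC A B) :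
    hiEnd A B - loEnd A B ≤ 4 * (Delta A B * kappa m n ^ 2) ∧
    (ColsFin A B → hiEnd A B - loEnd A B ≤ 4 * (Delta A B * kappa m n)) ∧
    (AllFin A B → hiEnd A B - loEnd A B ≤ 3 * (upperC A B - lowerC A B)) := by
  have hΔ := h.delta_pos hlt
  have hκ : (1 : ℤ) ≤ kappa m n := by exact_mod_cast h.kappa_pos
  have e1 : Delta A B ≤ Delta A B * kappa m n := by nlinarith
  have e2 : Delta A B * kappa m n ≤ Delta A B * kappa m n ^ 2 := by
    rw [sq, ← mul_assoc]; nlinarith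
  have e3 := h.delta_eq
  have e4 := le_max_left (upperC A B) (-lowerC A B)
  have e5 := le_max_right (upperC A B) (-lowerC A B)
  simp only [hiEnd, loEnd, not_le.2 hlt, false_or]
  split_ifs with h1 h2
  · refine ⟨?_, fun _ => ?_, fun _ => ?_⟩ <;> linarith
  · exact ⟨by linarith, fun _ => by linarith, fun h => absurd (Or.inr h) h1⟩
  · exact ⟨by linarith, fun h => absurd h h2, fun h => absurd (Or.inr h) h1⟩

theorem abs_end_le (h : Admissible A B M) (hlt : lowerC A B < upperC A B) {t : ℝ}
    (h1 : (loEnd A B : ℝ) ≤ t) (h2 : t ≤ hiEnd A B) :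
    |t| ≤ 4 * M * kappa m n ^ 2 ∧ (ColsFin A B → |t| ≤ 4 * M * kappa m n) ∧
    (AllFin A B → |t| ≤ 2 * M + 1) := by
  have hΔ : (1 : ℝ) ≤ Delta A B := by exact_mod_cast h.delta_pos hlt
  have hΔM : (Delta A B : ℝ) ≤ 2 * M := by exact_mod_cast h.delta_le
  have hκ : (1 : ℝ) ≤ kappa m n := by exact_mod_cast h.kappa_pos
  have e1 : (Delta A B : ℝ) * kappa m n ≤ 2 * M * kappa m n := by gcongr
  have e2 : (Delta A B : ℝ) * kappa m n ^ 2 ≤ 2 * M * kappa m n ^ 2 := by gcongr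
  have e0 : 2 * (M : ℝ) ≤ 2 * M * kappa m n := by nlinarith
  have e3 : 2 * (M : ℝ) * kappa m n ≤ 2 * M * kappa m n ^ 2 := by
    rw [sq, ← mul_assoc]; nlinarith [show (0 : ℝ) ≤ 2 * M * kappa m n by positivity]
  have e4 : (upperC A B : ℝ) ≤ 2 * M := by
    exact_mod_cast (abs_le.1 (h.abs_diff_le h.isGreatest_upperC.1)).2
  have e5 : -(2 * (M : ℝ)) ≤ lowerC A B := by
    exact_mod_cast (abs_le.1 (h.abs_diff_le h.isLeast_lowerC.1)).1
  simp only [hiEnd, loEnd, not_le.2 hlt, false_or] at h1 h2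
  split_ifs at h1 h2 with g1 g2
  · push_cast at h1 h2
    have : |t| ≤ 2 * M + 1 := abs_le.2 ⟨by linarith, by linarith⟩
    exact ⟨by linarith, fun _ => by linarith, fun _ => this⟩
  · push_cast at h1 h2
    have : |t| ≤ 4 * M * kappa m n := abs_le.2 ⟨by linarith, by linarith⟩
    exact ⟨by linarith, fun _ => this, fun h => absurd (Or.inr h) g1⟩
  · push_cast at h1 h2
    have : |t| ≤ 4 * M * kappa m n ^ 2 := abs_le.2 ⟨by linarith, by linarith⟩
    exact ⟨this, fun h => absurd h g2, fun h => absurd (Or.inr h) g1⟩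

end Admissible

/-! ### The games submitted to the oracle -/

/-- The nodes of Max in the game for the pair of stacked matrices. -/
def stackEquiv (m : ℕ) : Fin m ⊕ Fin m ≃ Fin (2 * m) :=
  finSumFinEquiv.trans (finCongr (two_mul m).symm)

theorem stackEquiv_inl (i : Fin m) : ((stackEquiv m (Sum.inl i) : Fin (2 * m)) : ℕ) = i := by
  simp [stackEquiv]

theorem stackEquiv_inr (i : Fin m) : ((stackEquiv m (Sum.inr i) : Fin (2 * m)) : ℕ) = m + i := by
  simp [stackEquiv, add_comm]

/-- The payments of Min in the scaled game. -/
def sampleP (A B : Matrix (Fin m) (Fin n) (WithBot ℤ)) (sc D x₁ y₁ : ℤ) :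
    Matrix (Fin (2 * m)) (Fin n) (WithBot ℤ) := fun i j =>
  ((stackEquiv m).symm i).elim (fun i => (A i j).map fun a => D * (sc * a) - x₁)
    (fun i => (B i j).map fun b => D * (sc * b) + y₁)

/-- The payments to Max in the scaled game. -/
def sampleQ (A B : Matrix (Fin m) (Fin n) (WithBot ℤ)) (sc D x₂ y₂ : ℤ) :
    Matrix (Fin (2 * m)) (Fin n) (WithBot ℤ) := fun i j =>
  ((stackEquiv m).symm i).elim (fun i => (B i j).map fun b => D * (sc * b) + x₂)
    (fun i => (A i j).map fun a => D * (sc * a) - y₂)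

theorem sampleP_inl (sc D x₁ y₁ : ℤ) (i : Fin m) (j : Fin n) :
    sampleP A B sc D x₁ y₁ (stackEquiv m (Sum.inl i)) j =
      (A i j).map fun a => D * (sc * a) - x₁ := by
  rw [sampleP, Equiv.symm_apply_apply, Sum.elim_inl]

theorem sampleP_inr (sc D x₁ y₁ : ℤ) (i : Fin m) (j : Fin n) :
    sampleP A B sc D x₁ y₁ (stackEquiv m (Sum.inr i)) j =
      (B i j).map fun b => D * (sc * b) + y₁ := by
  rw [sampleP, Equiv.symm_apply_apply, Sum.elim_inr]

theorem sampleQ_inl (sc D x₂ y₂ : ℤ) (i : Fin m) (j : Fin n) :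
    sampleQ A B sc D x₂ y₂ (stackEquiv m (Sum.inl i)) j =
      (B i j).map fun b => D * (sc * b) + x₂ := by
  rw [sampleQ, Equiv.symm_apply_apply, Sum.elim_inl]

theorem sampleQ_inr (sc D x₂ y₂ : ℤ) (i : Fin m) (j : Fin n) :
    sampleQ A B sc D x₂ y₂ (stackEquiv m (Sum.inr i)) j =
      (A i j).map fun a => D * (sc * a) - y₂ := by
  rw [sampleQ, Equiv.symm_apply_apply, Sum.elim_inr]

/-- The scaled game whose value yields one value of the spectral function. -/
def sampleGame (A B : Matrix (Fin m) (Fin n) (WithBot ℤ)) (sc D x₁ x₂ y₁ y₂ : ℤ) : Game :=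
  ⟨2 * m, n, sampleP A B sc D x₁ y₁, sampleQ A B sc D x₂ y₂⟩

theorem map_ne_bot {f : ℤ → ℤ} {a : WithBot ℤ} : a.map f ≠ ⊥ ↔ a ≠ ⊥ := by
  cases a <;> simp

theorem val_map {f : ℤ → ℤ} {a : WithBot ℤ} (h : a ≠ ⊥) : val (a.map f) = f (val a) := by
  cases a with
  | bot => exact absurd rfl h
  | coe a => rfl

theorem val_map_eq {f : ℤ → ℤ} (a : WithBot ℤ) : val (a.map f) = flag a * f (val a) := by
  cases a with
  | bot => simp [val, flag]
  | coe a => simp [val, flag]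

theorem flag_map {f : ℤ → ℤ} (a : WithBot ℤ) : flag (a.map f) = flag a := by
  cases a <;> rfl

theorem flag_ne_zero {a : WithBot ℤ} : flag a ≠ 0 ↔ a ≠ ⊥ := by
  cases a <;> simp [flag]

theorem flag_cases (a : WithBot ℤ) : flag a = 0 ∨ flag a = 1 := by
  cases a <;> simp [flag]

theorem EntriesLE.of_val {C : Matrix (Fin m) (Fin n) (WithBot ℤ)} {W : ℕ}
    (h : ∀ i j, C i j ≠ ⊥ → |val (C i j)| ≤ W) : EntriesLE C W := fun i j a ha => by
  have := h i j (by simp [ha])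
  rwa [ha] at this

section SampleGame

variable {sc D x₁ x₂ y₁ y₂ : ℤ}

theorem sampleGame_valid (h : Admissible A B M) : (sampleGame A B sc D x₁ x₂ y₁ y₂).Valid := by
  refine ⟨h.cols_pos, fun (j : Fin n) => ?_, fun (i : Fin (2 * m)) => ?_⟩
  · change ∃ i, sampleP A B sc D x₁ y₁ i j ≠ ⊥
    obtain ⟨i, hi | hi⟩ := h.column j
    · exact ⟨stackEquiv m (Sum.inl i), by rwa [sampleP_inl, map_ne_bot]⟩
    · exact ⟨stackEquiv m (Sum.inr i), by rwa [sampleP_inr, map_ne_bot]⟩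
  · change ∃ j, sampleQ A B sc D x₂ y₂ i j ≠ ⊥
    obtain ⟨i, rfl⟩ := (stackEquiv m).surjective i
    rcases i with i | i
    · obtain ⟨k, hk⟩ := h.row_right i
      exact ⟨k, by rwa [sampleQ_inl, map_ne_bot]⟩
    · obtain ⟨k, hk⟩ := h.row_left i
      exact ⟨k, by rwa [sampleQ_inr, map_ne_bot]⟩

/-- Only the sums `x₁ + x₂` and `y₁ + y₂` enter the payments per turn. Half of their total carries
the parameter `D λ = N / 2`; half of their difference is common to all payments and is simply added
to the value. So integer shifts suffice even if `N` is odd. The assumption on `sc` replaces every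
difference `d` by `d - c`, which the shift by `2 D c` undoes. -/
theorem sampleGame_isVal (h : Admissible A B M) {N c : ℤ} (hsc : ∀ d ∈ diffs A B, sc * d = d - c)
    (hD : 0 < D) (hN : x₁ + x₂ + (y₁ + y₂) = N - 2 * D * c) :
    (sampleGame A B sc D x₁ x₂ y₁ y₂).rg.IsVal
      (D * sval A B (N / (2 * D)) + ((x₁ + x₂) - (y₁ + y₂)) / 2) := by
  have hDr : (0 : ℝ) < D := by exact_mod_cast hD
  have hNr : (x₁ : ℝ) + x₂ + (y₁ + y₂) = N - 2 * D * c := by exact_mod_cast hN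
  have : Nonempty (Fin (sampleGame A B sc D x₁ x₂ y₁ y₂).cols) := h.nonempty
  have hl : (D : ℝ) * (N / (2 * D)) = N / 2 := by field_simp
  have he : ∀ (j : Fin n) (i : Fin m ⊕ Fin m),
      sampleP A B sc D x₁ y₁ (stackEquiv m i) j ≠ ⊥ ↔ (pgame A B (N / (2 * D))).e j i := by
    rintro j (i | i)
    · rw [sampleP_inl, map_ne_bot]; rfl
    · rw [sampleP_inr, map_ne_bot]; rfl
  have hf : ∀ (i : Fin m ⊕ Fin m) (j : Fin n),
      sampleQ A B sc D x₂ y₂ (stackEquiv m i) j ≠ ⊥ ↔ (pgame A B (N / (2 * D))).f i j := by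
    rintro (i | i) j
    · rw [sampleQ_inl, map_ne_bot]; rfl
    · rw [sampleQ_inr, map_ne_bot]; rfl
  refine RG.IsVal.map (sampleGame_valid h).rg (stackEquiv m) he hf hDr ?_ (h.isVal _)
  intro (j : Fin n) i (k : Fin n) he hf
  change -(val (sampleP A B sc D x₁ y₁ (stackEquiv m i) j) : ℝ) +
    (val (sampleQ A B sc D x₂ y₂ (stackEquiv m i) k) : ℝ) = _
  rcases i with i | i
  · have hd : (sc : ℝ) * (val (A i j) - val (B i k)) = val (A i j) - val (B i k) - c := by
      exact_mod_cast hsc _ (val_mem_diffs he hf)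
    rw [sampleP_inl, sampleQ_inl, val_map he, val_map hf]
    simp only [RG.w, pgame, Sum.elim_inl]
    push_cast
    linear_combination (-(D : ℝ)) * hd - hl + hNr / 2
  · have hd : (sc : ℝ) * (val (A i k) - val (B i j)) = val (A i k) - val (B i j) - c := by
      exact_mod_cast hsc _ (val_mem_diffs hf he)
    rw [sampleP_inr, sampleQ_inr, val_map he, val_map hf]
    simp only [RG.w, pgame, Sum.elim_inr]
    push_cast
    linear_combination (D : ℝ) * hd + hl - hNr / 2

theorem sampleGame_hasSize {W : ℕ}
    (h1 : ∀ i j, A i j ≠ ⊥ → |D * (sc * val (A i j)) - x₁| ≤ W)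
    (h2 : ∀ i j, B i j ≠ ⊥ → |D * (sc * val (B i j)) + y₁| ≤ W)
    (h3 : ∀ i j, B i j ≠ ⊥ → |D * (sc * val (B i j)) + x₂| ≤ W)
    (h4 : ∀ i j, A i j ≠ ⊥ → |D * (sc * val (A i j)) - y₂| ≤ W) :
    (sampleGame A B sc D x₁ x₂ y₁ y₂).HasSize (2 * m) n W := by
  refine ⟨rfl, rfl, EntriesLE.of_val (C := sampleP A B sc D x₁ y₁) fun i j hne => ?_,
    EntriesLE.of_val (C := sampleQ A B sc D x₂ y₂) fun i j hne => ?_⟩ <;>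
    obtain ⟨i, rfl⟩ := (stackEquiv m).surjective i <;> rcases i with i | i
  · rw [sampleP_inl] at hne ⊢; rw [map_ne_bot] at hne; rw [val_map hne]; exact h1 i j hne
  · rw [sampleP_inr] at hne ⊢; rw [map_ne_bot] at hne; rw [val_map hne]; exact h2 i j hne
  · rw [sampleQ_inl] at hne ⊢; rw [map_ne_bot] at hne; rw [val_map hne]; exact h3 i j hne
  · rw [sampleQ_inr] at hne ⊢; rw [map_ne_bot] at hne; rw [val_map hne]; exact h4 i j hne

end SampleGame

theorem RG.IsVal.abs_le {I J : Type*} [Finite J] [Nonempty J] {g : RG I J} (hg : g.Valid) {v W : ℝ}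
    (h : g.IsVal v) (hW : g.PayLE 0 W) : |v| ≤ W := by
  obtain ⟨y, hy⟩ := h.up
  exact _root_.abs_le.2 ⟨hy.neg_le hg hW, h.le (up_zero hg hW)⟩

/-- The value of an integer game is a fraction with a small denominator. -/
theorem Game.Valid.exists_rat {G : Game} (h : G.Valid) :
    ∃ q : ℚ, G.rg.IsVal q ∧ q.den ≤ G.cols := by
  have : Nonempty (Fin G.cols) := ⟨⟨0, h.1⟩⟩
  obtain ⟨v, hv⟩ := RG.exists_isVal h.rg
  obtain ⟨x, hx⟩ := hv.eig
  obtain ⟨k, c, d, hk, hkn, -, -, hsum⟩ := hx.exists_cycle h.rg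
  let a : ℤ := ∑ t ∈ Finset.range k, (-val (G.P (d t) (c t)) + val (G.Q (d t) (c (t + 1))))
  have ha : (a : ℝ) = k * v := by
    rw [← hsum]
    push_cast [a]
    rfl
  have hkr : (k : ℝ) ≠ 0 := by exact_mod_cast hk.ne'
  refine ⟨Rat.divInt a k, ?_, ?_⟩
  · have : ((Rat.divInt a k : ℚ) : ℝ) = v := by
      rw [Rat.divInt_eq_div]
      push_cast
      rw [ha]
      field_simp
    rwa [this]
  · have h1 : ((Rat.divInt a k).den : ℤ) ∣ k := Rat.den_dvd a k
    have h2 := Int.le_of_dvd (by exact_mod_cast hk) h1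
    simp only [Nat.card_eq_fintype_card, Fintype.card_fin] at hkn
    omega

/-! ### Rounding -/

/-- `S / N` exceeds `v = a / k₀` by at most `C / N < 1 / n²`, while distinct fractions with
denominators at most `n` differ by at least `1 / n²`. So rounding down to a multiple of `1 / k`
never ends above `v`. -/
theorem floor_mul_le {S a : ℤ} {N k₀ n : ℕ} {v C : ℝ} (hv : v * k₀ = a)
    (hk₀n : k₀ ≤ n) (h2 : (S : ℝ) ≤ N * v + C) (hC : C * (n : ℝ) ^ 2 < N) (hC0 : 0 ≤ C)
    {k : ℕ} (hk : k ≤ n) (hN : 0 < N) :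
    S * k / N * k₀ ≤ a * k := by
  have hf : S * k / N * (N : ℤ) ≤ S * k := Int.ediv_mul_le _ (by exact_mod_cast hN.ne')
  have hfr : ((S * k / N : ℤ) : ℝ) * N ≤ S * k := by exact_mod_cast hf
  by_contra! hlt
  have hlt' : (a : ℝ) * k + 1 ≤ ((S * k / N : ℤ) : ℝ) * k₀ := by exact_mod_cast hlt
  have hkr : (k : ℝ) ≤ n := by exact_mod_cast hk
  have hk₀r : (k₀ : ℝ) ≤ n := by exact_mod_cast hk₀n
  have hNr : (0 : ℝ) < N := by exact_mod_cast hN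
  have e1 : ((S * k / N : ℤ) : ℝ) * k₀ * N ≤ S * k * k₀ := by
    nlinarith [Nat.cast_nonneg (α := ℝ) k₀]
  have e2 : (S : ℝ) * k * k₀ ≤ (N * v + C) * k * k₀ := by gcongr
  have e3 : C * k * k₀ ≤ C * (n : ℝ) ^ 2 := by
    rw [mul_assoc, sq]
    gcongr
  have e4 : (N * v + C) * k * k₀ = N * (a * k) + C * k * k₀ := by rw [← hv]; ring
  nlinarith

/-- At the true denominator the rounded number is not below `v` either, so `v` is the largest of the
rounded fractions. -/
theorem floor_mul_eq {S a : ℤ} {N k₀ n : ℕ} {v C : ℝ} (hv : v * k₀ = a) (hk₀ : 0 < k₀)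
    (hk₀n : k₀ ≤ n) (h1 : N * v ≤ S) (h2 : (S : ℝ) ≤ N * v + C) (hC : C * (n : ℝ) ^ 2 < N)
    (hC0 : 0 ≤ C) (hN : 0 < N) : S * k₀ / N = a := by
  refine le_antisymm ?_ ?_
  · have := floor_mul_le hv hk₀n h2 hC hC0 hk₀n hN
    exact le_of_mul_le_mul_right this (by exact_mod_cast hk₀)
  · rw [Int.le_ediv_iff_mul_le (by exact_mod_cast hN)]
    have : (a : ℝ) * N ≤ S * k₀ := by
      rw [← hv]
      nlinarith [Nat.cast_nonneg (α := ℝ) k₀]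
    exact_mod_cast this

/-! ### Pieces of the spectral function and intervals of its zero set -/

/-- The pieces `0, …, K` describe the function `s` on `(-∞, t]`. -/
structure PieceInv (s : ℝ → ℝ) (K : ℕ) (t : ℝ) (brk slope off : ℕ → ℚ) : Prop where
  mono : ∀ i, i + 1 < K → brk i < brk (i + 1)
  lt : ∀ i, i < K → (brk i : ℝ) < t
  ne : ∀ i, i < K → slope i ≠ slope (i + 1)
  eq : ∀ i, i ≤ K → ∀ x : ℝ, x ≤ t → (0 < i → (brk (i - 1) : ℝ) ≤ x) →
    (i < K → x ≤ (brk i : ℝ)) → s x = slope i * x + off i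

namespace PieceInv

variable {s : ℝ → ℝ} {K : ℕ} {u t : ℝ} {brk slope off brk' slope' off' : ℕ → ℚ} {a b : ℚ}

theorem init (h : ∀ x ≤ t, s x = slope 0 * x + off 0) : PieceInv s 0 t brk slope off :=
  ⟨fun _ h => by omega, fun _ h => by omega, fun _ h => by omega, fun i hi x hx _ _ => by
    obtain rfl : i = 0 := by omega
    exact h x hx⟩

theorem congr (h : PieceInv s K t brk slope off) (h1 : ∀ i < K, brk' i = brk i)
    (h2 : ∀ i ≤ K, slope' i = slope i) (h3 : ∀ i ≤ K, off' i = off i) :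
    PieceInv s K t brk' slope' off' where
  mono i hi := by rw [h1 i (by omega), h1 _ hi]; exact h.mono i hi
  lt i hi := by rw [h1 i hi]; exact h.lt i hi
  ne i hi := by rw [h2 i hi.le, h2 _ hi]; exact h.ne i hi
  eq i hi x hx hx1 hx2 := by
    rw [h2 i hi, h3 i hi]
    refine h.eq i hi x hx (fun h0 => ?_) (fun h0 => ?_)
    · rw [← h1 _ (by omega)]; exact hx1 h0
    · rw [← h1 _ h0]; exact hx2 h0

theorem eq_last (h : PieceInv s K u brk slope off) : s u = slope K * u + off K :=
  h.eq K le_rfl u le_rfl (fun _ => (h.lt _ (by omega)).le) (fun h => by omega)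

theorem extend_same (h : PieceInv s K u brk slope off) (hut : u < t) (ha : slope K = a)
    (hab : ∀ x, u ≤ x → x ≤ t → s x = a * x + b) : PieceInv s K t brk slope off where
  mono := h.mono
  lt i hi := (h.lt i hi).trans hut
  ne := h.ne
  eq i hi x hx hx1 hx2 := by
    rcases le_or_gt x u with hxu | hxu
    · exact h.eq i hi x hxu hx1 hx2
    · rcases hi.lt_or_eq with hi | rfl
      · exact absurd (hx2 hi) (not_le.2 ((h.lt i hi).trans hxu))
      · have e1 := h.eq_last
        have e2 := hab u le_rfl hut.le
        rw [hab x hxu.le hx, ha]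
        rw [ha] at e1
        linarith

theorem extend_new (h : PieceInv s K u brk slope off) (hut : u < t) (ha : slope K ≠ a)
    (hab : ∀ x, u ≤ x → x ≤ t → s x = a * x + b)
    (h1 : ∀ i < K, brk' i = brk i) (h1' : (brk' K : ℝ) = u)
    (h2 : ∀ i ≤ K, slope' i = slope i) (h2' : slope' (K + 1) = a)
    (h3 : ∀ i ≤ K, off' i = off i) (h3' : off' (K + 1) = b) :
    PieceInv s (K + 1) t brk' slope' off' := by
  have h := h.congr h1 h2 h3
  refine ⟨fun i hi => ?_, fun i hi => ?_, fun i hi => ?_, fun i hi x hx hx1 hx2 => ?_⟩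
  · rcases Nat.lt_or_ge (i + 1) K with h' | h'
    · exact h.mono i h'
    · obtain rfl : K = i + 1 := by omega
      have := h.lt i (by omega)
      rw [← h1'] at this
      exact_mod_cast this
  · rcases Nat.lt_or_ge i K with h' | h'
    · exact (h.lt i h').trans hut
    · obtain rfl : i = K := by omega
      rw [h1']
      exact hut
  · rcases Nat.lt_or_ge i K with h' | h'
    · exact h.ne i h'
    · obtain rfl : i = K := by omega
      rw [h2', h2 _ le_rfl]
      exact ha
  · rcases Nat.lt_or_ge i (K + 1) with h' | h'
    · have hxb := hx2 h'
      rcases Nat.lt_or_ge i K with h'' | h''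
      · exact h.eq i (by omega) x (hxb.trans (h.lt i h'').le) hx1 fun _ => hxb
      · obtain rfl : i = K := by omega
        rw [h1'] at hxb
        exact h.eq i le_rfl x hxb hx1 (fun h => by omega)
    · obtain rfl : i = K + 1 := by omega
      have := hx1 (by omega)
      simp only [Nat.add_sub_cancel] at this
      rw [h1'] at this
      rw [h2', h3']
      exact hab x this hx

theorem finish (h : PieceInv s K t brk slope off) {f : ℝ × ℝ} (hut : u < t)
    (hf : ∀ x, u ≤ x → s x = f.1 * x + f.2) {F : ℝ → WithBot ℝ} (hF : ∀ x, F x = (s x : WithBot ℝ)) :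
    IsAffineDecomposition F K brk slope off := by
  refine ⟨h.mono, h.ne, fun i hi x hx1 hx2 => ?_⟩
  rw [hF]
  norm_cast
  rcases le_or_gt x t with hxt | hxt
  · exact h.eq i hi x hxt hx1 hx2
  · rcases hi.lt_or_eq with hi | rfl
    · exact absurd (hx2 hi) (not_le.2 ((h.lt i hi).trans hxt))
    -- A point where the last piece and the ray overlap. Together with `t` it identifies the slope
    -- of the ray with that of the last piece.
    · obtain ⟨w, hw1, hw2, hw3⟩ : ∃ w, u ≤ w ∧ w < t ∧ (0 < i → (brk (i - 1) : ℝ) ≤ w) := by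
        by_cases h0 : 0 < i
        · exact ⟨max u (brk (i - 1)), le_max_left _ _, max_lt hut (h.lt _ (by omega)),
            fun _ => le_max_right _ _⟩
        · exact ⟨u, le_rfl, hut, fun h => absurd h h0⟩
      have e1 := h.eq i le_rfl w hw2.le hw3 (fun h => by omega)
      have e2 := h.eq_last
      rw [hf w hw1] at e1
      rw [hf t hut.le] at e2
      rw [hf x (hut.trans hxt).le]
      have e3 : (f.1 - slope i) * (t - w) = 0 := by linarith
      have e4 : f.1 = slope i := by
        rcases mul_eq_zero.1 e3 with h | h <;> linarith
      rw [e4] at e2 ⊢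
      linarith

end PieceInv

/-- The intervals `0, …, J - 1` describe the set `S` on `(-∞, t]`. -/
structure ZeroInv (S : Set ℝ) (J : ℕ) (t : ℝ) (lo hi : ℕ → EReal) : Prop where
  le : ∀ j, j < J → lo j ≤ hi j
  lt : ∀ j, j + 1 < J → hi j < lo (j + 1)
  hi_le : ∀ j, j < J → hi j ≤ (t : EReal)
  iff : ∀ x : ℝ, x ≤ t → (x ∈ S ↔ ∃ j, j < J ∧ lo j ≤ (x : EReal) ∧ (x : EReal) ≤ hi j)

namespace ZeroInv

variable {S : Set ℝ} {J : ℕ} {u t : ℝ} {lo hi lo' hi' : ℕ → EReal}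

theorem congr (h : ZeroInv S J t lo hi) (h1 : ∀ j < J, lo' j = lo j) (h2 : ∀ j < J, hi' j = hi j) :
    ZeroInv S J t lo' hi' where
  le j hj := by rw [h1 j hj, h2 j hj]; exact h.le j hj
  lt j hj := by rw [h1 _ hj, h2 j (by omega)]; exact h.lt j hj
  hi_le j hj := by rw [h2 j hj]; exact h.hi_le j hj
  iff x hx := by
    rw [h.iff x hx]
    refine exists_congr fun j => and_congr_right fun hj => ?_
    rw [h1 j hj, h2 j hj]

theorem extend_none (h : ZeroInv S J u lo hi) (hut : u < t)
    (hS : ∀ x, u < x → x ≤ t → x ∉ S) : ZeroInv S J t lo hi where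
  le := h.le
  lt := h.lt
  hi_le j hj := (h.hi_le j hj).trans (by exact_mod_cast hut.le)
  iff x hx := by
    rcases le_or_gt x u with hxu | hxu
    · exact h.iff x hxu
    · refine iff_of_false (hS x hxu hx) ?_
      rintro ⟨j, hj, -, h2⟩
      exact absurd (h2.trans (h.hi_le j hj)) (not_le.2 (by exact_mod_cast hxu))

theorem extend_new (h : ZeroInv S J u lo hi) (hut : u < t) (htS : t ∈ S)
    (hS : ∀ x, u < x → x < t → x ∉ S) (h1 : ∀ j < J, lo' j = lo j) (h2 : ∀ j < J, hi' j = hi j)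
    (h1' : lo' J = t) (h2' : hi' J = t) : ZeroInv S (J + 1) t lo' hi' := by
  have h := h.congr h1 h2
  refine ⟨fun j hj => ?_, fun j hj => ?_, fun j hj => ?_, fun x hx => ?_⟩
  · rcases Nat.lt_or_ge j J with h' | h'
    · exact h.le j h'
    · obtain rfl : j = J := by omega
      rw [h1', h2']
  · rcases Nat.lt_or_ge (j + 1) J with h' | h'
    · exact h.lt j h'
    · obtain rfl : J = j + 1 := by omega
      rw [h1']
      exact (h.hi_le j (by omega)).trans_lt (by exact_mod_cast hut)
  · rcases Nat.lt_or_ge j J with h' | h'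
    · exact (h.hi_le j h').trans (by exact_mod_cast hut.le)
    · obtain rfl : j = J := by omega
      rw [h2']
  · rcases le_or_gt x u with hxu | hxu
    · rw [h.iff x hxu]
      constructor
      · rintro ⟨j, hj, h3⟩
        exact ⟨j, by omega, h3⟩
      · rintro ⟨j, hj, h3, h4⟩
        rcases Nat.lt_or_ge j J with h' | h'
        · exact ⟨j, h', h3, h4⟩
        · obtain rfl : j = J := by omega
          rw [h1'] at h3
          exact absurd (EReal.coe_le_coe_iff.1 h3) (not_le.2 (hxu.trans_lt hut))
    · rcases hx.lt_or_eq with hxt | rfl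
      · refine iff_of_false (hS x hxu hxt) ?_
        rintro ⟨j, hj, h3, h4⟩
        rcases Nat.lt_or_ge j J with h' | h'
        · exact absurd (h4.trans (h.hi_le j h')) (not_le.2 (by exact_mod_cast hxu))
        · obtain rfl : j = J := by omega
          rw [h1'] at h3
          exact absurd (EReal.coe_le_coe_iff.1 h3) (not_le.2 hxt)
      · exact iff_of_true htS ⟨J, by omega, h1'.le, h2'.ge⟩

/-- All intervals end at or before `u`, and they are ordered; so the one that contains `u` is the
last and ends exactly there. -/
theorem last_eq (h : ZeroInv S J u lo hi) (huS : u ∈ S) : 0 < J ∧ hi (J - 1) = u := by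
  obtain ⟨j, hj, -, h2⟩ := (h.iff u le_rfl).1 huS
  refine ⟨by omega, ?_⟩
  rcases Nat.lt_or_ge (j + 1) J with h' | h'
  · have := (h2.trans_lt (h.lt j h')).trans_le ((h.le _ h').trans (h.hi_le _ h'))
    exact absurd this (lt_irrefl _)
  · obtain rfl : j = J - 1 := by omega
    exact le_antisymm (h.hi_le _ hj) h2

theorem extend_same (h : ZeroInv S J u lo hi) (hut : u < t)
    (hS : ∀ x, u ≤ x → x ≤ t → x ∈ S) (h1 : ∀ j < J, lo' j = lo j) (h2 : ∀ j < J - 1, hi' j = hi j)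
    (h2' : hi' (J - 1) = t) : ZeroInv S J t lo' hi' := by
  obtain ⟨hJ, hlast⟩ := h.last_eq (hS u le_rfl hut.le)
  have hle : ∀ j < J, hi j ≤ hi' j := fun j hj => by
    rcases Nat.lt_or_ge j (J - 1) with h' | h'
    · rw [h2 j h']
    · obtain rfl : j = J - 1 := by omega
      rw [h2', hlast]
      exact_mod_cast hut.le
  refine ⟨fun j hj => ?_, fun j hj => ?_, fun j hj => ?_, fun x hx => ?_⟩
  · rw [h1 j hj]
    exact (h.le j hj).trans (hle j hj)
  · rw [h1 _ hj, h2 j (by omega)]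
    exact h.lt j hj
  · rcases Nat.lt_or_ge j (J - 1) with h' | h'
    · rw [h2 j h']
      exact (h.hi_le j hj).trans (by exact_mod_cast hut.le)
    · obtain rfl : j = J - 1 := by omega
      rw [h2']
  · rcases le_or_gt x u with hxu | hxu
    · rw [h.iff x hxu]
      constructor
      · rintro ⟨j, hj, h3, h4⟩
        exact ⟨j, hj, by rwa [h1 j hj], h4.trans (hle j hj)⟩
      · rintro ⟨j, hj, h3, h4⟩
        rw [h1 j hj] at h3
        refine ⟨j, hj, h3, ?_⟩
        rcases Nat.lt_or_ge j (J - 1) with h' | h'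
        · rwa [h2 j h'] at h4
        · obtain rfl : j = J - 1 := by omega
          rw [hlast]
          exact_mod_cast hxu
    · refine iff_of_true (hS x hxu.le hx) ⟨J - 1, by omega, ?_, ?_⟩
      · rw [h1 _ (by omega)]
        refine (h.le _ (by omega)).trans ?_
        rw [hlast]
        exact_mod_cast hxu.le
      · rw [h2']
        exact_mod_cast hx

theorem finish_none (h : ZeroInv S J t lo hi) (hS : ∀ x, t ≤ x → x ∉ S) :
    IsIntervalDecomposition S J lo hi := by
  refine ⟨h.le, h.lt, Set.ext fun x => ?_⟩
  rcases le_or_gt x t with hxt | hxt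
  · exact h.iff x hxt
  · refine iff_of_false (hS x hxt.le) ?_
    rintro ⟨j, hj, -, h2⟩
    exact absurd (h2.trans (h.hi_le j hj)) (not_le.2 (by exact_mod_cast hxt))

theorem finish_top (h : ZeroInv S J t lo hi) (hS : ∀ x, t ≤ x → x ∈ S)
    (h1 : ∀ j < J, lo' j = lo j) (h2 : ∀ j < J - 1, hi' j = hi j) (h2' : hi' (J - 1) = ⊤) :
    IsIntervalDecomposition S J lo' hi' := by
  obtain ⟨hJ, hlast⟩ := h.last_eq (hS t le_rfl)
  have hle : ∀ j < J, hi j ≤ hi' j := fun j hj => by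
    rcases Nat.lt_or_ge j (J - 1) with h' | h'
    · rw [h2 j h']
    · obtain rfl : j = J - 1 := by omega
      rw [h2']
      exact le_top
  refine ⟨fun j hj => ?_, fun j hj => ?_, Set.ext fun x => ?_⟩
  · rw [h1 j hj]
    exact (h.le j hj).trans (hle j hj)
  · rw [h1 _ hj, h2 j (by omega)]
    exact h.lt j hj
  · simp only [Set.mem_ofPred_eq]
    rcases le_or_gt x t with hxt | hxt
    · rw [h.iff x hxt]
      constructor
      · rintro ⟨j, hj, h3, h4⟩
        exact ⟨j, hj, by rwa [h1 j hj], h4.trans (hle j hj)⟩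
      · rintro ⟨j, hj, h3, h4⟩
        rw [h1 j hj] at h3
        refine ⟨j, hj, h3, ?_⟩
        rcases Nat.lt_or_ge j (J - 1) with h' | h'
        · rwa [h2 j h'] at h4
        · obtain rfl : j = J - 1 := by omega
          rw [hlast]
          exact_mod_cast hxt
    · refine iff_of_true (hS x hxt.le) ⟨J - 1, by omega, ?_, ?_⟩
      · rw [h1 _ (by omega)]
        refine (h.le _ (by omega)).trans ?_
        rw [hlast]
        exact_mod_cast hxt.le
      · rw [h2']
        exact le_top

end ZeroInv

/-- A nonpositive affine function with a zero in the interior of an interval vanishes. -/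
theorem eq_zero_of_interior_zero {s : ℝ → ℝ} {a b u v z : ℝ} (hs : ∀ x, s x ≤ 0)
    (h : ∀ x, u ≤ x → x ≤ v → s x = a * x + b) (hu : u < z) (hv : z < v) (hz : s z = 0) :
    a = 0 ∧ b = 0 := by
  have h1 := hs u
  have h2 := hs v
  rw [h u le_rfl (hu.trans hv).le] at h1
  rw [h v (hu.trans hv).le le_rfl] at h2
  rw [h z hu.le hv.le] at hz
  have : a = 0 := by
    rcases lt_trichotomy a 0 with h0 | h0 | h0
    · nlinarith
    · exact h0
    · nlinarith
  subst this
  exact ⟨rfl, by linarith⟩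

/-! ### Counting and enumerating the grid -/

/-- The grid points in `[t, hi]`, with multiplicities. -/
noncomputable def gridFrom (κ : ℕ) (lo hi : ℤ) (t : ℝ) : Finset (Σ _ : ℕ, ℤ) :=
  ((Finset.Icc 1 (κ ^ 2)).sigma fun D => Finset.Icc (2 * D * lo) (2 * D * hi)).filter
    fun a => t ≤ (a.2 : ℝ) / (2 * a.1)

/-- Each `D ≤ κ²` has `2 D (hi - lo) + 1 ≤ 3 κ² (hi - lo)` numerators. The final `κ⁴` is the basic
factor of all call bounds. -/
theorem card_gridFrom_le (κ : ℕ) {lo hi : ℤ} (h : lo < hi) (t : ℝ) :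
    ((gridFrom κ lo hi t).card : ℤ) ≤ 3 * κ ^ 4 * (hi - lo) := by
  have h1 : ((gridFrom κ lo hi t).card : ℤ) ≤
      ∑ D ∈ Finset.Icc 1 (κ ^ 2), ((Finset.Icc (2 * (D : ℤ) * lo) (2 * D * hi)).card : ℤ) := by
    have := Finset.card_filter_le ((Finset.Icc 1 (κ ^ 2)).sigma fun D =>
      Finset.Icc (2 * (D : ℤ) * lo) (2 * D * hi)) fun a => t ≤ (a.2 : ℝ) / (2 * a.1)
    rw [Finset.card_sigma] at this
    rw [← Nat.cast_sum]
    exact Nat.cast_le.2 this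
  refine h1.trans ?_
  calc _ ≤ ∑ D ∈ Finset.Icc 1 (κ ^ 2), (3 * (κ : ℤ) ^ 2 * (hi - lo)) := by
        refine Finset.sum_le_sum fun D hD => ?_
        rw [Finset.mem_Icc] at hD
        have hD2 : (D : ℤ) ≤ (κ : ℤ) ^ 2 := by exact_mod_cast hD.2
        have hD1 : (1 : ℤ) ≤ D := by exact_mod_cast hD.1
        rw [Int.card_Icc, Int.toNat_of_nonneg (by nlinarith)]
        nlinarith
    _ = _ := by
        rw [Finset.sum_const, Nat.card_Icc]
        simp only [Nat.add_sub_cancel, nsmul_eq_mul]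
        push_cast
        ring

/-- The termination measure of the main loop: moving to a larger point drops the current fraction.
-/
theorem card_gridFrom_lt {κ : ℕ} {lo hi : ℤ} {N : ℤ} {D : ℕ} (hD1 : 1 ≤ D) (hD2 : D ≤ κ ^ 2)
    (hlo : 2 * D * lo ≤ N) (hhi : N ≤ 2 * D * hi) {t : ℝ} (ht : (N : ℝ) / (2 * D) < t) :
    (gridFrom κ lo hi t).card < (gridFrom κ lo hi ((N : ℝ) / (2 * D))).card := by
  refine Finset.card_lt_card (Finset.ssubset_iff_of_subset ?_ |>.2 ⟨⟨D, N⟩, ?_, ?_⟩)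
  · intro a ha
    simp only [gridFrom, Finset.mem_filter] at ha ⊢
    exact ⟨ha.1, ht.le.trans ha.2⟩
  · simp only [gridFrom, Finset.mem_filter, Finset.mem_sigma, Finset.mem_Icc]
    exact ⟨⟨⟨hD1, hD2⟩, hlo, hhi⟩, le_rfl⟩
  · simp only [gridFrom, Finset.mem_filter, not_and, not_le]
    exact fun _ => ht

/-- The least fraction with denominator `2 d` above `N / (2 D)`. -/
theorem next_num_le {N D : ℤ} (hD : 0 < D) (d a : ℤ) :
    N * d / D + 1 ≤ a ↔ N * d < a * D := by
  rw [Int.add_one_le_iff, Int.ediv_lt_iff_lt_mul hD]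


/-! ### Reasoning about programs -/

instance : Add Expr := ⟨Expr.op .add⟩
instance : Sub Expr := ⟨Expr.op .sub⟩
instance : Mul Expr := ⟨Expr.op .mul⟩
instance : Div Expr := ⟨Expr.op .div⟩
instance (k : ℕ) : OfNat Expr k := ⟨.const k⟩

/-- The test `e < f`. -/
abbrev Expr.lt (e f : Expr) : Expr := .op .lt e f

/-- The test `e = f`. -/
abbrev Expr.eq (e f : Expr) : Expr := .op .eq e f

/-- Register `x`. -/
abbrev rg (x : ℕ) : Expr := .reg x

infixr:60 " ;; " => Com.seq

section Simp

variable (σ : State) (e f : Expr)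

@[simp] theorem eval_add : (e + f).eval σ = e.eval σ + f.eval σ := rfl
@[simp] theorem eval_sub : (e - f).eval σ = e.eval σ - f.eval σ := rfl
@[simp] theorem eval_mul : (e * f).eval σ = e.eval σ * f.eval σ := rfl
@[simp] theorem eval_div : (e / f).eval σ = e.eval σ / f.eval σ := rfl
@[simp] theorem eval_lt : (Expr.op .lt e f).eval σ = if e.eval σ < f.eval σ then 1 else 0 := rfl
@[simp] theorem eval_eq : (Expr.op .eq e f).eval σ = if e.eval σ = f.eval σ then 1 else 0 := rfl
@[simp] theorem eval_reg (x : ℕ) : (Expr.reg x).eval σ = σ.reg x := rfl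
@[simp] theorem eval_cell (a : ℕ) : (Expr.cell a e f).eval σ = σ.mem a (e.eval σ) (f.eval σ) := rfl
@[simp] theorem eval_const (c : ℤ) : (Expr.const c).eval σ = c := rfl
@[simp] theorem eval_zero : (0 : Expr).eval σ = 0 := rfl
@[simp] theorem eval_one : (1 : Expr).eval σ = 1 := rfl
@[simp] theorem eval_two : (2 : Expr).eval σ = 2 := rfl

@[simp] theorem setReg_reg (x y : ℕ) (v : ℤ) :
    (σ.setReg x v).reg y = if y = x then v else σ.reg y := by
  simp [State.setReg, Function.update_apply]
@[simp] theorem setReg_mem (x : ℕ) (v : ℤ) : (σ.setReg x v).mem = σ.mem := rfl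
@[simp] theorem setCell_reg (a : ℕ) (i j v : ℤ) : (σ.setCell a i j v).reg = σ.reg := rfl
@[simp] theorem setCell_mem (a : ℕ) (i j v : ℤ) (a' : ℕ) (i' j' : ℤ) :
    (σ.setCell a i j v).mem a' i' j' = if a' = a ∧ i' = i ∧ j' = j then v else σ.mem a' i' j' := rfl

end Simp

/-- Exponents that bound the registers in terms of a base. -/
def regExp (x : ℕ) : ℕ := if x < 100 then 1 else if x < 200 then 25 else 500

/-- Exponents that bound the arrays in terms of a base. -/
def memExp (a : ℕ) : ℕ := if a = 6 ∨ a = 7 then 25 else if a = 8 ∨ a = 9 then 500 else 1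

/-- All registers and cells are bounded by the powers of `B` assigned to them. -/
structure Ty (B : ℕ) (σ : State) : Prop where
  reg : ∀ x, |σ.reg x| ≤ (B : ℤ) ^ regExp x
  mem : ∀ a i j, |σ.mem a i j| ≤ (B : ℤ) ^ memExp a

/-- An exponent that bounds an expression. -/
def Expr.deg : Expr → ℕ
  | .const c => bits c
  | .reg x => regExp x
  | .cell a _ _ => memExp a
  | .op .add e f => max e.deg f.deg + 1
  | .op .sub e f => max e.deg f.deg + 1
  | .op .mul e f => e.deg + f.deg
  | .op .div e _ => e.deg
  | .op .lt _ _ => 0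
  | .op .eq _ _ => 0

/-- A factor that bounds the cost of an expression. -/
def Expr.wt : Expr → ℕ
  | .const c => bits c + 2
  | .reg x => regExp x + 2
  | .cell a i j => i.wt + j.wt + memExp a + 2
  | .op o e f => e.wt + f.wt + (Expr.op o e f).deg + 2

/-- A constant that bounds the running time of a program with short loops. -/
def Com.kc : Com → ℕ
  | .skip => 1
  | .assign _ e => e.wt + 1
  | .store _ i j e => i.wt + j.wt + e.wt + 1
  | .seq c d => c.kc + d.kc
  | .ite e c d => e.wt + 1 + (c.kc + d.kc)
  | .loop e c => 2 * (e.wt + 1) + c.kc + 2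
  | .call => 1

/-- Whether the program may change the register `x`. -/
def Com.wr : Com → ℕ → Bool
  | .skip, _ => false
  | .assign x _, y => y == x
  | .store _ _ _ _, _ => false
  | .seq c d, y => c.wr y || d.wr y
  | .ite _ c d, y => c.wr y || d.wr y
  | .loop _ c, y => c.wr y
  | .call, y => y == 2 || y == 3

/-- Whether the program may change the array `a`. -/
def Com.wm : Com → ℕ → Bool
  | .skip, _ => false
  | .assign _ _, _ => false
  | .store a _ _ _, b => b == a
  | .seq c d, y => c.wm y || d.wm y
  | .ite _ c d, y => c.wm y || d.wm y
  | .loop _ c, y => c.wm y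
  | .call, _ => false

/-- `σ'` differs from `σ` at most in the places that `c` may change. -/
structure Fr (c : Com) (σ σ' : State) : Prop where
  reg : ∀ x, c.wr x = false → σ'.reg x = σ.reg x
  mem : ∀ a, c.wm a = false → σ'.mem a = σ.mem a

theorem Fr.refl (c : Com) (σ : State) : Fr c σ σ := ⟨fun _ _ => rfl, fun _ _ => rfl⟩

theorem Fr.trans {c : Com} {σ₁ σ₂ σ₃ : State} (h : Fr c σ₁ σ₂) (h' : Fr c σ₂ σ₃) : Fr c σ₁ σ₃ :=
  ⟨fun x hx => (h'.reg x hx).trans (h.reg x hx), fun x hx => (h'.mem x hx).trans (h.mem x hx)⟩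

theorem Fr.seq_left {c d : Com} {σ σ' : State} (h : Fr c σ σ') : Fr (c ;; d) σ σ' :=
  ⟨fun x hx => h.reg x (by simp [Com.wr] at hx; exact hx.1),
    fun x hx => h.mem x (by simp [Com.wm] at hx; exact hx.1)⟩

theorem Fr.seq_right {c d : Com} {σ σ' : State} (h : Fr d σ σ') : Fr (c ;; d) σ σ' :=
  ⟨fun x hx => h.reg x (by simp [Com.wr] at hx; exact hx.2),
    fun x hx => h.mem x (by simp [Com.wm] at hx; exact hx.2)⟩

theorem Exec.fr {c : Com} {σ σ' : State} {t : ℕ} {gs : List Game} (h : Exec c σ σ' t gs) :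
    Fr c σ σ' := by
  induction h with
  | skip σ => exact Fr.refl _ _
  | assign σ x e =>
    refine ⟨fun y hy => ?_, fun _ _ => rfl⟩
    simp only [Com.wr, beq_eq_false_iff_ne] at hy
    simp [hy]
  | store σ a i j e =>
    refine ⟨fun _ _ => rfl, fun b hb => ?_⟩
    simp only [Com.wm, beq_eq_false_iff_ne] at hb
    funext i' j'
    simp [hb]
  | seq _ _ ih₁ ih₂ => exact ih₁.seq_left.trans ih₂.seq_right
  | ite_true _ _ ih => exact ⟨fun x hx => ih.reg x (by simp [Com.wr] at hx; exact hx.1),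
      fun x hx => ih.mem x (by simp [Com.wm] at hx; exact hx.1)⟩
  | ite_false _ _ ih => exact ⟨fun x hx => ih.reg x (by simp [Com.wr] at hx; exact hx.2),
      fun x hx => ih.mem x (by simp [Com.wm] at hx; exact hx.2)⟩
  | loop_true _ _ _ ih₁ ih₂ => exact Fr.trans ⟨ih₁.reg, ih₁.mem⟩ ih₂
  | loop_false _ => exact Fr.refl _ _
  | call _ _ _ =>
    refine ⟨fun y hy => ?_, fun _ _ => rfl⟩
    simp only [Com.wr, Bool.or_eq_false_iff, beq_eq_false_iff_ne] at hy
    simp [hy.1, hy.2]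

/-- `Z` bounds the length of numbers of size `B`. -/
structure Ctx (B Z : ℕ) : Prop where
  two_le : 2 ≤ B
  one_le : 1 ≤ Z
  size_le : Nat.size B ≤ Z

section Run

variable {B Z : ℕ}

theorem bits_le (hc : Ctx B Z) {v : ℤ} {d : ℕ} (h : |v| ≤ (B : ℤ) ^ d) : bits v ≤ d * Z + 1 := by
  rw [bits, Nat.size_le]
  have h1 : v.natAbs ≤ B ^ d := by zify; exact h
  calc v.natAbs ≤ B ^ d := h1
    _ ≤ (2 ^ Z) ^ d := by
        gcongr
        exact (Nat.lt_size_self B).le.trans (Nat.pow_le_pow_right (by norm_num) hc.size_le)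
    _ < 2 ^ (d * Z + 1) := by
        rw [← pow_mul, mul_comm Z d]
        exact Nat.pow_lt_pow_right (by norm_num) (by omega)

theorem one_le_pow_cast (hc : Ctx B Z) (d : ℕ) : (1 : ℤ) ≤ (B : ℤ) ^ d :=
  one_le_pow₀ (by have := hc.two_le; omega)

theorem pow_le_pow_cast (hc : Ctx B Z) {d d' : ℕ} (h : d ≤ d') : (B : ℤ) ^ d ≤ (B : ℤ) ^ d' :=
  pow_le_pow_right₀ (by have := hc.two_le; omega) h

theorem abs_add_le_pow (hc : Ctx B Z) {a b c : ℤ} {d d' : ℕ} (ha : |a| ≤ (B : ℤ) ^ d)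
    (hb : |b| ≤ (B : ℤ) ^ d') (habc : |c| ≤ |a| + |b|) : |c| ≤ (B : ℤ) ^ (max d d' + 1) := by
  have h1 := pow_le_pow_cast hc (le_max_left d d')
  have h2 := pow_le_pow_cast hc (le_max_right d d')
  have h3 := one_le_pow_cast hc (max d d')
  have h4 : (2 : ℤ) ≤ B := by exact_mod_cast hc.two_le
  rw [pow_succ]
  nlinarith

/-- The degree is a purely syntactic bound: a sum costs one more power because `2 ≤ B`, degrees add
up under products, and a quotient costs nothing. -/
theorem abs_eval_le (hc : Ctx B Z) {σ : State} (hσ : Ty B σ) (e : Expr) :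
    |e.eval σ| ≤ (B : ℤ) ^ e.deg := by
  induction e with
  | const c =>
    have h1 : c.natAbs < 2 ^ bits c := Nat.lt_size_self _
    have h2 : 2 ^ bits c ≤ B ^ bits c := Nat.pow_le_pow_left hc.two_le _
    have : c.natAbs ≤ B ^ bits c := h1.le.trans h2
    zify at this
    exact this
  | reg x => exact hσ.reg x
  | cell a i j _ _ => exact hσ.mem a _ _
  | op o e f he hf =>
    have hb : ∀ p : Prop, ∀ [Decidable p], |if p then (1 : ℤ) else 0| ≤ (B : ℤ) ^ 0 := by
      intro p _
      split_ifs <;> simp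
    cases o with
    | add => exact abs_add_le_pow hc he hf (abs_add_le _ _)
    | sub => exact abs_add_le_pow hc he hf (abs_sub _ _)
    | mul =>
      show |e.eval σ * f.eval σ| ≤ (B : ℤ) ^ (e.deg + f.deg)
      rw [abs_mul, pow_add]
      exact mul_le_mul he hf (abs_nonneg _) (by positivity)
    | div =>
      refine le_trans ?_ he
      show |e.eval σ / f.eval σ| ≤ _
      have := Int.natAbs_ediv_le_natAbs (e.eval σ) (f.eval σ)
      zify at this
      exact this
    | lt => exact hb _
    | eq => exact hb _

theorem cost_le (hc : Ctx B Z) {σ : State} (hσ : Ty B σ) (e : Expr) : e.cost σ ≤ e.wt * Z := by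
  have h1 := hc.one_le
  induction e with
  | const c =>
    simp only [Expr.cost, Expr.wt]
    nlinarith
  | reg x =>
    have := bits_le hc (hσ.reg x)
    simp only [Expr.cost, Expr.wt]
    nlinarith
  | cell a i j hi hj =>
    have := bits_le hc (hσ.mem a (i.eval σ) (j.eval σ))
    simp only [Expr.cost, Expr.wt]
    nlinarith
  | op o e f he hf =>
    have := bits_le hc (abs_eval_le hc hσ (.op o e f))
    simp only [Expr.eval] at this
    simp only [Expr.cost, Expr.wt]
    nlinarith

/-- Started in `σ`, the program stops in time in a state with the property `Q`, without oracle
calls and within the bounds for all numbers. -/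
def Run (B Z : ℕ) (c : Com) (σ : State) (Q : State → Prop) : Prop :=
  ∃ σ' t, Exec c σ σ' t [] ∧ t ≤ c.kc * Z ^ c.kc ∧ Ty B σ' ∧ Q σ'

theorem Run.mono {c : Com} {σ : State} {Q Q' : State → Prop} (h : Run B Z c σ Q)
    (hQ : ∀ σ', Ty B σ' → Fr c σ σ' → Q σ' → Q' σ') : Run B Z c σ Q' := by
  obtain ⟨σ', t, h1, h2, h3, h4⟩ := h
  exact ⟨σ', t, h1, h2, h3, hQ σ' h3 h1.fr h4⟩

theorem le_mul_pow {a Z k : ℕ} (hZ : 1 ≤ Z) (h : a + 1 ≤ k) : a * Z + 1 ≤ k * Z ^ k := by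
  obtain ⟨k, rfl⟩ : ∃ k', k = k' + 1 := ⟨k - 1, by omega⟩
  have h1 : 1 ≤ Z ^ k := Nat.one_le_pow _ _ hZ
  calc a * Z + 1 ≤ (a + 1) * Z := by nlinarith
    _ ≤ (k + 1) * Z := Nat.mul_le_mul_right _ h
    _ ≤ (k + 1) * (Z ^ k * Z) := Nat.mul_le_mul_left _ (Nat.le_mul_of_pos_left _ h1)
    _ = _ := by rw [pow_succ]

/-- The expression `k * Z ^ k` is superadditive in `k`, so the constants of composed programs may
simply be added. -/
theorem mul_pow_add_le {Z k l : ℕ} (hZ : 1 ≤ Z) :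
    k * Z ^ k + l * Z ^ l ≤ (k + l) * Z ^ (k + l) := by
  have h1 : Z ^ k ≤ Z ^ (k + l) := Nat.pow_le_pow_right hZ (by omega)
  have h2 : Z ^ l ≤ Z ^ (k + l) := Nat.pow_le_pow_right hZ (by omega)
  nlinarith

theorem Run.skip (hc : Ctx B Z) {σ : State} (hσ : Ty B σ) {Q : State → Prop} (hQ : Q σ) :
    Run B Z .skip σ Q :=
  ⟨σ, 1, .skip σ, by simpa [Com.kc] using hc.one_le, hσ, hQ⟩

theorem Ty.setReg {σ : State} (hσ : Ty B σ) {x : ℕ} {v : ℤ} (hv : |v| ≤ (B : ℤ) ^ regExp x) :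
    Ty B (σ.setReg x v) where
  reg y := by
    rw [setReg_reg]
    split_ifs with h
    · rw [h]; exact hv
    · exact hσ.reg y
  mem := hσ.mem

theorem Ty.setCell {σ : State} (hσ : Ty B σ) {a : ℕ} {i j v : ℤ}
    (hv : |v| ≤ (B : ℤ) ^ memExp a) : Ty B (σ.setCell a i j v) where
  reg := hσ.reg
  mem b i' j' := by
    rw [setCell_mem]
    split_ifs with h
    · rw [h.1]; exact hv
    · exact hσ.mem b i' j'

theorem Run.assign (hc : Ctx B Z) {σ : State} (hσ : Ty B σ) {x : ℕ} {e : Expr} {Q : State → Prop}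
    (v : ℤ) (hv : e.eval σ = v) (hb : |v| ≤ (B : ℤ) ^ regExp x)
    (hQ : Ty B (σ.setReg x v) → Q (σ.setReg x v)) : Run B Z (.assign x e) σ Q := by
  subst hv
  refine ⟨_, _, .assign σ x e, ?_, hσ.setReg hb, hQ (hσ.setReg hb)⟩
  have := cost_le hc hσ e
  exact (Nat.add_le_add_right this 1).trans (le_mul_pow hc.one_le le_rfl)

/-- The assigned value is bounded for reasons of type only. -/
theorem Run.assignT (hc : Ctx B Z) {σ : State} (hσ : Ty B σ) {x : ℕ} {e : Expr} {Q : State → Prop}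
    (v : ℤ) (hv : e.eval σ = v) (hd : e.deg ≤ regExp x)
    (hQ : Ty B (σ.setReg x v) → Q (σ.setReg x v)) : Run B Z (.assign x e) σ Q :=
  Run.assign hc hσ v hv (hv ▸ (abs_eval_le hc hσ e).trans (pow_le_pow_cast hc hd)) hQ

theorem Run.store (hc : Ctx B Z) {σ : State} (hσ : Ty B σ) {a : ℕ} {i j e : Expr}
    {Q : State → Prop} (v : ℤ) (hv : e.eval σ = v) (hb : |v| ≤ (B : ℤ) ^ memExp a)
    (hQ : Ty B (σ.setCell a (i.eval σ) (j.eval σ) v) → Q (σ.setCell a (i.eval σ) (j.eval σ) v)) :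
    Run B Z (.store a i j e) σ Q := by
  subst hv
  refine ⟨_, _, .store σ a i j e, ?_, hσ.setCell hb, hQ (hσ.setCell hb)⟩
  have h1 := cost_le hc hσ e
  have h2 := cost_le hc hσ i
  have h3 := cost_le hc hσ j
  have h4 := le_mul_pow (a := i.wt + j.wt + e.wt) hc.one_le le_rfl
  simp only [Com.kc]
  refine le_trans ?_ h4
  nlinarith

theorem Run.storeT (hc : Ctx B Z) {σ : State} (hσ : Ty B σ) {a : ℕ} {i j e : Expr}
    {Q : State → Prop} (v : ℤ) (hv : e.eval σ = v) (hd : e.deg ≤ memExp a)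
    (hQ : Ty B (σ.setCell a (i.eval σ) (j.eval σ) v) → Q (σ.setCell a (i.eval σ) (j.eval σ) v)) :
    Run B Z (.store a i j e) σ Q :=
  Run.store hc hσ v hv (hv ▸ (abs_eval_le hc hσ e).trans (pow_le_pow_cast hc hd)) hQ

theorem Run.seq (hc : Ctx B Z) {c d : Com} {σ : State} {Q Q' : State → Prop}
    (h : Run B Z c σ Q') (h' : ∀ σ', Ty B σ' → Fr c σ σ' → Q' σ' → Run B Z d σ' Q) :
    Run B Z (c ;; d) σ Q := by
  obtain ⟨σ', t, h1, h2, h3, h4⟩ := h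
  obtain ⟨σ'', t', h1', h2', h3', h4'⟩ := h' σ' h3 h1.fr h4
  exact ⟨σ'', t + t', .seq h1 h1', (Nat.add_le_add h2 h2').trans (mul_pow_add_le hc.one_le),
    h3', h4'⟩

theorem Run.ite (hc : Ctx B Z) {c d : Com} {e : Expr} {σ : State} {Q : State → Prop}
    (hσ : Ty B σ) (h : e.eval σ ≠ 0 → Run B Z c σ Q) (h' : e.eval σ = 0 → Run B Z d σ Q) :
    Run B Z (.ite e c d) σ Q := by
  have h1 := cost_le hc hσ e
  have h2 := mul_pow_add_le (k := c.kc) (l := d.kc) hc.one_le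
  have h3 := mul_pow_add_le (k := e.wt + 1) (l := c.kc + d.kc) hc.one_le
  have h4 := le_mul_pow (a := e.wt) hc.one_le le_rfl
  by_cases he : e.eval σ = 0
  · obtain ⟨σ', t, g1, g2, g3, g4⟩ := h' he
    refine ⟨σ', _, .ite_false he g1, ?_, g3, g4⟩
    simp only [Com.kc]
    omega
  · obtain ⟨σ', t, g1, g2, g3, g4⟩ := h he
    refine ⟨σ', _, .ite_true he g1, ?_, g3, g4⟩
    simp only [Com.kc]
    omega

/-- The index of the invariant counts the turns that are left. There are at most `Z` of them, and
this extra factor is absorbed by the larger exponent in `Com.kc`. -/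
theorem Run.loop (hc : Ctx B Z) {c : Com} {e : Expr} {σ : State} (hσ : Ty B σ)
    (Inv : ℕ → State → Prop) (k : ℕ) (hk : k ≤ Z) (h0 : Inv k σ)
    (hs : ∀ k σ', Ty B σ' → Fr c σ σ' → Inv k σ' → e.eval σ' ≠ 0 →
      ∃ k', k = k' + 1 ∧ Run B Z c σ' (Inv k')) :
    Run B Z (.loop e c) σ fun σ' => e.eval σ' = 0 ∧ ∃ k, Inv k σ' := by
  have key : ∀ k σ', Ty B σ' → Fr c σ σ' → Inv k σ' → ∃ σ'' t, Exec (.loop e c) σ' σ'' t [] ∧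
      t ≤ k * (e.wt * Z + 1 + c.kc * Z ^ c.kc) + (e.wt * Z + 1) ∧ Ty B σ'' ∧
      e.eval σ'' = 0 ∧ ∃ k, Inv k σ'' := by
    intro k
    induction k with
    | zero =>
      intro σ' hσ' hF hI
      have h1 := cost_le hc hσ' e
      by_cases he : e.eval σ' = 0
      · exact ⟨σ', _, .loop_false he, by omega, hσ', he, 0, hI⟩
      · obtain ⟨k', hk', _⟩ := hs 0 σ' hσ' hF hI he
        omega
    | succ k ih =>
      intro σ' hσ' hF hI
      have h1 := cost_le hc hσ' e
      by_cases he : e.eval σ' = 0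
      · exact ⟨σ', _, .loop_false he, by omega, hσ', he, k + 1, hI⟩
      · obtain ⟨k', hk', σ₁, t₁, g1, g2, g3, g4⟩ := hs _ σ' hσ' hF hI he
        obtain rfl : k = k' := by omega
        obtain ⟨σ₂, t₂, f1, f2, f3⟩ := ih σ₁ g3 (hF.trans g1.fr) g4
        refine ⟨σ₂, _, .loop_true he g1 f1, ?_, f3⟩
        rw [Nat.succ_mul]
        omega
  obtain ⟨σ', t, h1, h2, h3, h4⟩ := key k σ hσ (Fr.refl _ _) h0
  refine ⟨σ', t, h1, h2.trans ?_, h3, h4⟩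
  have hZ := hc.one_le
  have hp : ∀ l, 1 ≤ Z ^ l := fun l => Nat.one_le_pow _ _ hZ
  have e1 : Z * Z ^ c.kc ≤ Z ^ (Com.loop e c).kc := by
    rw [← pow_succ']
    exact Nat.pow_le_pow_right hZ (by simp only [Com.kc]; omega)
  have e2 : Z * Z ≤ Z ^ (Com.loop e c).kc := by
    rw [← sq]
    exact Nat.pow_le_pow_right hZ (by simp only [Com.kc]; omega)
  have e3 : Z ≤ Z * Z := by nlinarith
  calc k * (e.wt * Z + 1 + c.kc * Z ^ c.kc) + (e.wt * Z + 1)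
      ≤ Z * (e.wt * Z + 1 + c.kc * Z ^ c.kc) + (e.wt * Z + 1) := by gcongr
    _ = e.wt * (Z * Z) + Z + c.kc * (Z * Z ^ c.kc) + e.wt * Z + 1 := by ring
    _ ≤ e.wt * Z ^ (Com.loop e c).kc + Z ^ (Com.loop e c).kc + c.kc * Z ^ (Com.loop e c).kc +
        e.wt * Z ^ (Com.loop e c).kc + Z ^ (Com.loop e c).kc := by
        gcongr
        · exact e3.trans e2
        · exact e3.trans e2
        · exact hp _
    _ = (2 * (e.wt + 1) + c.kc) * Z ^ (Com.loop e c).kc := by ring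
    _ ≤ _ := by
        gcongr
        simp only [Com.kc]
        omega

/-- A loop over the values of register `i` below the value of register `r`. -/
def forTo (i r : ℕ) (body : Com) : Com :=
  .assign i 0 ;; .loop (.lt (rg i) (rg r)) (body ;; .assign i (rg i + 1))

/-- The body must establish the invariant for the state after the counter has been increased, since
that assignment follows the body; the invariant may therefore not depend on the old counter. -/
theorem Run.forTo (hc : Ctx B Z) {i r : ℕ} {body : Com} {σ : State} (hσ : Ty B σ) (n : ℕ)
    (hr : σ.reg r = n) (hnB : n ≤ B) (hnZ : n ≤ Z) (hi : i < 100) (hir : r ≠ i)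
    (hbi : body.wr i = false) (hbr : body.wr r = false) (Inv : ℕ → State → Prop)
    (h0 : Inv 0 (σ.setReg i 0))
    (hs : ∀ k < n, ∀ σ', Ty B σ' → Fr (TwoSided.forTo i r body) σ σ' → σ'.reg i = k → Inv k σ' →
      Run B Z body σ' fun σ'' => Inv (k + 1) (σ''.setReg i ((k + 1 : ℕ) : ℤ))) :
    Run B Z (TwoSided.forTo i r body) σ (Inv n) := by
  have hexp : regExp i = 1 := by simp [regExp, hi]
  refine Run.seq hc (Run.assign hc hσ (Q := fun σ' => σ' = σ.setReg i 0) 0 (by simp)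
    (by rw [abs_zero]; positivity) (fun _ => rfl)) ?_
  rintro σ₁ hσ₁ hF₁ rfl
  refine Run.mono (Run.loop hc hσ₁
    (fun k σ' => k ≤ n ∧ σ'.reg i = ((n - k : ℕ) : ℤ) ∧ Inv (n - k) σ')
    n hnZ ⟨le_rfl, by simp, by simpa using h0⟩ ?_) ?_
  · rintro k σ' hσ' hF ⟨hkn, hik, hI⟩ he
    have hr' : σ'.reg r = n := by
      rw [hF.reg r (by simp [Com.wr, hbr, hir]), setReg_reg, if_neg hir, hr]
    have hk : 0 < k := by
      by_contra hk
      obtain rfl : k = 0 := by omega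
      simp [hik, hr'] at he
    obtain ⟨k, rfl⟩ : ∃ k', k = k' + 1 := ⟨k - 1, by omega⟩
    refine ⟨k, rfl, ?_⟩
    have hFr : Fr (TwoSided.forTo i r body) σ σ' := by
      constructor
      · intro x hx
        simp only [TwoSided.forTo, Com.wr, Bool.or_eq_false_iff, beq_eq_false_iff_ne] at hx
        rw [hF.reg x (by simp [Com.wr, hx]), setReg_reg, if_neg hx.1]
      · intro a ha
        simp only [TwoSided.forTo, Com.wm, Bool.or_eq_false_iff] at ha
        rw [hF.mem a (by simp [Com.wm, ha])]
        rfl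
    refine Run.seq hc (hs (n - (k + 1)) (by omega) σ' hσ' hFr hik hI) fun σ'' hσ'' hF'' hI'' => ?_
    have h1 : n - (k + 1) + 1 = n - k := by omega
    rw [h1] at hI''
    have h2 : σ''.reg i = ((n - (k + 1) : ℕ) : ℤ) := by rw [hF''.reg i hbi, hik]
    refine Run.assign hc hσ'' ((n - k : ℕ) : ℤ) (by simp [h2]; omega) ?_ fun _ => ?_
    · rw [hexp, pow_one, abs_of_nonneg (by positivity)]
      exact_mod_cast (Nat.sub_le n k).trans hnB
    · exact ⟨by omega, by simp, hI''⟩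
  · rintro σ' hσ' hF ⟨he, k, hkn, hik, hI⟩
    have hr' : σ'.reg r = n := by
      rw [hF.reg r (by simp [Com.wr, hbr, hir]), setReg_reg, if_neg hir, hr]
    have : k = 0 := by
      by_contra hk
      simp [hik, hr'] at he
      omega
    subst this
    simpa using hI

end Run

/-! ### The subprograms -/

/-- Loads the scaled game: `D` in register 51, shifts in registers 63-66. -/
def fillProg : Com :=
  forTo 20 10 (forTo 21 1 (
    .store 1 (rg 20) (rg 21)
      -- The flag is a factor, so that `-∞` is stored with the value `0`, as the encoding of
      -- matrices requires.
      (.cell 0 (rg 20) (rg 21) * (rg 51 * .cell 20 (rg 20) (rg 21) - rg 63)) ;;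
    .store 1 (rg 10 + rg 20) (rg 21)
      (.cell 0 (rg 10 + rg 20) (rg 21) * (rg 51 * .cell 21 (rg 20) (rg 21) + rg 65)) ;;
    .store 3 (rg 20) (rg 21)
      (.cell 2 (rg 20) (rg 21) * (rg 51 * .cell 21 (rg 20) (rg 21) + rg 64)) ;;
    .store 3 (rg 10 + rg 20) (rg 21)
      (.cell 2 (rg 10 + rg 20) (rg 21) * (rg 51 * .cell 20 (rg 20) (rg 21) - rg 66))))

/-- The values stored for the nodes `i` and `m + i` of Max. -/
structure FillRow (m : ℕ) (σ σ' : State) (i j : ℕ) : Prop where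
  h1 : σ'.mem 1 i j = σ.mem 0 i j * (σ.reg 51 * σ.mem 20 i j - σ.reg 63)
  h2 : σ'.mem 1 (m + i) j = σ.mem 0 (m + i) j * (σ.reg 51 * σ.mem 21 i j + σ.reg 65)
  h3 : σ'.mem 3 i j = σ.mem 2 i j * (σ.reg 51 * σ.mem 21 i j + σ.reg 64)
  h4 : σ'.mem 3 (m + i) j = σ.mem 2 (m + i) j * (σ.reg 51 * σ.mem 20 i j - σ.reg 66)

section

variable {B Z : ℕ}

theorem run_fillProg (hc : Ctx B Z) {σ : State} (hσ : Ty B σ) {m n : ℕ} (hm : σ.reg 10 = m)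
    (hn : σ.reg 1 = n) (hmB : m ≤ B) (hnB : n ≤ B) (hmZ : m ≤ Z) (hnZ : n ≤ Z)
    (b1 : ∀ i < m, ∀ j < n, |σ.mem 0 i j * (σ.reg 51 * σ.mem 20 i j - σ.reg 63)| ≤ B)
    (b2 : ∀ i < m, ∀ j < n, |σ.mem 0 (m + i) j * (σ.reg 51 * σ.mem 21 i j + σ.reg 65)| ≤ B)
    (b3 : ∀ i < m, ∀ j < n, |σ.mem 2 i j * (σ.reg 51 * σ.mem 21 i j + σ.reg 64)| ≤ B)
    (b4 : ∀ i < m, ∀ j < n, |σ.mem 2 (m + i) j * (σ.reg 51 * σ.mem 20 i j - σ.reg 66)| ≤ B) :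
    Run B Z fillProg σ fun σ' => ∀ i < m, ∀ j < n, FillRow m σ σ' i j := by
  refine Run.forTo hc hσ m hm hmB hmZ (by norm_num) (by norm_num) rfl rfl
    (fun k σ' => ∀ i < k, ∀ j < n, FillRow m σ σ' i j) (fun i hi => by omega) ?_
  intro k hk σ₁ hσ₁ hF₁ hk₁ hI₁
  refine Run.mono (Run.forTo hc hσ₁ n ((hF₁.reg 1 rfl).trans hn) hnB hnZ (by norm_num)
    (by norm_num) rfl rfl
    (fun l σ' => (∀ i < k, ∀ j < n, FillRow m σ σ' i j) ∧ ∀ j < l, FillRow m σ σ' k j)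
    ⟨fun i hi j hj => ⟨(hI₁ i hi j hj).h1, (hI₁ i hi j hj).h2, (hI₁ i hi j hj).h3,
      (hI₁ i hi j hj).h4⟩, fun i hi => by omega⟩ ?_) ?_
  · intro l hl σ₂ hσ₂ hF₂ hl₂ hI₂
    have e20 : σ₂.reg 20 = k := (hF₂.reg 20 rfl).trans hk₁
    have e10 : σ₂.reg 10 = m := ((hF₂.reg 10 rfl).trans (hF₁.reg 10 rfl)).trans hm
    have e51 : σ₂.reg 51 = σ.reg 51 := (hF₂.reg 51 rfl).trans (hF₁.reg 51 rfl)
    have e63 : σ₂.reg 63 = σ.reg 63 := (hF₂.reg 63 rfl).trans (hF₁.reg 63 rfl)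
    have e64 : σ₂.reg 64 = σ.reg 64 := (hF₂.reg 64 rfl).trans (hF₁.reg 64 rfl)
    have e65 : σ₂.reg 65 = σ.reg 65 := (hF₂.reg 65 rfl).trans (hF₁.reg 65 rfl)
    have e66 : σ₂.reg 66 = σ.reg 66 := (hF₂.reg 66 rfl).trans (hF₁.reg 66 rfl)
    have m0 : σ₂.mem 0 = σ.mem 0 := (hF₂.mem 0 rfl).trans (hF₁.mem 0 rfl)
    have m2 : σ₂.mem 2 = σ.mem 2 := (hF₂.mem 2 rfl).trans (hF₁.mem 2 rfl)
    have m20 : σ₂.mem 20 = σ.mem 20 := (hF₂.mem 20 rfl).trans (hF₁.mem 20 rfl)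
    have m21 : σ₂.mem 21 = σ.mem 21 := (hF₂.mem 21 rfl).trans (hF₁.mem 21 rfl)
    refine Run.seq hc (Run.store hc hσ₂ (Q := (· = _)) _
      (by simp [e20, hl₂, e51, e63, m0, m20]; rfl) (by simpa [memExp] using b1 k hk l hl)
      (fun _ => rfl)) ?_
    rintro σ₃ hσ₃ - rfl
    refine Run.seq hc (Run.store hc hσ₃ (Q := (· = _)) _
      (by simp [e20, hl₂, e10, e51, e65, m0, m21]; rfl) (by simpa [memExp] using b2 k hk l hl)
      (fun _ => rfl)) ?_
    rintro σ₃ hσ₃ - rfl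
    refine Run.seq hc (Run.store hc hσ₃ (Q := (· = _)) _
      (by simp [e20, hl₂, e51, e64, m2, m21]; rfl) (by simpa [memExp] using b3 k hk l hl)
      (fun _ => rfl)) ?_
    rintro σ₃ hσ₃ - rfl
    refine Run.store hc hσ₃ _
      (by simp [e20, hl₂, e10, e51, e66, m2, m20]; rfl) (by simpa [memExp] using b4 k hk l hl)
      (fun _ => ?_)
    -- The four stores complete the cells of the pair `(k, l)` and leave those of all other pairs
    -- alone; `key` treats both parts of the invariant at once.
    refine (fun key : ∀ i ≤ k, ∀ j, (i < k ∨ j ≠ l → FillRow m σ σ₂ i j) →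
      FillRow m σ (State.setReg _ 21 ((l + 1 : ℕ) : ℤ)) i j =>
        ⟨fun i hi j hj => key i hi.le j (fun _ => hI₂.1 i hi j hj),
          fun j hj => key k le_rfl j (fun h => hI₂.2 j (by omega))⟩) fun i hi j h => ?_
    by_cases hij : i = k ∧ j = l
    · obtain ⟨rfl, rfl⟩ := hij
      constructor <;> simp [e20, hl₂, e10] <;> omega
    · have h := h (by omega)
      constructor
      · simp [e20, hl₂, e10]
        rw [if_neg (by omega), if_neg (by omega), h.h1]
      · simp [e20, hl₂, e10]
        rw [if_neg (by omega), if_neg (by omega), h.h2]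
      · simp [e20, hl₂, e10]
        rw [if_neg (by omega), if_neg (by omega), h.h3]
      · simp [e20, hl₂, e10]
        rw [if_neg (by omega), if_neg (by omega), h.h4]
  · rintro σ₂ - - ⟨h1, h2⟩ i hi j hj
    have h : FillRow m σ σ₂ i j := by
      rcases Nat.lt_or_ge i k with h | h
      · exact h1 i h j hj
      · obtain rfl : i = k := by omega
        exact h2 j hj
    exact ⟨h.h1, h.h2, h.h3, h.h4⟩

end

/-! ### Maxima of fractions and of rows -/

/-- The fraction `u / v` is the largest of the fractions `p k / q k` with `c k ≠ 0`, and `-1 / 0` if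
there are none. -/
structure MaxSpec (n : ℕ) (c p q : ℕ → ℤ) (u v : ℤ) : Prop where
  le : ∀ k < n, c k ≠ 0 → p k * v ≤ u * q k
  eq : (u = -1 ∧ v = 0 ∧ ∀ k < n, c k = 0) ∨ ∃ k < n, c k ≠ 0 ∧ u = p k ∧ v = q k

namespace MaxSpec

variable {n : ℕ} {c p q : ℕ → ℤ} {u v : ℤ}

theorem zero : MaxSpec 0 c p q (-1) 0 :=
  ⟨fun _ h => by omega, Or.inl ⟨rfl, rfl, fun _ h => by omega⟩⟩

theorem skip (h : MaxSpec n c p q u v) (hq : c n ≠ 0 → 0 < q n)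
    (h' : c n ≠ 0 → p n * v ≤ u * q n) :
    MaxSpec (n + 1) c p q u v := by
  refine ⟨fun k hk hck => ?_, ?_⟩
  · rcases Nat.lt_succ_iff_lt_or_eq.1 hk with hk | rfl
    · exact h.le k hk hck
    · exact h' hck
  · rcases h.eq with ⟨h1, h2, h3⟩ | ⟨k, hk, h1⟩
    · by_cases hcn : c n = 0
      · refine Or.inl ⟨h1, h2, fun k hk => ?_⟩
        rcases Nat.lt_succ_iff_lt_or_eq.1 hk with hk | rfl
        · exact h3 k hk
        · exact hcn
      -- The fraction `-1 / 0` acts as `-∞`: the comparison with it would read `0 ≤ -q n`, which is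
      -- impossible for positive `q n`.
      · have := h' hcn
        have := hq hcn
        simp only [h1, h2] at *
        omega
    · exact Or.inr ⟨k, by omega, h1⟩

theorem update (h : MaxSpec n c p q u v) (hq : ∀ k < n + 1, c k ≠ 0 → 0 < q k) (hcn : c n ≠ 0)
    (h' : u * q n < p n * v) : MaxSpec (n + 1) c p q (p n) (q n) := by
  refine ⟨fun k hk hck => ?_, Or.inr ⟨n, by omega, hcn, rfl, rfl⟩⟩
  rcases Nat.lt_succ_iff_lt_or_eq.1 hk with hk | rfl
  · have h1 := h.le k hk hck
    have h2 := hq k (by omega) hck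
    have h3 := hq n (by omega) hcn
    rcases h.eq with ⟨-, -, h0⟩ | ⟨l, hl, hcl, -, hv⟩
    · exact absurd (h0 k hk) hck
    · have hv0 : 0 < v := hv ▸ hq l (by omega) hcl
      refine le_of_mul_le_mul_right ?_ hv0
      nlinarith
  · exact le_rfl

/-- The maximum of integers. -/
theorem isGreatest (h : MaxSpec n c p (fun _ => 1) u v) (hv : v ≠ 0) :
    (∃ k < n, c k ≠ 0 ∧ u = p k) ∧ ∀ k < n, c k ≠ 0 → p k ≤ u := by
  rcases h.eq with ⟨-, h0, -⟩ | ⟨k, hk, hck, hu, rfl⟩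
  · exact absurd h0 hv
  · exact ⟨⟨k, hk, hck, hu⟩, fun l hl hcl => by simpa using h.le l hl hcl⟩

theorem ne_zero_iff (h : MaxSpec n c p q u v) (hq : ∀ k < n, c k ≠ 0 → 0 < q k) :
    v ≠ 0 ↔ ∃ k < n, c k ≠ 0 := by
  rcases h.eq with ⟨-, h0, h1⟩ | ⟨k, hk, hck, hu, rfl⟩
  · refine iff_of_false (by simp [h0]) ?_
    rintro ⟨k, hk, h2⟩
    exact h2 (h1 k hk)
  · exact iff_of_true (hq k hk hck).ne' ⟨k, hk, hck⟩

end MaxSpec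

/-- The largest of the fractions `p / q` with `c ≠ 0`, for the values of register `i` below the
value of register `r`, is written to registers `x` and `y`. -/
def maxLoop (i r x y : ℕ) (c p q : Expr) : Com :=
  .assign x (.const (-1)) ;; .assign y 0 ;;
    forTo i r (.ite c (.ite (.lt (rg x * q) (p * rg y)) (.assign x p ;; .assign y q) .skip) .skip)

section

variable {B Z : ℕ}

theorem run_maxLoop (hc : Ctx B Z) {σ : State} (hσ : Ty B σ) {i r x y : ℕ} {c p q : Expr} (n : ℕ)
    (hr : σ.reg r = n) (hnB : n ≤ B) (hnZ : n ≤ Z) (hi : i < 100) (hir : r ≠ i)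
    (hxy : x ≠ i ∧ x ≠ r ∧ y ≠ i ∧ y ≠ r ∧ x ≠ y) (cv pv qv : ℕ → ℤ)
    (hev : ∀ k < n, ∀ σ', Ty B σ' → Fr (maxLoop i r x y c p q) σ σ' → σ'.reg i = k →
      c.eval σ' = cv k ∧ p.eval σ' = pv k ∧ q.eval σ' = qv k)
    (hq : ∀ k < n, cv k ≠ 0 → 0 < qv k) (hdp : p.deg ≤ regExp x) (hdq : q.deg ≤ regExp y) :
    Run B Z (maxLoop i r x y c p q) σ fun σ' => MaxSpec n cv pv qv (σ'.reg x) (σ'.reg y) := by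
  obtain ⟨hxi, hxr, hyi, hyr, hxy⟩ := hxy
  have hFr : ∀ {σ₁ σ' : State}, Fr (.assign x (.const (-1)) ;; .assign y 0) σ σ₁ →
      Fr (TwoSided.forTo i r (.ite c (.ite (.lt (rg x * q) (p * rg y))
        (.assign x p ;; .assign y q) .skip) .skip)) σ₁ σ' → Fr (maxLoop i r x y c p q) σ σ' := by
    intro σ₁ σ' h1 h2
    constructor
    · intro z hz
      simp only [maxLoop, TwoSided.forTo, Com.wr, Bool.or_eq_false_iff, Bool.or_false] at hz
      rw [h2.reg z (by simp [TwoSided.forTo, Com.wr, hz]), h1.reg z (by simp [Com.wr, hz])]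
    · intro a ha
      rw [h2.mem a rfl, h1.mem a rfl]
  refine Run.seq hc (Run.assign hc hσ (Q := (· = _)) (-1) rfl
    (by simpa using one_le_pow_cast hc _) (fun _ => rfl)) ?_
  rintro σ₁ hσ₁ hF₁ rfl
  refine Run.seq hc (Run.assign hc hσ₁ (Q := (· = _)) 0 rfl
    (by rw [abs_zero]; positivity) (fun _ => rfl)) ?_
  rintro σ₁ hσ₁ hF₂ rfl
  have hF₁ := hF₁.seq_left (d := Com.assign y 0) |>.trans hF₂.seq_right
  refine Run.forTo hc hσ₁ n (by simp [hxr.symm, hyr.symm, hr]) hnB hnZ hi hir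
    (by simp [Com.wr, hxi.symm, hyi.symm]) (by simp [Com.wr, hxr.symm, hyr.symm])
    (fun k σ' => MaxSpec k cv pv qv (σ'.reg x) (σ'.reg y))
    (by simpa [hxi, hyi, hxy] using MaxSpec.zero) ?_
  intro k hk σ₂ hσ₂ hF hk₂ hI
  obtain ⟨e1, e2, e3⟩ := hev k hk σ₂ hσ₂ (hFr hF₁ hF) hk₂
  refine Run.ite hc hσ₂ (fun h => ?_) (fun h => Run.skip hc hσ₂ ?_)
  · rw [e1] at h
    refine Run.ite hc hσ₂ (fun h' => ?_) (fun h' => Run.skip hc hσ₂ ?_)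
    · have h' : σ₂.reg x * qv k < pv k * σ₂.reg y := by
        by_contra h0
        simp [e2, e3, h0] at h'
      refine Run.seq hc (Run.assignT hc hσ₂ (Q := (· = _)) _ e2 hdp (fun _ => rfl)) ?_
      rintro σ₃ hσ₃ hF₃ rfl
      have hFb : Fr (TwoSided.forTo i r (.ite c (.ite (.lt (rg x * q) (p * rg y))
          (.assign x p ;; .assign y q) .skip) .skip)) σ₂ (σ₂.setReg x (pv k)) := by
        refine ⟨fun z hz => ?_, fun a ha => rfl⟩
        simp only [TwoSided.forTo, Com.wr, Bool.or_eq_false_iff, Bool.or_false] at hz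
        rw [hF₃.reg z (by simp [Com.wr, hz])]
      -- The denominator is evaluated after register `x` has been overwritten; this is why `hev`
      -- covers all states that differ from the first one only in places the loop may change.
      obtain ⟨-, -, e3'⟩ := hev k hk _ hσ₃ (hFr hF₁ (hF.trans hFb)) (by simp [hxi.symm, hk₂])
      refine Run.assignT hc hσ₃ _ e3' hdq (fun _ => ?_)
      simpa [hxi, hyi, hxy] using hI.update (fun l hl => hq l (by omega)) h h'
    · have h' : pv k * σ₂.reg y ≤ σ₂.reg x * qv k := by
        by_contra h0
        simp [e2, e3, not_le.1 h0] at h'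
      simpa [hxi, hyi] using hI.skip (hq k hk) fun _ => h'
  · simpa [hxi, hyi] using hI.skip (hq k hk) fun h' => absurd (e1 ▸ h) h'

end

@[simp] theorem deg_one : (1 : Expr).deg = 1 := by
  change Nat.size 1 = 1
  simp

theorem Fr.weaken {c d : Com} {σ σ' : State} (h : Fr c σ σ')
    (h1 : ∀ x, d.wr x = false → c.wr x = false) (h2 : ∀ a, d.wm a = false → c.wm a = false) :
    Fr d σ σ' :=
  ⟨fun x hx => h.reg x (h1 x hx), fun a ha => h.mem a (h2 a ha)⟩

/-- `u` is the largest of the numbers `p k` with `c k ≠ 0`. -/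
structure IsMaxOf (n : ℕ) (c p : ℕ → ℤ) (u : ℤ) : Prop where
  ex : ∃ k < n, c k ≠ 0 ∧ u = p k
  le : ∀ k < n, c k ≠ 0 → p k ≤ u

theorem MaxSpec.isMaxOf {n : ℕ} {c p : ℕ → ℤ} {u v : ℤ} (h : MaxSpec n c p (fun _ => 1) u v)
    (hne : ∃ k < n, c k ≠ 0) : IsMaxOf n c p u :=
  have := h.isGreatest ((h.ne_zero_iff fun _ _ _ => one_pos).2 hne)
  ⟨this.1, this.2⟩

/-- Stores the negatives of the maxima of all rows in array `a`. -/
def negRowMax (i r k s a : ℕ) (c p : Expr) : Com :=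
  forTo i r (maxLoop k s 100 101 c p 1 ;; .store a (rg i) 0 (0 - rg 100))

section

variable {B Z : ℕ}

theorem run_negRowMax (hc : Ctx B Z) {σ : State} (hσ : Ty B σ) {i r k s a : ℕ} {c p : Expr}
    (R S : ℕ) (hr : σ.reg r = R) (hs : σ.reg s = S) (hRB : R ≤ B) (hRZ : R ≤ Z) (hSB : S ≤ B)
    (hSZ : S ≤ Z) (hik : i < 100 ∧ k < 100 ∧ r < 100 ∧ s < 100 ∧ r ≠ i ∧ s ≠ k ∧ i ≠ k ∧ r ≠ k ∧ s ≠ i)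
    (cv pv : ℕ → ℕ → ℤ)
    (hev : ∀ l < R, ∀ j < S, ∀ σ', Fr (negRowMax i r k s a c p) σ σ' → σ'.reg i = l →
      σ'.reg k = j → c.eval σ' = cv l j ∧ p.eval σ' = pv l j)
    (hne : ∀ l < R, ∃ j < S, cv l j ≠ 0)
    (hb : ∀ l < R, ∀ j < S, cv l j ≠ 0 → |pv l j| ≤ (B : ℤ) ^ memExp a) (hdp : p.deg ≤ 25) :
    Run B Z (negRowMax i r k s a c p) σ fun σ' =>
      ∀ l < R, IsMaxOf S (cv l) (pv l) (-σ'.mem a l 0) := by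
  obtain ⟨hi, hk, hr1, hs1, hri, hsk, hik, hrk, hsi⟩ := hik
  refine Run.forTo hc hσ R hr hRB hRZ hi hri (by simp [Com.wr, maxLoop, TwoSided.forTo]; omega)
    (by simp [Com.wr, maxLoop, TwoSided.forTo]; omega)
    (fun L σ' => ∀ l < L, IsMaxOf S (cv l) (pv l) (-σ'.mem a l 0)) (fun l hl => by omega) ?_
  intro L hL σ₁ hσ₁ hF₁ hL₁ hI
  refine Run.seq hc (run_maxLoop hc hσ₁ S (by rw [hF₁.reg s, hs]; simp [Com.wr, maxLoop, TwoSided.forTo]; omega)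
    hSB hSZ hk hsk (by omega) (cv L) (pv L) (fun _ => 1) ?_ (fun _ _ _ => one_pos)
    (by simpa [regExp] using hdp) (by simp [regExp])) ?_
  · intro j hj σ' hσ' hF hj'
    have hF' : Fr (negRowMax i r k s a c p) σ σ' := by
      refine hF₁.trans (hF.weaken (fun x hx => ?_) (fun x hx => ?_))
      · simp only [TwoSided.forTo, Com.wr, Bool.or_eq_false_iff] at hx
        exact hx.2.1.1
      · simp only [TwoSided.forTo, Com.wm, Bool.or_eq_false_iff] at hx
        exact hx.2.1.1
    have hi' : σ'.reg i = L := by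
      rw [hF.reg i, hL₁]
      simp [Com.wr, maxLoop, TwoSided.forTo]; omega
    exact ⟨(hev L hL j hj σ' hF' hi' hj').1, (hev L hL j hj σ' hF' hi' hj').2, rfl⟩
  · intro σ₂ hσ₂ hF₂ hM
    have hM := hM.isMaxOf (hne L hL)
    have hi₂ : σ₂.reg i = L := by
      rw [hF₂.reg i, hL₁]
      simp [Com.wr, maxLoop, TwoSided.forTo]; omega
    obtain ⟨j, hj, hcj, hu⟩ := hM.ex
    refine Run.store hc hσ₂ (-σ₂.reg 100) (by simp) ?_ fun _ => ?_
    · rw [hu, abs_neg]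
      exact hb L hL j hj hcj
    · intro l hl
      rcases Nat.lt_succ_iff_lt_or_eq.1 hl with hl | rfl
      · have : ¬ (l : ℤ) = L := by omega
        have hm : σ₂.mem = σ₁.mem := funext fun b => hF₂.mem b rfl
        simpa [hi₂, this, hm] using hI l hl
      · simpa [hi₂] using hM

end

/-! ### Value iteration -/

namespace RG

variable {I J : Type*} {g : RG I J}

theorem IsStep.unique {y z z' : J → ℝ} (h : g.IsStep y z) (h' : g.IsStep y z') : z = z' := by
  funext j
  have h1 := h.mono h' (c := 0) (fun j => by simp) j
  have h2 := h'.mono h (c := 0) (fun j => by simp) j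
  simp only [add_zero] at h1 h2
  exact le_antisymm h1 h2

theorem IsStep.abs_le (hg : g.Valid) {y z : J → ℝ} (h : g.IsStep y z) {W X : ℝ} (hW : g.PayLE 0 W)
    (hy : ∀ j, |y j| ≤ X) (j : J) : |z j| ≤ X + W := by
  obtain ⟨i, hi, h1⟩ := h.le j
  obtain ⟨k, hk⟩ := hg.f_total i
  obtain ⟨k', hk', h2⟩ := h.ge j i hi
  have a1 := _root_.abs_le.1 (hW j i k hi hk)
  have a2 := _root_.abs_le.1 (hW j i k' hi hk')
  have a3 := _root_.abs_le.1 (hy k)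
  have a4 := _root_.abs_le.1 (hy k')
  have := h1 k hk
  rw [_root_.abs_le]
  constructor <;> linarith

end RG

/-- One step of value iteration for the vector in array 30. -/
def viStep : Com :=
  -- Both halves of the Shapley operator are negated maxima: the first stores `-max_k (Q i k + x
  -- k)`, and the negated maximum of this plus `P i j` is `min_i (-P i j + max_k (Q i k + x k))`.
  negRowMax 20 0 22 1 31 (.cell 2 (rg 20) (rg 22)) (.cell 3 (rg 20) (rg 22) + .cell 30 (rg 22) 0) ;;
  negRowMax 21 1 22 0 30 (.cell 0 (rg 22) (rg 21)) (.cell 1 (rg 22) (rg 21) + .cell 31 (rg 22) 0)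

/-- Evaluates the loaded game by value iteration, with the horizon in register 42. -/
def viProg : Com :=
  forTo 21 1 (.store 30 (rg 21) 0 0) ;;
  forTo 23 42 viStep ;;
  maxLoop 21 1 100 101 1 (.cell 30 (rg 21) 0) 1 ;;
  -- With `S` in register 100 and the horizon `N` in register 42, the largest of the fractions `⌊S k
  -- / N⌋ / k`, `1 ≤ k ≤ n`, is the exact value.
  maxLoop 21 1 202 203 1 (rg 100 * (rg 21 + 1) / rg 42) (rg 21 + 1) ;;
  .assign 2 (rg 202) ;; .assign 3 (rg 203)

section

variable {B Z : ℕ}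

theorem run_viStep (hc : Ctx B Z) {σ : State} (hσ : Ty B σ) {G : Game} (hG : G.Valid)
    (hL : Loaded σ G) (hpB : G.rows ≤ B) (hpZ : G.rows ≤ Z) (hnB : G.cols ≤ B) (hnZ : G.cols ≤ Z)
    {W X : ℤ} (hWX : 2 * W + X ≤ B) (hW0 : 0 ≤ W) (hP : ∀ i j, |val (G.P i j)| ≤ W)
    (hQ : ∀ i j, |val (G.Q i j)| ≤ W) {x : Fin G.cols → ℤ} (hx : ∀ j : Fin G.cols, σ.mem 30 (j : ℕ) 0 = x j)
    (hX : ∀ j, |x j| ≤ X) :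
    Run B Z viStep σ fun σ' => ∃ x' : Fin G.cols → ℤ,
      (∀ j : Fin G.cols, σ'.mem 30 (j : ℕ) 0 = x' j) ∧
      G.rg.IsStep (fun j => (x j : ℝ)) (fun j => (x' j : ℝ)) := by
  have hval := hL.2.2
  refine Run.seq hc (run_negRowMax hc hσ G.rows G.cols hL.1 hL.2.1 hpB hpZ hnB hnZ (by norm_num)
    (fun i j => σ.mem 2 i j) (fun i j => σ.mem 3 i j + σ.mem 30 j 0) ?_ ?_ ?_ (by decide)) ?_
  · intro i hi j hj σ' hF e1 e2
    simp [e1, e2, hF.mem 2 rfl, hF.mem 3 rfl, hF.mem 30 rfl]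
  · intro i hi
    obtain ⟨j, hj⟩ := hG.2.2 ⟨i, hi⟩
    exact ⟨j, j.2, by rw [(hval ⟨i, hi⟩ j).2.2.1]; exact flag_ne_zero.2 hj⟩
  · intro i hi j hj _
    have h1 := hQ ⟨i, hi⟩ ⟨j, hj⟩
    have h2 := hX ⟨j, hj⟩
    rw [(hval ⟨i, hi⟩ ⟨j, hj⟩).2.2.2, hx ⟨j, hj⟩]
    refine (abs_add_le _ _).trans ?_
    simp only [memExp]
    norm_num
    linarith
  · intro σ₁ hσ₁ hF₁ hM₁
    have hv₁ : ∀ i : Fin G.rows, |σ₁.mem 31 (i : ℕ) 0| ≤ W + X := by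
      intro i
      obtain ⟨j, hj, -, h⟩ := (hM₁ i i.2).ex
      rw [← abs_neg, h, (hval i ⟨j, hj⟩).2.2.2, hx ⟨j, hj⟩]
      exact (abs_add_le _ _).trans (add_le_add (hQ _ _) (hX _))
    refine Run.mono (run_negRowMax hc hσ₁ G.cols G.rows ((hF₁.reg 1 rfl).trans hL.2.1)
      ((hF₁.reg 0 rfl).trans hL.1) hnB hnZ hpB hpZ (by norm_num)
      (fun j i => σ.mem 0 i j) (fun j i => σ.mem 1 i j + σ₁.mem 31 i 0) ?_ ?_ ?_ (by decide)) ?_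
    · intro j hj i hi σ' hF e1 e2
      simp [e1, e2, hF.mem 0 rfl, hF.mem 1 rfl, hF.mem 31 rfl, hF₁.mem 0 rfl, hF₁.mem 1 rfl]
    · intro j hj
      obtain ⟨i, hi⟩ := hG.2.1 ⟨j, hj⟩
      exact ⟨i, i.2, by rw [(hval i ⟨j, hj⟩).1]; exact flag_ne_zero.2 hi⟩
    · intro j hj i hi _
      have h1 := hP ⟨i, hi⟩ ⟨j, hj⟩
      have h2 := hv₁ ⟨i, hi⟩
      rw [(hval ⟨i, hi⟩ ⟨j, hj⟩).2.1]
      refine (abs_add_le _ _).trans ?_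
      simp only [memExp]
      norm_num
      simp only at h2
      linarith
    · intro σ₂ _ _ hM₂
      refine ⟨fun j => σ₂.mem 30 (j : ℕ) 0, fun j => rfl, fun j => ?_, fun j i he => ?_⟩
      · obtain ⟨i, hi, h1, h2⟩ := (hM₂ j j.2).ex
        rw [(hval ⟨i, hi⟩ j).1] at h1
        rw [(hval ⟨i, hi⟩ j).2.1] at h2
        refine ⟨⟨i, hi⟩, flag_ne_zero.1 h1, fun k hf => ?_⟩
        have h3 := (hM₁ i hi).le k k.2 (by rw [(hval ⟨i, hi⟩ k).2.2.1]; exact flag_ne_zero.2 hf)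
        rw [(hval ⟨i, hi⟩ k).2.2.2, hx k] at h3
        have : -val (G.P ⟨i, hi⟩ j) + val (G.Q ⟨i, hi⟩ k) + x k ≤ σ₂.mem 30 (j : ℕ) 0 := by
          linarith
        simp only [Game.rg, RG.w]
        exact_mod_cast this
      · obtain ⟨k, hk, h1, h2⟩ := (hM₁ i i.2).ex
        rw [(hval i ⟨k, hk⟩).2.2.1] at h1
        rw [(hval i ⟨k, hk⟩).2.2.2, hx ⟨k, hk⟩] at h2
        refine ⟨⟨k, hk⟩, flag_ne_zero.1 h1, ?_⟩
        have h3 := (hM₂ j j.2).le i i.2 (by rw [(hval i j).1]; exact flag_ne_zero.2 he)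
        rw [(hval i j).2.1] at h3
        have : σ₂.mem 30 (j : ℕ) 0 ≤ -val (G.P i j) + val (G.Q i ⟨k, hk⟩) + x ⟨k, hk⟩ := by
          linarith
        simp only [Game.rg, RG.w]
        exact_mod_cast this

/-- Payments differ from the value by at most `2 V`, so there is a potential between `0` and `2 V
n`, and the maximum after `N` steps lies between `N v` and `N v + 2 V n`. The assumption `2 V n³ <
N` makes the relative error less than `1 / n²`, as rounding needs. -/
theorem run_viProg (hc : Ctx B Z) {σ : State} (hσ : Ty B σ) {G : Game} (hG : G.Valid)
    (hL : Loaded σ G) (hpB : G.rows ≤ B) (hpZ : G.rows ≤ Z) (hnB : G.cols ≤ B) (hnZ : G.cols ≤ Z)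
    {W V N : ℕ} (hN : σ.reg 42 = N) (hNB : 2 * W + N * V ≤ B) (hNB' : N ≤ B) (hNZ : N ≤ Z)
    (hP : ∀ i j, |val (G.P i j)| ≤ (W : ℤ)) (hQ : ∀ i j, |val (G.Q i j)| ≤ (W : ℤ))
    (hV : G.rg.PayLE 0 V) (hVN : 2 * V * G.cols ^ 3 < N) :
    Run B Z viProg σ fun σ' => ∃ v : ℝ, G.rg.IsVal v ∧ 0 < σ'.reg 3 ∧ σ'.reg 3 ≤ G.cols ∧
      (σ'.reg 2 : ℝ) = v * σ'.reg 3 := by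
  have : Nonempty (Fin G.cols) := ⟨⟨0, hG.1⟩⟩
  obtain ⟨v, hv⟩ := RG.exists_isVal hG.rg
  choose T hT using RG.exists_step (g := G.rg) hG.rg
  let z : ℕ → Fin G.cols → ℝ := fun t => T^[t] 0
  have hz : ∀ t, G.rg.IsStep (z t) (z (t + 1)) := fun t => by
    simp only [z, Function.iterate_succ_apply']
    exact hT _
  have hzb : ∀ t j, |z t j| ≤ t * V := by
    intro t
    induction t with
    | zero => simp [z]
    | succ t ih =>
      intro j
      have := (hz t).abs_le hG.rg hV ih j
      push_cast
      linarith
  have hLF : ∀ {c : Com} {σ₁ : State}, Fr c σ σ₁ → c.wr 0 = false → c.wr 1 = false →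
      c.wm 0 = false → c.wm 1 = false → c.wm 2 = false → c.wm 3 = false → Loaded σ₁ G := by
    intro c σ₁ hF a1 a2 a3 a4 a5 a6
    refine ⟨by rw [hF.reg 0 a1, hL.1], by rw [hF.reg 1 a2, hL.2.1], ?_⟩
    rw [hF.mem 0 a3, hF.mem 1 a4, hF.mem 2 a5, hF.mem 3 a6]
    exact hL.2.2
  refine Run.seq hc (Run.forTo hc hσ G.cols hL.2.1 hnB hnZ (by norm_num) (by norm_num) rfl rfl
    (fun l σ' => ∀ j < l, σ'.mem 30 (j : ℕ) 0 = 0) (fun j hj => by omega) ?_) ?_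
  · intro l hl σ₁ hσ₁ hF₁ hl₁ hI
    refine Run.store hc hσ₁ 0 (by simp) (by rw [abs_zero]; positivity) fun _ j hj => ?_
    simp only [setReg_mem, setCell_mem, eval_reg, hl₁]
    split_ifs with h0
    · rfl
    · exact hI j (by simp at h0; omega)
  intro σ₁ hσ₁ hF₁ h0
  refine Run.seq hc (Run.forTo hc hσ₁ N ((hF₁.reg 42 rfl).trans hN) hNB' hNZ (by norm_num)
    (by norm_num) rfl rfl
    (fun t σ' => ∃ x : Fin G.cols → ℤ, (∀ j : Fin G.cols, σ'.mem 30 (j : ℕ) 0 = x j) ∧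
      z t = fun j => (x j : ℝ))
    ⟨0, fun j => h0 j j.2, by funext j; simp [z]⟩ ?_) ?_
  · rintro t ht σ₂ hσ₂ hF₂ - ⟨x, hx, hzx⟩
    have hX : ∀ j, |x j| ≤ ((t * V : ℕ) : ℤ) := fun j => by
      have := hzb t j
      simp only [hzx] at this
      exact_mod_cast this
    refine Run.mono (run_viStep hc hσ₂ hG (hLF (hF₁.seq_left.trans hF₂.seq_right) rfl rfl rfl rfl rfl rfl)
      hpB hpZ hnB hnZ (W := W) (X := (t * V : ℕ)) ?_ (by positivity) hP hQ hx hX) ?_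
    · have : t * V ≤ N * V := Nat.mul_le_mul_right _ ht.le
      exact_mod_cast (by omega : 2 * W + t * V ≤ B)
    · rintro σ₃ - - ⟨x', hx', hs⟩
      refine ⟨x', hx', (hz t).unique ?_⟩
      rw [hzx]
      exact hs
  rintro σ₂ hσ₂ hF₂ ⟨x, hx, hzx⟩
  have hF₂ := hF₁.seq_left.trans hF₂.seq_right
  refine Run.seq hc (run_maxLoop hc hσ₂ G.cols ((hF₂.reg 1 rfl).trans hL.2.1) hnB hnZ (by norm_num)
    (by norm_num) (by norm_num) (fun _ => 1) (fun j => σ₂.mem 30 j 0) (fun _ => 1) ?_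
    (fun _ _ _ => one_pos) (by decide) (by simp [regExp])) ?_
  · intro j hj σ' hσ' hF e1
    simp [e1, hF.mem 30 rfl]
  intro σ₃ hσ₃ hF₃ hM₃
  have hM₃ := hM₃.isMaxOf ⟨0, hG.1, one_ne_zero⟩
  have hF₃' := hF₂.seq_left.trans hF₃.seq_right
  set S := σ₃.reg 100 with hS
  refine Run.seq hc (run_maxLoop hc hσ₃ G.cols ((hF₃'.reg 1 rfl).trans hL.2.1) hnB hnZ (by norm_num)
    (by norm_num) (by norm_num) (fun _ => 1) (fun k => S * (k + 1 : ℕ) / N) (fun k => (k + 1 : ℕ)) ?_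
    (fun _ _ _ => by positivity) ?_ ?_) ?_
  · intro j hj σ' hσ' hF e1
    simp [e1, hF.reg 42 rfl, hF.reg 100 rfl, hF₃'.reg 42 rfl, hN, hS]
  · have : (rg 100 * (rg 21 + 1) / rg 42).deg = 25 + (1 + 1) := by
      change 25 + (max 1 (1 : Expr).deg + 1) = _
      simp
    rw [this]; simp [regExp]
  · have : (rg 21 + 1).deg = 1 + 1 := by
      change (max 1 (1 : Expr).deg + 1) = _
      simp
    rw [this]; simp [regExp]
  intro σ₄ hσ₄ hF₄ hM₄
  have hb : |v| ≤ V := hv.abs_le hG.rg hV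
  obtain ⟨y, hy⟩ := hv.up
  obtain ⟨y', hy', hyb⟩ := hy.exists_bounded hG.rg (W := 2 * V) (fun j i k he hf => by
    have h1 := abs_le.1 (hV j i k he hf)
    have h2 := abs_le.1 hb
    rw [abs_le]
    constructor <;> linarith) (by positivity)
  rw [Fintype.card_fin] at hyb
  have hit := hv.iterate hy' hyb rfl hz N
  have hS1 : (N : ℝ) * v ≤ S := by
    obtain ⟨j, hj⟩ := hit.2
    have h1 := hM₃.le j j.2 one_ne_zero
    rw [hx j] at h1
    simp only [hzx] at hj
    exact hj.trans (by exact_mod_cast h1)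
  have hS2 : (S : ℝ) ≤ N * v + G.cols * (2 * V) := by
    obtain ⟨j, hj, -, h1⟩ := hM₃.ex
    rw [h1, hx ⟨j, hj⟩]
    have := hit.1 ⟨j, hj⟩
    rwa [hzx] at this
  have hC : (G.cols * (2 * V) : ℝ) * (G.cols : ℝ) ^ 2 < N := by
    have : ((2 * V * G.cols ^ 3 : ℕ) : ℝ) < N := by exact_mod_cast hVN
    push_cast at this
    linarith
  have hN0 : 0 < N := by omega
  obtain ⟨q, hq, hqn⟩ := hG.exists_rat
  obtain rfl := hv.unique hq
  have hqd : ((q : ℝ)) * (q.den : ℕ) = q.num := by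
    exact_mod_cast Rat.mul_den_eq_num q
  have hfl := floor_mul_eq hqd q.pos hqn hS1 hS2 hC (by positivity) hN0
  rcases hM₄.eq with ⟨-, -, h0⟩ | ⟨l, hl, -, hp, hd⟩
  · exact absurd (h0 0 hG.1) one_ne_zero
  -- The index `k` of the loop stands for the denominator `k + 1`. The candidate with the true
  -- denominator equals the value and no candidate exceeds it, so the maximum is the value.
  have h1 := hM₄.le (q.den - 1) (by omega) one_ne_zero
  have hden : q.den - 1 + 1 = q.den := Nat.sub_add_cancel q.pos
  rw [hden, hfl, hp, hd] at h1
  have h2 := floor_mul_le hqd hqn hS2 hC (by positivity) (k := l + 1) (by omega) hN0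
  have h3 := le_antisymm h1 h2
  have h4 : (σ₄.reg 202 : ℝ) = q * σ₄.reg 203 := by
    have h3r : (q.num : ℝ) * (l + 1 : ℕ) = (σ₄.reg 202 : ℝ) * q.den := by
      rw [hp]
      exact_mod_cast h3
    rw [hd, ← hqd] at *
    have : (q.den : ℝ) ≠ 0 := by exact_mod_cast q.pos.ne'
    apply mul_right_cancel₀ this
    push_cast at *
    linarith
  refine Run.seq hc (Run.assign hc hσ₄ (Q := (· = _)) (σ₄.reg 202) (by simp) ?_ (fun _ => rfl)) ?_
  · have : |(σ₄.reg 202 : ℝ)| ≤ N := by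
      rw [h4, abs_mul]
      have h5 : |(σ₄.reg 203 : ℝ)| ≤ G.cols := by
        rw [hd, abs_of_nonneg (by positivity)]
        exact_mod_cast hl
      have h6 : (1 : ℝ) ≤ G.cols := by exact_mod_cast hG.1
      have h7 : (V * G.cols : ℝ) ≤ G.cols * (2 * V) * (G.cols : ℝ) ^ 2 := by
        have : (0 : ℝ) ≤ V * G.cols := by positivity
        nlinarith [mul_le_mul_of_nonneg_left (one_le_pow₀ h6 : (1 : ℝ) ≤ (G.cols : ℝ) ^ 2) this]
      calc _ ≤ (V : ℝ) * G.cols := by gcongr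
        _ ≤ _ := h7
        _ ≤ N := hC.le
    have : |σ₄.reg 202| ≤ (N : ℤ) := by exact_mod_cast this
    simp only [regExp]
    norm_num
    omega
  rintro σ₅ hσ₅ - rfl
  refine Run.assign hc hσ₅ (σ₄.reg 203) (by simp) ?_ (fun _ => ?_)
  · simp only [regExp, hd]
    norm_num
    rw [abs_of_nonneg (by positivity)]
    omega
  · refine ⟨q, hv, ?_⟩
    simp only [setReg_reg]
    norm_num
    exact ⟨by rw [hd]; positivity, by rw [hd]; exact_mod_cast hl, h4⟩

end

/-! ### Scanning the input -/

theorem load_loaded (G : Game) : Loaded (load G) G := by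
  refine ⟨rfl, rfl, fun i j => ⟨?_, ?_, ?_, ?_⟩⟩ <;> simp [load, table]

/-- The index of the row, and the two indices of columns, that a number encodes. -/
def tripleI : Expr := rg 20 / (rg 1 * rg 1)
def tripleJ : Expr := rg 20 / rg 1 - rg 20 / (rg 1 * rg 1) * rg 1
def tripleK : Expr := rg 20 - rg 20 / rg 1 * rg 1

/-- Computes the extreme differences and looks for infinite entries and columns. -/
def scanProg : Com :=
  .assign 24 (rg 0 * (rg 1 * rg 1)) ;;
  .assign 25 (rg 0 * rg 1) ;;
  maxLoop 20 24 108 109 (.cell 0 tripleI tripleJ * .cell 2 tripleI tripleK)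
    (.cell 1 tripleI tripleJ - .cell 3 tripleI tripleK) 1 ;;
  maxLoop 20 24 102 103 (.cell 0 tripleI tripleJ * .cell 2 tripleI tripleK)
    (.cell 3 tripleI tripleK - .cell 1 tripleI tripleJ) 1 ;;
  -- This is a search, not a maximum: the denominator in register 105 stays `0` unless some position
  -- has an infinite entry in one of the matrices.
  maxLoop 20 25 104 105 (1 - .cell 0 (rg 20 / rg 1) tripleK * .cell 2 (rg 20 / rg 1) tripleK) 0 1 ;;
  negRowMax 21 1 20 0 22 1 (.cell 0 (rg 20) (rg 21)) ;;
  negRowMax 21 1 20 0 23 1 (.cell 2 (rg 20) (rg 21)) ;;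
  -- Arrays 22 and 23 hold `-1` for a column with a finite entry and `0` for a column of `-∞`; the
  -- product is `1` exactly if both columns have a finite entry.
  maxLoop 21 1 106 107 (1 - .cell 22 (rg 21) 0 * .cell 23 (rg 21) 0) 0 1 ;;
  .assign 30 (rg 108) ;; .assign 31 (0 - rg 102) ;; .assign 33 (rg 105) ;; .assign 34 (rg 107)

section

variable {b Z : ℕ}

/-- The results of the scan. -/
structure Scanned (A B : Matrix (Fin m) (Fin n) (WithBot ℤ)) (σ : State) : Prop where
  r30 : σ.reg 30 = upperC A B
  r31 : σ.reg 31 = lowerC A B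
  r33 : σ.reg 33 = 0 ↔ AllFin A B
  r34 : σ.reg 34 = 0 ↔ ColsFin A B

theorem eval_triple {σ : State} {q : ℕ} (h20 : σ.reg 20 = q) (h1 : σ.reg 1 = n) :
    tripleI.eval σ = (q / (n * n) : ℕ) ∧ tripleJ.eval σ = (q / n % n : ℕ) ∧
      tripleK.eval σ = (q % n : ℕ) := by
  refine ⟨by simp [tripleI, h20, h1], ?_, ?_⟩
  · simp only [tripleJ, eval_sub, eval_div, eval_mul, eval_reg, h20, h1]
    have h := Nat.div_add_mod (q / n) n
    rw [Nat.div_div_eq_div_mul] at h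
    have h' : ((n * (q / (n * n)) + q / n % n : ℕ) : ℤ) = (q / n : ℕ) := by rw [h]
    push_cast at h' ⊢
    linarith
  · simp only [tripleK, eval_sub, eval_div, eval_mul, eval_reg, h20, h1]
    have h := Nat.div_add_mod q n
    have h' : ((n * (q / n) + q % n : ℕ) : ℤ) = q := by rw [h]
    push_cast at h' ⊢
    linarith

/-- The triple is encoded as `k + n (j + n i)`, so that a single loop replaces three nested ones. -/
theorem exists_triple_iff (hn : 0 < n) {p : ℕ → ℕ → ℕ → Prop} :
    (∃ q < m * (n * n), p (q / (n * n)) (q / n % n) (q % n)) ↔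
      ∃ (i : Fin m) (j k : Fin n), p i j k := by
  constructor
  · rintro ⟨q, hq, h⟩
    exact ⟨⟨_, (Nat.div_lt_iff_lt_mul (by positivity)).2 hq⟩, ⟨_, Nat.mod_lt _ hn⟩,
      ⟨_, Nat.mod_lt _ hn⟩, h⟩
  · rintro ⟨i, j, k, h⟩
    have h1 : (k + n * (j + n * i) : ℕ) / n = j + n * i := by
      rw [Nat.add_mul_div_left _ _ hn, Nat.div_eq_of_lt k.2, zero_add]
    have h2 : (k + n * (j + n * i) : ℕ) % n = k := by
      rw [Nat.add_mul_mod_self_left, Nat.mod_eq_of_lt k.2]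
    have h3 : (j + n * i : ℕ) / n = i := by
      rw [Nat.add_mul_div_left _ _ hn, Nat.div_eq_of_lt j.2, zero_add]
    have h4 : (j + n * i : ℕ) % n = j := by
      rw [Nat.add_mul_mod_self_left, Nat.mod_eq_of_lt j.2]
    refine ⟨k + n * (j + n * i), ?_, ?_⟩
    · rw [← Nat.div_lt_iff_lt_mul (by positivity), ← Nat.div_div_eq_div_mul, h1, h3]
      exact i.2
    · rw [← Nat.div_div_eq_div_mul, h1, h2, h3, h4]
      exact h

theorem exists_pair_iff (hn : 0 < n) {p : ℕ → ℕ → Prop} :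
    (∃ q < m * n, p (q / n) (q % n)) ↔ ∃ (i : Fin m) (j : Fin n), p i j := by
  constructor
  · rintro ⟨q, hq, h⟩
    exact ⟨⟨_, (Nat.div_lt_iff_lt_mul (by positivity)).2 hq⟩, ⟨_, Nat.mod_lt _ hn⟩, h⟩
  · rintro ⟨i, j, h⟩
    have h3 : (j + n * i : ℕ) / n = i := by
      rw [Nat.add_mul_div_left _ _ hn, Nat.div_eq_of_lt j.2, zero_add]
    have h4 : (j + n * i : ℕ) % n = j := by
      rw [Nat.add_mul_mod_self_left, Nat.mod_eq_of_lt j.2]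
    refine ⟨j + n * i, ?_, ?_⟩
    · rw [← Nat.div_lt_iff_lt_mul (by positivity), h3]
      exact i.2
    · rw [h3, h4]
      exact h

/-- The maximum of a function of a triple of indices. -/
theorem IsMaxOf.isGreatest_triple (hn : 0 < n) {c p : ℕ → ℕ → ℕ → ℤ} {u : ℤ}
    (h : IsMaxOf (m * (n * n)) (fun q => c (q / (n * n)) (q / n % n) (q % n))
      (fun q => p (q / (n * n)) (q / n % n) (q % n)) u) {S : Set ℤ}
    (hS : ∀ d, d ∈ S ↔ ∃ (i : Fin m) (j k : Fin n), c i j k ≠ 0 ∧ d = p i j k) :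
    IsGreatest S u := by
  refine ⟨(hS u).2
    ((exists_triple_iff hn (p := fun i j k => c i j k ≠ 0 ∧ u = p i j k)).1 h.ex), fun d hd => ?_⟩
  obtain ⟨i, j, k, hc, rfl⟩ := (hS d).1 hd
  obtain ⟨q, hq, h1, h2⟩ := (exists_triple_iff (m := m) hn
    (p := fun i' j' k' => c i' j' k' ≠ 0 ∧ p i' j' k' = p i j k)).2 ⟨i, j, k, hc, rfl⟩
  rw [← h2]
  exact h.le q hq h1

theorem run_scanProg (hc : Ctx b Z) (h : Admissible A B M) {σ : State} (hσ : Ty b σ)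
    (hL : Loaded σ ⟨m, n, A, B⟩) (hZ : (m + n) ^ 3 ≤ Z) (hb : (m + n) ^ 3 ≤ b) (hM : 2 * M ≤ b) :
    Run b Z scanProg σ (Scanned A B) := by
  have hn := h.cols_pos
  have hval := hL.2.2
  have h0 : σ.reg 0 = m := hL.1
  have h1 : σ.reg 1 = n := hL.2.1
  have s1 : m * (n * n) ≤ (m + n) ^ 3 := by nlinarith [Nat.zero_le (m * n), Nat.zero_le (m * (m * n)), Nat.zero_le (n * n * n), Nat.zero_le (m*m*m)]
  have s2 : m * n ≤ m * (n * n) := Nat.mul_le_mul_left _ (Nat.le_mul_of_pos_left _ hn)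
  have s3 : m ≤ m * n := Nat.le_mul_of_pos_right _ hn
  have s4 : n ≤ m * n := Nat.le_mul_of_pos_left _ h.rows_pos
  refine Run.seq hc (Run.assign hc hσ (Q := (· = _)) (m * (n * n) : ℕ) (by simp [h0, h1]) ?_ (fun _ => rfl)) ?_
  · simp only [regExp]
    norm_num only [if_true, pow_one, Nat.abs_cast]
    exact_mod_cast s1.trans hb
  rintro σ₁ hσ₁ hF₁ rfl
  refine Run.seq hc (Run.assign hc hσ₁ (Q := (· = _)) (m * n : ℕ) (by simp [h0, h1]) ?_ (fun _ => rfl)) ?_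
  · simp only [regExp]
    norm_num only [if_true, pow_one, Nat.abs_cast]
    exact_mod_cast (s2.trans s1).trans hb
  rintro σ₂ hσ₂ hF₂ rfl
  set σ₂ := (σ.setReg 24 ↑(m * (n * n))).setReg 25 ↑(m * n) with hσ2
  have hF₂ := hF₁.seq_left.trans hF₂.seq_right
  refine Run.seq hc (run_maxLoop hc hσ₂ (m * (n * n)) (by simp [hσ2]) (s1.trans hb) (s1.trans hZ)
    (by norm_num) (by norm_num) (by norm_num)
    (fun q => σ.mem 0 (q / (n * n) : ℕ) (q / n % n : ℕ) * σ.mem 2 (q / (n * n) : ℕ) (q % n : ℕ))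
    (fun q => σ.mem 1 (q / (n * n) : ℕ) (q / n % n : ℕ) - σ.mem 3 (q / (n * n) : ℕ) (q % n : ℕ))
    (fun _ => 1) ?_ (fun _ _ _ => one_pos) (by decide) (by simp [regExp])) ?_
  · intro q hq σ' hσ' hF hq'
    obtain ⟨e1, e2, e3⟩ := eval_triple hq' (((hF.reg 1 rfl).trans (hF₂.reg 1 rfl)).trans h1)
    simp [e1, e2, e3, hF.mem 0 rfl, hF.mem 1 rfl, hF.mem 2 rfl, hF.mem 3 rfl, hσ2]
  intro σ₃ hσ₃ hF₃ hM₃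
  have hF₃' := hF₂.seq_left.trans hF₃.seq_right
  refine Run.seq hc (run_maxLoop hc hσ₃ (m * (n * n)) (by rw [hF₃.reg 24 rfl]; simp [hσ2]) (s1.trans hb) (s1.trans hZ)
    (by norm_num) (by norm_num) (by norm_num)
    (fun q => σ.mem 0 (q / (n * n) : ℕ) (q / n % n : ℕ) * σ.mem 2 (q / (n * n) : ℕ) (q % n : ℕ))
    (fun q => σ.mem 3 (q / (n * n) : ℕ) (q % n : ℕ) - σ.mem 1 (q / (n * n) : ℕ) (q / n % n : ℕ))
    (fun _ => 1) ?_ (fun _ _ _ => one_pos) (by decide) (by simp [regExp])) ?_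
  · intro q hq σ' hσ' hF hq'
    obtain ⟨e1, e2, e3⟩ := eval_triple hq' (((hF.reg 1 rfl).trans (hF₃'.reg 1 rfl)).trans h1)
    simp [e1, e2, e3, hF.mem 0 rfl, hF.mem 1 rfl, hF.mem 2 rfl, hF.mem 3 rfl, hF₃'.mem 0 rfl,
      hF₃'.mem 1 rfl, hF₃'.mem 2 rfl, hF₃'.mem 3 rfl]
  intro σ₄ hσ₄ hF₄ hM₄
  have hF₄' := hF₃'.seq_left.trans hF₄.seq_right
  have t108 : σ₄.reg 108 = σ₃.reg 108 := hF₄.reg 108 rfl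
  have hex : ∃ q < m * (n * n), σ.mem 0 (q / (n * n) : ℕ) (q / n % n : ℕ) *
      σ.mem 2 (q / (n * n) : ℕ) (q % n : ℕ) ≠ 0 := by
    obtain ⟨j, hj⟩ := h.row_left ⟨0, h.rows_pos⟩
    obtain ⟨k, hk⟩ := h.row_right ⟨0, h.rows_pos⟩
    refine (exists_triple_iff hn (p := fun i j k => σ.mem 0 i j * σ.mem 2 i k ≠ 0)).2
      ⟨⟨0, h.rows_pos⟩, j, k, ?_⟩
    rw [(hval _ j).1, (hval _ k).2.2.1]
    exact mul_ne_zero (flag_ne_zero.2 hj) (flag_ne_zero.2 hk)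
  have hcond : ∀ (i : Fin m) (j k : Fin n), σ.mem 0 (i : ℕ) (j : ℕ) * σ.mem 2 (i : ℕ) (k : ℕ) ≠ 0 ↔
      A i j ≠ ⊥ ∧ B i k ≠ ⊥ := fun i j k => by
    rw [(hval i j).1, (hval i k).2.2.1, mul_ne_zero_iff, flag_ne_zero, flag_ne_zero]
  have hU : σ₃.reg 108 = upperC A B := by
    refine (IsMaxOf.isGreatest_triple hn (c := fun i j k => σ.mem 0 i j * σ.mem 2 i k)
      (p := fun i j k => σ.mem 1 i j - σ.mem 3 i k) (hM₃.isMaxOf hex) fun d => ?_).unique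
      h.isGreatest_upperC
    rw [mem_diffs_iff]
    refine exists_congr fun i => exists_congr fun j => exists_congr fun k => ?_
    rw [hcond i j k, (hval i j).2.1, (hval i k).2.2.2, and_assoc]
  have hLw : σ₄.reg 102 = -lowerC A B := by
    refine (IsMaxOf.isGreatest_triple hn (c := fun i j k => σ.mem 0 i j * σ.mem 2 i k)
      (p := fun i j k => σ.mem 3 i k - σ.mem 1 i j) (hM₄.isMaxOf hex) fun d => ?_).unique
      (h.upperC_swap ▸ h.swap.isGreatest_upperC)
    rw [← neg_neg d, neg_mem_diffs_swap, mem_diffs_iff]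
    refine exists_congr fun i => exists_congr fun j => exists_congr fun k => ?_
    rw [hcond i j k, (hval i j).2.1, (hval i k).2.2.2, and_assoc]
    refine and_congr_right fun _ => and_congr_right fun _ => ?_
    change _ ↔ - -d = val (B i k) - val (A i j)
    constructor <;> intro _ <;> linarith
  refine Run.seq hc (run_maxLoop hc hσ₄ (m * n) (by rw [hF₄.reg 25 rfl, hF₃.reg 25 rfl]; simp [hσ2])
    ((s2.trans s1).trans hb) ((s2.trans s1).trans hZ)
    (by norm_num) (by norm_num) (by norm_num)
    (fun q => 1 - σ.mem 0 (q / n : ℕ) (q % n : ℕ) * σ.mem 2 (q / n : ℕ) (q % n : ℕ))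
    (fun _ => 0) (fun _ => 1) ?_ (fun _ _ _ => one_pos) (by decide) (by simp [regExp])) ?_
  · intro q hq σ' hσ' hF hq'
    have e0 := ((hF.reg 1 rfl).trans (hF₄'.reg 1 rfl)).trans h1
    obtain ⟨e1, e2, e3⟩ := eval_triple hq' e0
    simp [e3, e0, hq', hF.mem 0 rfl, hF.mem 2 rfl, hF₄'.mem 0 rfl, hF₄'.mem 2 rfl]
  intro σ₅ hσ₅ hF₅ hM₅
  have hF₅' := hF₄'.seq_left.trans hF₅.seq_right
  have hone : ∀ a : ℤ, a = 0 ∨ a = 1 → |a| ≤ (b : ℤ) ^ memExp 22 := by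
    rintro a (rfl | rfl)
    · simp
    · simpa using one_le_pow_cast hc _
  refine Run.seq hc (run_negRowMax hc hσ₅ n m ((hF₅'.reg 1 rfl).trans h1) ((hF₅'.reg 0 rfl).trans h0)
    (s4.trans ((s2.trans s1).trans hb)) (s4.trans ((s2.trans s1).trans hZ))
    (s3.trans ((s2.trans s1).trans hb)) (s3.trans ((s2.trans s1).trans hZ)) (by norm_num)
    (fun _ _ => 1) (fun j i => σ.mem 0 i j) ?_ (fun _ _ => ⟨0, h.rows_pos, one_ne_zero⟩) ?_
    (by decide)) ?_
  · intro j hj i hi σ' hF e1 e2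
    simp [e1, e2, hF.mem 0 rfl, hF₅'.mem 0 rfl]
  · intro j hj i hi _
    rw [(hval ⟨i, hi⟩ ⟨j, hj⟩).1]
    exact hone _ (flag_cases _)
  intro σ₆ hσ₆ hF₆ hM₆
  have hF₆' := hF₅'.seq_left.trans hF₆.seq_right
  refine Run.seq hc (run_negRowMax hc hσ₆ n m ((hF₆'.reg 1 rfl).trans h1) ((hF₆'.reg 0 rfl).trans h0)
    (s4.trans ((s2.trans s1).trans hb)) (s4.trans ((s2.trans s1).trans hZ))
    (s3.trans ((s2.trans s1).trans hb)) (s3.trans ((s2.trans s1).trans hZ)) (by norm_num)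
    (fun _ _ => 1) (fun j i => σ.mem 2 i j) ?_ (fun _ _ => ⟨0, h.rows_pos, one_ne_zero⟩) ?_
    (by decide)) ?_
  · intro j hj i hi σ' hF e1 e2
    simp [e1, e2, hF.mem 2 rfl, hF₆'.mem 2 rfl]
  · intro j hj i hi _
    rw [(hval ⟨i, hi⟩ ⟨j, hj⟩).2.2.1]
    exact hone _ (flag_cases _)
  intro σ₇ hσ₇ hF₇ hM₇
  have hF₇' := hF₆'.seq_left.trans hF₇.seq_right
  refine Run.seq hc (run_maxLoop hc hσ₇ n ((hF₇'.reg 1 rfl).trans h1)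
    (s4.trans ((s2.trans s1).trans hb)) (s4.trans ((s2.trans s1).trans hZ))
    (by norm_num) (by norm_num) (by norm_num)
    (fun j => 1 - σ₆.mem 22 j 0 * σ₇.mem 23 j 0)
    (fun _ => 0) (fun _ => 1) ?_ (fun _ _ _ => one_pos) (by decide) (by simp [regExp])) ?_
  · intro q hq σ' hσ' hF hq'
    simp [hq', hF.mem 22 rfl, hF.mem 23 rfl, hF₇.mem 22 rfl]
  intro σ₈ hσ₈ hF₈ hM₈
  have hF₈' := hF₇.seq_left.trans hF₈.seq_right
  have t108 : σ₈.reg 108 = upperC A B := by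
    rw [hF₈'.reg 108 rfl, hF₆.reg 108 rfl, hF₅.reg 108 rfl, t108, hU]
  have t102 : σ₈.reg 102 = -lowerC A B := by
    rw [hF₈'.reg 102 rfl, hF₆.reg 102 rfl, hF₅.reg 102 rfl, hLw]
  have t105 : σ₈.reg 105 = 0 ↔ AllFin A B := by
    rw [hF₈'.reg 105 rfl, hF₆.reg 105 rfl, ← not_iff_not, ← Ne,
      hM₅.ne_zero_iff fun _ _ _ => one_pos,
      exists_pair_iff (m := m) hn (p := fun i j => 1 - σ.mem 0 i j * σ.mem 2 i j ≠ 0)]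
    constructor
    · rintro ⟨i, j, hij⟩ hfin
      rw [(hval i j).1, (hval i j).2.2.1, (flag_cases _).resolve_left (flag_ne_zero.2 (hfin.1 i j)),
        (flag_cases _).resolve_left (flag_ne_zero.2 (hfin.2 i j))] at hij
      exact hij rfl
    · intro hfin
      by_contra! hall
      refine hfin ⟨fun i j => ?_, fun i j => ?_⟩ <;>
      · have h2 := hall i j
        rw [(hval i j).1, (hval i j).2.2.1] at h2
        refine flag_ne_zero.1 fun h3 => ?_
        simp [h3] at h2
  have hcols : ∀ (C : Matrix (Fin m) (Fin n) (WithBot ℤ)) (f : ℕ → ℕ → ℤ) (u : ℕ → ℤ),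
      (∀ (i : Fin m) (j : Fin n), f i j = flag (C i j)) →
      (∀ j < n, IsMaxOf m (fun _ => 1) (fun i => f i j) (-u j)) → ∀ j : Fin n,
      (u j = 0 ∨ u j = -1) ∧ (u j = 0 ↔ ¬ ∃ i, C i j ≠ ⊥) := by
    intro C f u hf hu j
    obtain ⟨i, hi, -, h2⟩ := (hu j j.2).ex
    have h3 := fun i : Fin m => (hu j j.2).le i i.2 one_ne_zero
    rw [hf ⟨i, hi⟩ j] at h2
    constructor
    · rcases flag_cases (C ⟨i, hi⟩ j) with h4 | h4 <;> omega
    · constructor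
      · rintro h5 ⟨i', hi'⟩
        have h6 := h3 i'
        have h7 := (flag_cases _).resolve_left (flag_ne_zero.2 hi')
        simp only [hf, h7] at h6
        omega
      · intro h5
        push Not at h5
        rw [h5] at h2
        simpa [flag] using h2
  have hcA := hcols A (fun i j => σ.mem 0 i j) (fun j => σ₆.mem 22 j 0) (fun i j => (hval i j).1) hM₆
  have hcB := hcols B (fun i j => σ.mem 2 i j) (fun j => σ₇.mem 23 j 0)
    (fun i j => (hval i j).2.2.1) hM₇
  have t107 : σ₈.reg 107 = 0 ↔ ColsFin A B := by
    rw [← not_iff_not, ← Ne, hM₈.ne_zero_iff fun _ _ _ => one_pos]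
    constructor
    · rintro ⟨j, hj, hne⟩ hfin
      obtain ⟨a1, a2⟩ := hcA ⟨j, hj⟩
      obtain ⟨a3, a4⟩ := hcB ⟨j, hj⟩
      have a5 := a1.resolve_left fun h => a2.1 h (hfin.1 ⟨j, hj⟩)
      have a6 := a3.resolve_left fun h => a4.1 h (hfin.2 ⟨j, hj⟩)
      simp only at a5 a6
      simp [a5, a6] at hne
    · intro hfin
      by_contra! hall
      refine hfin ⟨fun j => ?_, fun j => ?_⟩
      · by_contra h2
        have h3 := (hcA j).2.2 h2
        have := hall j j.2
        simp [h3] at this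
      · by_contra h2
        have h3 := (hcB j).2.2 h2
        have := hall j j.2
        simp [h3] at this
  have hd : ∀ d : ℤ, d ∈ diffs A B → |d| ≤ (b : ℤ) := fun d hd =>
    (h.abs_diff_le hd).trans (by exact_mod_cast hM)
  have h01 : ∀ {q : ℕ → ℤ} {u v : ℤ} {k : ℕ}, MaxSpec k q (fun _ => 0) (fun _ => 1) u v →
      |v| ≤ (b : ℤ) := by
    intro q u v k hM
    have := one_le_pow_cast hc 1
    rcases hM.eq with ⟨-, h0, -⟩ | ⟨_, _, _, _, h0⟩ <;> simp [h0] at * <;> omega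
  refine Run.seq hc (Run.assign hc hσ₈ (Q := (· = _)) (upperC A B) (by simp [t108])
    (by simpa [regExp] using hd _ h.isGreatest_upperC.1) (fun _ => rfl)) ?_
  rintro σ₉ hσ₉ - rfl
  refine Run.seq hc (Run.assign hc hσ₉ (Q := (· = _)) (lowerC A B) (by simp [t102])
    (by simpa [regExp] using hd _ h.isLeast_lowerC.1) (fun _ => rfl)) ?_
  rintro σ₉ hσ₉ - rfl
  refine Run.seq hc (Run.assign hc hσ₉ (Q := (· = _)) (σ₈.reg 105) (by simp)
    ?_ (fun _ => rfl)) ?_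
  · rw [hF₈'.reg 105 rfl, hF₆.reg 105 rfl]
    simpa [regExp] using h01 hM₅
  rintro σ₉ hσ₉ - rfl
  refine Run.assign hc hσ₉ (σ₈.reg 107) (by simp) (by simpa [regExp] using h01 hM₈) (fun _ => ?_)
  exact ⟨by simp, by simp, by simpa using t105, by simpa using t107⟩

end

/-! ### Parameters and memory layout of the main loop -/

theorem Run.set {b Z : ℕ} (hc : Ctx b Z) {σ : State} (hσ : Ty b σ) {x : ℕ} {e : Expr} (v : ℤ)
    (hv : e.eval σ = v) (hb : |v| ≤ (b : ℤ) ^ regExp x) :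
    Run b Z (.assign x e) σ (· = σ.setReg x v) :=
  Run.assign hc hσ v hv hb fun _ => rfl

/-- The scale of the entries in the submitted games: `0` if all differences are equal. -/
noncomputable def scal (A B : Matrix (Fin m) (Fin n) (WithBot ℤ)) : ℤ :=
  if lowerC A B < upperC A B then 1 else 0

/-- The shift of the parameter in the submitted games. -/
noncomputable def ctr (A B : Matrix (Fin m) (Fin n) (WithBot ℤ)) : ℤ :=
  if lowerC A B < upperC A B then 0 else upperC A B

/-- A bound for the payments per turn in the submitted games. -/
noncomputable def payBound (A B : Matrix (Fin m) (Fin n) (WithBot ℤ)) : ℕ :=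
  kappa m n ^ 2 * ((scal A B * Delta A B).toNat * (1 + 2 * kappa m n ^ 2) + 1) + 1

/-- The horizon of value iteration. -/
noncomputable def horizon (A B : Matrix (Fin m) (Fin n) (WithBot ℤ)) : ℕ :=
  2 * payBound A B * n ^ 3 + 1

/-- Computes the parameters of the main loop. -/
def setupProg : Com :=
  .assign 10 (rg 0) ;;
  .ite (.lt (rg 0 + rg 0) (rg 1)) (.assign 35 (rg 0 + rg 0)) (.assign 35 (rg 1)) ;;
  .assign 36 (rg 35 * rg 35) ;;
  .ite (.lt (rg 30) (0 - rg 31)) (.assign 39 (0 - rg 31)) (.assign 39 (rg 30)) ;;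
  .ite (.lt (rg 31) (rg 30)) (.assign 40 1 ;; .assign 41 0) (.assign 40 0 ;; .assign 41 (rg 30)) ;;
  .assign 42 (2 * (rg 36 * (rg 40 * rg 39 * (1 + 2 * rg 36) + 1) + 1) * (rg 1 * rg 1 * rg 1) + 1) ;;
  -- The product is nonzero exactly if the differences are not all equal and some entry is infinite.
  .ite (rg 40 * rg 33)
    (.ite (rg 34) (.assign 44 (rg 36)) (.assign 44 (rg 35)) ;;
      .assign 37 (2 * (rg 39 * rg 44)) ;; .assign 38 (0 - 2 * (rg 39 * rg 44)))
    (.assign 37 (rg 30 + 1) ;; .assign 38 (rg 31 - 1))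

/-- Arranges the flags and the scaled values of the entries for the main loop. -/
def copyProg : Com :=
  forTo 20 10 (forTo 21 1 (
    .store 20 (rg 20) (rg 21) (rg 40 * .cell 1 (rg 20) (rg 21)) ;;
    .store 21 (rg 20) (rg 21) (rg 40 * .cell 3 (rg 20) (rg 21)) ;;
    -- In the stacked games, `P` is `A` above `B` and `Q` is `B` above `A`; hence the flags cross
    -- over in the lower halves.
    .store 0 (rg 10 + rg 20) (rg 21) (.cell 2 (rg 20) (rg 21)) ;;
    .store 2 (rg 10 + rg 20) (rg 21) (.cell 0 (rg 20) (rg 21)))) ;;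
  .assign 0 (rg 10 + rg 10)

section

variable {b Z : ℕ}

/-- The parameters of the main loop. -/
structure Params (A B : Matrix (Fin m) (Fin n) (WithBot ℤ)) (σ : State) : Prop where
  r1 : σ.reg 1 = n
  r10 : σ.reg 10 = m
  r35 : σ.reg 35 = kappa m n
  r36 : σ.reg 36 = (kappa m n ^ 2 : ℕ)
  r37 : σ.reg 37 = hiEnd A B
  r38 : σ.reg 38 = loEnd A B
  r40 : σ.reg 40 = scal A B
  r41 : σ.reg 41 = ctr A B
  r42 : σ.reg 42 = horizon A B

/-- The parameters, flags and scaled values during the main loop. -/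
structure Static (A B : Matrix (Fin m) (Fin n) (WithBot ℤ)) (σ : State) : Prop
    extends Params A B σ where
  r0 : σ.reg 0 = (2 * m : ℕ)
  a0 : ∀ i j, σ.mem 0 (i : Fin m).val (j : Fin n).val = flag (A i j)
  b0 : ∀ i j, σ.mem 0 (m + (i : Fin m).val) (j : Fin n).val = flag (B i j)
  b2 : ∀ i j, σ.mem 2 (i : Fin m).val (j : Fin n).val = flag (B i j)
  a2 : ∀ i j, σ.mem 2 (m + (i : Fin m).val) (j : Fin n).val = flag (A i j)
  a20 : ∀ i j, σ.mem 20 (i : Fin m).val (j : Fin n).val = scal A B * val (A i j)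
  b21 : ∀ i j, σ.mem 21 (i : Fin m).val (j : Fin n).val = scal A B * val (B i j)

theorem Params.congr {σ σ' : State} (h : Params A B σ) {c : Com} (hF : Fr c σ σ')
    (h1 : c.wr 1 = false) (h10 : c.wr 10 = false) (h35 : c.wr 35 = false) (h36 : c.wr 36 = false)
    (h37 : c.wr 37 = false) (h38 : c.wr 38 = false) (h40 : c.wr 40 = false)
    (h41 : c.wr 41 = false) (h42 : c.wr 42 = false) : Params A B σ' :=
  ⟨(hF.reg 1 h1).trans h.r1, (hF.reg 10 h10).trans h.r10, (hF.reg 35 h35).trans h.r35,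
    (hF.reg 36 h36).trans h.r36, (hF.reg 37 h37).trans h.r37, (hF.reg 38 h38).trans h.r38,
    (hF.reg 40 h40).trans h.r40, (hF.reg 41 h41).trans h.r41, (hF.reg 42 h42).trans h.r42⟩

theorem Static.congr {σ σ' : State} (h : Static A B σ) {c : Com} (hF : Fr c σ σ')
    (h1 : (∀ x ∈ [0, 1, 10, 35, 36, 37, 38, 40, 41, 42], c.wr x = false))
    (h2 : ∀ x ∈ [0, 2, 20, 21], c.wm x = false) : Static A B σ' where
  toParams := h.toParams.congr hF (h1 _ (by simp)) (h1 _ (by simp)) (h1 _ (by simp))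
    (h1 _ (by simp)) (h1 _ (by simp)) (h1 _ (by simp)) (h1 _ (by simp)) (h1 _ (by simp))
    (h1 _ (by simp))
  r0 := (hF.reg 0 (h1 _ (by simp))).trans h.r0
  a0 i j := by rw [hF.mem 0 (h2 _ (by simp))]; exact h.a0 i j
  b0 i j := by rw [hF.mem 0 (h2 _ (by simp))]; exact h.b0 i j
  a2 i j := by rw [hF.mem 2 (h2 _ (by simp))]; exact h.a2 i j
  b2 i j := by rw [hF.mem 2 (h2 _ (by simp))]; exact h.b2 i j
  a20 i j := by rw [hF.mem 20 (h2 _ (by simp))]; exact h.a20 i j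
  b21 i j := by rw [hF.mem 21 (h2 _ (by simp))]; exact h.b21 i j

/-! ### Bounds for the parameters -/

theorem two_mul_pow_le {P k l : ℕ} (hP : 2 ≤ P) (h : k < l) : 2 * P ^ k ≤ P ^ l :=
  calc 2 * P ^ k ≤ P * P ^ k := Nat.mul_le_mul_right _ hP
    _ = P ^ (k + 1) := (pow_succ' _ _).symm
    _ ≤ P ^ l := Nat.pow_le_pow_right (by omega) h

theorem add_le_pow {P a c k l : ℕ} (hP : 2 ≤ P) (ha : a ≤ P ^ k) (hc : c ≤ P ^ k) (h : k < l) :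
    a + c ≤ P ^ l :=
  (by omega : a + c ≤ 2 * P ^ k).trans (two_mul_pow_le hP h)

theorem mul_le_pow {P a c k l r : ℕ} (ha : a ≤ P ^ k) (hc : c ≤ P ^ l) (h : k + l = r) :
    a * c ≤ P ^ r := by
  rw [← h, pow_add]
  exact Nat.mul_le_mul ha hc

theorem kappa_le : kappa m n ≤ n := min_le_right _ _

namespace Admissible

theorem scal_cases (A B : Matrix (Fin m) (Fin n) (WithBot ℤ)) : scal A B = 0 ∨ scal A B = 1 := by
  simp only [scal]; split_ifs <;> simp

/-- One identity for both cases: either the scale is `1` and the shift `0`, or the scale is `0` and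
all differences equal the shift. -/
theorem scal_mul_eq (h : Admissible A B M) {d : ℤ} (hd : d ∈ diffs A B) :
    scal A B * d = d - ctr A B := by
  simp only [scal, ctr]
  split_ifs with h1
  · simp
  · rw [h.eq_of_le (not_lt.1 h1) d hd]; simp

theorem toNat_scal_delta_le (h : Admissible A B M) : (scal A B * Delta A B).toNat ≤ 2 * M := by
  have h1 := h.delta_le
  rcases scal_cases A B with h2 | h2 <;> rw [h2] <;> omega

theorem abs_hiEnd_le (h : Admissible A B M) : |hiEnd A B| ≤ 4 * (M * n ^ 2) + 1 := by
  have h1 := abs_le.1 (h.abs_diff_le h.isGreatest_upperC.1)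
  have h2 := h.delta_le
  have h3 := h.delta_nonneg
  have hn : (1 : ℤ) ≤ n := by exact_mod_cast h.cols_pos
  have hκ : (kappa m n : ℤ) ≤ n := by exact_mod_cast kappa_le
  have hκ0 : (0 : ℤ) ≤ kappa m n := by positivity
  have hn2 : (n : ℤ) ≤ n ^ 2 := by nlinarith
  have hM : (M : ℤ) ≤ M * n ^ 2 := by nlinarith [Int.natCast_nonneg M]
  have e1 : Delta A B * kappa m n ≤ 2 * M * n ^ 2 :=
    mul_le_mul h2 (hκ.trans hn2) hκ0 (by positivity)
  have e2 : Delta A B * (kappa m n : ℤ) ^ 2 ≤ 2 * M * n ^ 2 :=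
    mul_le_mul h2 (by gcongr) (by positivity) (by positivity)
  have e3 : 0 ≤ Delta A B * kappa m n := by positivity
  have e4 : 0 ≤ Delta A B * (kappa m n : ℤ) ^ 2 := by positivity
  rw [abs_le]
  simp only [hiEnd]
  split_ifs <;> constructor <;> linarith

theorem abs_loEnd_le (h : Admissible A B M) : |loEnd A B| ≤ 4 * (M * n ^ 2) + 1 := by
  have := h.swap.abs_hiEnd_le
  rwa [h.hiEnd_swap, abs_neg] at this

theorem payBound_le (h : Admissible A B M) {P : ℕ} (hP : m + n + M + 2 ≤ P) :
    payBound A B ≤ P ^ 10 := by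
  have h1 := h.toNat_scal_delta_le
  have h2 : kappa m n ≤ P := kappa_le.trans (by omega)
  have p2 : 2 ≤ P := by omega
  have e1 : kappa m n ^ 2 ≤ P ^ 2 := Nat.pow_le_pow_left h2 2
  have one : ∀ k, 1 ≤ P ^ k := fun k => Nat.one_le_pow _ _ (by omega)
  have e2 : 1 + 2 * kappa m n ^ 2 ≤ P ^ 4 :=
    add_le_pow p2 (one 3) (mul_le_pow (k := 1) (by simpa) e1 rfl) (by norm_num)
  have e3 : (scal A B * Delta A B).toNat ≤ P ^ 2 := by
    rw [sq]; refine h1.trans (Nat.mul_le_mul p2 (by omega))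
  exact add_le_pow p2 (mul_le_pow e1 (add_le_pow (l := 7) p2 (mul_le_pow e3 e2 rfl) (one 6)
    (by norm_num)) rfl) (one 9) (by norm_num)

theorem horizon_le (h : Admissible A B M) {P : ℕ} (hP : m + n + M + 2 ≤ P) :
    horizon A B ≤ P ^ 15 := by
  have h1 := h.payBound_le hP
  have p2 : 2 ≤ P := by omega
  have e1 : n ^ 3 ≤ P ^ 3 := Nat.pow_le_pow_left (by omega) 3
  exact add_le_pow (k := 14) p2 (mul_le_pow (k := 11) (mul_le_pow (k := 1) (by simpa) h1 rfl) e1 rfl)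
    (Nat.one_le_pow _ _ (by omega)) (by norm_num)

end Admissible

theorem run_setupProg (hc : Ctx b Z) (h : Admissible A B M) {σ : State} (hσ : Ty b σ)
    (h0 : σ.reg 0 = m) (h1 : σ.reg 1 = n) (hS : Scanned A B σ) (hb : (m + n + M + 2) ^ 20 ≤ b) :
    Run b Z setupProg σ (Params A B) := by
  set P := m + n + M + 2 with hP
  have p2 : 2 ≤ P := by omega
  have pw : ∀ {k l}, k ≤ l → P ^ k ≤ P ^ l := fun hkl => Nat.pow_le_pow_right (by omega) hkl
  have hPb : ∀ {k}, k ≤ 20 → ((P ^ k : ℕ) : ℤ) ≤ b := fun hk => by exact_mod_cast (pw hk).trans hb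
  have hκn := kappa_le (m := m) (n := n)
  have hΔ := h.delta_le
  have hΔ0 := h.delta_nonneg
  have hd : ∀ d : ℤ, d ∈ diffs A B → |d| ≤ (b : ℤ) := fun d hd => by
    have e1 := h.abs_diff_le hd
    have e2 : 2 * M ≤ P ^ 2 := by rw [sq]; exact Nat.mul_le_mul p2 (by omega)
    have e3 : ((2 * M : ℕ) : ℤ) ≤ (P ^ 2 : ℕ) := by exact_mod_cast e2
    have := hPb (k := 2) (by norm_num)
    push_cast at *
    linarith
  have hnat : ∀ {x k l : ℕ}, k ≤ P ^ l → l ≤ 20 → x < 100 → |(k : ℤ)| ≤ (b : ℤ) ^ regExp x := by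
    intro x k l hk hl hx
    simp only [regExp, if_pos hx, pow_one, Nat.abs_cast]
    exact (show (k : ℤ) ≤ (P ^ l : ℕ) by exact_mod_cast hk).trans (hPb hl)
  have hP1 : m ≤ P ^ 1 := by simp; omega
  have hκ2 : kappa m n ^ 2 ≤ P ^ 2 := Nat.pow_le_pow_left (by omega) 2
  refine Run.seq hc (Run.set hc hσ m (by simp [h0]) (hnat hP1 (by norm_num) (by norm_num))) ?_
  rintro σ₁ hσ₁ - rfl
  refine Run.seq hc (Q' := (· = (σ.setReg 10 m).setReg 35 (kappa m n))) ?_ ?_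
  · have hκb := hnat (x := 35) (show kappa m n ≤ P ^ 1 by simp; omega) (by norm_num) (by norm_num)
    refine Run.ite hc hσ₁ (fun hlt => ?_) (fun hlt => ?_) <;> simp [h0, h1] at hlt
    · refine Run.set hc hσ₁ _ ?_ hκb
      simp [h0, kappa]; omega
    · refine Run.set hc hσ₁ _ ?_ hκb
      simp [h1, kappa]; omega
  rintro σ₂ hσ₂ - rfl
  refine Run.seq hc (Run.set hc hσ₂ (kappa m n ^ 2 : ℕ) (by simp [sq])
    (hnat hκ2 (by norm_num) (by norm_num))) ?_
  rintro σ₃ hσ₃ - rfl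
  set σ₃ := ((σ.setReg 10 m).setReg 35 (kappa m n)).setReg 36 (kappa m n ^ 2 : ℕ) with hs3
  refine Run.seq hc (Q' := (· = σ₃.setReg 39 (Delta A B))) ?_ ?_
  · have hΔb : |Delta A B| ≤ (b : ℤ) ^ regExp 39 := by
      rw [h.delta_eq]
      simp only [regExp]
      norm_num only [if_true, pow_one]
      rcases max_choice (upperC A B) (-lowerC A B) with h2 | h2 <;> rw [h2]
      · exact hd _ h.isGreatest_upperC.1
      · rw [abs_neg]; exact hd _ h.isLeast_lowerC.1
    refine Run.ite hc hσ₃ (fun hlt => ?_) (fun hlt => ?_) <;> simp [hs3, hS.r30, hS.r31] at hlt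
    · refine Run.set hc hσ₃ _ ?_ hΔb
      simp [hs3, hS.r31, h.delta_eq]; omega
    · refine Run.set hc hσ₃ _ ?_ hΔb
      simp [hs3, hS.r30, h.delta_eq]; omega
  rintro σ₄ hσ₄ - rfl
  refine Run.seq hc (Q' := (· = ((σ₃.setReg 39 (Delta A B)).setReg 40 (scal A B)).setReg 41 (ctr A B))) ?_ ?_
  · refine Run.ite hc hσ₄ (fun hlt => ?_) (fun hlt => ?_) <;> simp [hs3, hS.r30, hS.r31] at hlt
    · refine Run.seq hc (Run.set hc hσ₄ (scal A B) (by simp [scal, hlt]) ?_) ?_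
      · simpa [scal, hlt] using one_le_pow_cast hc _
      rintro σ₅ hσ₅ - rfl
      exact Run.set hc hσ₅ _ (by simp [ctr, hlt]) (by simp [ctr, hlt])
    · have hlt := not_lt.2 hlt
      refine Run.seq hc (Run.set hc hσ₄ (scal A B) (by simp [scal, hlt]) ?_) ?_
      · simp [scal, hlt]
      rintro σ₅ hσ₅ - rfl
      refine Run.set hc hσ₅ _ (by simp [ctr, hlt, hs3, hS.r30]) ?_
      simpa [ctr, hlt, regExp] using hd _ h.isGreatest_upperC.1
  rintro σ₅ hσ₅ - rfl
  refine Run.seq hc (Run.set hc hσ₅ (horizon A B) ?_ (hnat (h.horizon_le le_rfl) (by norm_num) (by norm_num))) ?_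
  · have hpos : 0 ≤ scal A B * Delta A B := by
      rcases Admissible.scal_cases A B with h2 | h2 <;> rw [h2] <;> omega
    simp only [eval_add, eval_mul, eval_reg, eval_two, eval_one, setReg_reg, hs3, h1, horizon,
      payBound, Nat.reduceEqDiff, reduceIte]
    push_cast [Int.toNat_of_nonneg hpos]
    ring
  rintro σ₆ hσ₆ - rfl
  set σ₆ := (((σ₃.setReg 39 (Delta A B)).setReg 40 (scal A B)).setReg 41 (ctr A B)).setReg 42 (horizon A B) with hs6
  -- The program in this frame is never run; it only lists the registers that may still change.
  have hfin : ∀ σ', Fr (.assign 44 1 ;; .assign 37 1 ;; .assign 38 1) σ₆ σ' → σ'.reg 37 = hiEnd A B →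
      σ'.reg 38 = loEnd A B → Params A B σ' := by
    intro σ' hF e1 e2
    refine ⟨?_, ?_, ?_, ?_, e1, e2, ?_, ?_, ?_⟩
    · rw [hF.reg 1 rfl]; simp [hs6, hs3, h1]
    · rw [hF.reg 10 rfl]; simp [hs6, hs3]
    · rw [hF.reg 35 rfl]; simp [hs6, hs3]
    · rw [hF.reg 36 rfl]; simp [hs6, hs3]
    · rw [hF.reg 40 rfl]; simp [hs6]
    · rw [hF.reg 41 rfl]; simp [hs6]
    · rw [hF.reg 42 rfl]; simp [hs6]
  have hend : 4 * (M * n ^ 2) + 1 ≤ P ^ 6 := by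
    have e1 : M * n ^ 2 ≤ P ^ 3 := mul_le_pow (k := 1) (by simp; omega)
      (Nat.pow_le_pow_left (by omega) 2) rfl
    have e4 : 4 ≤ P ^ 2 := by nlinarith
    exact add_le_pow p2 (mul_le_pow e4 e1 rfl) (Nat.one_le_pow _ _ (by omega)) (by norm_num)
  have hendb : (4 * (M * n ^ 2) + 1 : ℤ) ≤ b := by
    have : ((4 * (M * n ^ 2) + 1 : ℕ) : ℤ) ≤ (P ^ 6 : ℕ) := by exact_mod_cast hend
    push_cast at this
    have h6 := hPb (k := 6) (by norm_num)
    push_cast at h6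
    linarith
  have hhi : |hiEnd A B| ≤ (b : ℤ) ^ regExp 37 := by simpa [regExp] using h.abs_hiEnd_le.trans hendb
  have hlo : |loEnd A B| ≤ (b : ℤ) ^ regExp 38 := by simpa [regExp] using h.abs_loEnd_le.trans hendb
  have d30 : σ₆.reg 30 = upperC A B := by simp [hs6, hs3, hS.r30]
  have d31 : σ₆.reg 31 = lowerC A B := by simp [hs6, hs3, hS.r31]
  have d33 : σ₆.reg 33 = 0 ↔ AllFin A B := by simpa [hs6, hs3] using hS.r33
  have d34 : σ₆.reg 34 = 0 ↔ ColsFin A B := by simpa [hs6, hs3] using hS.r34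
  have d35 : σ₆.reg 35 = kappa m n := by simp [hs6, hs3]
  have d36 : σ₆.reg 36 = (kappa m n ^ 2 : ℕ) := by simp [hs6, hs3]
  have d39 : σ₆.reg 39 = Delta A B := by simp [hs6]
  have d40 : σ₆.reg 40 = scal A B := by simp [hs6]
  refine Run.ite hc hσ₆ (fun hlt => ?_) (fun hlt => ?_)
  · simp only [eval_mul, eval_reg, d40, mul_ne_zero_iff, ne_eq, d33] at hlt
    obtain ⟨h2, h3⟩ := hlt
    have h2 : lowerC A B < upperC A B := by
      by_contra h4
      exact h2 (by simp [scal, h4])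
    have h4 : ¬ (upperC A B ≤ lowerC A B ∨ AllFin A B) := by
      rintro (h | h)
      · omega
      · exact h3 h
    classical
    refine Run.seq hc (Q' := (· = σ₆.setReg 44 (if ColsFin A B then kappa m n else (kappa m n ^ 2 : ℕ)))) ?_ ?_
    · refine Run.ite hc hσ₆ (fun h5 => ?_) (fun h5 => ?_) <;> simp only [eval_reg, ne_eq, d34] at h5
      · refine Run.set hc hσ₆ _ (by simp [h5, d36]) ?_
        rw [if_neg h5]
        exact hnat hκ2 (by norm_num) (by norm_num)
      · refine Run.set hc hσ₆ _ (by simp [h5, d35]) ?_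
        rw [if_pos h5]
        exact hnat (l := 1) (by simp; omega) (by norm_num) (by norm_num)
    rintro σ₇ hσ₇ hF₇ rfl
    refine Run.seq hc (Run.set hc hσ₇ (hiEnd A B) ?_ hhi) ?_
    · simp only [hiEnd, if_neg h4]
      split_ifs <;> simp [d39]
    rintro σ₈ hσ₈ - rfl
    refine Run.assign hc hσ₈ (loEnd A B) ?_ hlo (fun _ => ?_)
    · simp only [loEnd, if_neg h4]
      split_ifs <;> simp [d39]
    · refine hfin _ ⟨fun x hx => ?_, fun _ _ => rfl⟩ (by simp) (by simp)
      simp [Com.wr] at hx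
      simp [hx]
  · simp only [eval_mul, eval_reg, d40, mul_eq_zero, d33] at hlt
    have h4 : upperC A B ≤ lowerC A B ∨ AllFin A B := by
      refine hlt.imp_left fun h2 => ?_
      by_contra h4
      simp [scal, not_le.1 h4] at h2
    refine Run.seq hc (Run.set hc hσ₆ (hiEnd A B) (by simp [hiEnd, h4, d30]) hhi) ?_
    rintro σ₈ hσ₈ - rfl
    refine Run.assign hc hσ₈ (loEnd A B) (by simp [loEnd, h4, d31]) hlo (fun _ => ?_)
    refine hfin _ ⟨fun x hx => ?_, fun _ _ => rfl⟩ (by simp) (by simp)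
    simp [Com.wr] at hx
    simp [hx]

/-- The values stored for the rows `i` and `m + i`. -/
structure CopyRow (m : ℕ) (σ σ' : State) (i j : ℕ) : Prop where
  h20 : σ'.mem 20 i j = σ.reg 40 * σ.mem 1 i j
  h21 : σ'.mem 21 i j = σ.reg 40 * σ.mem 3 i j
  h0 : σ'.mem 0 (m + i) j = σ.mem 2 i j
  h2 : σ'.mem 2 (m + i) j = σ.mem 0 i j

theorem run_copyProg (hc : Ctx b Z) {σ : State} (hσ : Ty b σ)
    (hL : Loaded σ ⟨m, n, A, B⟩) (hp : Params A B σ) (hmb : 2 * m ≤ b) (hmZ : m ≤ Z) (hnb : n ≤ b)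
    (hnZ : n ≤ Z) : Run b Z copyProg σ (Static A B) := by
  have hsc : |σ.reg 40| ≤ 1 := by
    rw [hp.r40]
    rcases Admissible.scal_cases A B with h | h <;> simp [h]
  have hbd : ∀ {v : ℤ} {a : ℕ}, |v| ≤ (b : ℤ) ^ 1 → memExp a = 1 → |σ.reg 40 * v| ≤ (b : ℤ) ^ memExp a := by
    intro v a hv ha
    rw [ha, abs_mul]
    exact (mul_le_of_le_one_left (abs_nonneg _) hsc).trans hv
  refine Run.seq hc (Q' := fun σ' => (∀ i < m, ∀ j < n, CopyRow m σ σ' i j) ∧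
    ∀ i < m, ∀ j < n, σ'.mem 0 (i : ℕ) (j : ℕ) = σ.mem 0 i j ∧ σ'.mem 2 (i : ℕ) (j : ℕ) = σ.mem 2 i j) ?_ ?_
  · refine Run.mono (Run.forTo hc hσ m hp.r10 (by omega) hmZ (by norm_num) (by norm_num) rfl rfl
      (fun k σ' => (∀ i < k, ∀ j < n, CopyRow m σ σ' i j) ∧
        ∀ i < m, ∀ j < n, σ'.mem 0 (i : ℕ) (j : ℕ) = σ.mem 0 i j ∧ σ'.mem 2 (i : ℕ) (j : ℕ) = σ.mem 2 i j)
      ⟨fun i hi => by omega, fun i hi j hj => ⟨rfl, rfl⟩⟩ ?_) (fun _ _ _ h => h)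
    intro k hk σ₁ hσ₁ hF₁ hk₁ hI₁
    refine Run.mono (Run.forTo hc hσ₁ n ((hF₁.reg 1 rfl).trans hp.r1) hnb hnZ (by norm_num)
      (by norm_num) rfl rfl
      (fun l σ' => ((∀ i < k, ∀ j < n, CopyRow m σ σ' i j) ∧ ∀ j < l, CopyRow m σ σ' k j) ∧
        ∀ i < m, ∀ j < n, σ'.mem 0 (i : ℕ) (j : ℕ) = σ.mem 0 i j ∧ σ'.mem 2 (i : ℕ) (j : ℕ) = σ.mem 2 i j)
      ⟨⟨fun i hi j hj => ⟨(hI₁.1 i hi j hj).h20, (hI₁.1 i hi j hj).h21, (hI₁.1 i hi j hj).h0,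
        (hI₁.1 i hi j hj).h2⟩, fun i hi => by omega⟩, hI₁.2⟩ ?_) ?_
    · intro l hl σ₂ hσ₂ hF₂ hl₂ hI₂
      have e20 : σ₂.reg 20 = k := (hF₂.reg 20 rfl).trans hk₁
      have e10 : σ₂.reg 10 = m := ((hF₂.reg 10 rfl).trans (hF₁.reg 10 rfl)).trans hp.r10
      have e40 : σ₂.reg 40 = σ.reg 40 := (hF₂.reg 40 rfl).trans (hF₁.reg 40 rfl)
      have m1 : σ₂.mem 1 = σ.mem 1 := (hF₂.mem 1 rfl).trans (hF₁.mem 1 rfl)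
      have m3 : σ₂.mem 3 = σ.mem 3 := (hF₂.mem 3 rfl).trans (hF₁.mem 3 rfl)
      obtain ⟨q0, q2⟩ := hI₂.2 k hk l hl
      -- As `m` is positive, the row `m + k` of array 0 just written is not the row `k` that is
      -- still to be read.
      have hm : (0 : ℤ) < m := by omega
      refine Run.seq hc (Run.store hc hσ₂ (Q := (· = _)) (σ.reg 40 * σ.mem 1 k l)
        (by simp [e20, hl₂, e40, m1]) (hbd (hσ.mem 1 _ _) rfl) (fun _ => rfl)) ?_
      rintro σ₃ hσ₃ - rfl
      refine Run.seq hc (Run.store hc hσ₃ (Q := (· = _)) (σ.reg 40 * σ.mem 3 k l)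
        (by simp [e20, hl₂, e40, m3]) (hbd (hσ.mem 3 _ _) rfl) (fun _ => rfl)) ?_
      rintro σ₃ hσ₃ - rfl
      refine Run.seq hc (Run.store hc hσ₃ (Q := (· = _)) (σ.mem 2 k l)
        (by simp [e20, hl₂, q2]) (hσ.mem 2 _ _) (fun _ => rfl)) ?_
      rintro σ₃ hσ₃ - rfl
      refine Run.store hc hσ₃ (σ.mem 0 k l)
        (by simp [e20, hl₂, e10, q0]; omega) (hσ.mem 0 _ _) (fun _ => ?_)
      refine (fun (key : ∀ i ≤ k, ∀ j, (i < k ∨ j ≠ l → CopyRow m σ σ₂ i j) →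
        CopyRow m σ (State.setReg _ 21 ((l + 1 : ℕ) : ℤ)) i j) =>
          ⟨⟨fun i hi j hj => key i hi.le j (fun _ => hI₂.1.1 i hi j hj),
            fun j hj => key k le_rfl j (fun h => hI₂.1.2 j (by omega))⟩,
            fun i hi j hj => ?_⟩) fun i hi j h => ?_
      · by_cases hij : i = k ∧ j = l
        · obtain ⟨rfl, rfl⟩ := hij
          constructor <;> simp [e20, hl₂, e10]
        · have h := h (by omega)
          constructor
          · simp [e20, hl₂, e10]
            rw [if_neg (by omega), h.h20]
          · simp [e20, hl₂, e10]
            rw [if_neg (by omega), h.h21]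
          · simp [e20, hl₂, e10]
            rw [if_neg (by omega), h.h0]
          · simp [e20, hl₂, e10]
            rw [if_neg (by omega), h.h2]
      · obtain ⟨p0, p2⟩ := hI₂.2 i hi j hj
        constructor
        · simp [e20, hl₂, e10]
          rw [if_neg (by omega), p0]
        · simp [e20, hl₂, e10]
          rw [if_neg (by omega), p2]
    · rintro σ₂ - - ⟨⟨h1, h2⟩, h3⟩
      refine ⟨fun i hi j hj => ?_, h3⟩
      have h : CopyRow m σ σ₂ i j := by
        rcases Nat.lt_or_ge i k with h | h
        · exact h1 i h j hj
        · obtain rfl : i = k := by omega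
          exact h2 j hj
      exact ⟨h.h20, h.h21, h.h0, h.h2⟩
  · rintro σ₁ hσ₁ hF₁ ⟨h1, h2⟩
    have hp₁ := hp.congr hF₁ rfl rfl rfl rfl rfl rfl rfl rfl rfl
    refine Run.assign hc hσ₁ (2 * m : ℕ) (by simp [hp₁.r10, two_mul]) ?_ fun _ => ?_
    · simp only [regExp]
      norm_num only [if_true, pow_one, Nat.abs_cast]
      exact_mod_cast hmb
    · refine ⟨⟨by simpa using hp₁.r1, by simpa using hp₁.r10, by simpa using hp₁.r35,
        by simpa using hp₁.r36, by simpa using hp₁.r37, by simpa using hp₁.r38,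
        by simpa using hp₁.r40, by simpa using hp₁.r41, by simpa using hp₁.r42⟩, by simp,
        fun i j => ?_, fun i j => ?_, fun i j => ?_, fun i j => ?_, fun i j => ?_, fun i j => ?_⟩
      · exact (h2 i i.2 j j.2).1.trans (hL.2.2 i j).1
      · exact (h1 i i.2 j j.2).h0.trans (hL.2.2 i j).2.2.1
      · exact (h2 i i.2 j j.2).2.trans (hL.2.2 i j).2.2.1
      · exact (h1 i i.2 j j.2).h2.trans (hL.2.2 i j).1
      · refine (h1 i i.2 j j.2).h20.trans ?_
        rw [hp.r40, (hL.2.2 i j).2.1]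
      · refine (h1 i i.2 j j.2).h21.trans ?_
        rw [hp.r40, (hL.2.2 i j).2.2.2]

end

/-! ### The games of the sample points -/

/-- The game whose value yields the value of the spectral function at `N / (2 D)`. -/
noncomputable def gameAt (A B : Matrix (Fin m) (Fin n) (WithBot ℤ)) (N D : ℤ) : Game :=
  let X := N - 2 * D * ctr A B
  -- The shift is divided between left and right nodes, and within each half between `P` and `Q`; so
  -- each entry moves by about a quarter of `X`, and all four parts are integers.
  sampleGame A B (scal A B) D ((X - X / 2) / 2) ((X - X / 2) - (X - X / 2) / 2) (X / 2 / 2)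
    (X / 2 - X / 2 / 2)

/-- `N / (2 D)` is one of the points at which the spectral function is sampled. -/
structure Pt (A B : Matrix (Fin m) (Fin n) (WithBot ℤ)) (N : ℤ) (D : ℕ) : Prop where
  one_le : 1 ≤ D
  le : D ≤ kappa m n ^ 2
  lo : 2 * D * loEnd A B ≤ N
  hi : N ≤ 2 * D * hiEnd A B

section

variable {b Z : ℕ} {N : ℤ} {D : ℕ}

theorem gameAt_valid (h : Admissible A B M) : (gameAt A B N D).Valid := sampleGame_valid h

theorem gameAt_isVal (h : Admissible A B M) (hp : Pt A B N D) : (gameAt A B N D).rg.IsVal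
    (D * sval A B (N / (2 * D)) + (((N - 2 * D * ctr A B) - (N - 2 * D * ctr A B) / 2 : ℤ) -
      ((N - 2 * D * ctr A B) / 2 : ℤ)) / 2) := by
  have := sampleGame_isVal (x₁ := ((N - 2 * D * ctr A B) - (N - 2 * D * ctr A B) / 2) / 2)
    (x₂ := (N - 2 * D * ctr A B) - (N - 2 * D * ctr A B) / 2 -
      ((N - 2 * D * ctr A B) - (N - 2 * D * ctr A B) / 2) / 2)
    (y₁ := (N - 2 * D * ctr A B) / 2 / 2)
    (y₂ := (N - 2 * D * ctr A B) / 2 - (N - 2 * D * ctr A B) / 2 / 2) h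
    (fun d hd => h.scal_mul_eq hd) (by exact_mod_cast hp.one_le : (0 : ℤ) < (D : ℤ))
    (N := N) (by ring)
  refine Eq.mp (congrArg (gameAt A B N D).rg.IsVal ?_) this
  push_cast
  ring

theorem Admissible.abs_sub_ctr_le (h : Admissible A B M) :
    |hiEnd A B - ctr A B| ≤ scal A B * Delta A B * (2 * kappa m n ^ 2) + 1 ∧
    |loEnd A B - ctr A B| ≤ scal A B * Delta A B * (2 * kappa m n ^ 2) + 1 := by
  have h1 := abs_le.1 (h.abs_le_delta h.isGreatest_upperC.1)
  have h2 := abs_le.1 (h.abs_le_delta h.isLeast_lowerC.1)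
  have h3 := h.delta_nonneg
  have h4 := h.lowerC_le
  have hκ : (1 : ℤ) ≤ kappa m n := by exact_mod_cast h.kappa_pos
  have hκ2 : (kappa m n : ℤ) ≤ kappa m n ^ 2 := by nlinarith
  have e1 : Delta A B * kappa m n ≤ Delta A B * (kappa m n : ℤ) ^ 2 :=
    mul_le_mul_of_nonneg_left hκ2 h3
  have e2 : Delta A B ≤ Delta A B * kappa m n := le_mul_of_one_le_right h3 hκ
  by_cases hlt : lowerC A B < upperC A B
  · simp only [scal, ctr, hlt, hiEnd, loEnd, if_true, not_le.2 hlt, false_or, abs_le]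
    split_ifs <;> refine ⟨⟨?_, ?_⟩, ⟨?_, ?_⟩⟩ <;> linarith
  · simp only [scal, ctr, hlt, hiEnd, loEnd, if_false, not_lt.1 hlt, true_or, if_true, abs_le]
    refine ⟨⟨?_, ?_⟩, ⟨?_, ?_⟩⟩ <;> linarith

theorem Pt.abs_sub_le (h : Admissible A B M) (hp : Pt A B N D) :
    |N - 2 * D * ctr A B| ≤ 2 * D * (scal A B * Delta A B * (2 * kappa m n ^ 2) + 1) := by
  obtain ⟨h1, h2⟩ := h.abs_sub_ctr_le
  rw [abs_le] at h1 h2 ⊢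
  have := hp.lo
  have := hp.hi
  have : (0 : ℤ) ≤ D := by positivity
  constructor <;> nlinarith

theorem abs_half_le {X C : ℤ} (h : |X| ≤ 2 * C) : |X / 2| ≤ C ∧ |X - X / 2| ≤ C := by
  rw [abs_le] at *
  rw [abs_le]
  omega

theorem abs_half_le' {X C : ℤ} (h : |X| ≤ C) : |X / 2| ≤ C ∧ |X - X / 2| ≤ C :=
  abs_half_le (by have := abs_nonneg X; omega)

/-- A turn involves only differences of entries, so this bound depends on `Δ` and not on `M`; if the
scale is `0` it depends on `κ` alone. -/
theorem gameAt_payLE (h : Admissible A B M) (hp : Pt A B N D) :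
    (gameAt A B N D).rg.PayLE 0 (payBound A B) := by
  have hX := hp.abs_sub_le h
  rw [mul_assoc (2 : ℤ) (D : ℤ) (scal A B * Delta A B * (2 * kappa m n ^ 2) + 1)] at hX
  set X := N - 2 * D * ctr A B with hXd
  obtain ⟨hy, hx⟩ := abs_half_le hX
  have hΔ0 := h.delta_nonneg
  have hsΔ : 0 ≤ scal A B * Delta A B := by
    rcases Admissible.scal_cases A B with h2 | h2 <;> rw [h2] <;> omega
  have hD : (D : ℤ) ≤ (kappa m n : ℤ) ^ 2 := by exact_mod_cast hp.le
  have hbound : (D : ℤ) * (scal A B * Delta A B) +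
      D * (scal A B * Delta A B * (2 * kappa m n ^ 2) + 1) ≤ payBound A B := by
    simp only [payBound]
    push_cast [Int.toNat_of_nonneg hsΔ]
    have : (0 : ℤ) ≤ scal A B * Delta A B * (1 + 2 * kappa m n ^ 2) + 1 := by positivity
    have := mul_le_mul_of_nonneg_right hD this
    linarith
  have hd : ∀ d ∈ diffs A B, |(D : ℤ) * (scal A B * d)| ≤ D * (scal A B * Delta A B) := by
    intro d hd
    rw [abs_mul, abs_mul, Nat.abs_cast]
    have h1 := h.abs_le_delta hd
    have h2 : |scal A B| = scal A B := by
      rcases Admissible.scal_cases A B with h2 | h2 <;> simp [h2]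
    rw [h2]
    have : 0 ≤ scal A B := by rw [← h2]; exact abs_nonneg _
    gcongr
  suffices hs : ∀ (j : Fin n) (i : Fin m ⊕ Fin m) (k : Fin n),
      (gameAt A B N D).P (stackEquiv m i) j ≠ ⊥ → (gameAt A B N D).Q (stackEquiv m i) k ≠ ⊥ →
      |-val ((gameAt A B N D).P (stackEquiv m i) j) + val ((gameAt A B N D).Q (stackEquiv m i) k)| ≤
        (payBound A B : ℤ) by
    intro (j : Fin n) (i : Fin (2 * m)) (k : Fin n) he hf
    obtain ⟨i, rfl⟩ := (stackEquiv m).surjective i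
    have := hs j i k he hf
    simp only [RG.w, Game.rg, sub_zero]
    exact_mod_cast this
  rintro j (i | i) k he hf
  · change sampleP A B _ _ _ _ _ _ ≠ ⊥ at he
    change sampleQ A B _ _ _ _ _ _ ≠ ⊥ at hf
    change |-val (sampleP A B _ _ _ _ _ _) + val (sampleQ A B _ _ _ _ _ _)| ≤ _
    rw [sampleP_inl, map_ne_bot] at he
    rw [sampleQ_inl, map_ne_bot] at hf
    rw [sampleP_inl, sampleQ_inl, val_map he, val_map hf]
    have := hd _ (val_mem_diffs he hf)
    rw [abs_le] at this hx ⊢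
    constructor <;> linarith
  · change sampleP A B _ _ _ _ _ _ ≠ ⊥ at he
    change sampleQ A B _ _ _ _ _ _ ≠ ⊥ at hf
    change |-val (sampleP A B _ _ _ _ _ _) + val (sampleQ A B _ _ _ _ _ _)| ≤ _
    rw [sampleP_inr, map_ne_bot] at he
    rw [sampleQ_inr, map_ne_bot] at hf
    rw [sampleP_inr, sampleQ_inr, val_map he, val_map hf]
    have := hd _ (val_mem_diffs hf he)
    rw [abs_le] at this hy ⊢
    constructor <;> linarith

/-- Prepares the game for the point `N / (2 D)`, with `N` in register 50 and `D` in register 51. -/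
def prepProg : Com :=
  .assign 60 (rg 50 - 2 * rg 51 * rg 41) ;; .assign 61 (rg 60 / 2) ;;
  .assign 62 (rg 60 - rg 61) ;; .assign 63 (rg 62 / 2) ;; .assign 64 (rg 62 - rg 63) ;;
  .assign 65 (rg 61 / 2) ;; .assign 66 (rg 61 - rg 65) ;; fillProg

theorem Pt.abs_shift_le (h : Admissible A B M) (hp : Pt A B N D) {P : ℕ} (hP : m + n + M + 2 ≤ P) :
    |N - 2 * D * ctr A B| ≤ (P ^ 10 : ℕ) ∧ |N| ≤ (P ^ 12 : ℕ) := by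
  have p2 : 2 ≤ P := by omega
  have e1 : kappa m n ^ 2 ≤ P ^ 2 := Nat.pow_le_pow_left (kappa_le.trans (by omega)) 2
  have e2 : (scal A B * Delta A B).toNat ≤ P ^ 2 := by
    rw [sq]; exact h.toNat_scal_delta_le.trans (Nat.mul_le_mul p2 (by omega))
  have e3 : 2 * D * ((scal A B * Delta A B).toNat * (2 * kappa m n ^ 2) + 1) ≤ P ^ 10 := by
    refine mul_le_pow (k := 3) (l := 7) (mul_le_pow (k := 1) (by simpa) (hp.le.trans e1) rfl) ?_ rfl
    exact add_le_pow (k := 5) p2 (mul_le_pow e2 (mul_le_pow (k := 1) (by simpa) e1 rfl) rfl)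
      (Nat.one_le_pow _ _ (by omega)) (by norm_num)
  have hsΔ : 0 ≤ scal A B * Delta A B := by
    have := h.delta_nonneg
    rcases Admissible.scal_cases A B with h2 | h2 <;> rw [h2] <;> omega
  have h1 : |N - 2 * D * ctr A B| ≤ (P ^ 10 : ℕ) := by
    refine (hp.abs_sub_le h).trans ?_
    have e4 : ((2 * D * ((scal A B * Delta A B).toNat * (2 * kappa m n ^ 2) + 1) : ℕ) : ℤ) ≤
      (P ^ 10 : ℕ) := by exact_mod_cast e3
    push_cast [Int.toNat_of_nonneg hsΔ] at e4 ⊢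
    exact e4
  refine ⟨h1, ?_⟩
  have h2 : |(2 * D * ctr A B : ℤ)| ≤ (P ^ 10 : ℕ) := by
    have e5 : |ctr A B| ≤ (P ^ 2 : ℕ) := by
      simp only [ctr]
      split_ifs
      · simp
      · refine (h.abs_diff_le h.isGreatest_upperC.1).trans ?_
        have : 2 * M ≤ P ^ 2 := by rw [sq]; exact Nat.mul_le_mul p2 (by omega)
        exact_mod_cast this
    have e6 : 2 * D * P ^ 2 ≤ P ^ 10 :=
      (mul_le_pow (mul_le_pow (k := 1) (by simpa) (hp.le.trans e1) rfl) le_rfl rfl).trans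
        (Nat.pow_le_pow_right (by omega) (by norm_num))
    rw [abs_mul]
    calc _ ≤ |(2 * D : ℤ)| * (P ^ 2 : ℕ) := by gcongr
      _ = ((2 * D * P ^ 2 : ℕ) : ℤ) := by rw [abs_of_nonneg (by positivity)]; push_cast; ring
      _ ≤ _ := by exact_mod_cast e6
  have h3 : ((2 * P ^ 10 : ℕ) : ℤ) ≤ (P ^ 12 : ℕ) := by
    exact_mod_cast two_mul_pow_le p2 (by norm_num)
  have h4 := abs_add_le (N - 2 * D * ctr A B) (2 * D * ctr A B)
  rw [sub_add_cancel] at h4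
  push_cast at *
  linarith

theorem run_prepProg (hc : Ctx b Z) (h : Admissible A B M) {σ : State} (hσ : Ty b σ)
    (hS : Static A B σ) (hp : Pt A B N D) (hN : σ.reg 50 = N) (hD : σ.reg 51 = D)
    (hb : (m + n + M + 2) ^ 20 ≤ b) (hZ : m + n ≤ Z) :
    Run b Z prepProg σ fun σ' => Loaded σ' (gameAt A B N D) ∧
      σ'.reg 61 = (N - 2 * D * ctr A B) / 2 ∧
      σ'.reg 62 = (N - 2 * D * ctr A B) - (N - 2 * D * ctr A B) / 2 := by
  set P := m + n + M + 2 with hP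
  have p2 : 2 ≤ P := by omega
  have hPb : ∀ {k}, k ≤ 20 → P ^ k ≤ b := fun hk => (Nat.pow_le_pow_right (by omega) hk).trans hb
  obtain ⟨hX, -⟩ := hp.abs_shift_le h (P := P) le_rfl
  set X := N - 2 * D * ctr A B with hXd
  obtain ⟨hy, hx⟩ := abs_half_le' hX
  obtain ⟨hx1, hx2⟩ := abs_half_le' hx
  obtain ⟨hy1, hy2⟩ := abs_half_le' hy
  have hPb' : ∀ {v : ℤ} {x : ℕ}, |v| ≤ (P ^ 10 : ℕ) → x < 100 → |v| ≤ (b : ℤ) ^ regExp x := by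
    intro v x hv hx
    simp only [regExp, if_pos hx, pow_one]
    exact hv.trans (by exact_mod_cast hPb (by norm_num))
  refine Run.seq hc (Run.set hc hσ X (by simp [hN, hD, hS.r41, hXd]) (hPb' hX (by norm_num))) ?_
  rintro σ₁ hσ₁ - rfl
  refine Run.seq hc (Run.set hc hσ₁ (X / 2) (by simp) (hPb' hy (by norm_num))) ?_
  rintro σ₁ hσ₁ - rfl
  refine Run.seq hc (Run.set hc hσ₁ (X - X / 2) (by simp) (hPb' hx (by norm_num))) ?_
  rintro σ₁ hσ₁ - rfl
  refine Run.seq hc (Run.set hc hσ₁ ((X - X / 2) / 2) (by simp) (hPb' hx1 (by norm_num))) ?_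
  rintro σ₁ hσ₁ - rfl
  refine Run.seq hc (Run.set hc hσ₁ ((X - X / 2) - (X - X / 2) / 2) (by simp) (hPb' hx2 (by norm_num))) ?_
  rintro σ₁ hσ₁ - rfl
  refine Run.seq hc (Run.set hc hσ₁ (X / 2 / 2) (by simp) (hPb' hy1 (by norm_num))) ?_
  rintro σ₁ hσ₁ - rfl
  refine Run.seq hc (Run.set hc hσ₁ (X / 2 - X / 2 / 2) (by simp) (hPb' hy2 (by norm_num))) ?_
  rintro σ₁ hσ₁ - rfl
  generalize hs : (State.setReg _ 66 _) = σ₂ at hσ₁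
  have r63 : σ₂.reg 63 = (X - X / 2) / 2 := by simp [← hs]
  have r64 : σ₂.reg 64 = (X - X / 2) - (X - X / 2) / 2 := by simp [← hs]
  have r65 : σ₂.reg 65 = X / 2 / 2 := by simp [← hs]
  have r66 : σ₂.reg 66 = X / 2 - X / 2 / 2 := by simp [← hs]
  have r51 : σ₂.reg 51 = D := by simp [← hs, hD]
  have hm2 : σ₂.mem = σ.mem := by simp [← hs]
  have hmn : ∀ i < m, ∀ j < n, ∃ (i' : Fin m) (j' : Fin n), i = i'.val ∧ j = j'.val :=
    fun i hi j hj => ⟨⟨i, hi⟩, ⟨j, hj⟩, rfl, rfl⟩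
  have e1 : kappa m n ^ 2 ≤ P ^ 2 := Nat.pow_le_pow_left (kappa_le.trans (by omega)) 2
  have hent : ∀ {a v u : ℤ}, (a = 0 ∨ a = 1) → |v| ≤ M → |u| ≤ (P ^ 10 : ℕ) →
      |a * (D * (scal A B * v) - u)| ≤ b ∧ |a * (D * (scal A B * v) + u)| ≤ b := by
    intro a v u ha hv hu
    have h1 : |(D * (scal A B * v) : ℤ)| ≤ (P ^ 10 : ℕ) := by
      have h2 : |scal A B * v| ≤ M := by
        rcases Admissible.scal_cases A B with h2 | h2 <;> simp [h2, hv]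
      rw [abs_mul, Nat.abs_cast]
      have h3 : D * M ≤ P ^ 10 := (mul_le_pow (hp.le.trans e1) (l := 1) (by simp; omega) rfl).trans
        (Nat.pow_le_pow_right (by omega) (by norm_num))
      calc _ ≤ (D : ℤ) * M := by gcongr
        _ ≤ _ := by exact_mod_cast h3
    have h4 : ((2 * P ^ 10 : ℕ) : ℤ) ≤ b := by
      exact_mod_cast (two_mul_pow_le p2 (l := 11) (by norm_num)).trans (hPb (by norm_num))
    have h5 := abs_sub (D * (scal A B * v) : ℤ) u
    have h6 := abs_add_le (D * (scal A B * v) : ℤ) u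
    rcases ha with rfl | rfl
    · simp
    · rw [one_mul, one_mul]
      push_cast at *
      constructor <;> linarith
  refine Run.mono (run_fillProg hc hσ₁ (m := m) (n := n) (by simp [← hs, hS.r10]) (by simp [← hs, hS.r1])
    (le_trans (by simp; omega) (hPb (k := 1) (by norm_num)))
    (le_trans (by simp; omega) (hPb (k := 1) (by norm_num))) (by omega) (by omega) ?_ ?_ ?_ ?_) ?_
  · intro i hi j hj
    obtain ⟨i, j, rfl, rfl⟩ := hmn i hi j hj
    rw [hm2, hS.a0, hS.a20, r51, r63]
    exact (hent (flag_cases _) (h.bound_left.abs_val_le i j) hx1).1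
  · intro i hi j hj
    obtain ⟨i, j, rfl, rfl⟩ := hmn i hi j hj
    rw [hm2, hS.b0, hS.b21, r51, r65]
    exact (hent (flag_cases _) (h.bound_right.abs_val_le i j) hy1).2
  · intro i hi j hj
    obtain ⟨i, j, rfl, rfl⟩ := hmn i hi j hj
    rw [hm2, hS.b2, hS.b21, r51, r64]
    exact (hent (flag_cases _) (h.bound_right.abs_val_le i j) hx2).2
  · intro i hi j hj
    obtain ⟨i, j, rfl, rfl⟩ := hmn i hi j hj
    rw [hm2, hS.a2, hS.a20, r51, r66]
    exact (hent (flag_cases _) (h.bound_left.abs_val_le i j) hy2).1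
  · intro σ₃ hσ₃ hF hR
    refine ⟨⟨(hF.reg 0 rfl).trans (by simp [← hs, hS.r0, gameAt, sampleGame]),
      (hF.reg 1 rfl).trans (by simp [← hs, hS.r1, gameAt, sampleGame]), ?_⟩,
      (hF.reg 61 rfl).trans (by simp [← hs]), (hF.reg 62 rfl).trans (by simp [← hs])⟩
    intro (i : Fin (2 * m)) (j : Fin n)
    change _ = flag (sampleP A B _ _ _ _ i j) ∧ _ = val (sampleP A B _ _ _ _ i j) ∧
      _ = flag (sampleQ A B _ _ _ _ i j) ∧ _ = val (sampleQ A B _ _ _ _ i j)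
    obtain ⟨i, rfl⟩ := (stackEquiv m).surjective i
    rcases i with i | i
    · rw [sampleP_inl, sampleQ_inl, flag_map, flag_map, val_map_eq, val_map_eq, stackEquiv_inl]
      have hr := hR i i.2 j j.2
      refine ⟨?_, ?_, ?_, ?_⟩
      · rw [hF.mem 0 rfl, hm2, hS.a0]
      · rw [hr.h1, hm2, hS.a0, hS.a20, r51, r63]
      · rw [hF.mem 2 rfl, hm2, hS.b2]
      · rw [hr.h3, hm2, hS.b2, hS.b21, r51, r64]
    · rw [sampleP_inr, sampleQ_inr, flag_map, flag_map, val_map_eq, val_map_eq, stackEquiv_inr]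
      have hr := hR i i.2 j j.2
      push_cast
      refine ⟨?_, ?_, ?_, ?_⟩
      · rw [hF.mem 0 rfl, hm2, hS.b0]
      · rw [hr.h2, hm2, hS.b0, hS.b21, r51, r65]
      · rw [hF.mem 2 rfl, hm2, hS.a2]
      · rw [hr.h4, hm2, hS.a2, hS.a20, r51, r66]

end

/-! ### Evaluation of a sample by the oracle or by value iteration -/

section

variable {b Z : ℕ} {N : ℤ} {D : ℕ}

/-- Halving `X` twice bounds each of the four shifts by `C`, hence the assumption with `2 * (2 *
C)`. -/
theorem gameAt_hasSize (h : Admissible A B M) {C : ℤ} {W : ℕ}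
    (hX : |N - 2 * D * ctr A B| ≤ 2 * (2 * C)) (hW : D * M + C ≤ W) :
    (gameAt A B N D).HasSize (2 * m) n W := by
  obtain ⟨hy, hx⟩ := abs_half_le hX
  obtain ⟨hx1, hx2⟩ := abs_half_le hx
  obtain ⟨hy1, hy2⟩ := abs_half_le hy
  have hent : ∀ {v u : ℤ}, |v| ≤ M → |u| ≤ C →
      |(D * (scal A B * v) - u)| ≤ W ∧ |(D * (scal A B * v) + u)| ≤ W := by
    intro v u hv hu
    have h1 : |(D * (scal A B * v) : ℤ)| ≤ D * M := by
      have h2 : |scal A B * v| ≤ M := by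
        rcases Admissible.scal_cases A B with h2 | h2 <;> simp [h2, hv]
      rw [abs_mul, Nat.abs_cast]
      gcongr
    have h5 := abs_sub (D * (scal A B * v) : ℤ) u
    have h6 := abs_add_le (D * (scal A B * v) : ℤ) u
    constructor <;> linarith
  exact sampleGame_hasSize (fun i j _ => (hent (h.bound_left.abs_val_le i j) hx1).1)
    (fun i j _ => (hent (h.bound_right.abs_val_le i j) hy1).2)
    (fun i j _ => (hent (h.bound_right.abs_val_le i j) hx2).2)
    (fun i j _ => (hent (h.bound_left.abs_val_le i j) hy2).1)

/-- The value of the game for the point `N / (2 D)`. -/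
noncomputable def valAt (A B : Matrix (Fin m) (Fin n) (WithBot ℤ)) (N D : ℤ) : ℝ :=
  D * sval A B (N / (2 * D)) + (((N - 2 * D * ctr A B) - (N - 2 * D * ctr A B) / 2 : ℤ) -
      ((N - 2 * D * ctr A B) / 2 : ℤ)) / 2

theorem gameAt_isVal_valAt (h : Admissible A B M) (hp : Pt A B N D) :
    (gameAt A B N D).rg.IsVal (valAt A B N D) := by
  simpa only [valAt, Int.cast_natCast] using gameAt_isVal h hp

/-- The program `X` evaluates the games of the sample points; `L G` is the list of the oracle calls
for the game `G`. -/
def EvalSpec (b Z k : ℕ) (X : Com) (L : Game → List Game)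
    (A B : Matrix (Fin m) (Fin n) (WithBot ℤ)) : Prop :=
  ∀ (N : ℤ) (D : ℕ) (σ : State), Pt A B N D → Ty b σ → Static A B σ →
    Loaded σ (gameAt A B N D) → ∃ σ' t, Exec X σ σ' t (L (gameAt A B N D)) ∧ t ≤ k * Z ^ k ∧
      Ty b σ' ∧ Fr viProg σ σ' ∧ 0 < σ'.reg 3 ∧ σ'.reg 3 ≤ n ∧
      (σ'.reg 2 : ℝ) = valAt A B N D * σ'.reg 3

theorem evalSpec_viProg (hc : Ctx b Z) (h : Admissible A B M) (hb : (m + n + M + 2) ^ 30 ≤ b)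
    (hZ : 2 * m + n ≤ Z) (hH : horizon A B ≤ Z) :
    EvalSpec b Z viProg.kc viProg (fun _ => []) A B := by
  intro N D σ hp hσ hS hL
  set P := m + n + M + 2 with hP
  have p2 : 2 ≤ P := by omega
  have hPb : ∀ {k}, k ≤ 30 → P ^ k ≤ b := fun hk => (Nat.pow_le_pow_right (by omega) hk).trans hb
  have hP1 : 2 * m + n ≤ P ^ 2 := by nlinarith
  have hsize : (gameAt A B N D).HasSize (2 * m) n (P ^ 11) := by
    refine gameAt_hasSize h (C := (P ^ 10 : ℕ)) ?_ ?_
    · have := (hp.abs_shift_le h (P := P) le_rfl).1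
      linarith [abs_nonneg (N - 2 * D * ctr A B)]
    · have h1 : D * M ≤ P ^ 10 := (mul_le_pow (k := 2) (l := 1)
        (hp.le.trans (Nat.pow_le_pow_left (kappa_le.trans (by omega)) 2)) (by simp; omega) rfl).trans
        (Nat.pow_le_pow_right (by omega) (by norm_num))
      exact_mod_cast add_le_pow p2 h1 le_rfl (by norm_num)
  have hhor := h.horizon_le (P := P) le_rfl
  have hpay := h.payBound_le (P := P) le_rfl
  have hNB : 2 * P ^ 11 + horizon A B * payBound A B ≤ b :=
    (add_le_pow (k := 25) (l := 26) p2 (two_mul_pow_le p2 (by norm_num)) (mul_le_pow hhor hpay rfl)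
      (by norm_num)).trans (hPb (by norm_num))
  obtain ⟨σ', t, h1, h2, h3, v, h4, h5, h6, h7⟩ := run_viProg hc hσ (gameAt_valid h) hL
    (show 2 * m ≤ b by have := hPb (k := 2) (by norm_num); omega) (show 2 * m ≤ Z by omega)
    (show n ≤ b by have := hPb (k := 2) (by norm_num); omega) (show n ≤ Z by omega)
    (W := P ^ 11) (V := payBound A B) hS.r42 hNB (hhor.trans (hPb (by norm_num))) hH
    (fun i j => hsize.2.2.1.abs_val_le i j) (fun i j => hsize.2.2.2.abs_val_le i j)
    (gameAt_payLE h hp) (Nat.lt_succ_self _)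
  obtain rfl := h4.unique (gameAt_isVal_valAt h hp)
  exact ⟨σ', t, h1, h2, h3, h1.fr, h5, h6, h7⟩

/-- The oracle is consulted only if the differences are not all equal. Otherwise, the call bounds
may be `0`, but the scaled entries vanish and the horizon is polynomial in `m` and `n`, so value
iteration is cheap. -/
theorem evalSpec_call (hc : Ctx b Z) (h : Admissible A B M) (hb : (m + n + M + 2) ^ 30 ≤ b)
    (hZ : 2 * m + n ≤ Z) (hH : scal A B = 0 → horizon A B ≤ Z) :
    EvalSpec b Z (Com.ite (rg 40) .call viProg).kc (.ite (rg 40) .call viProg)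
      (fun G => if scal A B = 0 then [] else [G]) A B := by
  intro N D σ hp hσ hS hL
  have hcost := cost_le hc hσ (rg 40)
  have hkc : (Com.ite (rg 40) .call viProg).kc = (rg 40).wt + 1 + (1 + viProg.kc) := rfl
  have hpow := mul_pow_add_le (k := (rg 40).wt + 1) (l := 1 + viProg.kc) hc.one_le
  have hpow1 := le_mul_pow (a := (rg 40).wt) hc.one_le le_rfl
  have hpow2 := mul_pow_add_le (k := 1) (l := viProg.kc) hc.one_le
  have hZ1 := hc.one_le
  by_cases hs : scal A B = 0
  · obtain ⟨σ', t, h1, h2, h3, h4, h5⟩ := evalSpec_viProg hc h hb hZ (hH hs) N D σ hp hσ hS hL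
    beta_reduce
    rw [if_pos hs]
    refine ⟨σ', _, .ite_false (by simp [hS.r40, hs]) h1, ?_, h3, h4, h5⟩
    rw [hkc]
    omega
  · beta_reduce
    rw [if_neg hs]
    have hG := gameAt_valid (N := N) (D := D) h
    have hval := gameAt_isVal_valAt h hp
    obtain ⟨q, hq, hqn⟩ := hG.exists_rat
    have hqv := hq.unique hval
    have hqb : |(q : ℝ)| ≤ payBound A B := by
      have : Nonempty (Fin (gameAt A B N D).cols) := h.nonempty
      exact hq.abs_le hG.rg (gameAt_payLE h hp)
    have hmul : ((q : ℝ)) * (q.den : ℕ) = q.num := by exact_mod_cast Rat.mul_den_eq_num q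
    have hqn : q.den ≤ n := hqn
    set P := m + n + M + 2 with hP
    have hPb : ∀ {k}, k ≤ 30 → P ^ k ≤ b := fun hk => (Nat.pow_le_pow_right (by omega) hk).trans hb
    have hpay := h.payBound_le (P := P) le_rfl
    have hnum : |q.num| ≤ (b : ℤ) ^ regExp 2 := by
      have h1 : |(q.num : ℝ)| ≤ payBound A B * n := by
        rw [← hmul, abs_mul, Nat.abs_cast]
        gcongr
      have h2 : payBound A B * n ≤ b := (mul_le_pow (l := 1) hpay (by simp; omega) rfl).trans
        (hPb (by norm_num))
      simp only [regExp]
      norm_num only [if_true, pow_one]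
      have h3 : |(q.num : ℝ)| ≤ b := h1.trans (by exact_mod_cast h2)
      exact_mod_cast h3
    have hden : |(q.den : ℤ)| ≤ (b : ℤ) ^ regExp 3 := by
      simp only [regExp]
      norm_num only [if_true, pow_one]
      rw [Nat.abs_cast]
      have := hPb (k := 1) (by norm_num)
      rw [pow_one] at this
      exact_mod_cast (by omega : q.den ≤ b)
    refine ⟨_, _, .ite_true (by simpa [hS.r40] using hs) (.call hG hL (Game.value_eq hG hq)), ?_,
      (hσ.setReg hnum).setReg hden, ⟨fun x hx => ?_, fun _ _ => rfl⟩, ?_, ?_, ?_⟩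
    · rw [hkc]
      have : 1 ≤ (1 + viProg.kc) * Z ^ (1 + viProg.kc) := Nat.mul_pos (by omega) (Nat.pow_pos hZ1)
      omega
    · have h2 : x ≠ 2 := by rintro rfl; exact absurd hx (by decide)
      have h3 : x ≠ 3 := by rintro rfl; exact absurd hx (by decide)
      simp [h2, h3]
    · simpa using q.pos
    · simpa using hqn
    · simp only [setReg_reg]
      norm_num
      rw [← hqv, hmul]

end

/-! ### Output of the affine pieces -/

/-- Appends the affine piece that ends at the current point, unless it continues the last one. -/
def emitPiece : Com :=
  .ite (rg 58) .skip (
    -- The current sample is `(N, D, p, q)` in registers 50, 51, 67, 68, the previous one is in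
    -- registers 52 to 55. Registers 100 and 101 receive the slope of the line through both, as a
    -- fraction.
    .assign 100 ((rg 67 * rg 55 - rg 54 * rg 68) * (2 * rg 51) * (2 * rg 53)) ;;
    .assign 101 (rg 68 * rg 55 * (rg 50 * (2 * rg 53) - rg 52 * (2 * rg 51))) ;;
    -- Slopes are compared by cross-multiplication. If they agree, continuity makes the offsets
    -- agree as well, and the last piece simply goes on.
    .ite (.eq (.cell 6 (rg 4) 0 * rg 101) (rg 100 * .cell 7 (rg 4) 0)) .skip (
      .assign 200 (rg 67 * rg 101 * (2 * rg 51) - rg 100 * rg 50 * rg 68) ;;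
      .assign 201 (rg 101 * rg 68 * (2 * rg 51)) ;;
      -- For the first piece register 4 is `-1`, so this spurious breakpoint is written to the cell
      -- of index `-1`, outside the output.
      .store 4 (rg 4) 0 (rg 52) ;; .store 5 (rg 4) 0 (2 * rg 53) ;;
      .assign 4 (rg 4 + 1) ;;
      .store 6 (rg 4) 0 (rg 100) ;; .store 7 (rg 4) 0 (rg 101) ;;
      .store 8 (rg 4) 0 (rg 200) ;; .store 9 (rg 4) 0 (rg 201)))

/-- The pieces in the output describe the spectral function on `(-∞, u]`; at the left end, there is
no piece yet, but a forged slope that differs from all others. -/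
def PInv (A B : Matrix (Fin m) (Fin n) (WithBot ℤ)) (u : ℝ) (σ : State) : Prop :=
  (u = loEnd A B ∧ σ.reg 4 = -1 ∧ σ.mem 6 (-1) 0 = 1 ∧ σ.mem 7 (-1) 0 = 0) ∨
  ∃ K : ℕ, σ.reg 4 = K ∧ (∀ i : ℕ, i < K → 0 < σ.mem 5 i 0) ∧
    (∀ i : ℕ, i ≤ K → 0 < σ.mem 7 i 0 ∧ 0 < σ.mem 9 i 0) ∧
    PieceInv (sval A B) K u (frac σ 4) (frac σ 6) (frac σ 8)

/-- A sample point, its coordinate `N / (2 D)` and the value `p / q` of the spectral function. -/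
structure Sampled (A B : Matrix (Fin m) (Fin n) (WithBot ℤ)) (N : ℤ) (D : ℕ) (p q : ℤ) : Prop where
  pt : Pt A B N D
  pos : 0 < q
  eq : (p : ℝ) = sval A B (N / (2 * D)) * q

theorem slope_formula {t u a c st su : ℝ} {N N' D D' p q p' q' : ℝ} (hN : N = t * (2 * D))
    (hN' : N' = u * (2 * D')) (hp : p = st * q) (hp' : p' = su * q') (hst : st = a * t + c)
    (hsu : su = a * u + c) :
    (p * q' - p' * q) * (2 * D) * (2 * D') =
      a * (q * q' * (N * (2 * D') - N' * (2 * D))) := by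
  subst hN hN' hp hp' hst hsu
  ring

theorem offset_formula {t a c st d : ℝ} {N D p q : ℝ} (hN : N = t * (2 * D)) (hp : p = st * q)
    (hst : st = a * t + c) : p * d * (2 * D) - a * d * N * q = c * (d * q * (2 * D)) := by
  subst hN hp hst
  ring

section

variable {b Z : ℕ} {N N' p q p' q' : ℤ} {D D' : ℕ}

theorem isGrid_intCast (h : Admissible A B M) (k : ℤ) : IsGrid (kappa m n) (k : ℝ) :=
  ⟨2 * k, 1, le_rfl, Nat.one_le_pow _ _ h.kappa_pos, by push_cast; ring⟩

theorem Sampled.eq_mul (h : Sampled A B N D p q) : (N : ℝ) = N / (2 * D) * (2 * D) := by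
  have : (D : ℝ) ≠ 0 := by have := h.pt.one_le; positivity
  field_simp

/-- On `(-∞, u]` there is one affine piece if `u` follows the left end. -/
theorem affine_left (h : Admissible A B M) {t a c : ℝ} (ht : (loEnd A B : ℝ) < t)
    (hgap : ∀ x, (loEnd A B : ℝ) < x → x < t → ¬ IsGrid (kappa m n) x)
    (hf : ∀ x, (loEnd A B : ℝ) ≤ x → x ≤ t → sval A B x = a * x + c) :
    ∀ x ≤ t, sval A B x = a * x + c := by
  obtain ⟨f, hf'⟩ := h.affine_loEnd
  -- The integer `loEnd + 1` is a grid point, so the first gap does not extend past it and lies in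
  -- the left affine ray.
  have ht1 : t ≤ loEnd A B + 1 := by
    by_contra! h1
    refine hgap ((loEnd A B + 1 : ℤ) : ℝ) (by push_cast; linarith) (by push_cast; exact h1)
      (isGrid_intCast h _)
  have e1 := hf (loEnd A B) le_rfl ht.le
  have e2 := hf t ht.le le_rfl
  rw [hf' _ (by linarith)] at e1
  rw [hf' _ ht1] at e2
  have e3 : (f.1 - a) * (t - loEnd A B) = 0 := by linarith
  have e4 : f.1 = a := by
    rcases mul_eq_zero.1 e3 with h | h <;> linarith
  intro x hx
  rw [hf' x (by linarith), e4]
  rw [e4] at e1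
  linarith

theorem run_emitPiece (hc : Ctx b Z) (h : Admissible A B M) {σ : State} (hσ : Ty b σ)
    (h50 : σ.reg 50 = N) (h51 : σ.reg 51 = D) (h67 : σ.reg 67 = p) (h68 : σ.reg 68 = q)
    (hs : Sampled A B N D p q) {c : ℤ} (h4 : σ.reg 4 ≤ c) (hcb : c + 1 ≤ b)
    (hDb : ((2 * kappa m n ^ 2 : ℕ) : ℤ) ≤ b)
    (hprev : (σ.reg 58 ≠ 0 ∧ (N : ℝ) / (2 * D) = loEnd A B ∧ PInv A B (loEnd A B) σ) ∨
      (σ.reg 58 = 0 ∧ σ.reg 52 = N' ∧ σ.reg 53 = D' ∧ σ.reg 54 = p' ∧ σ.reg 55 = q' ∧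
        Sampled A B N' D' p' q' ∧ (N' : ℝ) / (2 * D') < N / (2 * D) ∧
        (∀ x : ℝ, (N' : ℝ) / (2 * D') < x → x < N / (2 * D) → ¬ IsGrid (kappa m n) x) ∧
        PInv A B (N' / (2 * D')) σ)) :
    Run b Z emitPiece σ fun σ' => PInv A B (N / (2 * D)) σ' ∧ σ'.reg 4 ≤ c + 1 := by
  rcases hprev with ⟨h58, hN, hP⟩ | ⟨h58, h52, h53, h54, h55, hs', hlt, hgap, hP⟩
  · refine Run.ite hc hσ (fun _ => Run.skip hc hσ ⟨by rwa [hN], by omega⟩) (fun h0 => absurd h0 h58)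
  refine Run.ite hc hσ (fun h0 => absurd h58 h0) (fun _ => ?_)
  set t : ℝ := (N : ℝ) / (2 * D) with ht
  set u : ℝ := (N' : ℝ) / (2 * D') with hu
  set an : ℤ := (p * q' - p' * q) * (2 * D) * (2 * D') with han
  set ad : ℤ := q * q' * (N * (2 * D') - N' * (2 * D)) with had
  obtain ⟨⟨a, c'⟩, hf⟩ := h.exists_affine_gap hlt hgap
  simp only at hf
  have hDr : (0 : ℝ) < D := by have := hs.pt.one_le; positivity
  have hDr' : (0 : ℝ) < D' := by have := hs'.pt.one_le; positivity
  have hqr : (0 : ℝ) < q := by exact_mod_cast hs.pos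
  have hqr' : (0 : ℝ) < q' := by exact_mod_cast hs'.pos
  have hanr : (an : ℝ) = a * ad := by
    rw [han, had]
    push_cast
    exact slope_formula hs.eq_mul hs'.eq_mul hs.eq hs'.eq (hf t hlt.le le_rfl) (hf u le_rfl hlt.le)
  have hadr : (0 : ℝ) < ad := by
    rw [had]
    push_cast
    rw [hs.eq_mul, hs'.eq_mul, ← ht, ← hu]
    have : t * (2 * D) * (2 * D') - u * (2 * D') * (2 * D) = (t - u) * (2 * D) * (2 * D') := by ring
    rw [this]
    have : 0 < t - u := sub_pos.2 hlt
    positivity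
  have had0 : 0 < ad := by exact_mod_cast hadr
  have haq : (((an : ℚ) / ad : ℚ) : ℝ) = a := by
    push_cast
    rw [hanr]
    field_simp
  set fn : ℤ := p * ad * (2 * D) - an * N * q with hfn
  set fd : ℤ := ad * q * (2 * D) with hfd
  have hfd0 : 0 < fd := by
    have := hs.pt.one_le
    have := hs.pos
    positivity
  have hfnr : (fn : ℝ) = c' * fd := by
    rw [hfn, hfd]
    push_cast
    rw [hanr]
    exact offset_formula hs.eq_mul hs.eq (hf t hlt.le le_rfl)
  have hcq : (((fn : ℚ) / fd : ℚ) : ℝ) = c' := by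
    have : (0 : ℝ) < fd := by exact_mod_cast hfd0
    push_cast
    rw [hfnr]
    field_simp
  refine Run.seq hc (Run.assignT hc hσ (Q := (· = _)) an
    (by simp [h67, h55, h54, h68, h51, h53, han]) (by decide) (fun _ => rfl)) ?_
  rintro σ₁ hσ₁ - rfl
  refine Run.seq hc (Run.assignT hc hσ₁ (Q := (· = _)) ad
    (by simp [h68, h55, h50, h53, h52, h51, had]) (by decide) (fun _ => rfl)) ?_
  rintro σ₁ hσ₁ - rfl
  set σ₁ := (σ.setReg 100 an).setReg 101 ad with hσ1
  have hfrac : ∀ x i, frac σ₁ x i = frac σ x i := fun x i => rfl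
  refine Run.ite hc hσ₁ (fun h0 => Run.skip hc hσ₁ ⟨?_, by simp [hσ1]; omega⟩) (fun h0 => ?_)
  · have h0 : σ.mem 6 (σ.reg 4) 0 * ad = an * σ.mem 7 (σ.reg 4) 0 := by
      by_contra h1
      simp [hσ1, h1] at h0
    rcases hP with ⟨-, e4, e6, e7⟩ | ⟨K, e4, e5, e7, hpi⟩
    -- The forged slope is `1 / 0`; agreement with it would mean that the positive denominator `ad`
    -- is `0`.
    · rw [e4, e6, e7] at h0
      omega
    · rw [e4] at h0
      refine Or.inr ⟨K, by simp [hσ1, e4], e5, e7, ?_⟩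
      refine hpi.extend_same hlt (a := (an : ℚ) / ad) (b := (fn : ℚ) / fd) ?_ ?_
      · rw [frac, div_eq_div_iff (by exact_mod_cast (e7 K le_rfl).1.ne') (by exact_mod_cast had0.ne')]
        exact_mod_cast h0
      · rw [haq, hcq]; exact hf
  · have h0 : σ.mem 6 (σ.reg 4) 0 * ad ≠ an * σ.mem 7 (σ.reg 4) 0 := by
      intro h1
      simp [hσ1, h1] at h0
    refine Run.seq hc (Run.assignT hc hσ₁ (Q := (· = _)) fn
      (by simp [hσ1, h67, h51, h50, h68, hfn]) (by decide) (fun _ => rfl)) ?_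
    rintro σ₂ hσ₂ - rfl
    refine Run.seq hc (Run.assignT hc hσ₂ (Q := (· = _)) fd
      (by simp [hσ1, h68, h51, hfd]) (by decide) (fun _ => rfl)) ?_
    rintro σ₂ hσ₂ - rfl
    refine Run.seq hc (Run.storeT hc hσ₂ (Q := (· = _)) N'
      (by simp [hσ1, h52]) (by decide) (fun _ => rfl)) ?_
    rintro σ₂ hσ₂ - rfl
    refine Run.seq hc (Run.store hc hσ₂ (Q := (· = _)) (2 * D')
      (by simp [hσ1, h53]) ?_ (fun _ => rfl)) ?_
    · have h1 := hs'.pt.le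
      have h2 : ((2 * D' : ℕ) : ℤ) ≤ (2 * kappa m n ^ 2 : ℕ) := by exact_mod_cast (by omega)
      rw [abs_of_nonneg (by positivity)]
      simp only [memExp]
      norm_num
      push_cast at h2 hDb
      linarith
    rintro σ₂ hσ₂ - rfl
    have h4l : -1 ≤ σ.reg 4 := by
      rcases hP with ⟨-, e4, -⟩ | ⟨K, e4, -⟩ <;> omega
    refine Run.seq hc (Run.assign hc hσ₂ (Q := (· = _)) (σ.reg 4 + 1)
      (by simp [hσ1]) ?_ (fun _ => rfl)) ?_
    · simp only [regExp]
      norm_num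
      rw [abs_of_nonneg (by omega)]
      omega
    rintro σ₂ hσ₂ - rfl
    refine Run.seq hc (Run.storeT hc hσ₂ (Q := (· = _)) an
      (by simp [hσ1]) (by decide) (fun _ => rfl)) ?_
    rintro σ₂ hσ₂ - rfl
    refine Run.seq hc (Run.storeT hc hσ₂ (Q := (· = _)) ad
      (by simp [hσ1]) (by decide) (fun _ => rfl)) ?_
    rintro σ₂ hσ₂ - rfl
    refine Run.seq hc (Run.storeT hc hσ₂ (Q := (· = _)) fn
      (by simp) (by decide) (fun _ => rfl)) ?_
    rintro σ₂ hσ₂ - rfl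
    refine Run.storeT hc hσ₂ fd (by simp) (by decide) (fun _ => ?_)
    generalize hfin : State.setCell _ 9 _ _ _ = σ₃
    have m4 : ∀ i : ℤ, σ₃.mem 4 i 0 = if i = σ.reg 4 then N' else σ.mem 4 i 0 := by
      intro i; simp [← hfin, hσ1]
    have m5 : ∀ i : ℤ, σ₃.mem 5 i 0 = if i = σ.reg 4 then 2 * (D' : ℤ) else σ.mem 5 i 0 := by
      intro i; simp [← hfin, hσ1]
    have m6 : ∀ i : ℤ, σ₃.mem 6 i 0 = if i = σ.reg 4 + 1 then an else σ.mem 6 i 0 := by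
      intro i; simp [← hfin, hσ1]
    have m7 : ∀ i : ℤ, σ₃.mem 7 i 0 = if i = σ.reg 4 + 1 then ad else σ.mem 7 i 0 := by
      intro i; simp [← hfin, hσ1]
    have m8 : ∀ i : ℤ, σ₃.mem 8 i 0 = if i = σ.reg 4 + 1 then fn else σ.mem 8 i 0 := by
      intro i; simp [← hfin, hσ1]
    have m9 : ∀ i : ℤ, σ₃.mem 9 i 0 = if i = σ.reg 4 + 1 then fd else σ.mem 9 i 0 := by
      intro i; simp [← hfin, hσ1]
    have r4 : σ₃.reg 4 = σ.reg 4 + 1 := by simp [← hfin]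
    refine ⟨Or.inr ?_, by omega⟩
    rcases hP with ⟨hul, e4, e6, e7⟩ | ⟨K, e4, e5, e7, hpi⟩
    · rw [e4] at r4 m4 m5 m6 m7 m8 m9
      refine ⟨0, by simpa using r4, fun i hi => by omega, fun i hi => ?_, PieceInv.init ?_⟩
      · obtain rfl : i = 0 := by omega
        simp [m7, m9, had0, hfd0]
      · rw [frac, frac]
        simp only [Nat.cast_zero, m6, m7, m8, m9]
        norm_num only [if_true]
        rw [haq, hcq]
        rw [hul] at hlt hgap hf
        exact affine_left h hlt hgap hf
    · rw [e4] at r4 m4 m5 m6 m7 m8 m9 h0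
      refine ⟨K + 1, by simpa using r4, fun i hi => ?_, fun i hi => ?_, ?_⟩
      · rw [m5]
        split_ifs with h1
        · have := hs'.pt.one_le; positivity
        · exact e5 i (by omega)
      · rw [m7, m9]
        split_ifs with h1
        · exact ⟨had0, hfd0⟩
        · exact e7 i (by omega)
      · refine hpi.extend_new hlt (a := (an : ℚ) / ad) (b := (fn : ℚ) / fd) ?_ ?_ ?_ ?_ ?_ ?_ ?_ ?_
        · rw [frac, Ne, div_eq_div_iff (by exact_mod_cast (e7 K le_rfl).1.ne') (by exact_mod_cast had0.ne')]
          exact_mod_cast h0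
        · rw [haq, hcq]; exact hf
        · intro i hi
          simp only [frac]
          rw [m4, m5, if_neg (by omega), if_neg (by omega)]
        · simp only [frac]
          rw [m4, m5, if_pos rfl, if_pos rfl, hu]
          push_cast
          rfl
        · intro i hi
          simp only [frac]
          rw [m6, m7, if_neg (by omega), if_neg (by omega)]
        · simp only [frac]
          rw [m6, m7, if_pos (by push_cast; rfl), if_pos (by push_cast; rfl)]
        · intro i hi
          simp only [frac]
          rw [m8, m9, if_neg (by omega), if_neg (by omega)]
        · simp only [frac]
          rw [m8, m9, if_pos (by push_cast; rfl), if_pos (by push_cast; rfl)]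

end

/-! ### Output of the spectrum -/

/-- Updates the intervals of zeros of the spectral function at the current point. -/
def emitZero : Com :=
  .ite (.eq (rg 67) 0) (
    -- Register 56 tells whether the previous sample was a zero; then the current interval is
    -- prolonged, otherwise a new one starts.
    .ite (rg 56) .skip (
      -- At the first and at the last sample point, the flags in registers 58 and 59 turn the
      -- denominator into `0`, which encodes an infinite end.
      .store 10 (rg 5) 0 (rg 50) ;; .store 11 (rg 5) 0 ((1 - rg 58) * (2 * rg 51)) ;;
      .assign 5 (rg 5 + 1)) ;;
    .store 12 (rg 5 - 1) 0 (rg 50) ;; .store 13 (rg 5 - 1) 0 ((1 - rg 59) * (2 * rg 51))) .skip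

/-- The intervals in the output describe the spectrum in `(-∞, u]`. -/
def ZInv (A B : Matrix (Fin m) (Fin n) (WithBot ℤ)) (u : ℝ) (σ : State) : Prop :=
  ∃ J : ℕ, σ.reg 5 = J ∧ (∀ j : ℕ, j < J → 0 ≤ σ.mem 11 j 0 ∧ 0 ≤ σ.mem 13 j 0) ∧
    ZeroInv (spec (toReal A) (toReal B)) J u (extFrac σ ⊥ 10) (extFrac σ ⊤ 12)

/-- The intervals in the output describe the spectrum. -/
def ZDone (A B : Matrix (Fin m) (Fin n) (WithBot ℤ)) (σ : State) : Prop :=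
  ∃ J : ℕ, σ.reg 5 = J ∧ (∀ j : ℕ, j < J → 0 ≤ σ.mem 11 j 0 ∧ 0 ≤ σ.mem 13 j 0) ∧
    IsIntervalDecomposition (spec (toReal A) (toReal B)) J (extFrac σ ⊥ 10) (extFrac σ ⊤ 12)

section

variable {b Z : ℕ} {N N' p q p' q' : ℤ} {D D' : ℕ}

theorem eq_zero_of_ends {s : ℝ → ℝ} {a c u t : ℝ} (hut : u < t)
    (h : ∀ x, u ≤ x → x ≤ t → s x = a * x + c) (hu : s u = 0) (ht : s t = 0) :
    ∀ x, u ≤ x → x ≤ t → s x = 0 := by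
  rw [h u le_rfl hut.le] at hu
  rw [h t hut.le le_rfl] at ht
  have e : a * (t - u) = 0 := by linarith
  have ha : a = 0 := by
    rcases mul_eq_zero.1 e with h | h <;> linarith
  intro x h1 h2
  rw [h x h1 h2, ha]
  rw [ha] at hu
  linarith

theorem ends_eq_zero {s : ℝ → ℝ} {a c u t z : ℝ} (hs : ∀ x, s x ≤ 0)
    (h : ∀ x, u ≤ x → x ≤ t → s x = a * x + c) (hu : u < z) (ht : z < t) (hz : s z = 0) :
    ∀ x, u ≤ x → x ≤ t → s x = 0 := by
  obtain ⟨rfl, rfl⟩ := eq_zero_of_interior_zero hs h hu ht hz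
  intro x h1 h2
  rw [h x h1 h2]
  ring

/-- The spectral function vanishes at the right end if and only if it vanishes beyond. -/
theorem Admissible.zero_right (h : Admissible A B M) {x : ℝ} (hx : (hiEnd A B : ℝ) ≤ x) :
    sval A B x = 0 ↔ sval A B (hiEnd A B) = 0 := by
  obtain ⟨f, hf⟩ := h.affine_hiEnd
  have key : ∀ z, (hiEnd A B : ℝ) ≤ z → sval A B z = 0 →
      ∀ y, (hiEnd A B : ℝ) - 1 ≤ y → y ≤ max x z + 1 → sval A B y = 0 := fun z hz hz0 =>
    ends_eq_zero h.sval_nonpos (fun y hy _ => hf y hy) (by linarith)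
      (by linarith [le_max_right x z]) hz0
  constructor
  · intro h0
    exact key x hx h0 _ (by linarith) (by linarith [le_max_left x x])
  · intro h0
    exact key _ le_rfl h0 x (by linarith) (by linarith [le_max_left x (hiEnd A B)])

theorem Admissible.zero_left (h : Admissible A B M) {x : ℝ} (hx : x ≤ (loEnd A B : ℝ)) :
    sval A B x = 0 ↔ sval A B (loEnd A B) = 0 := by
  have := h.swap.zero_right (x := -x) (by rw [h.hiEnd_swap]; push_cast; linarith)
  simpa only [h.hiEnd_swap, sval_swap A B, Int.cast_neg, neg_neg] using this

theorem extFrac_of_pos {σ : State} {e : EReal} {a i : ℕ} (h : σ.mem a i 0 = N)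
    (h' : σ.mem (a + 1) i 0 = 2 * D) (hD : 1 ≤ D) :
    extFrac σ e a i = (((N : ℝ) / (2 * D) : ℝ) : EReal) := by
  rw [extFrac, if_neg (by rw [h']; positivity), frac, h, h']
  push_cast
  rfl

/-- Between consecutive samples `s` is affine and nonpositive: it vanishes throughout if it vanishes
at both ends, and has no inner zero otherwise. Outside the sampled range it vanishes exactly if it
does so at the nearer end point. So the samples decide everything, and single zeros become one-point
intervals. -/
theorem run_emitZero (hc : Ctx b Z) (h : Admissible A B M) {σ : State} (hσ : Ty b σ)
    (h50 : σ.reg 50 = N) (h51 : σ.reg 51 = D) (h67 : σ.reg 67 = p) (hs : Sampled A B N D p q)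
    {c : ℤ} (h5 : σ.reg 5 ≤ c) (hcb : c + 1 ≤ b) (hDb : ((2 * kappa m n ^ 2 : ℕ) : ℤ) ≤ b)
    (hlast : (σ.reg 59 = 0) ∨ (σ.reg 59 = 1 ∧ (N : ℝ) / (2 * D) = hiEnd A B))
    (hprev : (σ.reg 58 = 1 ∧ (N : ℝ) / (2 * D) = loEnd A B ∧ σ.reg 5 = 0 ∧ σ.reg 56 = 0) ∨
      (σ.reg 58 = 0 ∧ Sampled A B N' D' p' q' ∧ (σ.reg 56 ≠ 0 ↔ p' = 0) ∧
        (N' : ℝ) / (2 * D') < N / (2 * D) ∧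
        (∀ x : ℝ, (N' : ℝ) / (2 * D') < x → x < N / (2 * D) → ¬ IsGrid (kappa m n) x) ∧
        ZInv A B (N' / (2 * D')) σ)) :
    Run b Z emitZero σ fun σ' => (σ.reg 59 = 0 → ZInv A B (N / (2 * D)) σ') ∧
      (σ.reg 59 = 1 → ZDone A B σ') ∧ σ'.reg 5 ≤ c + 1 := by
  have hzero : ∀ {N p q : ℤ} {D : ℕ}, Sampled A B N D p q → (sval A B (N / (2 * D)) = 0 ↔ p = 0) := by
    intro N p q D hs
    have hq : (q : ℝ) ≠ 0 := by exact_mod_cast hs.pos.ne'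
    have := hs.eq
    constructor
    · intro h0
      rw [h0, zero_mul] at this
      exact_mod_cast this
    · rintro rfl
      rw [Int.cast_zero, eq_comm, mul_eq_zero] at this
      exact this.resolve_right hq
  have hz := hzero hs
  set t : ℝ := (N : ℝ) / (2 * D) with ht
  have hS : ∀ x, x ∈ spec (toReal A) (toReal B) ↔ sval A B x = 0 := h.mem_spec_iff
  refine Run.ite hc hσ (fun h0 => ?_) (fun h0 => Run.skip hc hσ ?_)
  · have hp : p = 0 := by
      by_contra h1
      simp [h67, h1] at h0
    have ht0 := hz.2 hp
    have hden : ∀ {v : ℤ}, v = 0 ∨ v = 1 → |(1 - v) * (2 * D)| ≤ (b : ℤ) := by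
      intro v hv
      have h1 := hs.pt.le
      have h2 : ((2 * D : ℕ) : ℤ) ≤ (2 * kappa m n ^ 2 : ℕ) := by exact_mod_cast (by omega)
      push_cast at h2 hDb
      rcases hv with rfl | rfl
      · rw [sub_zero, one_mul, abs_of_nonneg (by positivity)]; linarith
      · simp
    have hprev' : σ.reg 56 = 0 ∨ (σ.reg 56 ≠ 0 ∧ σ.reg 58 = 0) := by
      by_cases h6 : σ.reg 56 = 0
      · exact Or.inl h6
      · rcases hprev with ⟨-, -, -, h6'⟩ | ⟨h8, -⟩
        · exact absurd h6' h6
        · exact Or.inr ⟨h6, h8⟩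
    have h58 : σ.reg 58 = 0 ∨ σ.reg 58 = 1 := hprev.symm.imp (fun h => h.1) (fun h => h.1)
    obtain ⟨J, hJ⟩ : ∃ J : ℕ, σ.reg 5 = J := by
      rcases hprev with ⟨-, -, h5, -⟩ | ⟨-, -, -, -, -, J, h5, -⟩
      · exact ⟨0, h5⟩
      · exact ⟨J, h5⟩
    -- the state before the upper end is stored
    refine Run.seq hc (Q' := fun σ₁ => ∃ J' : ℕ, σ₁.reg 5 = J' ∧ 0 < J' ∧ (J' : ℤ) ≤ c + 1 ∧
      σ₁.reg 50 = N ∧ σ₁.reg 51 = D ∧ σ₁.reg 59 = σ.reg 59 ∧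
      (∀ j : ℕ, j < J' → 0 ≤ σ₁.mem 11 j 0) ∧ (∀ j : ℕ, j < J' - 1 → 0 ≤ σ₁.mem 13 j 0) ∧
      ∀ hi : ℕ → EReal, (∀ j < J' - 1, hi j = extFrac σ₁ ⊤ 12 j) → hi (J' - 1) = t →
        ZeroInv (spec (toReal A) (toReal B)) J' t (extFrac σ₁ ⊥ 10) hi) ?_ ?_
    · refine Run.ite hc hσ (fun h56 => Run.skip hc hσ ?_) (fun h56 => ?_)
      · rcases hprev with ⟨-, -, -, h6'⟩ | ⟨h8, hs', h6, hlt, hgap, J₀, h5', hden', hZ⟩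
        · exact absurd h6' h56
        obtain rfl : J₀ = J := by omega
        have hu0 := (hzero hs').2 (h6.1 h56)
        obtain ⟨f, hf⟩ := h.exists_affine_gap hlt hgap
        have hall := eq_zero_of_ends hlt hf hu0 ht0
        have hJ0 := (hZ.last_eq ((hS _).2 hu0)).1
        exact ⟨J₀, h5', hJ0, by omega, h50, h51, rfl, fun j hj => (hden' j hj).1,
          fun j hj => (hden' j (by omega)).2, fun hi h1 h2 =>
            hZ.extend_same hlt (fun x hx hx' => (hS x).2 (hall x hx hx')) (fun _ _ => rfl) h1 h2⟩
      · have h56 : σ.reg 56 = 0 := h56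
        refine Run.seq hc (Run.storeT hc hσ (Q := (· = _)) N (by simp [h50]) (by decide)
          (fun _ => rfl)) ?_
        rintro σ₁ hσ₁ - rfl
        refine Run.seq hc (Run.store hc hσ₁ (Q := (· = _)) ((1 - σ.reg 58) * (2 * D))
          (by simp [h51]) (by simpa [memExp] using hden h58) (fun _ => rfl)) ?_
        rintro σ₁ hσ₁ - rfl
        refine Run.assign hc hσ₁ (J + 1 : ℕ) (by simp [hJ]) ?_ (fun _ => ?_)
        · simp only [regExp]
          norm_num only [if_true, pow_one, Nat.abs_cast]
          push_cast
          omega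
        generalize hfin : State.setReg _ 5 _ = σ₁
        have m10 : ∀ j : ℕ, σ₁.mem 10 j 0 = if j = J then N else σ.mem 10 j 0 := by
          intro j; simp [← hfin, hJ]
        have m11 : ∀ j : ℕ, σ₁.mem 11 j 0 = if j = J then (1 - σ.reg 58) * (2 * D) else σ.mem 11 j 0 := by
          intro j; simp [← hfin, hJ]
        have m12 : ∀ j : ℕ, σ₁.mem 12 j 0 = σ.mem 12 j 0 := by intro j; simp [← hfin]
        have m13 : ∀ j : ℕ, σ₁.mem 13 j 0 = σ.mem 13 j 0 := by intro j; simp [← hfin]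
        have hx12 : ∀ j, extFrac σ₁ ⊤ 12 j = extFrac σ ⊤ 12 j := by
          intro j; simp [extFrac, frac, m12, m13]
        have hx10 : ∀ j < J, extFrac σ₁ ⊥ 10 j = extFrac σ ⊥ 10 j := by
          intro j hj
          simp [extFrac, frac, m10, m11, hj.ne]
        have h11J : 0 ≤ (1 - σ.reg 58) * (2 * (D : ℤ)) := by
          rcases h58 with h8 | h8 <;> rw [h8] <;> norm_num
        refine ⟨J + 1, by simp [← hfin], by omega, by push_cast; omega, by simp [← hfin, h50],
          by simp [← hfin, h51], by simp [← hfin], fun j hj => ?_, fun j hj => ?_,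
          fun hi h1 h2 => ?_⟩
        · rw [m11]
          split_ifs with h1
          · exact h11J
          · rcases hprev with ⟨-, -, h5', -⟩ | ⟨-, -, -, -, -, J₀, h5', hden', -⟩
            · omega
            · exact (hden' j (by omega)).1
        · rw [m13]
          rcases hprev with ⟨-, -, h5', -⟩ | ⟨-, -, -, -, -, J₀, h5', hden', -⟩
          · omega
          · exact (hden' j (by omega)).2
        · rw [Nat.add_sub_cancel] at h1 h2
          rcases hprev with ⟨h8, htl, h5', -⟩ | ⟨h8, hs', h6, hlt, hgap, J₀, h5', hden', hZ⟩
          · obtain rfl : J = 0 := by omega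
            have hlo : extFrac σ₁ ⊥ 10 0 = ⊥ := by
              rw [extFrac, if_pos]
              rw [m11, if_pos rfl, h8]
              norm_num
            refine ⟨fun j hj => ?_, fun j hj => by omega, fun j hj => ?_, fun x hx => ?_⟩
            · obtain rfl : j = 0 := by omega
              rw [hlo]; exact bot_le
            · obtain rfl : j = 0 := by omega
              rw [h2]
            · rw [hS]
              rw [htl] at hx ht0
              refine iff_of_true ((h.zero_left hx).2 ht0) ⟨0, by omega, by rw [hlo]; exact bot_le, ?_⟩
              rw [h2, htl]
              exact_mod_cast hx
          · obtain rfl : J₀ = J := by omega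
            obtain ⟨f, hf⟩ := h.exists_affine_gap hlt hgap
            refine hZ.extend_new hlt ((hS t).2 ht0) (fun x hx hx' hxS => ?_) hx10
              (fun j hj => by rw [h1 j hj, hx12]) ?_ h2
            · have := ends_eq_zero h.sval_nonpos hf hx hx' ((hS x).1 hxS) _ le_rfl hlt.le
              exact absurd h56 (h6.2 ((hzero hs').1 this))
            · exact extFrac_of_pos (by rw [m10, if_pos rfl]) (by rw [m11, if_pos rfl, h8]; norm_num)
                hs.pt.one_le
    · rintro σ₁ hσ₁ - ⟨J', e5, hJ0, hJc, e50, e51, e59, d11, d13, hZ⟩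
      have e59' : σ.reg 59 = 0 ∨ σ.reg 59 = 1 := hlast.imp_right fun h => h.1
      refine Run.seq hc (Run.storeT hc hσ₁ (Q := (· = _)) N (by simp [e50]) (by decide)
        (fun _ => rfl)) ?_
      rintro σ₂ hσ₂ - rfl
      refine Run.store hc hσ₂ ((1 - σ.reg 59) * (2 * D))
        (by simp [e51, e59]) (by simpa [memExp] using hden e59') (fun _ => ?_)
      generalize hfin : State.setCell _ 13 _ _ _ = σ₃
      have m10 : ∀ j : ℕ, σ₃.mem 10 j 0 = σ₁.mem 10 j 0 := by intro j; simp [← hfin]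
      have m11 : ∀ j : ℕ, σ₃.mem 11 j 0 = σ₁.mem 11 j 0 := by intro j; simp [← hfin]
      have m12 : ∀ j : ℕ, σ₃.mem 12 j 0 = if (j : ℤ) = J' - 1 then N else σ₁.mem 12 j 0 := by
        intro j; simp [← hfin, e5]
      have m13 : ∀ j : ℕ, σ₃.mem 13 j 0 =
          if (j : ℤ) = J' - 1 then (1 - σ.reg 59) * (2 * D) else σ₁.mem 13 j 0 := by
        intro j; simp [← hfin, e5]
      have e5' : σ₃.reg 5 = J' := by simp [← hfin, e5]
      have hx10 : extFrac σ₃ ⊥ 10 = extFrac σ₁ ⊥ 10 := by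
        funext j; simp [extFrac, frac, m10, m11]
      have hx12 : ∀ j < J' - 1, extFrac σ₃ ⊤ 12 j = extFrac σ₁ ⊤ 12 j := by
        intro j hj
        have h1 : ¬ (j : ℤ) = J' - 1 := by omega
        simp [extFrac, frac, m12, m13, h1]
      have hdens : ∀ j : ℕ, j < J' → 0 ≤ σ₃.mem 11 j 0 ∧ 0 ≤ σ₃.mem 13 j 0 := by
        intro j hj
        refine ⟨by rw [m11]; exact d11 j hj, ?_⟩
        rw [m13]
        split_ifs with h1
        · rcases e59' with h9 | h9 <;> rw [h9] <;> norm_num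
        · exact d13 j (by omega)
      refine ⟨fun h9 => ⟨J', e5', hdens, ?_⟩, fun h9 => ⟨J', e5', hdens, ?_⟩, by rw [e5']; exact hJc⟩
      · rw [hx10]
        refine hZ _ hx12 (extFrac_of_pos ?_ ?_ hs.pt.one_le)
        · rw [m12, if_pos (by omega)]
        · rw [m13, if_pos (by omega), h9]; norm_num
      · rw [hx10]
        have htop : t = hiEnd A B := by
          rcases hlast with h | h
          · omega
          · exact h.2
        refine (hZ (fun j => if j < J' - 1 then extFrac σ₁ ⊤ 12 j else t) (fun j hj => if_pos hj)
          (if_neg (lt_irrefl _))).finish_top (fun x hx => (hS x).2 ?_) (fun _ _ => rfl)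
          (fun j hj => by rw [hx12 j hj, if_pos hj]) ?_
        · rw [htop] at hx ht0
          exact (h.zero_right hx).2 ht0
        · rw [extFrac, if_pos]
          rw [m13, if_pos (by omega), h9]
          norm_num
  · have hp : p ≠ 0 := by
      rintro rfl
      simp [h67] at h0
    have ht0 : sval A B t ≠ 0 := fun h1 => hp (hz.1 h1)
    have hZ : ZInv A B t σ := by
      rcases hprev with ⟨-, htl, h5', -⟩ | ⟨-, hs', -, hlt, hgap, J, h5', hden, hZ⟩
      · refine ⟨0, h5', fun j hj => by omega, fun j hj => by omega, fun j hj => by omega,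
          fun j hj => by omega, fun x hx => iff_of_false (fun hxS => ?_) (by rintro ⟨j, hj, -⟩; omega)⟩
        rw [htl] at hx ht0
        exact ht0 ((h.zero_left hx).1 ((hS x).1 hxS))
      · obtain ⟨f, hf⟩ := h.exists_affine_gap hlt hgap
        refine ⟨J, h5', hden, hZ.extend_none hlt fun x hx hx' hxS => ?_⟩
        rcases hx'.lt_or_eq with hx' | rfl
        · exact ht0 (ends_eq_zero h.sval_nonpos hf hx hx' ((hS x).1 hxS) _ hlt.le le_rfl)
        · exact ht0 ((hS _).1 hxS)
    refine ⟨fun _ => hZ, fun h9 => ?_, by omega⟩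
    obtain ⟨J, h5', hden, hZ⟩ := hZ
    have htop : t = hiEnd A B := by
      rcases hlast with h | h
      · omega
      · exact h.2
    refine ⟨J, h5', hden, hZ.finish_none fun x hx hxS => ?_⟩
    rw [htop] at hx ht0
    exact ht0 ((h.zero_right hx).1 ((hS x).1 hxS))

end

/-! ### Passing from one sample to the next -/

/-- Proceeds to the next sample point. -/
def nextProg : Com :=
  .ite (rg 59) .skip (
    -- The least numerator over `2 d` beyond `N / (2 D)` is `⌊N d / D⌋ + 1`; the least such fraction
    -- over `1 ≤ d ≤ κ²` is found as the largest of the negatives.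
    maxLoop 20 36 102 103 1 (0 - (rg 50 * (rg 20 + 1) / rg 51 + 1)) (rg 20 + 1) ;;
    .assign 50 (0 - rg 102) ;; .assign 51 (rg 103))

/-- Saves the current sample. -/
def saveProg : Com :=
  .assign 56 (.eq (rg 67) 0) ;; .assign 52 (rg 50) ;; .assign 53 (rg 51) ;; .assign 54 (rg 67) ;;
  .assign 55 (rg 68) ;; .assign 58 0 ;; .assign 57 (1 - rg 59)

/-- Processes the value of the game in registers 2 and 3. -/
def tailProg : Com :=
  -- The game value is `D s + (x - y) / 2` with `x` and `y` in registers 62 and 61; solving for `s`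
  -- gives this numerator and denominator.
  .assign 67 (2 * rg 2 - (rg 62 - rg 61) * rg 3) ;; .assign 68 (2 * rg 51 * rg 3) ;;
  emitPiece ;; emitZero ;; saveProg ;; nextProg

/-- The sample before the current one is saved, and the output is correct up to it. -/
structure Prev (A B : Matrix (Fin m) (Fin n) (WithBot ℤ)) (N : ℤ) (D : ℕ) (σ : State) : Prop where
  sampled : Sampled A B N D (σ.reg 54) (σ.reg 55)
  r52 : σ.reg 52 = N
  r53 : σ.reg 53 = D
  r56 : σ.reg 56 ≠ 0 ↔ σ.reg 54 = 0
  r58 : σ.reg 58 = 0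
  pieces : PInv A B ((N : ℝ) / (2 * D)) σ
  zeros : ZInv A B ((N : ℝ) / (2 * D)) σ

/-- The number of sample points from `t` on, with multiplicities. -/
noncomputable def remaining (A B : Matrix (Fin m) (Fin n) (WithBot ℤ)) (t : ℝ) : ℕ :=
  (gridFrom (kappa m n) (loEnd A B) (hiEnd A B) t).card

/-- The invariant of the main loop, at the sample point `N / (2 D)`. -/
structure LoopInv (A B : Matrix (Fin m) (Fin n) (WithBot ℤ)) (cap : ℤ) (N : ℤ) (D : ℕ) (σ : State) :
    Prop where
  static : Static A B σ
  pt : Pt A B N D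
  r50 : σ.reg 50 = N
  r51 : σ.reg 51 = D
  r57 : σ.reg 57 = 1
  -- Each turn adds at most one piece and one interval and uses up a grid point; so `cap` bounds
  -- both counters, as the size bounds for registers require.
  r4 : σ.reg 4 + remaining A B (N / (2 * D)) ≤ cap
  r5 : σ.reg 5 + remaining A B (N / (2 * D)) ≤ cap
  prev : (σ.reg 58 = 1 ∧ (N : ℝ) / (2 * D) = loEnd A B ∧ σ.reg 5 = 0 ∧ σ.reg 56 = 0 ∧
      PInv A B (loEnd A B) σ) ∨
    ∃ N' D', Prev A B N' D' σ ∧ (N' : ℝ) / (2 * D') < N / (2 * D) ∧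
      ∀ x : ℝ, (N' : ℝ) / (2 * D') < x → x < N / (2 * D) → ¬ IsGrid (kappa m n) x

section

variable {b Z : ℕ} {N : ℤ} {D : ℕ}

theorem PInv.congr {u : ℝ} {σ σ' : State} (h : PInv A B u σ) (h4 : σ'.reg 4 = σ.reg 4)
    (hm : ∀ a ∈ [4, 5, 6, 7, 8, 9], σ'.mem a = σ.mem a) : PInv A B u σ' := by
  have m5 := hm 5 (by simp)
  have m6 := hm 6 (by simp)
  have m7 := hm 7 (by simp)
  have m9 := hm 9 (by simp)
  have f4 : frac σ' 4 = frac σ 4 := by funext i; simp [frac, hm]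
  have f6 : frac σ' 6 = frac σ 6 := by funext i; simp [frac, hm]
  have f8 : frac σ' 8 = frac σ 8 := by funext i; simp [frac, hm]
  rw [PInv, h4, m5, m6, m7, m9, f4, f6, f8]
  exact h

theorem ZInv.congr {u : ℝ} {σ σ' : State} (h : ZInv A B u σ) (h5 : σ'.reg 5 = σ.reg 5)
    (hm : ∀ a ∈ [10, 11, 12, 13], σ'.mem a = σ.mem a) : ZInv A B u σ' := by
  have f10 : extFrac σ' ⊥ 10 = extFrac σ ⊥ 10 := by funext i; simp [extFrac, frac, hm]
  have f12 : extFrac σ' ⊤ 12 = extFrac σ ⊤ 12 := by funext i; simp [extFrac, frac, hm]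
  rw [ZInv, h5, hm 11 (by simp), hm 13 (by simp), f10, f12]
  exact h

theorem ZDone.congr {σ σ' : State} (h : ZDone A B σ) (h5 : σ'.reg 5 = σ.reg 5)
    (hm : ∀ a ∈ [10, 11, 12, 13], σ'.mem a = σ.mem a) : ZDone A B σ' := by
  have f10 : extFrac σ' ⊥ 10 = extFrac σ ⊥ 10 := by funext i; simp [extFrac, frac, hm]
  have f12 : extFrac σ' ⊤ 12 = extFrac σ ⊤ 12 := by funext i; simp [extFrac, frac, hm]
  rw [ZDone, h5, hm 11 (by simp), hm 13 (by simp), f10, f12]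
  exact h

theorem PInv.isReconstruction (h : Admissible A B M) {σ : State} (hP : PInv A B (hiEnd A B) σ)
    (hZ : ZDone A B σ) : IsReconstruction A B σ := by
  refine ⟨?_, hZ⟩
  rcases hP with ⟨h1, -⟩ | ⟨K, e4, e5, e7, hpi⟩
  · have := h.lo_lt_hi
    have h1 : hiEnd A B = loEnd A B := by exact_mod_cast h1
    omega
  · obtain ⟨f, hf⟩ := h.affine_hiEnd
    exact ⟨K, e4, e5, e7, hpi.finish (by linarith) hf h.specFun_eq⟩

/-- The successor of a sample point. -/
theorem exists_next {u v : ℤ} (h : Admissible A B M) (hp : Pt A B N D) (hne : N ≠ 2 * D * hiEnd A B)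
    (hM : MaxSpec (kappa m n ^ 2) (fun _ => 1) (fun k => -(N * (k + 1 : ℕ) / D + 1))
      (fun k => (k + 1 : ℕ)) u v) :
    ∃ D' : ℕ, v = D' ∧ Pt A B (-u) D' ∧ (N : ℝ) / (2 * D) < ((-u : ℤ) : ℝ) / (2 * D') ∧
      ∀ x : ℝ, (N : ℝ) / (2 * D) < x → x < ((-u : ℤ) : ℝ) / (2 * D') → ¬ IsGrid (kappa m n) x := by
  have hκ := h.kappa_pos
  have hD0 : (0 : ℤ) < D := by exact_mod_cast hp.one_le
  have hDr : (0 : ℝ) < D := by exact_mod_cast hp.one_le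
  rcases hM.eq with ⟨-, -, h0⟩ | ⟨k, hk, -, hu, rfl⟩
  · exact absurd (h0 0 (by positivity)) one_ne_zero
  have hu' : N * (k + 1 : ℕ) / D + 1 ≤ -u := by omega
  have hlt := (next_num_le hD0 _ _).1 hu'
  have hlt' : (N : ℝ) / (2 * D) < ((-u : ℤ) : ℝ) / (2 * (k + 1 : ℕ)) := by
    rw [div_lt_div_iff₀ (by positivity) (by positivity)]
    have : (N : ℝ) * (k + 1 : ℕ) < ((-u : ℤ) : ℝ) * D := by exact_mod_cast hlt
    linarith
  refine ⟨k + 1, rfl, ⟨by omega, hk, ?_, ?_⟩, hlt', ?_⟩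
  · have h1 := hp.lo
    have h2 : (0 : ℤ) < ((k + 1 : ℕ) : ℤ) := by positivity
    have h3 : 2 * ((k + 1 : ℕ) : ℤ) * loEnd A B * D < -u * D := by nlinarith
    exact (lt_of_mul_lt_mul_right h3 hD0.le).le
  -- The integer `hiEnd` is a competitor with denominator `2 · 1`, so the next point does not
  -- overshoot it.
  · have h1 := hM.le 0 (by positivity) one_ne_zero
    have h2 : N * 1 < (2 * hiEnd A B) * D := by
      have := lt_of_le_of_ne hp.hi hne
      linarith
    have h3 := (next_num_le hD0 _ _).2 h2
    simp only [zero_add, Nat.cast_one, mul_one] at h1 h3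
    have h4 : (0 : ℤ) < ((k + 1 : ℕ) : ℤ) := by positivity
    nlinarith
  · rintro x hx hx' ⟨a, d, hd1, hd2, rfl⟩
    have hdr : (0 : ℝ) < d := by exact_mod_cast hd1
    rw [div_lt_div_iff₀ (by positivity) (by positivity)] at hx hx'
    have g1 : N * d < a * D := by
      have : (N : ℝ) * d < a * D := by linarith
      exact_mod_cast this
    have g2 := (next_num_le hD0 _ _).2 g1
    have g3 : a * (k + 1 : ℕ) < -u * d := by
      have : (a : ℝ) * (k + 1 : ℕ) < ((-u : ℤ) : ℝ) * d := by push_cast at hx' ⊢; linarith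
      exact_mod_cast this
    have g4 := hM.le (d - 1) (by omega) one_ne_zero
    rw [Nat.sub_add_cancel hd1] at g4
    have h4 : (0 : ℤ) < ((k + 1 : ℕ) : ℤ) := by positivity
    nlinarith

theorem run_nextProg (hc : Ctx b Z) (h : Admissible A B M) {σ : State} (hσ : Ty b σ)
    (hS : Static A B σ) (hp : Pt A B N D) (h50 : σ.reg 50 = N) (h51 : σ.reg 51 = D)
    (h59 : σ.reg 59 = if N = 2 * D * hiEnd A B then 1 else 0)
    (hb : (m + n + M + 2) ^ 30 ≤ b) (hZ : kappa m n ^ 2 ≤ Z) :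
    Run b Z nextProg σ fun σ' => N ≠ 2 * D * hiEnd A B → ∃ (N' : ℤ) (D' : ℕ), σ'.reg 50 = N' ∧
      σ'.reg 51 = D' ∧ Pt A B N' D' ∧ (N : ℝ) / (2 * D) < N' / (2 * D') ∧
      ∀ x : ℝ, (N : ℝ) / (2 * D) < x → x < N' / (2 * D') → ¬ IsGrid (kappa m n) x := by
  have hPb : ∀ {k}, k ≤ 30 → (m + n + M + 2) ^ k ≤ b :=
    fun hk => (Nat.pow_le_pow_right (by omega) hk).trans hb
  have hκb : kappa m n ^ 2 ≤ b := (Nat.pow_le_pow_left (kappa_le.trans (by omega)) 2).trans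
    (hPb (k := 2) (by norm_num))
  refine Run.ite hc hσ (fun h0 => Run.skip hc hσ fun h1 => ?_) (fun h0 => ?_)
  · rw [if_neg h1] at h59
    exact absurd h59 h0
  · have hne : N ≠ 2 * D * hiEnd A B := by
      intro h1
      rw [if_pos h1] at h59
      simp [h59] at h0
    refine Run.seq hc (run_maxLoop hc hσ (kappa m n ^ 2) hS.r36 hκb hZ (by norm_num) (by norm_num)
      (by norm_num) (fun _ => 1) (fun k => -(N * (k + 1 : ℕ) / D + 1)) (fun k => (k + 1 : ℕ)) ?_
      (fun _ _ _ => by positivity) (by decide) (by decide)) ?_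
    · intro k hk σ' _ hF hk'
      simp [hF.reg 50 rfl, hF.reg 51 rfl, hk', h50, h51]
    intro σ₁ hσ₁ hF₁ hM
    obtain ⟨D', hD', hp', hlt, hgap⟩ := exists_next h hp hne hM
    refine Run.seq hc (Run.set hc hσ₁ (-σ₁.reg 102) (by simp) ?_) ?_
    · have := (hp'.abs_shift_le h le_rfl).2
      simp only [regExp]
      norm_num only [if_true, pow_one]
      exact this.trans (by exact_mod_cast hPb (by norm_num))
    rintro σ₂ hσ₂ - rfl
    refine Run.assign hc hσ₂ D' (by simp [hD']) ?_ (fun _ _ => ?_)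
    · simp only [regExp]
      norm_num only [if_true, pow_one, Nat.abs_cast]
      exact_mod_cast hp'.le.trans hκb
    · exact ⟨_, D', by simp, by simp, hp', hlt, hgap⟩

theorem run_tailProg (hc : Ctx b Z) (h : Admissible A B M) {σ : State} (hσ : Ty b σ) {cap : ℤ}
    (hI : LoopInv A B cap N D σ) (h61 : σ.reg 61 = (N - 2 * D * ctr A B) / 2)
    (h62 : σ.reg 62 = (N - 2 * D * ctr A B) - (N - 2 * D * ctr A B) / 2)
    (h59 : σ.reg 59 = if N = 2 * D * hiEnd A B then 1 else 0) (h3 : 0 < σ.reg 3)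
    (h3n : σ.reg 3 ≤ n) (h2 : (σ.reg 2 : ℝ) = valAt A B N D * σ.reg 3) (hcap : cap + 1 ≤ b)
    (hb : (m + n + M + 2) ^ 30 ≤ b) (hZ : kappa m n ^ 2 ≤ Z) :
    Run b Z tailProg σ fun σ' =>
      (N = 2 * D * hiEnd A B ∧ σ'.reg 57 = 0 ∧ IsReconstruction A B σ') ∨
      ∃ N' D', LoopInv A B cap N' D' σ' ∧
        remaining A B (N' / (2 * D')) < remaining A B (N / (2 * D)) := by
  set P := m + n + M + 2 with hP
  have p2 : 2 ≤ P := by omega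
  have hPb : ∀ {k}, k ≤ 30 → P ^ k ≤ b := fun hk => (Nat.pow_le_pow_right (by omega) hk).trans hb
  have hDP : D ≤ P ^ 2 := hI.pt.le.trans (Nat.pow_le_pow_left (kappa_le.trans (by omega)) 2)
  have hDb : ((2 * kappa m n ^ 2 : ℕ) : ℤ) ≤ b := by
    have := (Nat.pow_le_pow_left ((kappa_le (m := m) (n := n)).trans (by omega : n ≤ P)) 2)
    exact_mod_cast (mul_le_pow (k := 1) (by simpa) this rfl).trans (hPb (k := 3) (by norm_num))
  have hDr : (0 : ℝ) < D := by have := hI.pt.one_le; positivity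
  set X := N - 2 * D * ctr A B with hX
  have hxy : X - X / 2 - X / 2 = 0 ∨ X - X / 2 - X / 2 = 1 := by omega
  have hval := gameAt_isVal_valAt h hI.pt
  have hvb : |valAt A B N D| ≤ payBound A B := by
    have : Nonempty (Fin (gameAt A B N D).cols) := h.nonempty
    exact hval.abs_le (gameAt_valid h).rg (gameAt_payLE h hI.pt)
  have h2b : |σ.reg 2| ≤ (payBound A B * n : ℕ) := by
    have h1 : |(σ.reg 2 : ℝ)| ≤ payBound A B * n := by
      rw [h2, abs_mul]
      have h4 : |(σ.reg 3 : ℝ)| ≤ n := by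
        rw [abs_of_pos (by exact_mod_cast h3)]
        exact_mod_cast h3n
      gcongr
    exact_mod_cast h1
  set p : ℤ := 2 * σ.reg 2 - (X - X / 2 - X / 2) * σ.reg 3 with hp
  set q : ℤ := 2 * D * σ.reg 3 with hq
  have hs : Sampled A B N D p q := by
    refine ⟨hI.pt, by have := hI.pt.one_le; positivity, ?_⟩
    rw [hp, hq]
    push_cast
    rw [h2, valAt, ← hX]
    push_cast
    ring
  have hpb : |p| ≤ (b : ℤ) := by
    have e1 : payBound A B * n ≤ P ^ 11 := mul_le_pow (l := 1) (h.payBound_le le_rfl) (by simp; omega) rfl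
    have e2 : ((2 * (payBound A B * n) + n : ℕ) : ℤ) ≤ b := by
      exact_mod_cast (add_le_pow p2 (mul_le_pow (k := 1) (by simpa) e1 rfl)
        ((by simp; omega : n ≤ P ^ 1).trans (Nat.pow_le_pow_right (by omega) (by norm_num)))
        (Nat.lt_succ_self _)).trans (hPb (by norm_num))
    have e3 : |(X - X / 2 - X / 2) * σ.reg 3| ≤ n := by
      rcases hxy with h | h <;> rw [h]
      · simp
      · rw [one_mul, abs_of_pos h3]; exact h3n
    have e4 := abs_sub (2 * σ.reg 2) ((X - X / 2 - X / 2) * σ.reg 3)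
    rw [abs_mul 2] at e4
    simp only [Nat.abs_ofNat] at e4
    push_cast at *
    linarith
  have hqb : |q| ≤ (b : ℤ) := by
    have e1 : 2 * D * n ≤ b := (mul_le_pow (l := 1) (mul_le_pow (k := 1) (by simpa) hDP rfl)
      (by simp; omega) rfl).trans (hPb (k := 4) (by norm_num))
    rw [abs_of_pos hs.pos, hq]
    calc 2 * (D : ℤ) * σ.reg 3 ≤ 2 * D * n := by gcongr
      _ ≤ b := by exact_mod_cast e1
  refine Run.seq hc (Run.set hc hσ p (by simp [h61, h62, hp, hX]) (by simpa [regExp] using hpb)) ?_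
  rintro σ₁ hσ₁ - rfl
  refine Run.seq hc (Run.set hc hσ₁ q (by simp [hI.r51, hq]) (by simpa [regExp] using hqb)) ?_
  rintro σ₂ hσ₂ hF₂ rfl
  generalize hs2 : (σ.setReg 67 p).setReg 68 q = σ₂ at hσ₂
  have hreg : ∀ x, x ≠ 67 → x ≠ 68 → σ₂.reg x = σ.reg x := by
    intro x h1 h2; simp [← hs2, h1, h2]
  have hmem : σ₂.mem = σ.mem := by simp [← hs2]
  have e67 : σ₂.reg 67 = p := by simp [← hs2]
  have e68 : σ₂.reg 68 = q := by simp [← hs2]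
  have hr0 : (0 : ℤ) ≤ remaining A B (N / (2 * D)) := by positivity
  have hlo : (if N = 2 * D * hiEnd A B then (1 : ℤ) else 0) = 0 ∨
      (if N = 2 * D * hiEnd A B then (1 : ℤ) else 0) = 1 ∧ (N : ℝ) / (2 * D) = hiEnd A B := by
    split_ifs with h1
    · refine Or.inr ⟨rfl, ?_⟩
      rw [h1]
      push_cast
      field_simp
    · exact Or.inl rfl
  obtain ⟨N', D', hprev⟩ : ∃ (N' : ℤ) (D' : ℕ), (σ.reg 58 = 1 ∧ (N : ℝ) / (2 * D) = loEnd A B ∧ σ.reg 5 = 0 ∧ σ.reg 56 = 0 ∧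
      PInv A B (loEnd A B) σ) ∨ (Prev A B N' D' σ ∧ (N' : ℝ) / (2 * D') < N / (2 * D) ∧
      ∀ x : ℝ, (N' : ℝ) / (2 * D') < x → x < N / (2 * D) → ¬ IsGrid (kappa m n) x) := by
    rcases hI.prev with h | ⟨N', D', h⟩
    · exact ⟨0, 0, Or.inl h⟩
    · exact ⟨N', D', Or.inr h⟩
  have tP : ∀ {u}, PInv A B u σ → PInv A B u σ₂ := fun hP =>
    hP.congr (hreg 4 (by norm_num) (by norm_num)) (fun a _ => by rw [hmem])
  refine Run.seq hc (run_emitPiece hc h hσ₂ (N := N) (D := D) (N' := N') (D' := D') (p := p) (q := q)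
    (p' := σ.reg 54) (q' := σ.reg 55) (by rw [hreg 50 (by norm_num) (by norm_num)]; exact hI.r50)
    (by rw [hreg 51 (by norm_num) (by norm_num)]; exact hI.r51) e67 e68 hs
    (c := cap - remaining A B (N / (2 * D)))
    (by rw [hreg 4 (by norm_num) (by norm_num)]; linarith [hI.r4]) (by linarith) hDb ?_) ?_
  · simp only [hreg _ (by norm_num : 58 ≠ 67) (by norm_num), hreg _ (by norm_num : 52 ≠ 67) (by norm_num),
      hreg _ (by norm_num : 53 ≠ 67) (by norm_num), hreg _ (by norm_num : 54 ≠ 67) (by norm_num),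
      hreg _ (by norm_num : 55 ≠ 67) (by norm_num)]
    rcases hprev with ⟨h8, h9, -, -, h10⟩ | ⟨hpr, hlt, hgap⟩
    · exact Or.inl ⟨by rw [h8]; norm_num, h9, tP h10⟩
    · exact Or.inr ⟨hpr.r58, hpr.r52, hpr.r53, trivial, trivial, hpr.sampled, hlt, hgap, tP hpr.pieces⟩
  rintro σ₃ hσ₃ hF₃ ⟨hP₃, h4₃⟩
  have hreg₃ : ∀ x, emitPiece.wr x = false → x ≠ 67 → x ≠ 68 → σ₃.reg x = σ.reg x := by
    intro x h1 h2 h3; rw [hF₃.reg x h1, hreg x h2 h3]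
  refine Run.seq hc (run_emitZero hc h hσ₃ (N := N) (D := D) (N' := N') (D' := D') (p := p) (q := q)
    (p' := σ.reg 54) (q' := σ.reg 55)
    (by rw [hreg₃ 50 rfl (by norm_num) (by norm_num)]; exact hI.r50)
    (by rw [hreg₃ 51 rfl (by norm_num) (by norm_num)]; exact hI.r51)
    (by rw [hF₃.reg 67 rfl]; exact e67) hs
    (c := cap - remaining A B (N / (2 * D)))
    (by rw [hreg₃ 5 rfl (by norm_num) (by norm_num)]; linarith [hI.r5]) (by linarith) hDb ?_ ?_) ?_
  · rw [hreg₃ 59 rfl (by norm_num) (by norm_num), h59]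
    exact hlo
  · rw [hreg₃ 58 rfl (by norm_num) (by norm_num), hreg₃ 5 rfl (by norm_num) (by norm_num),
      hreg₃ 56 rfl (by norm_num) (by norm_num)]
    rcases hprev with ⟨h8, h9, h10, h11, -⟩ | ⟨hpr, hlt, hgap⟩
    · exact Or.inl ⟨h8, h9, h10, h11⟩
    · refine Or.inr ⟨hpr.r58, hpr.sampled, hpr.r56, hlt, hgap, hpr.zeros.congr
        (hreg₃ 5 rfl (by norm_num) (by norm_num)) fun a ha => ?_⟩
      rw [hF₃.mem a (by fin_cases ha <;> rfl), hmem]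
  rw [hreg₃ 59 rfl (by norm_num) (by norm_num)]
  rintro σ₄ hσ₄ hF₄ ⟨hZ₄, hZd₄, h5₄⟩
  have hP₄ : PInv A B (N / (2 * D)) σ₄ := hP₃.congr (hF₄.reg 4 rfl)
    (fun a ha => hF₄.mem a (by fin_cases ha <;> rfl))
  have h4₄ : σ₄.reg 4 ≤ cap - remaining A B (N / (2 * D)) + 1 := by rw [hF₄.reg 4 rfl]; exact h4₃
  have hreg₄ : ∀ x, emitPiece.wr x = false → emitZero.wr x = false → x ≠ 67 → x ≠ 68 →
      σ₄.reg x = σ.reg x := by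
    intro x h1 h2 h3 h4; rw [hF₄.reg x h2, hreg₃ x h1 h3 h4]
  have e67' : σ₄.reg 67 = p := by rw [hF₄.reg 67 rfl, hF₃.reg 67 rfl, e67]
  have e68' : σ₄.reg 68 = q := by rw [hF₄.reg 68 rfl, hF₃.reg 68 rfl, e68]
  have e50 : σ₄.reg 50 = N := by rw [hreg₄ 50 rfl rfl (by norm_num) (by norm_num), hI.r50]
  have e51 : σ₄.reg 51 = D := by rw [hreg₄ 51 rfl rfl (by norm_num) (by norm_num), hI.r51]
  have e59 : σ₄.reg 59 = σ.reg 59 := hreg₄ 59 rfl rfl (by norm_num) (by norm_num)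
  have hS₄ : Static A B σ₄ := by
    have hS₂ : Static A B σ₂ := hI.static.congr (c := .assign 67 1 ;; .assign 68 1)
      ⟨fun x hx => hreg x (by rintro rfl; exact absurd hx (by decide))
        (by rintro rfl; exact absurd hx (by decide)), fun a _ => by rw [hmem]⟩ (by decide) (by decide)
    exact (hS₂.congr hF₃ (by decide) (by decide)).congr hF₄ (by decide) (by decide)
  have one : |(1 : ℤ)| ≤ (b : ℤ) ^ 1 := by simpa using one_le_pow_cast hc 1
  have hsmall : ∀ (P : Prop) [Decidable P], |(if P then (1 : ℤ) else 0)| ≤ (b : ℤ) ^ 1 := by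
    intro P _
    split_ifs
    · exact one
    · simp
  refine Run.seq hc (Q' := fun σ' => σ'.reg 52 = N ∧ σ'.reg 53 = D ∧ σ'.reg 54 = p ∧
    σ'.reg 55 = q ∧ (σ'.reg 56 ≠ 0 ↔ p = 0) ∧ σ'.reg 58 = 0 ∧ σ'.reg 57 = 1 - σ.reg 59) ?_ ?_
  · refine Run.seq hc (Run.set hc hσ₄ (if p = 0 then 1 else 0) (by simp [e67']) (hsmall _)) ?_
    rintro σ₅ hσ₅ - rfl
    refine Run.seq hc (Run.assignT hc hσ₅ (Q := (· = _)) N (by simp [e50]) (by decide) (fun _ => rfl)) ?_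
    rintro σ₅ hσ₅ - rfl
    refine Run.seq hc (Run.assignT hc hσ₅ (Q := (· = _)) D (by simp [e51]) (by decide) (fun _ => rfl)) ?_
    rintro σ₅ hσ₅ - rfl
    refine Run.seq hc (Run.assignT hc hσ₅ (Q := (· = _)) p (by simp [e67']) (by decide) (fun _ => rfl)) ?_
    rintro σ₅ hσ₅ - rfl
    refine Run.seq hc (Run.assignT hc hσ₅ (Q := (· = _)) q (by simp [e68']) (by decide) (fun _ => rfl)) ?_
    rintro σ₅ hσ₅ - rfl
    refine Run.seq hc (Run.set hc hσ₅ 0 (by simp) (by rw [abs_zero]; positivity)) ?_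
    rintro σ₅ hσ₅ - rfl
    refine Run.assign hc hσ₅ (1 - σ.reg 59) (by simp [e59]) ?_ (fun _ => ?_)
    · rw [h59]
      split_ifs
      · simp
      · exact one
    · simp
  rintro σ₅ hσ₅ hF₅ ⟨f52, f53, f54, f55, f56, f58, f57⟩
  have hS₅ := hS₄.congr hF₅ (by decide) (by decide)
  refine Run.mono (run_nextProg hc h hσ₅ hS₅ hI.pt ((hF₅.reg 50 rfl).trans e50)
    ((hF₅.reg 51 rfl).trans e51) ((hF₅.reg 59 rfl).trans (e59.trans h59)) hb hZ) ?_
  intro σ₆ hσ₆ hF₆ hnext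
  have hP₆ : PInv A B (N / (2 * D)) σ₆ := hP₄.congr ((hF₆.reg 4 rfl).trans (hF₅.reg 4 rfl))
    (fun a ha => by rw [hF₆.mem a rfl, hF₅.mem a rfl])
  have h57₆ : σ₆.reg 57 = 1 - σ.reg 59 := (hF₆.reg 57 rfl).trans f57
  by_cases hl : N = 2 * D * hiEnd A B
  · rw [if_pos hl] at h59 hlo
    have hZd : ZDone A B σ₆ := (hZd₄ h59).congr ((hF₆.reg 5 rfl).trans (hF₅.reg 5 rfl))
      (fun a ha => by rw [hF₆.mem a rfl, hF₅.mem a rfl])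
    refine Or.inl ⟨hl, by rw [h57₆, h59]; norm_num, ?_⟩
    have ht : (N : ℝ) / (2 * D) = hiEnd A B := (hlo.resolve_left (by norm_num)).2
    rw [ht] at hP₆
    exact hP₆.isReconstruction h hZd
  · rw [if_neg hl] at h59
    obtain ⟨N₁, D₁, g50, g51, hpt, hlt, hgap⟩ := hnext hl
    have hZ₆ : ZInv A B (N / (2 * D)) σ₆ := (hZ₄ h59).congr ((hF₆.reg 5 rfl).trans (hF₅.reg 5 rfl))
      (fun a ha => by rw [hF₆.mem a rfl, hF₅.mem a rfl])
    have hcard : remaining A B (N₁ / (2 * D₁)) < remaining A B (N / (2 * D)) :=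
      card_gridFrom_lt hI.pt.one_le hI.pt.le hI.pt.lo hI.pt.hi hlt
    refine Or.inr ⟨N₁, D₁, ⟨hS₅.congr hF₆ (by decide) (by decide), hpt, g50, g51,
      by rw [h57₆, h59]; norm_num, ?_, ?_, Or.inr ⟨N, D, ?_, hlt, hgap⟩⟩, hcard⟩
    · rw [hF₆.reg 4 rfl, hF₅.reg 4 rfl]
      omega
    · rw [hF₆.reg 5 rfl, hF₅.reg 5 rfl]
      omega
    · have g54 : σ₆.reg 54 = p := (hF₆.reg 54 rfl).trans f54
      have g55 : σ₆.reg 55 = q := (hF₆.reg 55 rfl).trans f55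
      refine ⟨by rw [g54, g55]; exact hs, (hF₆.reg 52 rfl).trans f52, (hF₆.reg 53 rfl).trans f53, ?_,
        (hF₆.reg 58 rfl).trans f58, hP₆, hZ₆⟩
      rw [g54, hF₆.reg 56 rfl]
      exact f56

end

/-! ### The complete program -/

/-- Processes one sample point; `X` evaluates the game. -/
def bodyCom (X : Com) : Com :=
  .assign 59 (.eq (rg 50) (2 * rg 51 * rg 37)) ;; prepProg ;; X ;; tailProg

/-- Starts at the first sample point. -/
def initProg : Com :=
  .assign 50 (2 * rg 38) ;; .assign 51 1 ;; .assign 4 (0 - 1) ;; .assign 5 0 ;; .assign 56 0 ;;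
  -- Together with the initial `0` in array 7, this is the forged slope `1 / 0` at index `-1`, which
  -- no true slope equals.
  .store 6 (0 - 1) 0 1 ;; .assign 57 1 ;; .assign 58 1

/-- What precedes the main loop. -/
def headProg : Com := scanProg ;; setupProg ;; copyProg ;; initProg

/-- The reconstruction, where `X` evaluates the games. -/
def reconProg (X : Com) : Com := headProg ;; .loop (rg 57) (bodyCom X)

/-- The number of sample points. -/
noncomputable def gridSize (A B : Matrix (Fin m) (Fin n) (WithBot ℤ)) : ℕ :=
  remaining A B (((2 * loEnd A B : ℤ) : ℝ) / (2 * (1 : ℕ)))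

section

variable {b Z : ℕ} {N : ℤ} {D : ℕ}

theorem LoopInv.congr {cap : ℤ} {σ σ' : State} (h : LoopInv A B cap N D σ) {c : Com}
    (hF : Fr c σ σ') (h1 : ∀ x ∈ [0, 1, 10, 35, 36, 37, 38, 40, 41, 42], c.wr x = false)
    (h2 : ∀ x ∈ [0, 2, 20, 21], c.wm x = false)
    (h3 : ∀ x ∈ [4, 5, 50, 51, 52, 53, 54, 55, 56, 57, 58], c.wr x = false)
    (h4 : ∀ x ∈ [4, 5, 6, 7, 8, 9, 10, 11, 12, 13], c.wm x = false) : LoopInv A B cap N D σ' := by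
  have r : ∀ x ∈ [4, 5, 50, 51, 52, 53, 54, 55, 56, 57, 58], σ'.reg x = σ.reg x :=
    fun x hx => hF.reg x (h3 x hx)
  have e4 := r 4 (by simp)
  have e5 := r 5 (by simp)
  have hP : ∀ {u}, PInv A B u σ → PInv A B u σ' := fun hp => hp.congr e4
    fun a ha => hF.mem a (h4 a (by simp at ha ⊢; omega))
  refine ⟨h.static.congr hF h1 h2, h.pt, (r 50 (by simp)).trans h.r50, (r 51 (by simp)).trans h.r51,
    (r 57 (by simp)).trans h.r57, e4 ▸ h.r4, e5 ▸ h.r5, ?_⟩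
  rcases h.prev with ⟨g1, g2, g3, g4, g5⟩ | ⟨N', D', g, g'⟩
  · exact Or.inl ⟨(r 58 (by simp)).trans g1, g2, e5.trans g3, (r 56 (by simp)).trans g4, hP g5⟩
  · refine Or.inr ⟨N', D', ⟨?_, (r 52 (by simp)).trans g.r52, (r 53 (by simp)).trans g.r53, ?_,
      (r 58 (by simp)).trans g.r58, hP g.pieces, ?_⟩, g'⟩
    · rw [r 54 (by simp), r 55 (by simp)]; exact g.sampled
    · rw [r 54 (by simp), r 56 (by simp)]; exact g.r56
    · exact g.zeros.congr e5 fun a ha => hF.mem a (h4 a (by simp at ha ⊢; omega))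

/-- A constant that bounds the running time of the body of the main loop. -/
def bodyK (k : ℕ) : ℕ :=
  (Com.assign 59 (.eq (rg 50) (2 * rg 51 * rg 37))).kc + (prepProg.kc + (k + tailProg.kc))

theorem exec_body (hc : Ctx b Z) (h : Admissible A B M) {k : ℕ} {X : Com} {L : Game → List Game}
    (hX : EvalSpec b Z k X L A B) {σ : State} (hσ : Ty b σ) {cap : ℤ}
    (hI : LoopInv A B cap N D σ) (hcap : cap + 1 ≤ b) (hb : (m + n + M + 2) ^ 30 ≤ b)
    (hZ : kappa m n ^ 2 ≤ Z) (hZ' : m + n ≤ Z) :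
    ∃ σ' t, Exec (bodyCom X) σ σ' t (L (gameAt A B N D)) ∧ t ≤ bodyK k * Z ^ bodyK k ∧ Ty b σ' ∧
      ((N = 2 * D * hiEnd A B ∧ σ'.reg 57 = 0 ∧ IsReconstruction A B σ') ∨
      ∃ N' D', LoopInv A B cap N' D' σ' ∧
        remaining A B (N' / (2 * D')) < remaining A B (N / (2 * D))) := by
  have hb20 : (m + n + M + 2) ^ 20 ≤ b := (Nat.pow_le_pow_right (by omega) (by norm_num)).trans hb
  obtain ⟨σ₁, t₁, x₁, l₁, hσ₁, rfl⟩ := Run.set hc hσ (x := 59)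
    (e := .eq (rg 50) (2 * rg 51 * rg 37)) (if N = 2 * D * hiEnd A B then 1 else 0)
    (by simp [hI.r50, hI.r51, hI.static.r37]) (by
      split_ifs
      · simpa using one_le_pow_cast hc _
      · simp)
  have hI₁ := hI.congr x₁.fr (by decide) (by decide) (by decide) (by decide)
  obtain ⟨σ₂, t₂, x₂, l₂, hσ₂, hL, h61, h62⟩ :=
    run_prepProg hc h hσ₁ hI₁.static hI.pt hI₁.r50 hI₁.r51 hb20 hZ'
  have hI₂ := hI₁.congr x₂.fr (by decide) (by decide) (by decide) (by decide)
  obtain ⟨σ₃, t₃, x₃, l₃, hσ₃, hF₃, h3, h3n, h2⟩ := hX N D σ₂ hI.pt hσ₂ hI₂.static hL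
  have hI₃ := hI₂.congr hF₃ (by decide) (by decide) (by decide) (by decide)
  obtain ⟨σ₄, t₄, x₄, l₄, hσ₄, hpost⟩ := run_tailProg hc h hσ₃ hI₃
    ((hF₃.reg 61 rfl).trans h61) ((hF₃.reg 62 rfl).trans h62)
    ((hF₃.reg 59 rfl).trans ((x₂.fr.reg 59 rfl).trans (by simp))) h3 h3n h2 hcap hb hZ
  refine ⟨σ₄, _, by simpa [bodyCom] using Exec.seq x₁ (x₂.seq (x₃.seq x₄)), ?_, hσ₄, hpost⟩
  have e1 := mul_pow_add_le (k := k) (l := tailProg.kc) hc.one_le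
  have e2 := mul_pow_add_le (k := prepProg.kc) (l := k + tailProg.kc) hc.one_le
  have e3 := mul_pow_add_le (k := (Com.assign 59 (.eq (rg 50) (2 * rg 51 * rg 37))).kc)
    (l := prepProg.kc + (k + tailProg.kc)) hc.one_le
  simp only [bodyK]
  omega

/-- A constant that bounds the running time of one turn of the main loop. -/
def turnK (k : ℕ) : ℕ := (rg 57).wt + 1 + bodyK k

/-- Induction on the number of grid points that remain. The list records the sample points visited,
so that the running time can be charged to samples, and thereby to oracle calls, rather than to a
bound such as `Z`. -/
theorem exec_main (hc : Ctx b Z) (h : Admissible A B M) {k : ℕ} {X : Com} {L : Game → List Game}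
    (hX : EvalSpec b Z k X L A B) {cap : ℤ} (hcap : cap + 1 ≤ b) (hb : (m + n + M + 2) ^ 30 ≤ b)
    (hZ : kappa m n ^ 2 ≤ Z) (hZ' : m + n ≤ Z) (r : ℕ) :
    ∀ (N : ℤ) (D : ℕ) (σ : State), remaining A B (N / (2 * D)) ≤ r → Ty b σ →
      LoopInv A B cap N D σ → ∃ σ' t, ∃ l : List (ℤ × ℕ),
        Exec (.loop (rg 57) (bodyCom X)) σ σ' t (l.flatMap fun p => L (gameAt A B p.1 p.2)) ∧
        (∀ p ∈ l, Pt A B p.1 p.2) ∧ l.length ≤ remaining A B (N / (2 * D)) ∧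
        t ≤ (l.length + 1) * (turnK k * Z ^ turnK k) ∧ IsReconstruction A B σ' := by
  have e0 := le_mul_pow (a := (rg 57).wt) (Z := Z) hc.one_le le_rfl
  have e1 := mul_pow_add_le (k := (rg 57).wt + 1) (l := bodyK k) hc.one_le
  have e2 : (rg 57).wt * Z + 1 + bodyK k * Z ^ bodyK k ≤ turnK k * Z ^ turnK k := by
    simp only [turnK]; omega
  induction r with
  | zero =>
    intro N D σ hr hσ hI
    -- The current sample point is itself a grid point, so at least one remains.
    have := card_gridFrom_lt hI.pt.one_le hI.pt.le hI.pt.lo hI.pt.hi (lt_add_one _)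
    simp only [remaining] at hr
    omega
  | succ r ih =>
    intro N D σ hr hσ hI
    have hpos : 0 < remaining A B (N / (2 * D)) := (Nat.zero_le _).trans_lt
      (card_gridFrom_lt hI.pt.one_le hI.pt.le hI.pt.lo hI.pt.hi (lt_add_one _))
    have hcost := cost_le hc hσ (rg 57)
    obtain ⟨σ₁, t₁, x₁, l₁, hσ₁, hpost⟩ := exec_body hc h hX hσ hI hcap hb hZ hZ'
    rcases hpost with ⟨-, h57, hrec⟩ | ⟨N', D', hI', hlt⟩
    · have hcost' := cost_le hc hσ₁ (rg 57)
      have x₂ := Exec.loop_true (e := rg 57) (by simp [hI.r57]) x₁ (.loop_false (by simpa using h57))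
      refine ⟨σ₁, _, [(N, D)], by simpa using x₂, by simpa using hI.pt, by simpa using Nat.succ_le_of_lt hpos, ?_, hrec⟩
      simp only [List.length_singleton]
      omega
    · obtain ⟨σ₂, t₂, l, x₂, hl, hlen, ht, hrec⟩ := ih N' D' σ₁ (by omega) hσ₁ hI'
      refine ⟨σ₂, _, (N, D) :: l, by simpa using Exec.loop_true (e := rg 57) (by simp [hI.r57]) x₁ x₂,
        List.forall_mem_cons.2 ⟨hI.pt, hl⟩, ?_, ?_, hrec⟩
      · simp only [List.length_cons]; omega
      · simp only [List.length_cons]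
        rw [Nat.succ_mul]
        omega

theorem run_initProg (hc : Ctx b Z) (h : Admissible A B M) {σ : State} (hσ : Ty b σ)
    (hS : Static A B σ) (h7 : σ.mem 7 (-1) 0 = 0) (hb : (m + n + M + 2) ^ 30 ≤ b) :
    Run b Z initProg σ (LoopInv A B (gridSize A B) (2 * loEnd A B) 1) := by
  have hκ := h.kappa_pos
  have hlt := h.lo_lt_hi
  have hp : Pt A B (2 * loEnd A B) 1 := ⟨le_rfl, Nat.one_le_pow _ _ hκ, by simp, by simp; omega⟩
  have hN : |2 * loEnd A B| ≤ (b : ℤ) ^ 1 := by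
    rw [pow_one]
    refine (hp.abs_shift_le h le_rfl).2.trans ?_
    exact_mod_cast (Nat.pow_le_pow_right (by omega) (by norm_num)).trans hb
  have one : |(1 : ℤ)| ≤ (b : ℤ) ^ 1 := by simpa using one_le_pow_cast hc 1
  have hstat : ∀ σ', Fr initProg σ σ' → Static A B σ' := fun σ' hF =>
    hS.congr hF (by decide) (by decide)
  refine Run.mono (Q := fun σ' => σ'.reg 50 = 2 * loEnd A B ∧ σ'.reg 51 = 1 ∧ σ'.reg 4 = -1 ∧
    σ'.reg 5 = 0 ∧ σ'.reg 56 = 0 ∧ σ'.mem 6 (-1) 0 = 1 ∧ σ'.reg 57 = 1 ∧ σ'.reg 58 = 1) ?_ ?_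
  · refine Run.seq hc (Run.set hc hσ (2 * loEnd A B) (by simp [hS.r38]) hN) ?_
    rintro σ₁ hσ₁ - rfl
    refine Run.seq hc (Run.set hc hσ₁ 1 (by simp) one) ?_
    rintro σ₁ hσ₁ - rfl
    refine Run.seq hc (Run.set hc hσ₁ (-1) (by simp) (by rw [abs_neg]; exact one)) ?_
    rintro σ₁ hσ₁ - rfl
    refine Run.seq hc (Run.set hc hσ₁ 0 (by simp) (by rw [abs_zero]; positivity)) ?_
    rintro σ₁ hσ₁ - rfl
    refine Run.seq hc (Run.set hc hσ₁ 0 (by simp) (by rw [abs_zero]; positivity)) ?_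
    rintro σ₁ hσ₁ - rfl
    refine Run.seq hc (Run.store hc hσ₁ (Q := (· = _)) 1 (by simp)
      (by simpa using one_le_pow_cast hc _) (fun _ => rfl)) ?_
    rintro σ₁ hσ₁ - rfl
    refine Run.seq hc (Run.set hc hσ₁ 1 (by simp) one) ?_
    rintro σ₁ hσ₁ - rfl
    refine Run.assign hc hσ₁ 1 (by simp) one (fun _ => ?_)
    simp
  · rintro σ' hσ' hF ⟨r50, r51, r4, r5, r56, m6, r57, r58⟩
    have ht : ((2 * loEnd A B : ℤ) : ℝ) / (2 * (1 : ℕ)) = loEnd A B := by push_cast; field_simp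
    refine ⟨hstat σ' hF, hp, r50, by simpa using r51, r57, ?_, ?_,
      Or.inl ⟨r58, ht, r5, r56, Or.inl ⟨rfl, r4, m6, (congrFun₂ (hF.mem 7 rfl) _ _).trans h7⟩⟩⟩
    · rw [r4, gridSize]; omega
    · rw [r5, gridSize]; omega

theorem load_ty (hc : Ctx b Z) (h : Admissible A B M) (hb : m + n + M ≤ b) :
    Ty b (load ⟨m, n, A, B⟩) := by
  have hflag : ∀ (C : Matrix (Fin m) (Fin n) (WithBot ℤ)) (i j : ℤ), |table flag C i j| ≤ (b : ℤ) ^ 1 := by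
    intro C i j
    have h1 := one_le_pow_cast hc 1
    rw [table]
    split_ifs with hij
    · have : ∀ v : WithBot ℤ, |flag v| ≤ 1 := fun v => by cases v <;> simp [flag]
      exact (this _).trans h1
    · rw [abs_zero]; positivity
  have hval : ∀ (C : Matrix (Fin m) (Fin n) (WithBot ℤ)), EntriesLE C M → ∀ i j : ℤ,
      |table val C i j| ≤ (b : ℤ) ^ 1 := by
    intro C hC i j
    rw [table]
    split_ifs with hij
    · refine (hC.abs_val_le _ _).trans ?_
      rw [pow_one]
      exact_mod_cast (by omega : M ≤ b)
    · rw [abs_zero]; positivity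
  constructor
  · intro x
    match x with
    | 0 => simp [load, regExp]; omega
    | 1 => simp [load, regExp]; omega
    | x + 2 => simp [load]
  · intro a i j
    match a with
    | 0 => exact hflag A i j
    | 1 => exact hval A h.bound_left i j
    | 2 => exact hflag B i j
    | 3 => exact hval B h.bound_right i j
    | a + 4 => simp [load]

theorem run_headProg (hc : Ctx b Z) (h : Admissible A B M) (hb : (m + n + M + 2) ^ 30 ≤ b)
    (hZ : (m + n) ^ 3 ≤ Z) :
    Run b Z headProg (load ⟨m, n, A, B⟩) (LoopInv A B (gridSize A B) (2 * loEnd A B) 1) := by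
  have hPb : ∀ {k}, k ≤ 30 → (m + n + M + 2) ^ k ≤ b :=
    fun hk => (Nat.pow_le_pow_right (by omega) hk).trans hb
  have b1 := hPb (k := 1) (by norm_num)
  have b2 := hPb (k := 2) (by norm_num)
  have b3 : (m + n) ^ 3 ≤ b :=
    (Nat.pow_le_pow_left (by omega : m + n ≤ m + n + M + 2) 3).trans (hPb (k := 3) (by norm_num))
  have b4 : 2 * (m + n + M + 2) ≤ (m + n + M + 2) ^ 2 := by
    rw [sq]; exact Nat.mul_le_mul_right _ (by omega)
  have Z1 : m + n ≤ Z := by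
    refine le_trans ?_ hZ
    exact Nat.le_self_pow (by norm_num) _
  refine Run.seq hc (run_scanProg hc h (load_ty hc h (by omega)) (load_loaded _) hZ b3 (by omega)) ?_
  intro σ₁ hσ₁ hF₁ hs
  refine Run.seq hc (run_setupProg hc h hσ₁ ((hF₁.reg 0 rfl).trans rfl) ((hF₁.reg 1 rfl).trans rfl) hs
    (hPb (by norm_num))) ?_
  intro σ₂ hσ₂ hF₂ hp
  have hL : Loaded σ₂ ⟨m, n, A, B⟩ := by
    have hL := load_loaded ⟨m, n, A, B⟩
    refine ⟨(hF₂.reg 0 rfl).trans ((hF₁.reg 0 rfl).trans rfl),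
      (hF₂.reg 1 rfl).trans ((hF₁.reg 1 rfl).trans rfl), ?_⟩
    rw [hF₂.mem 0 rfl, hF₁.mem 0 rfl, hF₂.mem 1 rfl, hF₁.mem 1 rfl, hF₂.mem 2 rfl, hF₁.mem 2 rfl,
      hF₂.mem 3 rfl, hF₁.mem 3 rfl]
    exact hL.2.2
  refine Run.seq hc (run_copyProg hc hσ₂ hL hp (by omega) (by omega) (by omega) (by omega)) ?_
  intro σ₃ hσ₃ hF₃ hS
  refine run_initProg hc h hσ₃ hS ?_ hb
  rw [hF₃.mem 7 rfl, hF₂.mem 7 rfl, hF₁.mem 7 rfl]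
  rfl

theorem gridSize_le (h : Admissible A B M) :
    (gridSize A B : ℤ) ≤ 3 * kappa m n ^ 4 * (hiEnd A B - loEnd A B) :=
  card_gridFrom_le _ h.lo_lt_hi _

theorem gridSize_add_two_le (h : Admissible A B M) {P : ℕ} (hP : m + n + M + 2 ≤ P) :
    gridSize A B + 2 ≤ P ^ 12 := by
  have hκ := kappa_le (m := m) (n := n)
  have p2 : 2 ≤ P := by omega
  have e1 : 3 * kappa m n ^ 4 ≤ P ^ 6 := (mul_le_pow (k := 2) (by nlinarith)
    (Nat.pow_le_pow_left (by omega : kappa m n ≤ P) 4) rfl)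
  have e2 : M * n ^ 2 ≤ P ^ 3 := mul_le_pow (k := 1) (by simp; omega)
    (Nat.pow_le_pow_left (by omega : n ≤ P) 2) rfl
  have e3 : 4 * (M * n ^ 2) + 1 ≤ P ^ 4 * 2 := by
    have : 1 ≤ P ^ 3 := Nat.one_le_pow _ _ (by omega)
    have : 4 ≤ P := by have := h.rows_pos; have := h.cols_pos; omega
    rw [pow_succ]
    nlinarith
  have h1 := abs_le.1 h.abs_hiEnd_le
  have h2 := abs_le.1 h.abs_loEnd_le
  have e4 : (4 * (M * n ^ 2) + 1 : ℤ) ≤ (P : ℤ) ^ 4 * 2 := by exact_mod_cast e3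
  have e5 : hiEnd A B - loEnd A B ≤ (P : ℤ) ^ 4 * 4 := by linarith
  have e6 : (3 * kappa m n ^ 4 : ℤ) ≤ (P : ℤ) ^ 6 := by exact_mod_cast e1
  have e7 : (gridSize A B : ℤ) ≤ (P : ℤ) ^ 6 * (P ^ 4 * 4) := by
    refine (gridSize_le h).trans ?_
    have := h.lo_lt_hi
    gcongr
  have p4 : 4 ≤ P := by have := h.rows_pos; have := h.cols_pos; omega
  have e8 : P ^ 6 * (P ^ 4 * 4) + 2 ≤ P ^ 12 := by
    have h3 : 4 * 4 ≤ P * P := Nat.mul_le_mul p4 p4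
    have h4 : 1 ≤ P ^ 10 := Nat.one_le_pow _ _ (by omega)
    have h5 : P ^ 12 = P ^ 10 * (P * P) := by ring
    have h6 : P ^ 6 * (P ^ 4 * 4) = P ^ 10 * 4 := by ring
    rw [h5, h6]
    nlinarith
  have e9 : gridSize A B ≤ P ^ 6 * (P ^ 4 * 4) := by exact_mod_cast e7
  omega

theorem exec_reconProg (hc : Ctx b Z) (h : Admissible A B M) {k : ℕ} {X : Com}
    {L : Game → List Game} (hX : EvalSpec b Z k X L A B) (hb : (m + n + M + 2) ^ 30 ≤ b)
    (hZ : (m + n) ^ 3 ≤ Z) : ∃ σ' t, ∃ l : List (ℤ × ℕ),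
      Exec (reconProg X) (load ⟨m, n, A, B⟩) σ' t (l.flatMap fun p => L (gameAt A B p.1 p.2)) ∧
      (∀ p ∈ l, Pt A B p.1 p.2) ∧ l.length ≤ gridSize A B ∧
      t ≤ headProg.kc * Z ^ headProg.kc + (l.length + 1) * (turnK k * Z ^ turnK k) ∧
      IsReconstruction A B σ' := by
  have Z2 : (m + n) ^ 2 ≤ Z := (Nat.pow_le_pow_right (by have := h.rows_pos; omega) (by norm_num)).trans hZ
  have Z3 : kappa m n ^ 2 ≤ Z := (Nat.pow_le_pow_left (kappa_le.trans (by omega)) 2).trans Z2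
  have Z1 : m + n ≤ Z := (Nat.le_self_pow (by norm_num) _).trans Z2
  have hcap : (gridSize A B : ℤ) + 1 ≤ b := by
    have h1 := gridSize_add_two_le h le_rfl
    have h2 := (Nat.pow_le_pow_right (n := m + n + M + 2) (by omega) (by norm_num : 12 ≤ 30)).trans hb
    omega
  obtain ⟨σ₁, t₁, x₁, l₁, hσ₁, hI⟩ := run_headProg (A := A) (B := B) hc h hb hZ
  obtain ⟨σ₂, t₂, l, x₂, hl, hlen, ht, hrec⟩ := exec_main hc h hX hcap hb Z3 Z1 _ _ _ σ₁ le_rfl hσ₁ hI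
  exact ⟨σ₂, _, l, by simpa [reconProg] using x₁.seq x₂, hl, hlen, by omega, hrec⟩

end

/-! ### Sizes of the submitted games and the number of calls -/

section

variable {N : ℤ} {D : ℕ}

/-- If the parameter is at most `T` in absolute value, the total shift is at most `2 D T`; a quarter
of it is added to entries of size `D M`. -/
theorem Pt.hasSize_of_abs_le (hp : Pt A B N D) (h : Admissible A B M)
    (hlt : lowerC A B < upperC A B) {T C W : ℕ} (hT : |(N : ℝ) / (2 * D)| ≤ T) (hC : D * T ≤ 2 * C)
    (hW : D * M + C ≤ W) : (gameAt A B N D).HasSize (2 * m) n W := by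
  refine gameAt_hasSize h (C := C) ?_ (by exact_mod_cast hW)
  have hD : (0 : ℝ) < 2 * D := by have := hp.one_le; positivity
  rw [abs_div, abs_of_pos hD, div_le_iff₀ hD] at hT
  have h1 : |N| ≤ T * (2 * D) := by exact_mod_cast hT
  have h2 : (D * T : ℤ) ≤ 2 * C := by exact_mod_cast hC
  rw [ctr, if_pos hlt]
  simp only [mul_zero, sub_zero]
  linarith

/-- The sizes of the games for the sample points. -/
theorem Pt.hasSize (hp : Pt A B N D) (h : Admissible A B M) (hlt : lowerC A B < upperC A B) :
    (gameAt A B N D).HasSize (2 * m) n (kappa m n ^ 2 * (M + 4 * M * kappa m n ^ 2)) ∧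
    (ColsFin A B → (gameAt A B N D).HasSize (2 * m) n (kappa m n ^ 2 * (M + 4 * M * kappa m n))) ∧
    (AllFin A B → (gameAt A B N D).HasSize (2 * m) n (3 * M * kappa m n ^ 2)) := by
  have hDr : (0 : ℝ) < 2 * D := by have := hp.one_le; positivity
  have e1 : (loEnd A B : ℝ) ≤ N / (2 * D) := by
    rw [le_div_iff₀ hDr]
    have : (2 * D * loEnd A B : ℝ) ≤ N := by exact_mod_cast hp.lo
    linarith
  have e2 : (N : ℝ) / (2 * D) ≤ hiEnd A B := by
    rw [div_le_iff₀ hDr]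
    have : (N : ℝ) ≤ 2 * D * hiEnd A B := by exact_mod_cast hp.hi
    linarith
  obtain ⟨b1, b2, b3⟩ := h.abs_end_le hlt e1 e2
  have hM : 1 ≤ M := by
    have h1 := h.delta_pos hlt
    have h2 := h.delta_le
    omega
  have hD := hp.le
  refine ⟨?_, fun hc => ?_, fun hf => ?_⟩
  · refine hp.hasSize_of_abs_le h hlt (T := 4 * M * kappa m n ^ 2) (C := D * (2 * M * kappa m n ^ 2))
      (by exact_mod_cast b1) (by linarith) ?_
    rw [← mul_add]
    gcongr
    norm_num
  · refine hp.hasSize_of_abs_le h hlt (T := 4 * M * kappa m n) (C := D * (2 * M * kappa m n))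
      (by exact_mod_cast b2 hc) (by linarith) ?_
    rw [← mul_add]
    gcongr
    norm_num
  · refine hp.hasSize_of_abs_le h hlt (T := 2 * M + 1) (C := D * (2 * M)) (by exact_mod_cast b3 hf)
      ?_ ?_
    · nlinarith
    · calc D * M + D * (2 * M) = 3 * M * D := by ring
        _ ≤ _ := by gcongr

/-- If all differences are equal, the list of calls is empty and any nonnegative bound holds;
otherwise there is exactly one call for each sample point. -/
theorem callsWithin_samples (h : Admissible A B M) {l : List (ℤ × ℕ)} (hl : ∀ p ∈ l, Pt A B p.1 p.2)
    {T : ℤ} {W : ℕ} (hT : 0 ≤ T) (hlen : lowerC A B < upperC A B → (l.length : ℤ) ≤ T)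
    (hW : lowerC A B < upperC A B → ∀ (N : ℤ) (D : ℕ), Pt A B N D →
      (gameAt A B N D).HasSize (2 * m) n W) :
    CallsWithin (l.flatMap fun p => if scal A B = 0 then [] else [gameAt A B p.1 p.2]) T (2 * m) n W := by
  by_cases hlt : lowerC A B < upperC A B
  · have hs : scal A B = 1 := if_pos hlt
    simp only [hs, one_ne_zero, if_false, ← List.map_eq_flatMap]
    refine ⟨by simpa using hlen hlt, fun G hG => ?_⟩
    obtain ⟨p, hp, rfl⟩ := List.mem_map.1 hG
    have hV := gameAt_valid (A := A) (B := B) (N := p.1) (D := p.2) h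
    have hS := hW hlt _ _ (hl p hp)
    exact ⟨⟨hV, hS⟩, fun O _ => le_iSup₂_of_le _ ⟨hV, hS⟩ le_rfl⟩
  · have hs : scal A B = 0 := if_neg hlt
    simp only [hs, if_true]
    exact ⟨by simpa using hT, by simp⟩

end

/-! ### Polynomial time bounds -/

instance decidableCallFree : (c : Com) → Decidable c.CallFree
  | .skip => .isTrue trivial
  | .assign _ _ => .isTrue trivial
  | .store _ _ _ _ => .isTrue trivial
  | .seq c d => @instDecidableAnd _ _ (decidableCallFree c) (decidableCallFree d)
  | .ite _ c d => @instDecidableAnd _ _ (decidableCallFree c) (decidableCallFree d)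
  | .loop _ c => decidableCallFree c
  | .call => .isFalse id

theorem exists_poly_bound (K a e : ℕ) :
    ∃ c : ℕ, ∀ S : ℕ, 1 ≤ S → K * (a * S ^ e) ^ K ≤ c * S ^ c := by
  refine ⟨K * a ^ K + e * K, fun S hS => ?_⟩
  calc K * (a * S ^ e) ^ K = (K * a ^ K) * S ^ (e * K) := by rw [mul_pow, ← pow_mul]; ring
    _ ≤ _ := Nat.mul_le_mul (Nat.le_add_right _ _) (Nat.pow_le_pow_right hS (Nat.le_add_left _ _))

theorem size_pow_le {x k l : ℕ} (h : x ≤ 2 ^ k) : Nat.size (x ^ l) ≤ k * l + 1 := by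
  rw [Nat.size_le]
  calc x ^ l ≤ (2 ^ k) ^ l := Nat.pow_le_pow_left h l
    _ = 2 ^ (k * l) := (pow_mul _ _ _).symm
    _ < _ := Nat.pow_lt_pow_right (by norm_num) (Nat.lt_succ_self _)

/-- A program of time `x + y` where `x` and `y` are polynomial in `Z`. -/
theorem two_phase_le {K₁ K₂ Z r a : ℕ} (hZ : 1 ≤ Z) (hr : r ≤ a * Z ^ 2) :
    K₁ * Z ^ K₁ + r * (K₂ * Z ^ K₂) ≤ (K₁ + a * K₂ + K₂ + 2) * Z ^ (K₁ + a * K₂ + K₂ + 2) := by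
  have h1 : Z ^ K₁ ≤ Z ^ (K₁ + a * K₂ + K₂ + 2) := Nat.pow_le_pow_right hZ (by omega)
  have h2 : Z ^ 2 * Z ^ K₂ ≤ Z ^ (K₁ + a * K₂ + K₂ + 2) := by
    rw [← pow_add]; exact Nat.pow_le_pow_right hZ (by omega)
  calc K₁ * Z ^ K₁ + r * (K₂ * Z ^ K₂) ≤ K₁ * Z ^ K₁ + a * Z ^ 2 * (K₂ * Z ^ K₂) := by gcongr
    _ = K₁ * Z ^ K₁ + a * K₂ * (Z ^ 2 * Z ^ K₂) := by ring
    _ ≤ K₁ * Z ^ (K₁ + a * K₂ + K₂ + 2) + a * K₂ * Z ^ (K₁ + a * K₂ + K₂ + 2) := by gcongr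
    _ = (K₁ + a * K₂) * Z ^ (K₁ + a * K₂ + K₂ + 2) := by ring
    _ ≤ _ := Nat.mul_le_mul_right _ (by omega)

/-- With `P = m + n + M + 2`, the choice `Z = P ^ 15` exceeds the horizon, so value iteration counts
as a short loop; the number of samples is below `Z ^ 2`. -/
theorem exists_reconstruction_pseudoPoly :
    ∃ c : ℕ, ∀ (m n M : ℕ) (A B : Matrix (Fin m) (Fin n) (WithBot ℤ)), Admissible A B M →
      ∃ (σ : State) (t : ℕ), Exec (reconProg viProg) (load ⟨m, n, A, B⟩) σ t [] ∧
        IsReconstruction A B σ ∧ t ≤ c * (m + n + M) ^ c := by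
  obtain ⟨c, hcb⟩ := exists_poly_bound (headProg.kc + 1 * turnK viProg.kc + turnK viProg.kc + 2) (2 ^ 15) 15
  refine ⟨c, fun m n M A B h => ?_⟩
  have hm := h.rows_pos
  have hn := h.cols_pos
  set P := m + n + M + 2 with hP
  have p4 : 4 ≤ P := by omega
  have pw : ∀ {k l}, k ≤ l → P ^ k ≤ P ^ l := fun hkl => Nat.pow_le_pow_right (by omega) hkl
  have hsize : Nat.size (P ^ 30) ≤ P ^ 15 := by
    have h1 := size_pow_le (l := 30) (Nat.lt_two_pow_self (n := P)).le
    have h2 : 4 * 4 * 4 * 4 ≤ P * P * P * P := by gcongr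
    have h3 : P ^ 5 = P * P * P * P * P := by ring
    have h4 := pw (show 5 ≤ 15 by norm_num)
    nlinarith
  have hc : Ctx (P ^ 30) (P ^ 15) := ⟨by
    have := pw (show 1 ≤ 30 by norm_num)
    rw [pow_one] at this
    omega, Nat.one_le_pow _ _ (by omega), hsize⟩
  have hZ3 : (m + n) ^ 3 ≤ P ^ 15 :=
    (Nat.pow_le_pow_left (by omega : m + n ≤ P) 3).trans (pw (by norm_num))
  have hZ2 : 2 * m + n ≤ P ^ 15 := by
    have h1 : P * 4 ≤ P ^ 2 := by rw [sq]; gcongr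
    have h2 := pw (show 2 ≤ 15 by norm_num)
    omega
  obtain ⟨σ, t, l, hx, hl, hlen, ht, hrec⟩ := exec_reconProg hc h
    (evalSpec_viProg hc h le_rfl hZ2 (h.horizon_le le_rfl)) le_rfl hZ3
  refine ⟨σ, t, List.flatMap_eq_nil_iff.2 (fun _ _ => rfl) ▸ hx, hrec, ht.trans ?_⟩
  have hg := gridSize_add_two_le h (P := P) le_rfl
  refine (two_phase_le (a := 1) hc.one_le ?_).trans (le_trans ?_ (hcb (m + n + M) (by omega)))
  · have h1 := pw (show 12 ≤ 30 by norm_num)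
    have h2 : (P ^ 15) ^ 2 = P ^ 30 := (pow_mul P 15 2).symm
    omega
  · rw [← mul_pow]
    gcongr
    omega

theorem size_bound {m n M : ℕ} : Nat.size ((m + n + M + 2) ^ 30) ≤
    (m + n + Nat.size M + 2) * 30 + 1 := by
  refine size_pow_le ?_
  have h1 : M + 1 ≤ 2 ^ Nat.size M := Nat.lt_size_self M
  have h2 : m + n + 2 ≤ 2 ^ (m + n + 2) := Nat.lt_two_pow_self.le
  have h3 : 1 ≤ 2 ^ Nat.size M := Nat.one_le_two_pow
  have h4 : 2 ^ (m + n + Nat.size M + 2) = 2 ^ (m + n + 2) * 2 ^ Nat.size M := by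
    rw [← pow_add]; congr 1; omega
  rw [h4]
  nlinarith

/-- Here `Z` is polynomial in `m`, `n` and the bit length of `M`, which still bounds the lengths of
all numbers. The main loop may have more than `Z` turns, but each turn pays with a call. Without
calls, if all differences are equal, there are at most `6 κ⁴` samples, and the whole run is
polynomial. -/
theorem exists_reconstruction_oracle :
    ∃ c : ℕ, ∀ (m n M : ℕ) (A B : Matrix (Fin m) (Fin n) (WithBot ℤ)), Admissible A B M →
      ∃ (σ : State) (t : ℕ) (l : List (ℤ × ℕ)),
        Exec (reconProg (.ite (rg 40) .call viProg)) (load ⟨m, n, A, B⟩) σ t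
          (l.flatMap fun p => if scal A B = 0 then [] else [gameAt A B p.1 p.2]) ∧
        IsReconstruction A B σ ∧ (∀ p ∈ l, Pt A B p.1 p.2) ∧ l.length ≤ gridSize A B ∧
        t ≤ ((l.flatMap fun p => if scal A B = 0 then [] else [gameAt A B p.1 p.2]).length + 1) *
          (c * (m + n + Nat.size M) ^ c) := by
  set k := (Com.ite (rg 40) .call viProg).kc with hk
  obtain ⟨c, hcb⟩ := exists_poly_bound (headProg.kc + 7 * turnK k + turnK k + 2) 100 5
  refine ⟨c, fun m n M A B h => ?_⟩
  have hm := h.rows_pos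
  have hn := h.cols_pos
  set S := m + n + Nat.size M with hS
  have s2 : 2 ≤ S := by omega
  have sw : ∀ {k l}, k ≤ l → S ^ k ≤ S ^ l := fun hkl => Nat.pow_le_pow_right (by omega) hkl
  have s15 := sw (show 1 ≤ 5 by norm_num)
  have s35 := sw (show 3 ≤ 5 by norm_num)
  have s25 := sw (show 2 ≤ 5 by norm_num)
  rw [pow_one] at s15
  have hκ := kappa_le (m := m) (n := n)
  have hκS : kappa m n ^ 2 ≤ S ^ 2 := Nat.pow_le_pow_left (by omega) 2
  have hc : Ctx ((m + n + M + 2) ^ 30) (100 * S ^ 5) := by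
    refine ⟨?_, by omega, size_bound.trans ?_⟩
    · have : (m + n + M + 2) ^ 1 ≤ (m + n + M + 2) ^ 30 := Nat.pow_le_pow_right (by omega) (by norm_num)
      rw [pow_one] at this
      omega
    · omega
  have hZ3 : (m + n) ^ 3 ≤ 100 * S ^ 5 := by
    have := Nat.pow_le_pow_left (by omega : m + n ≤ S) 3
    omega
  have hdeg : scal A B = 0 → horizon A B ≤ 100 * S ^ 5 := by
    intro hs
    rw [horizon, payBound, hs]
    simp only [zero_mul, Int.toNat_zero, zero_add, mul_one]
    have h1 : kappa m n ^ 2 * n ^ 3 ≤ S ^ 2 * S ^ 3 := by gcongr; omega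
    have h2 : n ^ 3 ≤ S ^ 3 := by gcongr; omega
    have h3 : S ^ 2 * S ^ 3 = S ^ 5 := by ring
    nlinarith
  obtain ⟨σ, t, l, hx, hl, hlen, ht, hrec⟩ := exec_reconProg hc h
    (evalSpec_call hc h le_rfl (by omega) hdeg) le_rfl hZ3
  refine ⟨σ, t, l, hx, hrec, hl, hlen, ht.trans ?_⟩
  rw [← hk]
  have hb := hcb S (by omega)
  by_cases hlt : lowerC A B < upperC A B
  · have hs : scal A B = 1 := if_pos hlt
    simp only [hs, one_ne_zero, if_false, ← List.map_eq_flatMap, List.length_map]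
    have h1 := two_phase_le (K₁ := headProg.kc) (K₂ := turnK k) (r := 1) (a := 7) hc.one_le (by
      have := Nat.one_le_pow 2 _ hc.one_le
      omega)
    refine le_trans ?_ (Nat.mul_le_mul_left _ (h1.trans hb))
    rw [mul_add, one_mul]
    exact Nat.add_le_add_right (Nat.le_mul_of_pos_left _ (Nat.succ_pos _)) _
  · have hs : scal A B = 0 := if_neg hlt
    simp only [hs, if_true]
    have h2 : (gridSize A B : ℤ) ≤ 6 * kappa m n ^ 4 := by
      refine (gridSize_le h).trans_eq ?_
      have h3 := h.lowerC_le
      rw [hiEnd, loEnd, if_pos (Or.inl (not_lt.1 hlt)), if_pos (Or.inl (not_lt.1 hlt)),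
        le_antisymm h3 (not_lt.1 hlt)]
      ring
    have h4 : gridSize A B ≤ 6 * kappa m n ^ 4 := by exact_mod_cast h2
    have h5 : kappa m n ^ 4 ≤ (100 * S ^ 5) ^ 2 := by
      calc kappa m n ^ 4 = (kappa m n ^ 2) ^ 2 := by ring
        _ ≤ _ := Nat.pow_le_pow_left (by omega) 2
    have h6 := two_phase_le (K₁ := headProg.kc) (K₂ := turnK k) (r := l.length + 1) (a := 7) hc.one_le (by
      have := Nat.one_le_pow 2 _ hc.one_le
      omega)
    simpa using h6.trans hb

end TwoSided

theorem theorem7 :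
    -- reconstruction with oracle calls
    (∃ (R : TwoSided.Com) (C c : ℕ), ∀ (m n M : ℕ) (A B : Matrix (Fin m) (Fin n) (WithBot ℤ)),
      TwoSided.Admissible A B M →
      ∃ (σ : TwoSided.State) (t : ℕ) (gs : List TwoSided.Game),
        TwoSided.Exec R (TwoSided.load ⟨m, n, A, B⟩) σ t gs ∧
        TwoSided.IsReconstruction A B σ ∧
        -- the time spent outside the oracle is polynomial in the size of the input, per call
        t ≤ (gs.length + 1) * (c * (m + n + Nat.size M) ^ c) ∧
        -- the general case
        TwoSided.CallsWithin gs (C * TwoSided.Delta A B * (TwoSided.kappa m n : ℤ) ^ 6) (2 * m) n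
          (TwoSided.kappa m n ^ 2 * (M + 4 * M * TwoSided.kappa m n ^ 2)) ∧
        -- neither matrix has a column of `-∞`
        ((∀ j, ∃ i, A i j ≠ ⊥) → (∀ j, ∃ i, B i j ≠ ⊥) →
          TwoSided.CallsWithin gs (C * TwoSided.Delta A B * (TwoSided.kappa m n : ℤ) ^ 5) (2 * m) n
            (TwoSided.kappa m n ^ 2 * (M + 4 * M * TwoSided.kappa m n))) ∧
        -- both matrices are real
        ((∀ i j, A i j ≠ ⊥) → (∀ i j, B i j ≠ ⊥) →
          TwoSided.CallsWithin gs
            (C * (TwoSided.upperC A B - TwoSided.lowerC A B) * (TwoSided.kappa m n : ℤ) ^ 4)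
            (2 * m) n (3 * M * TwoSided.kappa m n ^ 2))) ∧
    -- reconstruction in pseudo-polynomial time, without any oracle
    (∃ (R : TwoSided.Com) (c : ℕ), R.CallFree ∧
      ∀ (m n M : ℕ) (A B : Matrix (Fin m) (Fin n) (WithBot ℤ)),
      TwoSided.Admissible A B M →
      ∃ (σ : TwoSided.State) (t : ℕ),
        TwoSided.Exec R (TwoSided.load ⟨m, n, A, B⟩) σ t [] ∧
        TwoSided.IsReconstruction A B σ ∧
        t ≤ c * (m + n + M) ^ c) := by
  constructor
  · obtain ⟨c, hc⟩ := TwoSided.exists_reconstruction_oracle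
    -- The constant is `3 κ⁴` samples per unit length times a length of `4 Δ κ²` or `4 Δ κ`; for
    -- finite matrices the length `3 (C̄ - C̲)` would allow `9`.
    refine ⟨TwoSided.reconProg (.ite (TwoSided.rg 40) .call TwoSided.viProg), 12, c, fun m n M A B h => ?_⟩
    obtain ⟨σ, t, l, hx, hrec, hl, hlen, ht⟩ := hc m n M A B h
    have hΔ := h.delta_nonneg
    have hlow := sub_nonneg.2 h.lowerC_le
    have hlen' : (l.length : ℤ) ≤ 3 * TwoSided.kappa m n ^ 4 *
        (TwoSided.hiEnd A B - TwoSided.loEnd A B) :=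
      (Nat.cast_le.2 hlen).trans (TwoSided.gridSize_le h)
    have hκ : (0 : ℤ) ≤ 3 * TwoSided.kappa m n ^ 4 := by positivity
    refine ⟨σ, t, _, hx, hrec, ht, TwoSided.callsWithin_samples h hl (by positivity) (fun hlt => ?_)
      (fun hlt N D hp => (hp.hasSize h hlt).1), fun h1 h2 => TwoSided.callsWithin_samples h hl
        (by positivity) (fun hlt => ?_) (fun hlt N D hp => (hp.hasSize h hlt).2.1 ⟨h1, h2⟩),
      fun h1 h2 => TwoSided.callsWithin_samples h hl (by positivity) (fun hlt => ?_)
        (fun hlt N D hp => (hp.hasSize h hlt).2.2 ⟨h1, h2⟩)⟩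
    · refine (hlen'.trans (mul_le_mul_of_nonneg_left (h.hiEnd_sub_loEnd_le hlt).1 hκ)).trans_eq ?_
      push_cast
      ring
    · refine (hlen'.trans (mul_le_mul_of_nonneg_left ((h.hiEnd_sub_loEnd_le hlt).2.1 ⟨h1, h2⟩)
        hκ)).trans_eq ?_
      push_cast
      ring
    · refine (hlen'.trans (mul_le_mul_of_nonneg_left ((h.hiEnd_sub_loEnd_le hlt).2.2 ⟨h1, h2⟩)
        hκ)).trans ?_
      have : (0 : ℤ) ≤ (TwoSided.upperC A B - TwoSided.lowerC A B) * TwoSided.kappa m n ^ 4 := by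
        positivity
      push_cast
      nlinarith
  · obtain ⟨c, hc⟩ := TwoSided.exists_reconstruction_pseudoPoly
    exact ⟨TwoSided.reconProg TwoSided.viProg, c, by decide, hc⟩
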